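/- Let $n>2$ be an integer, $M>0$, $e>0$, $m\in\mathbb{R}$, and $$V(r)=r^2+\frac{2M}{r^{n-2}}-\frac{e^2}{r^{n-1}}-1 .$$ Assume subextremality, i.e. the polynomial $p(r)=r^{n-1}V(r)$ has exactly three positive roots $0<r_-<r_+<r_c$, and assume $V''(r_c)>0$. Let $\phi$ be a smooth real-valued solution of the Klein-Gordon equation $\square_g\phi-m^2\phi=0$ in the cosmological region $\{(r,t,\omega): r>r_c,\ t\in\mathbb{R},\ \omega\in S^{n-1}\}$ of the $(n+1)$-dimensional Reissner-Nordström-de Sitter spacetime with metric $$g=-\frac1V\,dr^2+V\,dt^2+r^2\,d\Omega^2,$$ where $d\Omega^2$ is the unit round metric on $S^{n-1}$. Suppose that $\phi$ is smooth up to the two branches of the future cosmological horizon: with $r_*>r_c$ fixed, $u=t+\int_{r_*}^r\frac{ds}{V(s)}$ and $v=-t+\int_{r_*}^r\frac{ds}{V(s)}$, it extends smoothly in the coordinates $(u,r,\omega)$ to $\mathcal{CH}_1^+=\{r=r_c,\ u\in\mathbb{R}\}$, and in the coordinates $(v,r,\omega)$ to $\mathcal{CH}_2^+=\{r=r_c,\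 v\in\mathbb{R}\}$. Let $k>\frac n2+2$ be an integer, and suppose that $$\|\phi\|_{H^k(\mathcal{CH}_1^+)}<\infty\quad\text{and}\quad\|\phi\|_{H^k(\mathcal{CH}_2^+)}<\infty,$$ where $\mathcal{CH}_1^+\simeq\mathcal{CH}_2^+\simeq\mathbb{R}\times S^{n-1}$ are parameterised by $(u,\omega)$ and $(v,\omega)$ respectively. Then for every $\epsilon>0$ there exist $r_0>r_c$ and a constant $C$ such that for all $r\ge r_0$, $$\|\phi(r,\cdot)\|_{L^\infty(\mathbb{R}\times S^{n-1})}\le C\,r^{-\frac n2+\epsilon}\quad\text{if } |m|>\tfrac n2,$$ $$\|\phi(r,\cdot)\|_{L^\infty(\mathbb{R}\times S^{n-1})}\le C\,r^{-\frac n2+\sqrt{\frac{n^2}{4}-m^2}+\epsilon}\quad\text{if } |m|\le\tfrac n2.$$ -/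

import Mathlib

open MeasureTheory
open scoped ContDiff ENNReal

noncomputable section

namespace RNdS

/-- Euclidean space `ℝⁿ`. A point `x ≠ 0` has polar coordinates `r = ‖x‖`, `ω = x / ‖x‖`, so that
`{x | a < ‖x‖}` is `(a, ∞) × S^{n-1}`, and the unit sphere of `ℝⁿ` is `S^{n-1}`. -/
abbrev E (n : ℕ) : Type := EuclideanSpace ℝ (Fin n)

/-- The unit sphere `S^{n-1}`. -/
abbrev S (n : ℕ) : Type := Metric.sphere (0 : E n) 1

/-- The measure `dt dΩ` on the cylinder `ℝ × S^{n-1}`. -/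
abbrev cylMeasure (n : ℕ) : Measure (ℝ × S n) :=
  (volume : Measure ℝ).prod (volume : Measure (E n)).toSphere

/-- The metric function `V(r) = r² + 2M / r^{n-2} - e² / r^{n-1} - 1`. -/
def V (n : ℕ) (M e r : ℝ) : ℝ :=
  r ^ 2 + 2 * M / r ^ (n - 2) - e ^ 2 / r ^ (n - 1) - 1

/-- Subextremality: `p(r) = r^{n-1} V(r)` has exactly three positive roots `r₋ < r₊ < r_c`. -/
def IsSubextremal (n : ℕ) (M e rm rp rc : ℝ) : Prop :=
  0 < rm ∧ rm < rp ∧ rp < rc ∧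
    {r : ℝ | 0 < r ∧ r ^ (n - 1) * V n M e r = 0} = {rm, rp, rc}

/-- The coordinate basis of `ℝ × ℝⁿ`: `none` is the direction of the first factor. -/
def basisVec {n : ℕ} : Option (Fin n) → ℝ × E n
  | none => (1, 0)
  | some i => (0, EuclideanSpace.single i 1)

/-- The coordinate partial derivative `∂_μ f`. -/
def partialDeriv {n : ℕ} (μ : Option (Fin n)) (f : ℝ × E n → ℝ) (p : ℝ × E n) : ℝ :=
  fderiv ℝ f p (basisVec μ)

/-- The Laplace-Beltrami (d'Alembert) operator of a metric `g` given in coordinates,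
`□_g f = |det g|^{-1/2} ∂_μ (|det g|^{1/2} g^{μν} ∂_ν f)`. -/
def boxOp {n : ℕ} (g : ℝ × E n → Matrix (Option (Fin n)) (Option (Fin n)) ℝ)
    (f : ℝ × E n → ℝ) (p : ℝ × E n) : ℝ :=
  (√|(g p).det|)⁻¹ * ∑ μ, partialDeriv μ
    (fun q => √|(g q).det| * ∑ ν, (g q)⁻¹ μ ν * partialDeriv ν f q) p

/-- The differential of `r = ‖x‖` at `x`, applied to `ξ`. -/
def dr {n : ℕ} (x ξ : E n) : ℝ := inner ℝ x ξ / ‖x‖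

/-- The metric `-V⁻¹ dr² + V dt² + r² dΩ²` in the coordinates `(t, x)`, `x = r ω`,
where `r² dΩ² = |dx|² - dr²`. -/
def metric (n : ℕ) (M e : ℝ) (p : ℝ × E n) : Matrix (Option (Fin n)) (Option (Fin n)) ℝ :=
  Matrix.of fun μ ν =>
    -(1 / V n M e ‖p.2‖) * (dr p.2 (basisVec μ).2 * dr p.2 (basisVec ν).2)
      + V n M e ‖p.2‖ * ((basisVec μ).1 * (basisVec ν).1)
      + (inner ℝ (basisVec μ).2 (basisVec ν).2
          - dr p.2 (basisVec μ).2 * dr p.2 (basisVec ν).2)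

/-- `∫_{r_*}^r ds / V(s)`, the function with `u = t + ∫ dr / V` and `v = -t + ∫ dr / V`. -/
def tortoise (n : ℕ) (M e rs r : ℝ) : ℝ := ∫ s in rs..r, 1 / V n M e s

/-- Indices of the frame of Killing fields of the cylinder `ℝ × S^{n-1}`: the translation field
(`none`) and the rotation fields `L_ij`, `i < j`. -/
abbrev KillingIdx (n : ℕ) : Type := Option {p : Fin n × Fin n // p.1 < p.2}

/-- The value at `p = (s, x)` of the translation field `∂_s`, and of the rotation field
`L_ij = x^i ∂_j - x^j ∂_i`. -/
def killingField {n : ℕ} : KillingIdx n → ℝ × E n → ℝ × E n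
  | none, _ => (1, 0)
  | some ij, p => (0, EuclideanSpace.single ij.1.2 (p.2 ij.1.1)
      - EuclideanSpace.single ij.1.1 (p.2 ij.1.2))

/-- The iterated derivative `Z_1 (Z_2 (⋯ F))` along a word of Killing fields. -/
def killingDeriv {n : ℕ} (w : List (KillingIdx n)) (F : ℝ × E n → ℝ) : ℝ × E n → ℝ :=
  w.foldr (fun Z G p => fderiv ℝ G p (killingField Z p)) F

/-- The extension of a function on `ℝ × S^{n-1}` to `ℝ × (ℝⁿ ∖ 0)` that is constant on rays. The
fields `L_ij` are tangent to the spheres, so that their action on the extension restricts to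
their action on the sphere. -/
def rayExtension {n : ℕ} (f : ℝ × S n → ℝ) (p : ℝ × E n) : ℝ :=
  open Classical in
  if h : ‖p.2‖⁻¹ • p.2 ∈ Metric.sphere (0 : E n) 1 then f (p.1, ⟨‖p.2‖⁻¹ • p.2, h⟩) else 0

/-- The square of the Sobolev norm `H^k(ℝ × S^{n-1})` of a smooth function: the sum of the
squared `L²` norms of all its derivatives of order at most `k` along `∂_s` and the `L_ij`. These
fields span the tangent space at each point (with `∑_{i<j} (L_ij f)² = |∇f|²` on the sphere) and
are invariant, so that they give the standard space. -/
def cylSobolevSq {n : ℕ} (k : ℕ) (f : ℝ × S n → ℝ) : ℝ≥0∞ :=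
  ∑ j ∈ Finset.range (k + 1), ∑ w : Fin j → KillingIdx n,
    ∫⁻ p : ℝ × S n,
      ENNReal.ofReal ((killingDeriv (List.ofFn w) (rayExtension f) (p.1, (p.2 : E n))) ^ 2)
      ∂(cylMeasure n)

/-- The restriction of a function of `(s, x)` to `ℝ × {‖x‖ = r}`, as a function on
`ℝ × S^{n-1}`. -/
def slice {n : ℕ} (φ : ℝ × E n → ℝ) (r : ℝ) (p : ℝ × S n) : ℝ := φ (p.1, r • (p.2 : E n))

end RNdS

end

/-! The problem is reduced to a family of wave equations in the two variables (t, r), one for each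
spherical harmonic, and each of them is treated by energy estimates whose constants do not depend on
the eigenvalue λ. Of the metric function only a few facts are used (`IsExpanding`): `V` vanishes
linearly at r_c, it is convex beyond r_c because V'' > 0 at r_c persists outward, and it equals r² +
O(1) at infinity.

Far from the horizon, put P = r ∂_r φ + (n/2) φ. If `V` were exactly r² and φ depended on r only, ψ
= r^{n/2} φ would satisfy (r∂_r)² ψ = (n²/4 - m²) ψ, so r∂_r of (r∂_r ψ)² + κ ψ² would be 2 (n²/4 -
m² + κ) ψ (r∂_r ψ). By the inequality between the arithmetic and geometric means this is at most 2β
times the same quantity as soon as |n²/4 - m² + κ| ≤ 2β √κ. Angular and t-derivatives enter with a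
favourable sign, and the deviation of `V` from r² gives integrable errors (`far_bulk_le`,
`IsForcedWave.far_deriv`, `exists_far_growth`). The pointwise rate is then r^{β - n/2}. For |m| >
n/2 the choice κ = m² - n²/4 annihilates the cross term, so β = ε is allowed; otherwise β = s + ε
with s² = n²/4 - m² and κ = β².

Near the horizon, the solution is regular at each of the two branches, but nothing is assumed where
they meet, so there is no regular slice from which to start. The traces f(u) and g(v) are therefore
subtracted. The remainder A - f(u) - g(v) solves the same equation with a source controlled by f, g,
f', g', and its energy E satisfies (E/V)' ≤ 2 V^{-1/2} (E/V) + C D V^{-1/2}, where D is the norm of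
the data; the singularity V^{-1/2} is integrable at r_c (`IsForcedWave.near_deriv`,
`exists_near_bound`). To start this inequality at r_c one needs E/V → 0. That is a qualitative
statement, obtained from a characteristic problem in the corner u, v → -∞ (`IsDoubleNull.remainder`,
`IsScalarWave.near_tendsto`); its constants may depend on the mode, since only the limit matters.

No decay in t is known beyond the horizon, so every energy carries the weight ζ(u) ζ(v). It has
bounded support in t, and because ζ is nonincreasing its flux has a sign (`weight_flux_nonpos`); the
resulting bounds are independent of the cutoff.

For the summation over modes, the source contains λ f, so a mode with frequency μ = (1 + λ)^{1/2}
costs μ⁴ on the squares of the undifferentiated data (`exists_mode_decay`). The angular Sobolev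
inequality asks for the weight μ^p with p ≥ n (`exists_harmSum_sq_le`), and a Sobolev inequality in
t on intervals of length 1/μ costs one further power of μ (`sq_le_integral_add`). With p = 2j + 1
this uses j + 3 derivatives on the horizon, and an integer k = j + 3 satisfies n ≤ 2j + 1 exactly
when k > n/2 + 2. -/

namespace RNdS

open Set Filter Topology

/-! ### The metric function beyond the cosmological horizon -/

/-- The properties of the metric function `V` beyond its largest root `rc` that the energy estimates
use. -/
structure IsExpanding (V V' : ℝ → ℝ) (rc : ℝ) : Prop where
  rc_pos : 0 < rc
  zero : V rc = 0
  hasDerivAt : ∀ r, 0 < r → HasDerivAt V (V' r) r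
  continuousOn_deriv : ContinuousOn V' (Ioi 0)
  mono : MonotoneOn V' (Ici rc)
  deriv_pos : 0 < V' rc
  asymp : ∃ K, ∀ r, rc ≤ r → |r ^ 2 - V r| ≤ K ∧ |r * V' r - 2 * V r| ≤ K

namespace IsExpanding

variable {V V' : ℝ → ℝ} {rc : ℝ}

theorem pos_of_lt (h : IsExpanding V V' rc) {r : ℝ} (hr : rc < r) : 0 < r := h.rc_pos.trans hr

theorem continuousOn (h : IsExpanding V V' rc) : ContinuousOn V (Ioi 0) :=
  fun r hr => (h.hasDerivAt r hr).continuousAt.continuousWithinAt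

theorem exists_mean (h : IsExpanding V V' rc) {r : ℝ} (hr : rc < r) :
    ∃ s ∈ Ioo rc r, V r = V' s * (r - rc) := by
  obtain ⟨s, hs, hs'⟩ := exists_hasDerivAt_eq_slope V V' hr
    (h.continuousOn.mono fun x hx => h.rc_pos.trans_le hx.1)
    (fun x hx => h.hasDerivAt x (h.pos_of_lt hx.1))
  refine ⟨s, hs, ?_⟩
  rw [hs', h.zero]
  field_simp [sub_ne_zero.2 hr.ne']
  simp

theorem le_deriv (h : IsExpanding V V' rc) {r : ℝ} (hr : rc ≤ r) : V' rc ≤ V' r :=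
  h.mono self_mem_Ici hr hr

theorem deriv_pos' (h : IsExpanding V V' rc) {r : ℝ} (hr : rc ≤ r) : 0 < V' r :=
  h.deriv_pos.trans_le (h.le_deriv hr)

theorem lower (h : IsExpanding V V' rc) {r : ℝ} (hr : rc < r) : V' rc * (r - rc) ≤ V r := by
  obtain ⟨s, hs, e⟩ := h.exists_mean hr
  rw [e]
  exact mul_le_mul_of_nonneg_right (h.le_deriv hs.1.le) (sub_pos.2 hr).le

theorem upper (h : IsExpanding V V' rc) {r : ℝ} (hr : rc < r) : V r ≤ V' r * (r - rc) := by
  obtain ⟨s, hs, e⟩ := h.exists_mean hr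
  rw [e]
  exact mul_le_mul_of_nonneg_right (h.mono hs.1.le hr.le hs.2.le) (sub_pos.2 hr).le

theorem upper_of_le (h : IsExpanding V V' rc) {r r₁ : ℝ} (hr : rc < r) (hr₁ : r ≤ r₁) :
    V r ≤ V' r₁ * (r - rc) :=
  (h.upper hr).trans (mul_le_mul_of_nonneg_right (h.mono hr.le (hr.le.trans hr₁) hr₁)
    (sub_pos.2 hr).le)

theorem pos (h : IsExpanding V V' rc) {r : ℝ} (hr : rc < r) : 0 < V r :=
  (mul_pos h.deriv_pos (sub_pos.2 hr)).trans_le (h.lower hr)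

theorem le_mul_deriv (h : IsExpanding V V' rc) {r : ℝ} (hr : rc < r) : V r ≤ r * V' r := by
  have := h.upper hr
  nlinarith [h.deriv_pos' hr.le, h.rc_pos]

end IsExpanding

/-- The derivative of the metric function. -/
noncomputable def Vderiv (n : ℕ) (M e r : ℝ) : ℝ :=
  2 * r - 2 * M * (n - 2) / r ^ (n - 1) + e ^ 2 * (n - 1) / r ^ n

theorem hasDerivAt_const_div_pow (c : ℝ) (k : ℕ) {r : ℝ} (hr : 0 < r) :
    HasDerivAt (fun r => c / r ^ k) (-(c * k) / r ^ (k + 1)) r := by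
  have h := ((hasDerivAt_pow k r).inv (pow_ne_zero k hr.ne')).const_mul c
  have e : (fun r : ℝ => c / r ^ k) = fun y => c * ((fun x => x ^ k)⁻¹) y := by
    funext y; simp [div_eq_mul_inv]
  rw [e]
  convert! h using 1
  rcases k with _ | k
  · simp
  · field_simp
    simp only [Nat.add_sub_cancel]
    ring

theorem hasDerivAt_V {n : ℕ} (hn : 2 < n) (M e : ℝ) {r : ℝ} (hr : 0 < r) :
    HasDerivAt (V n M e) (Vderiv n M e r) r := by
  obtain ⟨N, rfl⟩ : ∃ N, n = N + 3 := ⟨n - 3, by omega⟩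
  have h := (((hasDerivAt_pow 2 r).add (hasDerivAt_const_div_pow (2 * M) (N + 1) hr)).sub
    (hasDerivAt_const_div_pow (e ^ 2) (N + 2) hr)).sub_const 1
  convert! h using 1
  simp only [Vderiv, show N + 3 - 1 = N + 2 by omega]
  push_cast
  ring

theorem hasDerivAt_Vderiv {n : ℕ} (hn : 2 < n) (M e : ℝ) {r : ℝ} (hr : 0 < r) :
    HasDerivAt (Vderiv n M e)
      (2 + 2 * M * (n - 2) * (n - 1) / r ^ n - e ^ 2 * (n - 1) * n / r ^ (n + 1)) r := by
  obtain ⟨N, rfl⟩ : ∃ N, n = N + 3 := ⟨n - 3, by omega⟩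
  have h := (((hasDerivAt_id r).const_mul 2).sub
    (hasDerivAt_const_div_pow (2 * M * ((N + 3 : ℕ) - 2)) (N + 2) hr)).add
    (hasDerivAt_const_div_pow (e ^ 2 * ((N + 3 : ℕ) - 1)) (N + 3) hr)
  convert! h using 1
  push_cast
  ring

theorem V_pos_of_isSubextremal {n : ℕ} (hn : 2 < n) {M e rm rp rc : ℝ} (hM : 0 < M)
    (hsub : IsSubextremal n M e rm rp rc) {r : ℝ} (hr : rc < r) : 0 < V n M e r := by
  obtain ⟨h0, h1, h2, hs⟩ := hsub
  have hrc : 0 < rc := h0.trans (h1.trans h2)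
  have hne : ∀ s, rc < s → V n M e s ≠ 0 := by
    intro s hs' h
    have : s ∈ ({rm, rp, rc} : Set ℝ) := by
      rw [← hs]; exact ⟨hrc.trans hs', by simp [h]⟩
    simp only [mem_insert_iff, mem_singleton_iff] at this
    rcases this with h | h | h <;> linarith
  by_contra! hneg
  -- At this radius the charge term is at most e² and R² exceeds e² + 1, so the metric function is
  -- positive; a nonpositive value at r would then force a fourth root.
  set R := r + 2 + e ^ 2 with hR
  have hR2 : r < R := by nlinarith [sq_nonneg e]
  have hR1 : 1 ≤ R := by nlinarith [sq_nonneg e]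
  have hpos : 0 < V n M e R := by
    have a1 : 0 ≤ 2 * M / R ^ (n - 2) := by positivity
    have a2 : e ^ 2 / R ^ (n - 1) ≤ e ^ 2 :=
      div_le_self (sq_nonneg e) (one_le_pow₀ hR1)
    have : 2 + e ^ 2 < R := by linarith
    unfold V
    nlinarith [sq_nonneg e]
  have hc : ContinuousOn (V n M e) (Icc r R) := fun x hx =>
    (hasDerivAt_V hn M e (hrc.trans (hr.trans_le hx.1))).continuousAt.continuousWithinAt
  obtain ⟨s, hs1, hs2⟩ := intermediate_value_Icc hR2.le hc ⟨hneg, hpos.le⟩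
  exact hne s (hr.trans_le hs1.1) hs2

/-- A double root at r_c is excluded by counting zeros. If V'(r_c) = 0, the polynomial p = r^{n-1} V
has critical points in (r_-, r_+), in (r_+, r_c) and at r_c, hence two positive inflection points by
Rolle. But p'' is a power of r times a quadratic in r² with a single positive zero. -/
theorem Vderiv_pos_of_isSubextremal {n : ℕ} (hn : 2 < n) {M e rm rp rc : ℝ} (hM : 0 < M)
    (hsub : IsSubextremal n M e rm rp rc) : 0 < Vderiv n M e rc := by
  have hVpos : ∀ r, rc < r → 0 < V n M e r := fun r => V_pos_of_isSubextremal hn hM hsub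
  obtain ⟨h0, h1, h2, hs⟩ := hsub
  have hrc : 0 < rc := h0.trans (h1.trans h2)
  have hz : ∀ s ∈ ({rm, rp, rc} : Set ℝ), 0 < s ∧ s ^ (n - 1) * V n M e s = 0 := by
    intro s h; rw [← hs] at h; exact h
  have hVrc : V n M e rc = 0 := by
    have := (hz rc (by simp)).2
    rcases mul_eq_zero.1 this with h | h
    · exact absurd h (by positivity)
    · exact h
  have hge : 0 ≤ Vderiv n M e rc := by
    have := (hasDerivAt_V hn M e hrc).hasDerivWithinAt (s := Ioi rc)
    rw [hasDerivWithinAt_iff_tendsto_slope' (by simp)] at this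
    refine ge_of_tendsto this ?_
    filter_upwards [self_mem_nhdsWithin] with y hy
    rw [slope_def_field, hVrc, sub_zero]
    exact div_nonneg (hVpos y hy).le (sub_pos.2 hy).le
  rcases hge.lt_or_eq with h | h
  · exact h
  exfalso
  obtain ⟨N, rfl⟩ : ∃ N, n = N + 3 := ⟨n - 3, by omega⟩
  set p : ℝ → ℝ := fun r => r ^ (N + 4) - r ^ (N + 2) + 2 * M * r - e ^ 2 with hp
  set p1 : ℝ → ℝ := fun r => (N + 4) * r ^ (N + 3) - (N + 2) * r ^ (N + 1) + 2 * M with hp1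
  set p2 : ℝ → ℝ := fun r => (N + 4) * (N + 3) * r ^ (N + 2) - (N + 2) * (N + 1) * r ^ N with hp2
  have dp : ∀ r, HasDerivAt p (p1 r) r := by
    intro r
    have := (((hasDerivAt_pow (N + 4) r).sub (hasDerivAt_pow (N + 2) r)).add
      ((hasDerivAt_id r).const_mul (2 * M))).sub_const (e ^ 2)
    convert! this using 1
    simp [hp1]
  have dp1 : ∀ r, HasDerivAt p1 (p2 r) r := by
    intro r
    have := (((hasDerivAt_pow (N + 3) r).const_mul (N + 4 : ℝ)).sub
      ((hasDerivAt_pow (N + 1) r).const_mul (N + 2 : ℝ))).add_const (2 * M)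
    convert! this using 1
    simp [hp2]
    ring
  have pV : ∀ r, 0 < r → p r = r ^ (N + 2) * V (N + 3) M e r := by
    intro r hr
    simp only [hp, V, show N + 3 - 2 = N + 1 by omega, show N + 3 - 1 = N + 2 by omega]
    field_simp
    ring
  have pz : ∀ s ∈ ({rm, rp, rc} : Set ℝ), p s = 0 := fun s hs' => by
    rw [pV s (hz s hs').1]; exact (hz s hs').2
  obtain ⟨c1, hc1, e1⟩ := exists_hasDerivAt_eq_zero h1
    (fun x _ => (dp x).continuousAt.continuousWithinAt)
    ((pz rm (by simp)).trans (pz rp (by simp)).symm) (fun x _ => dp x)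
  obtain ⟨c2, hc2, e2⟩ := exists_hasDerivAt_eq_zero h2
    (fun x _ => (dp x).continuousAt.continuousWithinAt)
    ((pz rp (by simp)).trans (pz rc (by simp)).symm) (fun x _ => dp x)
  have e3 : p1 rc = 0 := by
    have a := ((hasDerivAt_pow (N + 2) rc).mul (hasDerivAt_V hn M e hrc))
    rw [← h, hVrc] at a
    simp only [mul_zero, add_zero] at a
    refine ((dp rc).congr_of_eventuallyEq ?_).unique a
    filter_upwards [lt_mem_nhds hrc] with r hr
    exact (pV r hr).symm
  obtain ⟨d1, hd1, f1⟩ := exists_hasDerivAt_eq_zero (hc1.2.trans hc2.1)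
    (fun x _ => (dp1 x).continuousAt.continuousWithinAt) (e1.trans e2.symm) (fun x _ => dp1 x)
  obtain ⟨d2, hd2, f2⟩ := exists_hasDerivAt_eq_zero hc2.2
    (fun x _ => (dp1 x).continuousAt.continuousWithinAt) (e2.trans e3.symm) (fun x _ => dp1 x)
  have key : ∀ d, 0 < d → p2 d = 0 → (N + 4 : ℝ) * (N + 3) * d ^ 2 = (N + 2) * (N + 1) := by
    intro d hd hd'
    have : d ^ N * ((N + 4 : ℝ) * (N + 3) * d ^ 2 - (N + 2) * (N + 1)) = 0 := by
      rw [← hd', hp2]; ring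
    rcases mul_eq_zero.1 this with h | h
    · exact absurd h (by positivity)
    · linarith
  have g1 : 0 < d1 := h0.trans (hc1.1.trans hd1.1)
  have g2 : d1 < d2 := hd1.2.trans hd2.1
  have k1 := key d1 g1 f1
  have k2 := key d2 (g1.trans g2) f2
  have : d1 ^ 2 < d2 ^ 2 := by nlinarith
  have : (N + 4 : ℝ) * (N + 3) * d1 ^ 2 < (N + 4 : ℝ) * (N + 3) * d2 ^ 2 :=
    mul_lt_mul_of_pos_left this (by positivity)
  linarith

theorem isExpanding_V {n : ℕ} (hn : 2 < n) {M e rm rp rc : ℝ} (hM : 0 < M)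
    (hsub : IsSubextremal n M e rm rp rc) (hV : 0 < deriv (deriv (V n M e)) rc) :
    IsExpanding (V n M e) (Vderiv n M e) rc := by
  have hd := Vderiv_pos_of_isSubextremal hn hM hsub
  obtain ⟨h0, h1, h2, hs⟩ := hsub
  have hrc : 0 < rc := h0.trans (h1.trans h2)
  have hVrc : V n M e rc = 0 := by
    have : rc ∈ {r : ℝ | 0 < r ∧ r ^ (n - 1) * V n M e r = 0} := by rw [hs]; simp
    rcases mul_eq_zero.1 this.2 with h | h
    · exact absurd h (by positivity)
    · exact h
  have hn' : (2 : ℝ) < n := by exact_mod_cast hn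
  refine ⟨hrc, hVrc, fun r hr => hasDerivAt_V hn M e hr, fun r hr =>
    (hasDerivAt_Vderiv hn M e hr).continuousAt.continuousWithinAt, ?_, hd, ?_⟩
  · refine monotoneOn_of_hasDerivWithinAt_nonneg (convex_Ici rc) (fun r hr =>
      (hasDerivAt_Vderiv hn M e (hrc.trans_le hr)).continuousAt.continuousWithinAt)
      (f' := fun r => 2 + 2 * M * (n - 2) * (n - 1) / r ^ n - e ^ 2 * (n - 1) * n / r ^ (n + 1))
      (fun r hr => (hasDerivAt_Vderiv hn M e
        (hrc.trans_le (interior_subset hr))).hasDerivWithinAt) ?_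
    intro r hr
    have hr : rc ≤ r := interior_subset hr
    have hr0 : 0 < r := hrc.trans_le hr
    have e1 : deriv (V n M e) =ᶠ[𝓝 rc] Vderiv n M e := by
      filter_upwards [lt_mem_nhds hrc] with s hs using (hasDerivAt_V hn M e hs).deriv
    rw [e1.deriv_eq, (hasDerivAt_Vderiv hn M e hrc).deriv] at hV
    -- Multiplied by s^{n+1}, the second derivative is an increasing function of s minus a constant,
    -- so its positivity at r_c propagates outward.
    have id : ∀ s : ℝ, 0 < s → 2 + 2 * M * (n - 2) * (n - 1) / s ^ n
        - e ^ 2 * (n - 1) * n / s ^ (n + 1)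
        = (2 * s ^ (n + 1) + 2 * M * (n - 2) * (n - 1) * s - e ^ 2 * (n - 1) * n) / s ^ (n + 1) := by
      intro s hs
      field_simp
      ring
    rw [id rc hrc, div_pos_iff_of_pos_right (by positivity)] at hV
    rw [id r hr0]
    refine div_nonneg ?_ (by positivity)
    have a1 : rc ^ (n + 1) ≤ r ^ (n + 1) := by gcongr
    have a2 : 2 * M * (n - 2) * (n - 1) * rc ≤ 2 * M * (n - 2) * (n - 1) * r := by
      refine mul_le_mul_of_nonneg_left hr ?_
      have := sub_pos.2 hn'
      have : (0 : ℝ) < n - 1 := by linarith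
      positivity
    linarith
  · obtain ⟨N, rfl⟩ : ∃ N, n = N + 3 := ⟨n - 3, by omega⟩
    -- The absolute values of the terms of r V' - 2 V are largest at r_c; their sum there also
    -- dominates r² - V.
    refine ⟨2 + 2 * M * (N + 3) / rc ^ (N + 1) + e ^ 2 * (N + 4) / rc ^ (N + 2), fun r hr => ?_⟩
    have hr0 : 0 < r := hrc.trans_le hr
    have b1 : M / r ^ (N + 1) ≤ M / rc ^ (N + 1) := by gcongr
    have b2 : e ^ 2 / r ^ (N + 2) ≤ e ^ 2 / rc ^ (N + 2) := by gcongr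
    have c1 : 0 ≤ M / r ^ (N + 1) := by positivity
    have c2 : 0 ≤ e ^ 2 / r ^ (N + 2) := by positivity
    have N0 : (0 : ℝ) ≤ N := by positivity
    have i1 : r ^ 2 - V (N + 3) M e r = 1 - 2 * (M / r ^ (N + 1)) + e ^ 2 / r ^ (N + 2) := by
      simp only [V, show N + 3 - 2 = N + 1 by omega, show N + 3 - 1 = N + 2 by omega]
      ring
    have i2 : r * Vderiv (N + 3) M e r - 2 * V (N + 3) M e r
        = 2 - 2 * (N + 3) * (M / r ^ (N + 1)) + (N + 4) * (e ^ 2 / r ^ (N + 2)) := by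
      simp only [V, Vderiv, show N + 3 - 2 = N + 1 by omega, show N + 3 - 1 = N + 2 by omega]
      push_cast
      field_simp
      ring
    rw [i1, i2]
    have i3 : 2 + 2 * M * (N + 3) / rc ^ (N + 1) + e ^ 2 * (N + 4) / rc ^ (N + 2)
        = 2 + 2 * (N + 3) * (M / rc ^ (N + 1)) + (N + 4) * (e ^ 2 / rc ^ (N + 2)) := by ring
    rw [i3]
    set x := M / r ^ (N + 1)
    set y := e ^ 2 / r ^ (N + 2)
    set X := M / rc ^ (N + 1)
    set Y := e ^ 2 / rc ^ (N + 2)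
    have d1 : (N : ℝ) * x ≤ N * X := mul_le_mul_of_nonneg_left b1 N0
    have d2 : (N : ℝ) * y ≤ N * Y := mul_le_mul_of_nonneg_left b2 N0
    have d3 : 0 ≤ (N : ℝ) * x := mul_nonneg N0 c1
    have d4 : 0 ≤ (N : ℝ) * y := mul_nonneg N0 c2
    constructor <;> rw [abs_le] <;> constructor <;> nlinarith

/-! ### The tortoise coordinate and its inverse -/

/-- The coordinates in which `V = dr / dx`: `τ` is a primitive of `1 / V` beyond `rc`. -/
structure IsTortoise (V τ : ℝ → ℝ) (rc : ℝ) : Prop where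
  hasDerivAt : ∀ r, rc < r → HasDerivAt τ (1 / V r) r

theorem IsExpanding.isTortoise {V V' : ℝ → ℝ} {rc rs : ℝ} (h : IsExpanding V V' rc)
    (hrs : rc < rs) : IsTortoise V (fun r => ∫ s in rs..r, 1 / V s) rc := by
  refine ⟨fun r hr => ?_⟩
  have hc : ContinuousOn (fun s => 1 / V s) (Ioi rc) := fun s hs =>
    (continuousAt_const.div (h.hasDerivAt s (h.pos_of_lt hs)).continuousAt
      (h.pos hs).ne').continuousWithinAt
  refine intervalIntegral.integral_hasDerivAt_right ?_ ?_ (hc.continuousAt (Ioi_mem_nhds hr))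
  · refine (hc.mono fun s hs => ?_).intervalIntegrable
    exact (lt_min hrs hr).trans_le hs.1
  · exact hc.stronglyMeasurableAtFilter isOpen_Ioi r hr

section

variable {V V' τ : ℝ → ℝ} {rc : ℝ}

theorem IsTortoise.continuousOn (ht : IsTortoise V τ rc) : ContinuousOn τ (Ioi rc) :=
  fun r hr => (ht.hasDerivAt r hr).continuousAt.continuousWithinAt

theorem IsTortoise.strictMonoOn (ht : IsTortoise V τ rc) (h : IsExpanding V V' rc) :
    StrictMonoOn τ (Ioi rc) := by
  refine strictMonoOn_of_deriv_pos (convex_Ioi rc) ht.continuousOn fun r hr => ?_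
  rw [interior_Ioi] at hr
  rw [(ht.hasDerivAt r hr).deriv]
  exact one_div_pos.2 (h.pos hr)

/-- Convexity gives V ≤ V'(r₁) (r - r_c) below r₁, so 1/V is at least the derivative of the
logarithmic term. This forces τ → -∞ at the horizon. -/
theorem IsTortoise.sub_log_monotoneOn (ht : IsTortoise V τ rc) (h : IsExpanding V V' rc)
    {r₁ : ℝ} (hr₁ : rc < r₁) :
    MonotoneOn (fun r => τ r - (V' r₁)⁻¹ * Real.log (r - rc)) (Ioc rc r₁) := by
  have hd : ∀ r, rc < r → HasDerivAt (fun r => τ r - (V' r₁)⁻¹ * Real.log (r - rc))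
      (1 / V r - (V' r₁)⁻¹ * (1 / (r - rc))) r := fun r hr =>
    (ht.hasDerivAt r hr).sub ((((hasDerivAt_id r).sub_const rc).log (sub_pos.2 hr).ne').const_mul _)
  refine monotoneOn_of_hasDerivWithinAt_nonneg (convex_Ioc rc r₁)
    (fun r hr => (hd r hr.1).continuousAt.continuousWithinAt)
    (fun r hr => (hd r (interior_subset hr).1).hasDerivWithinAt) fun r hr => ?_
  have hr := interior_subset hr
  have h1 := h.upper_of_le hr.1 hr.2
  have h2 := h.pos hr.1
  have h3 := h.deriv_pos' hr₁.le
  have h4 := sub_pos.2 hr.1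
  have : (V' r₁)⁻¹ * (1 / (r - rc)) = 1 / (V' r₁ * (r - rc)) := by field_simp
  rw [this, sub_nonneg]
  exact one_div_le_one_div_of_le h2 h1

/-- The opposite comparison V ≥ V'(r_c) (r - r_c): the divergence of τ is no worse than logarithmic.
-/
theorem IsTortoise.sub_log_antitoneOn (ht : IsTortoise V τ rc) (h : IsExpanding V V' rc) :
    AntitoneOn (fun r => τ r - (V' rc)⁻¹ * Real.log (r - rc)) (Ioi rc) := by
  have hd : ∀ r, rc < r → HasDerivAt (fun r => τ r - (V' rc)⁻¹ * Real.log (r - rc))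
      (1 / V r - (V' rc)⁻¹ * (1 / (r - rc))) r := fun r hr =>
    (ht.hasDerivAt r hr).sub ((((hasDerivAt_id r).sub_const rc).log (sub_pos.2 hr).ne').const_mul _)
  refine antitoneOn_of_hasDerivWithinAt_nonpos (convex_Ioi rc)
    (fun r hr => (hd r hr).continuousAt.continuousWithinAt)
    (fun r hr => (hd r (interior_subset hr)).hasDerivWithinAt) fun r hr => ?_
  have hr : rc < r := interior_subset hr
  have h1 := h.lower hr
  have h3 := h.deriv_pos
  have h4 := sub_pos.2 hr
  have : (V' rc)⁻¹ * (1 / (r - rc)) = 1 / (V' rc * (r - rc)) := by field_simp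
  rw [this, sub_nonpos]
  exact one_div_le_one_div_of_le (mul_pos h3 h4) h1

theorem tendsto_sub_nhdsGT (rc : ℝ) : Tendsto (fun r => r - rc) (𝓝[>] rc) (𝓝[>] 0) := by
  refine tendsto_nhdsWithin_iff.2 ⟨?_, ?_⟩
  · have : Tendsto (fun r => r - rc) (𝓝 rc) (𝓝 (rc - rc)) :=
      (continuous_id.sub continuous_const).tendsto rc
    rw [sub_self] at this
    exact this.mono_left nhdsWithin_le_nhds
  · filter_upwards [self_mem_nhdsWithin] with r hr using sub_pos.2 (mem_Ioi.1 hr)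

theorem IsTortoise.tendsto_atBot (ht : IsTortoise V τ rc) (h : IsExpanding V V' rc) :
    Tendsto τ (𝓝[>] rc) atBot := by
  have hr₁ : rc < rc + 1 := by linarith
  have hp := h.deriv_pos' hr₁.le
  have h1 : Tendsto (fun r => (τ (rc + 1)) + (V' (rc + 1))⁻¹ * Real.log (r - rc))
      (𝓝[>] rc) atBot := by
    refine tendsto_atBot_add_const_left _ _ (Tendsto.const_mul_atBot (inv_pos.2 hp) ?_)
    exact Real.tendsto_log_nhdsGT_zero.comp (tendsto_sub_nhdsGT rc)
  refine tendsto_atBot_mono' _ ?_ h1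
  filter_upwards [Ioc_mem_nhdsGT hr₁] with r hr
  have := ht.sub_log_monotoneOn h hr₁ hr (right_mem_Ioc.2 hr₁) hr.2
  simp at this
  linarith

/-- A factor r - r_c beats the logarithm. This absorbs the length of the t-support of the localized
energies, which grows like |τ| at the horizon. -/
theorem IsTortoise.tendsto_mul (ht : IsTortoise V τ rc) (h : IsExpanding V V' rc) :
    Tendsto (fun r => (r - rc) * τ r) (𝓝[>] rc) (𝓝 0) := by
  have hr₁ : rc < rc + 1 := by linarith
  have l0 : Tendsto (fun r => r - rc) (𝓝[>] rc) (𝓝 0) :=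
    (tendsto_sub_nhdsGT rc).mono_right nhdsWithin_le_nhds
  have l1 : Tendsto (fun r => Real.log (r - rc) * (r - rc)) (𝓝[>] rc) (𝓝 0) := by
    have := tendsto_log_mul_rpow_nhdsGT_zero (r := 1) one_pos
    simp only [Real.rpow_one] at this
    exact this.comp (tendsto_sub_nhdsGT rc)
  have lc : ∀ c : ℝ, Tendsto (fun r => (r - rc) * τ (rc + 1) +
      c * (Real.log (r - rc) * (r - rc))) (𝓝[>] rc) (𝓝 0) := by
    intro c
    simpa using (l0.mul_const (τ (rc + 1))).add (l1.const_mul c)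
  refine tendsto_of_tendsto_of_tendsto_of_le_of_le' (lc (V' rc)⁻¹) (lc (V' (rc + 1))⁻¹) ?_ ?_
  · filter_upwards [Ioc_mem_nhdsGT hr₁] with r hr
    have := ht.sub_log_antitoneOn h hr.1 hr₁ hr.2
    simp at this
    have h4 := sub_pos.2 hr.1
    nlinarith
  · filter_upwards [Ioc_mem_nhdsGT hr₁] with r hr
    have := ht.sub_log_monotoneOn h hr₁ hr (right_mem_Ioc.2 hr₁) hr.2
    simp at this
    have h4 := sub_pos.2 hr.1
    nlinarith

/-- The area radius as a function of the tortoise coordinate. -/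
structure IsRadius (V τ R : ℝ → ℝ) (rc r₁ : ℝ) : Prop where
  mem : ∀ x, x < τ r₁ → R x ∈ Ioo rc r₁
  right_inv : ∀ x, x < τ r₁ → τ (R x) = x
  left_inv : ∀ r ∈ Ioo rc r₁, R (τ r) = r
  hasDerivAt : ∀ x, x < τ r₁ → HasDerivAt R (V (R x)) x
  tendsto : Tendsto R atBot (𝓝 rc)

theorem IsTortoise.exists_radius (ht : IsTortoise V τ rc) (h : IsExpanding V V' rc) {r₁ : ℝ}
    (hr₁ : rc < r₁) : ∃ R, IsRadius V τ R rc r₁ := by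
  have hmono := ht.strictMonoOn h
  have hex : ∀ x, ∃ r, x < τ r₁ → r ∈ Ioo rc r₁ ∧ τ r = x := by
    intro x
    by_cases hx : x < τ r₁
    swap
    · exact ⟨0, fun h => absurd h hx⟩
    obtain ⟨a, ha, ha'⟩ := ((ht.tendsto_atBot h).eventually (eventually_lt_atBot x)).and
      (Ioo_mem_nhdsGT hr₁) |>.exists
    obtain ⟨r, hr, hr'⟩ := intermediate_value_Icc ha'.2.le
      (ht.continuousOn.mono fun s hs => ha'.1.trans_le hs.1) ⟨ha.le, hx.le⟩
    refine ⟨r, fun _ => ⟨⟨ha'.1.trans_le hr.1, ?_⟩, hr'⟩⟩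
    refine lt_of_le_of_ne hr.2 ?_
    rintro rfl
    exact hx.ne hr'.symm
  choose R hR using hex
  have mem : ∀ x, x < τ r₁ → R x ∈ Ioo rc r₁ := fun x hx => (hR x hx).1
  have rinv : ∀ x, x < τ r₁ → τ (R x) = x := fun x hx => (hR x hx).2
  have lt_iff : ∀ x, x < τ r₁ → ∀ r ∈ Ioo rc r₁, (R x < r ↔ x < τ r) := by
    intro x hx r hr
    rw [← hmono.lt_iff_lt (mem x hx).1 hr.1, rinv x hx]
  have gt_iff : ∀ x, x < τ r₁ → ∀ r ∈ Ioo rc r₁, (r < R x ↔ τ r < x) := by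
    intro x hx r hr
    rw [← hmono.lt_iff_lt hr.1 (mem x hx).1, rinv x hx]
  refine ⟨R, mem, rinv, ?_, ?_, ?_⟩
  · intro r hr
    have hx : τ r < τ r₁ := hmono hr.1 hr₁ hr.2
    exact hmono.injOn (mem _ hx).1 hr.1 (rinv _ hx)
  · intro x hx
    have hm := mem x hx
    -- Continuity of the inverse follows from order alone. Taking the maximum or minimum with a
    -- midpoint keeps the comparison value inside (r_c, r₁), where `lt_iff` and `gt_iff` apply.
    have hcont : ContinuousAt R x := by
      refine tendsto_order.2 ⟨fun a ha => ?_, fun a ha => ?_⟩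
      · have hb : max a ((rc + R x) / 2) ∈ Ioo rc r₁ :=
          ⟨lt_max_of_lt_right (by linarith [hm.1]), max_lt (ha.trans hm.2) (by linarith [hm.1, hm.2])⟩
        have : max a ((rc + R x) / 2) < R x := max_lt ha (by linarith [hm.1])
        filter_upwards [lt_mem_nhds ((gt_iff x hx _ hb).1 this), gt_mem_nhds hx] with y hy hy'
        exact (le_max_left _ _).trans_lt ((gt_iff y hy' _ hb).2 hy)
      · have hb : min a ((r₁ + R x) / 2) ∈ Ioo rc r₁ :=
          ⟨lt_min (hm.1.trans ha) (by linarith [hm.1]), min_lt_of_right_lt (by linarith [hm.2])⟩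
        have : R x < min a ((r₁ + R x) / 2) := lt_min ha (by linarith [hm.2])
        filter_upwards [gt_mem_nhds ((lt_iff x hx _ hb).1 this), gt_mem_nhds hx] with y hy hy'
        exact ((lt_iff y hy' _ hb).2 hy).trans_le (min_le_left _ _)
    have hV := h.pos hm.1
    have := HasDerivAt.of_local_left_inverse hcont (ht.hasDerivAt (R x) hm.1)
      (one_div_pos.2 hV).ne' (by filter_upwards [gt_mem_nhds hx] with y hy using rinv y hy)
    simpa using this
  · refine tendsto_order.2 ⟨fun a ha => ?_, fun a ha => ?_⟩
    · filter_upwards [eventually_lt_atBot (τ r₁)] with x hx using ha.trans (mem x hx).1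
    · have hb : min a ((r₁ + rc) / 2) ∈ Ioo rc r₁ :=
        ⟨lt_min ha (by linarith), min_lt_of_right_lt (by linarith)⟩
      filter_upwards [eventually_lt_atBot (τ r₁), eventually_lt_atBot (τ (min a ((r₁ + rc) / 2)))]
        with x hx hx'
      exact ((lt_iff x hx _ hb).2 hx').trans_le (min_le_left _ _)

end

/-! ### The characteristic problem in the corner between the two branches -/

theorem abs_sub_le_of_abs_deriv_le {y Y y' Y' : ℝ → ℝ} {a b : ℝ} (hab : a ≤ b)
    (hy : ∀ x ∈ Icc a b, HasDerivAt y (y' x) x) (hY : ∀ x ∈ Icc a b, HasDerivAt Y (Y' x) x)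
    (h : ∀ x ∈ Icc a b, |y' x| ≤ Y' x) : |y b - y a| ≤ Y b - Y a := by
  have h1 : MonotoneOn (fun x => Y x - y x) (Icc a b) := by
    refine monotoneOn_of_hasDerivWithinAt_nonneg (convex_Icc a b)
      (fun x hx => ((hY x hx).sub (hy x hx)).continuousAt.continuousWithinAt)
      (fun x hx => ((hY x (interior_subset hx)).sub (hy x (interior_subset hx))).hasDerivWithinAt)
      fun x hx => ?_
    have := (abs_le.1 (h x (interior_subset hx))).2
    linarith
  have h2 : MonotoneOn (fun x => Y x + y x) (Icc a b) := by
    refine monotoneOn_of_hasDerivWithinAt_nonneg (convex_Icc a b)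
      (fun x hx => ((hY x hx).add (hy x hx)).continuousAt.continuousWithinAt)
      (fun x hx => ((hY x (interior_subset hx)).add (hy x (interior_subset hx))).hasDerivWithinAt)
      fun x hx => ?_
    have := (abs_le.1 (h x (interior_subset hx))).1
    linarith
  have h1 := h1 (left_mem_Icc.2 hab) (right_mem_Icc.2 hab) hab
  have h2 := h2 (left_mem_Icc.2 hab) (right_mem_Icc.2 hab) hab
  simp only at h1 h2
  rw [abs_le]
  constructor <;> linarith

/-- This plays the role of integration from the horizon, which lies at -∞; a majorant with a limit
there replaces integrability of the derivative. -/
theorem abs_sub_le_of_abs_deriv_le_of_tendsto {y Y y' Y' : ℝ → ℝ} {b y₀ Y₀ : ℝ}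
    (hy : ∀ x ≤ b, HasDerivAt y (y' x) x) (hY : ∀ x ≤ b, HasDerivAt Y (Y' x) x)
    (h : ∀ x ≤ b, |y' x| ≤ Y' x) (hy₀ : Tendsto y atBot (𝓝 y₀)) (hY₀ : Tendsto Y atBot (𝓝 Y₀)) :
    |y b - y₀| ≤ Y b - Y₀ := by
  refine le_of_tendsto_of_tendsto ((tendsto_const_nhds.sub hy₀).abs) (tendsto_const_nhds.sub hY₀) ?_
  filter_upwards [eventually_le_atBot b] with a ha
  exact abs_sub_le_of_abs_deriv_le ha (fun x hx => hy x hx.2) (fun x hx => hY x hx.2)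
    (fun x hx => h x hx.2)

/-- A solution `Ψ` of a wave equation `∂_u ∂_v Ψ = k` in a region `u + v < s₂` of the past of which
only the two null boundaries `u = -∞`, `v = -∞`, but not their intersection, are known to be
regular. -/
structure IsDoubleNull (Ψ p q k : ℝ → ℝ → ℝ) (Z W : ℝ → ℝ) (f f' g g' : ℝ → ℝ) (K L s₁ s₂ : ℝ) :
    Prop where
  K_nonneg : 0 ≤ K
  L_nonneg : 0 ≤ L
  lt : s₁ < s₂
  deriv_u : ∀ u v, u + v < s₂ → HasDerivAt (fun u => Ψ u v) (p u v) u
  deriv_v : ∀ u v, u + v < s₂ → HasDerivAt (fun v => Ψ u v) (q u v) v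
  deriv_uv : ∀ u v, u + v < s₂ → HasDerivAt (fun v => p u v) (k u v) v
  deriv_vu : ∀ u v, u + v < s₂ → HasDerivAt (fun u => q u v) (k u v) u
  deriv_Z : ∀ s, s < s₂ → HasDerivAt Z (W s) s
  Z_nonneg : ∀ s, s < s₂ → 0 ≤ Z s
  Z_le : ∀ s, s < s₂ → Z s ≤ L * W s
  W_nonneg : ∀ s, s < s₂ → 0 ≤ W s
  tendsto_Z : Tendsto Z atBot (𝓝 0)
  bound : ∀ u v, u + v < s₂ → |k u v| ≤ K * W (u + v) * (|Ψ u v| + |p u v| + |q u v|)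
  tendsto_f : ∀ u, Tendsto (fun v => Ψ u v) atBot (𝓝 (f u))
  tendsto_g : ∀ v, Tendsto (fun u => Ψ u v) atBot (𝓝 (g v))
  tendsto_f' : ∀ u, Tendsto (fun v => p u v) atBot (𝓝 (f' u))
  tendsto_g' : ∀ v, Tendsto (fun u => q u v) atBot (𝓝 (g' v))
  strip_u : ∀ a b, ∃ B, ∀ u v, u ∈ Icc a b → u + v ≤ s₁ → |Ψ u v| + |p u v| + |q u v| ≤ B
  strip_v : ∀ a b, ∃ B, ∀ u v, v ∈ Icc a b → u + v ≤ s₁ → |Ψ u v| + |p u v| + |q u v| ≤ B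
  f_deriv : ∀ u, HasDerivAt f (f' u) u
  f_zero : Tendsto f atBot (𝓝 0)
  g_bound : ∀ T, ∃ B, ∀ v ≤ T, |g v| ≤ B ∧ |g' v| ≤ B

namespace IsDoubleNull

variable {Ψ p q k : ℝ → ℝ → ℝ} {Z W : ℝ → ℝ} {f f' g g' : ℝ → ℝ} {K L s₁ s₂ : ℝ}

theorem Z_mono (h : IsDoubleNull Ψ p q k Z W f f' g g' K L s₁ s₂) : MonotoneOn Z (Iio s₂) :=
  monotoneOn_of_hasDerivWithinAt_nonneg (convex_Iio s₂)
    (fun x hx => (h.deriv_Z x hx).continuousAt.continuousWithinAt)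
    (fun x hx => (h.deriv_Z x (mem_Iio.1 (interior_subset hx))).hasDerivWithinAt)
    fun x hx => h.W_nonneg x (mem_Iio.1 (interior_subset hx))

theorem deriv_Z_left (h : IsDoubleNull Ψ p q k Z W f f' g g' K L s₁ s₂) {u v : ℝ}
    (huv : u + v < s₂) : HasDerivAt (fun u => Z (u + v)) (W (u + v)) u := by
  simpa using (h.deriv_Z _ huv).comp_add_const u v

theorem deriv_Z_right (h : IsDoubleNull Ψ p q k Z W f f' g g' K L s₁ s₂) {u v : ℝ}
    (huv : u + v < s₂) : HasDerivAt (fun v => Z (u + v)) (W (u + v)) v := by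
  simpa using (h.deriv_Z _ huv).comp_const_add u v

theorem tendsto_Z_left (h : IsDoubleNull Ψ p q k Z W f f' g g' K L s₁ s₂) (v : ℝ) :
    Tendsto (fun u => Z (u + v)) atBot (𝓝 0) :=
  h.tendsto_Z.comp (tendsto_atBot_add_const_right _ v tendsto_id)

theorem tendsto_Z_right (h : IsDoubleNull Ψ p q k Z W f f' g g' K L s₁ s₂) (u : ℝ) :
    Tendsto (fun v => Z (u + v)) atBot (𝓝 0) :=
  h.tendsto_Z.comp (tendsto_atBot_add_const_left _ u tendsto_id)

/-- In the corner, bounds are available on the line v = w and on the branch u = -∞. Integrating `k`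
yields `p` from v = w and `q` from u = -∞, with errors K M Z. The derivative `p` of `Ψ` is not
small, so `Ψ` is compared with its values on v = w: the u-derivative of Ψ(u, w) - Ψ(u, v) is O(Z),
and Z ≤ L W makes this integrable up to u = -∞. -/
theorem corner_step (h : IsDoubleNull Ψ p q k Z W f f' g g' K L s₁ s₂) {w v' B M : ℝ}
    (hw : w + w ≤ s₁)
    (hM : 0 ≤ M)
    (hB : ∀ u ≤ w, |Ψ u w| + |p u w| + |q u w| ≤ B) (hg : ∀ v ≤ w, |g v| ≤ B ∧ |g' v| ≤ B)
    (hv : ∀ u v, u ≤ w → v ∈ Icc v' w → |Ψ u v| + |p u v| + |q u v| ≤ M) {u v : ℝ} (hu : u ≤ w)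
    (hv' : v ∈ Icc v' w) :
    |Ψ u v| + |p u v| + |q u v| ≤ 5 * B + K * (2 + L) * Z (w + w) * M := by
  have hlt : ∀ u v, u ≤ w → v ≤ w → u + v < s₂ := fun u v h1 h2 => by linarith [h.lt]
  have hk : ∀ u v, u ≤ w → v ∈ Icc v' w → |k u v| ≤ K * M * W (u + v) := by
    intro u v h1 h2
    refine (h.bound u v (hlt u v h1 h2.2)).trans ?_
    have := mul_le_mul_of_nonneg_left (hv u v h1 h2)
      (mul_nonneg h.K_nonneg (h.W_nonneg _ (hlt u v h1 h2.2)))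
    linarith
  have hKM : 0 ≤ K * M := mul_nonneg h.K_nonneg hM
  have hZw : ∀ u v, u ≤ w → v ≤ w → Z (u + v) ≤ Z (w + w) := fun u v h1 h2 =>
    h.Z_mono (hlt u v h1 h2) (hlt w w le_rfl le_rfl) (by linarith)
  -- the bound on `p`
  have hp : ∀ u ≤ w, |p u w - p u v| ≤ K * M * Z (u + w) := by
    intro u hu
    have := abs_sub_le_of_abs_deriv_le (y := fun v => p u v) (Y := fun v => K * M * Z (u + v))
      hv'.2 (fun x hx => h.deriv_uv u x (hlt u x hu hx.2))
      (fun x hx => (h.deriv_Z_right (hlt u x hu hx.2)).const_mul (K * M))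
      (fun x hx => hk u x hu ⟨hv'.1.trans hx.1, hx.2⟩)
    have h0 := mul_nonneg hKM (h.Z_nonneg _ (hlt u v hu hv'.2))
    linarith
  have hq : |q u v - g' v| ≤ K * M * Z (u + v) := by
    have := abs_sub_le_of_abs_deriv_le_of_tendsto (y := fun u => q u v)
      (Y := fun u => K * M * Z (u + v)) (b := u)
      (fun x hx => h.deriv_vu x v (hlt x v (hx.trans hu) hv'.2))
      (fun x hx => (h.deriv_Z_left (hlt x v (hx.trans hu) hv'.2)).const_mul (K * M))
      (fun x hx => hk x v (hx.trans hu) hv') (h.tendsto_g' v)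
      ((h.tendsto_Z_left v).const_mul (K * M))
    simpa using this
  have hΨ : |Ψ u w - Ψ u v - (g w - g v)| ≤ K * M * L * Z (u + w) := by
    have := abs_sub_le_of_abs_deriv_le_of_tendsto (y := fun u => Ψ u w - Ψ u v)
      (Y := fun u => K * M * L * Z (u + w)) (b := u)
      (fun x hx => (h.deriv_u x w (hlt x w (hx.trans hu) le_rfl)).sub
        (h.deriv_u x v (hlt x v (hx.trans hu) hv'.2)))
      (fun x hx => (h.deriv_Z_left (hlt x w (hx.trans hu) le_rfl)).const_mul (K * M * L))
      (fun x hx => (hp x (hx.trans hu)).trans ?_) ((h.tendsto_g w).sub (h.tendsto_g v))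
      ((h.tendsto_Z_left w).const_mul (K * M * L))
    · simpa using this
    · have := mul_le_mul_of_nonneg_left (h.Z_le _ (hlt x w (hx.trans hu) le_rfl)) hKM
      linarith
  have hB' := hB u hu
  have hg1 := hg v hv'.2
  have hg2 := hg w le_rfl
  have hp := hp u hu
  have z1 := mul_le_mul_of_nonneg_left (hZw u w hu le_rfl) hKM
  have z2 := mul_le_mul_of_nonneg_left (hZw u v hu hv'.2) hKM
  have z3 := mul_le_mul_of_nonneg_left (hZw u w hu le_rfl) (mul_nonneg hKM h.L_nonneg)
  have a1 : |p u v| ≤ |p u w| + |p u w - p u v| := by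
    have := abs_sub_abs_le_abs_sub (p u v) (p u w)
    rw [abs_sub_comm] at this
    linarith
  have a2 : |q u v| ≤ |g' v| + |q u v - g' v| := by
    have := abs_sub_abs_le_abs_sub (q u v) (g' v)
    linarith
  have a3 : |Ψ u v| ≤ |Ψ u w| + |g w| + |g v| + |Ψ u w - Ψ u v - (g w - g v)| := by
    have e : Ψ u v = Ψ u w - g w + g v - (Ψ u w - Ψ u v - (g w - g v)) := by ring
    calc |Ψ u v| = |Ψ u w - g w + g v - (Ψ u w - Ψ u v - (g w - g v))| := by rw [← e]
      _ ≤ |Ψ u w - g w + g v| + |Ψ u w - Ψ u v - (g w - g v)| := abs_sub _ _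
      _ ≤ _ := by
        have := abs_add_le (Ψ u w - g w) (g v)
        have := abs_sub (Ψ u w) (g w)
        linarith
  have b1 := abs_nonneg (q u w)
  have b2 := abs_nonneg (p u w)
  have : K * (2 + L) * Z (w + w) * M = K * M * Z (w + w) + K * M * Z (w + w) +
    K * M * L * Z (w + w) := by ring
  rw [this]
  linarith [hg1.1, hg1.2, hg2.1, abs_nonneg (g v)]

/-- An absorption argument. For v in a compact interval the supremum M is finite by `strip_v`, with
no uniformity as v → -∞; then M ≤ 5 B + M/2 gives a bound that no longer depends on the interval. -/
theorem corner_bound (h : IsDoubleNull Ψ p q k Z W f f' g g' K L s₁ s₂) {w B : ℝ}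
    (hw : w + w ≤ s₁) (hsmall : K * (2 + L) * Z (w + w) ≤ 1 / 2)
    (hB : ∀ u ≤ w, |Ψ u w| + |p u w| + |q u w| ≤ B) (hg : ∀ v ≤ w, |g v| ≤ B ∧ |g' v| ≤ B)
    {u v : ℝ} (hu : u ≤ w) (hv : v ≤ w) : |Ψ u v| + |p u v| + |q u v| ≤ 10 * B := by
  set S : Set ℝ := (fun z : ℝ × ℝ => |Ψ z.1 z.2| + |p z.1 z.2| + |q z.1 z.2|) ''
    {z | z.1 ≤ w ∧ z.2 ∈ Icc v w} with hS
  obtain ⟨B', hB'⟩ := h.strip_v v w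
  have hbdd : BddAbove S := by
    refine ⟨B', ?_⟩
    rintro _ ⟨z, hz, rfl⟩
    exact hB' z.1 z.2 hz.2 (by linarith [hz.1, hz.2.2])
  have hmem : ∀ z : ℝ × ℝ, z.1 ≤ w → z.2 ∈ Icc v w →
      |Ψ z.1 z.2| + |p z.1 z.2| + |q z.1 z.2| ≤ sSup S := fun z h1 h2 =>
    le_csSup hbdd ⟨z, ⟨h1, h2⟩, rfl⟩
  have hM : 0 ≤ sSup S := by
    refine le_trans ?_ (hmem (u, v) hu (left_mem_Icc.2 hv))
    positivity
  have hle : sSup S ≤ 5 * B + K * (2 + L) * Z (w + w) * sSup S := by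
    refine csSup_le ⟨_, (u, v), ⟨hu, left_mem_Icc.2 hv⟩, rfl⟩ ?_
    rintro _ ⟨z, hz, rfl⟩
    exact h.corner_step hw hM hB hg (fun u v h1 h2 => hmem (u, v) h1 h2) hz.1 hz.2
  have := mul_le_mul_of_nonneg_right hsmall hM
  have := hmem (u, v) hu (left_mem_Icc.2 hv)
  simp only at this
  linarith

/-- The region u, v ≤ T splits into a corner u, v ≤ w, with w so negative that the error can be
absorbed, and two strips in which u or v stays in a compact interval; there the regularity at one
branch suffices. -/
theorem bounded (h : IsDoubleNull Ψ p q k Z W f f' g g' K L s₁ s₂) (T : ℝ) :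
    ∃ B, 0 ≤ B ∧ ∀ u v, u ≤ T → v ≤ T → u + v ≤ s₁ → |Ψ u v| + |p u v| + |q u v| ≤ B := by
  have h1 : ∀ᶠ w in atBot, K * (2 + L) * Z (w + w) < 1 / 2 := by
    have : Tendsto (fun w : ℝ => K * (2 + L) * Z (w + w)) atBot (𝓝 (K * (2 + L) * 0)) :=
      (h.tendsto_Z.comp (tendsto_id.atBot_add_atBot tendsto_id)).const_mul _
    rw [mul_zero] at this
    exact this.eventually (gt_mem_nhds (by norm_num))
  obtain ⟨w, hw1, hw2, hw3⟩ := (h1.and ((eventually_le_atBot (s₁ / 2)).and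
    (eventually_le_atBot T))).exists
  obtain ⟨B₁, hB₁⟩ := h.strip_v w T
  obtain ⟨B₂, hB₂⟩ := h.strip_u w T
  obtain ⟨B₃, hB₃⟩ := h.g_bound w
  have hw : w + w ≤ s₁ := by linarith
  set B := max B₁ (max B₂ (max B₃ 0))
  have hB0 : 0 ≤ B := le_max_of_le_right (le_max_of_le_right (le_max_right _ _))
  have hB1 : B₁ ≤ B := le_max_left _ _
  have hB2 : B₂ ≤ B := le_max_of_le_right (le_max_left _ _)
  have hB3 : B₃ ≤ B := le_max_of_le_right (le_max_of_le_right (le_max_left _ _))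
  refine ⟨10 * B, by positivity, fun u v hu hv huv => ?_⟩
  by_cases h1 : u ≤ w
  · by_cases h2 : v ≤ w
    · exact h.corner_bound hw hw1.le
        (fun u hu => (hB₁ u w (left_mem_Icc.2 hw3) (by linarith)).trans hB1)
        (fun v hv => ⟨(hB₃ v hv).1.trans hB3, (hB₃ v hv).2.trans hB3⟩) h1 h2
    · have := hB₁ u v ⟨(not_le.1 h2).le, hv⟩ huv
      linarith
  · have := hB₂ u v ⟨(not_le.1 h1).le, hu⟩ huv
    linarith

/-- With `Ψ`, `p`, `q` bounded, integrating once more from the two branches gains a factor Z. For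
`Ψ` the integration starts at u = -∞, where the solution tends to g(v); there the trace f has to
vanish for the constant to be right. -/
theorem remainder (h : IsDoubleNull Ψ p q k Z W f f' g g' K L s₁ s₂) (T : ℝ) :
    ∃ C, 0 ≤ C ∧ ∀ u v, u ≤ T → v ≤ T → u + v ≤ s₁ → |p u v - f' u| ≤ C * Z (u + v) ∧
      |q u v - g' v| ≤ C * Z (u + v) ∧ |Ψ u v - f u - g v| ≤ C * Z (u + v) := by
  obtain ⟨B, hB, hbd⟩ := h.bounded T
  have hKB := mul_nonneg h.K_nonneg hB
  have hk : ∀ u v, u ≤ T → v ≤ T → u + v ≤ s₁ → |k u v| ≤ K * B * W (u + v) := by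
    intro u v h1 h2 h3
    have hlt : u + v < s₂ := h3.trans_lt h.lt
    refine (h.bound u v hlt).trans ?_
    have := mul_le_mul_of_nonneg_left (hbd u v h1 h2 h3)
      (mul_nonneg h.K_nonneg (h.W_nonneg _ hlt))
    linarith
  have hq : ∀ u v, u ≤ T → v ≤ T → u + v ≤ s₁ → |q u v - g' v| ≤ K * B * Z (u + v) := by
    intro u v h1 h2 h3
    have hlt : ∀ x ≤ u, x + v < s₂ := fun x hx => by linarith [h.lt]
    have := abs_sub_le_of_abs_deriv_le_of_tendsto (y := fun u => q u v)
      (Y := fun u => K * B * Z (u + v)) (b := u)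
      (fun x hx => h.deriv_vu x v (hlt x hx))
      (fun x hx => (h.deriv_Z_left (hlt x hx)).const_mul (K * B))
      (fun x hx => hk x v (hx.trans h1) h2 (by linarith)) (h.tendsto_g' v)
      ((h.tendsto_Z_left v).const_mul (K * B))
    simpa using this
  have hp : ∀ u v, u ≤ T → v ≤ T → u + v ≤ s₁ → |p u v - f' u| ≤ K * B * Z (u + v) := by
    intro u v h1 h2 h3
    have hlt : ∀ x ≤ v, u + x < s₂ := fun x hx => by linarith [h.lt]
    have := abs_sub_le_of_abs_deriv_le_of_tendsto (y := fun v => p u v)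
      (Y := fun v => K * B * Z (u + v)) (b := v)
      (fun x hx => h.deriv_uv u x (hlt x hx))
      (fun x hx => (h.deriv_Z_right (hlt x hx)).const_mul (K * B))
      (fun x hx => hk u x h1 (hx.trans h2) (by linarith)) (h.tendsto_f' u)
      ((h.tendsto_Z_right u).const_mul (K * B))
    simpa using this
  refine ⟨K * B * (1 + L), by have := h.L_nonneg; positivity, fun u v h1 h2 h3 => ?_⟩
  have hlt : ∀ x ≤ u, x + v < s₂ := fun x hx => by linarith [h.lt]
  have hz := mul_nonneg (mul_nonneg hKB (h.Z_nonneg _ (hlt u le_rfl))) h.L_nonneg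
  have hz' := mul_nonneg hKB (h.Z_nonneg _ (hlt u le_rfl))
  refine ⟨(hp u v h1 h2 h3).trans (by linarith), (hq u v h1 h2 h3).trans (by linarith), ?_⟩
  have := abs_sub_le_of_abs_deriv_le_of_tendsto (y := fun u => Ψ u v - f u)
      (Y := fun u => K * B * L * Z (u + v)) (b := u)
      (fun x hx => (h.deriv_u x v (hlt x hx)).sub (h.f_deriv x))
      (fun x hx => (h.deriv_Z_left (hlt x hx)).const_mul (K * B * L))
      (fun x hx => (hp x v (hx.trans h1) h2 (by linarith)).trans ?_)
      ((h.tendsto_g v).sub h.f_zero)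
      ((h.tendsto_Z_left v).const_mul (K * B * L))
  · simp only [sub_zero, mul_zero] at this
    linarith
  · have := mul_le_mul_of_nonneg_left (h.Z_le _ (hlt x hx)) hKB
    linarith

end IsDoubleNull

/-! ### A single angular mode as a characteristic problem -/

/-- `F` is continuously differentiable on `U`, with partial derivatives `F₁` and `F₂`. -/
structure HasPartials (F F₁ F₂ : ℝ → ℝ → ℝ) (U : Set (ℝ × ℝ)) : Prop where
  fst : ∀ x y, (x, y) ∈ U → HasDerivAt (fun x => F x y) (F₁ x y) x
  snd : ∀ x y, (x, y) ∈ U → HasDerivAt (fun y => F x y) (F₂ x y) y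
  cont : ContinuousOn (fun z : ℝ × ℝ => F z.1 z.2) U
  cont_fst : ContinuousOn (fun z : ℝ × ℝ => F₁ z.1 z.2) U
  cont_snd : ContinuousOn (fun z : ℝ × ℝ => F₂ z.1 z.2) U

theorem HasPartials.comp {F F₁ F₂ : ℝ → ℝ → ℝ} {U : Set (ℝ × ℝ)} (h : HasPartials F F₁ F₂ U)
    (hU : IsOpen U) {x y : ℝ → ℝ} {x' y' s : ℝ} (hs : (x s, y s) ∈ U) (hx : HasDerivAt x x' s)
    (hy : HasDerivAt y y' s) :
    HasDerivAt (fun s => F (x s) (y s)) (F₁ (x s) (y s) * x' + F₂ (x s) (y s) * y') s := by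
  have hev : ∀ᶠ z in 𝓝 (x s, y s), z ∈ U := hU.mem_nhds hs
  have key := hasStrictFDerivAt_uncurry_coprod (𝕜 := ℝ) (u := (x s, y s)) (f := F)
    (f₁ := fun a b => ContinuousLinearMap.toSpanSingleton ℝ (F₁ a b))
    (f₂ := fun a b => ContinuousLinearMap.toSpanSingleton ℝ (F₂ a b))
    (by filter_upwards [hev] with z hz using (h.fst z.1 z.2 hz).hasFDerivAt)
    (by filter_upwards [hev] with z hz using (h.snd z.1 z.2 hz).hasFDerivAt)
    ((ContinuousLinearMap.toSpanSingletonCLE (𝕜 := ℝ) (E := ℝ)).continuous.continuousAt.comp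
      (h.cont_fst.continuousAt (hU.mem_nhds hs)))
    ((ContinuousLinearMap.toSpanSingletonCLE (𝕜 := ℝ) (E := ℝ)).continuous.continuousAt.comp
      (h.cont_snd.continuousAt (hU.mem_nhds hs)))
  have := key.hasFDerivAt.comp_hasDerivAt s (hx.prodMk hy)
  refine (this.congr_deriv ?_)
  simp [Function.HasUncurry.uncurry, mul_comm]

/-- The exterior region `r > rc` in the coordinates `(t, r)`. -/
def beyond (rc : ℝ) : Set (ℝ × ℝ) := {z | rc < z.2}

theorem isOpen_beyond (rc : ℝ) : IsOpen (beyond rc) := isOpen_lt continuous_const continuous_snd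

/-- The Klein-Gordon equation for the coefficient `A(t, r)` of an angular mode with eigenvalue
`-lam` of the Laplacian on the sphere of dimension `d - 1`. -/
structure IsScalarWave (V V' : ℝ → ℝ) (rc d m lam : ℝ) (A At Ar Att Atr Arr : ℝ → ℝ → ℝ) :
    Prop where
  partials : HasPartials A At Ar (beyond rc)
  partials_t : HasPartials At Att Atr (beyond rc)
  partials_r : HasPartials Ar Atr Arr (beyond rc)
  eq : ∀ t r, rc < r → V r ^ 2 * Arr t r + V r * V' r * Ar t r + (d - 1) * V r ^ 2 / r * Ar t r
    - Att t r + V r * (lam / r ^ 2 + m ^ 2) * A t r = 0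

/-- The function `A(t, r)` extends, as a function `a` of `w = σ t + τ(r)` and `ρ = (r - rc)^{1/2}`,
continuously differentiably to the branch `ρ = 0` of the horizon, and has finite `H²` norm there. -/
structure IsBranch (τ : ℝ → ℝ) (rc σ : ℝ) (A a a' aρ : ℝ → ℝ → ℝ) (a'' : ℝ → ℝ) : Prop where
  partials : HasPartials a a' aρ univ
  eq : ∀ t ρ, 0 < ρ → a (σ * t + τ (rc + ρ ^ 2)) ρ = A t (rc + ρ ^ 2)
  deriv₂ : ∀ u, HasDerivAt (fun u => a' u 0) (a'' u) u
  cont₂ : Continuous a''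
  int₀ : Integrable (fun u => a u 0 ^ 2)
  int₁ : Integrable (fun u => a' u 0 ^ 2)
  int₂ : Integrable (fun u => a'' u ^ 2)

/-- Both f² and its derivative 2 f f' are integrable, so f² has a limit at -∞, which can only be
zero. -/
theorem tendsto_zero_of_integrable_sq {f f' : ℝ → ℝ} (hf : ∀ u, HasDerivAt f (f' u) u)
    (h0 : Integrable (fun u => f u ^ 2)) (h1 : Integrable (fun u => f' u ^ 2)) :
    Tendsto f atBot (𝓝 0) := by
  have hm : Measurable f' := by
    have : f' = deriv f := funext fun u => (hf u).deriv.symm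
    rw [this]; exact measurable_deriv f
  have hc : Continuous f := continuous_iff_continuousAt.2 fun u => (hf u).continuousAt
  have hi : Integrable (fun u => 2 * f u * f' u) := by
    refine (h0.add h1).mono' ((hc.measurable.const_mul 2).mul hm).aestronglyMeasurable
      (ae_of_all _ fun u => ?_)
    rw [Real.norm_eq_abs, abs_le]
    simp only [Pi.add_apply]
    constructor <;> nlinarith [sq_nonneg (f u - f' u), sq_nonneg (f u + f' u)]
  have := tendsto_zero_of_hasDerivAt_of_integrableOn_Iic (a := 0) (f := fun u => f u ^ 2)
    (f' := fun u => 2 * f u * f' u) (fun u _ => ((hf u).pow 2).congr_deriv (by simp))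
    hi.integrableOn h0.integrableOn
  have h2 := this.sqrt
  rw [Real.sqrt_zero] at h2
  simp_rw [Real.sqrt_sq_eq_abs] at h2
  exact (tendsto_zero_iff_abs_tendsto_zero f).2 h2

theorem exists_bound_Iic {f : ℝ → ℝ} (hc : Continuous f) (h0 : Tendsto f atBot (𝓝 0)) (T : ℝ) :
    ∃ B, ∀ v ≤ T, |f v| ≤ B := by
  have h1 : ∀ᶠ v in atBot, |f v| < 1 := by
    have := h0.abs
    rw [abs_zero] at this
    exact this.eventually (gt_mem_nhds one_pos)
  obtain ⟨N, hN⟩ := eventually_atBot.1 h1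
  obtain ⟨B, hB⟩ := (isCompact_Icc (a := N) (b := T)).exists_bound_of_continuousOn hc.continuousOn
  refine ⟨max 1 B, fun v hv => ?_⟩
  rcases le_total v N with h | h
  · exact (hN v h).le.trans (le_max_left _ _)
  · exact (hB v ⟨h, hv⟩).trans (le_max_right _ _)

section branch

variable {V V' τ : ℝ → ℝ} {rc σ : ℝ} {A At Ar a a' aρ : ℝ → ℝ → ℝ} {a'' : ℝ → ℝ}

theorem IsBranch.eq' (hb : IsBranch τ rc σ A a a' aρ a'') {t r : ℝ} (hr : rc < r) :
    A t r = a (σ * t + τ r) (√(r - rc)) := by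
  have h := hb.eq t (√(r - rc)) (Real.sqrt_pos.2 (sub_pos.2 hr))
  rw [Real.sq_sqrt (sub_pos.2 hr).le, add_sub_cancel] at h
  exact h.symm

theorem IsBranch.deriv_t (hb : IsBranch τ rc σ A a a' aρ a'') (hA : HasPartials A At Ar (beyond rc))
    {t r : ℝ} (hr : rc < r) : At t r = σ * a' (σ * t + τ r) (√(r - rc)) := by
  have h1 := hA.fst t r hr
  have h2 : HasDerivAt (fun t => a (σ * t + τ r) (√(r - rc)))
      (a' (σ * t + τ r) (√(r - rc)) * σ) t := by
    have := (hb.partials.fst (σ * t + τ r) (√(r - rc)) (mem_univ _)).comp t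
      (((hasDerivAt_id t).const_mul σ).add_const (τ r))
    exact this.congr_deriv (by simp)
  rw [show (fun t => A t r) = fun t => a (σ * t + τ r) (√(r - rc)) from
    funext fun t => hb.eq' hr] at h1
  rw [h1.unique h2, mul_comm]

theorem IsBranch.deriv_r (hb : IsBranch τ rc σ A a a' aρ a'') (hA : HasPartials A At Ar (beyond rc))
    (ht : IsTortoise V τ rc) {t r : ℝ} (hr : rc < r) :
    Ar t r = a' (σ * t + τ r) (√(r - rc)) * (1 / V r) +
      aρ (σ * t + τ r) (√(r - rc)) * (1 / (2 * √(r - rc))) := by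
  have h1 := hA.snd t r hr
  have h2 := hb.partials.comp isOpen_univ (mem_univ (σ * t + τ r, √(r - rc)))
    ((ht.hasDerivAt r hr).const_add (σ * t))
    (((hasDerivAt_id r).sub_const rc).sqrt (sub_pos.2 hr).ne')
  refine (h1.congr_of_eventuallyEq ?_).unique h2
  filter_upwards [lt_mem_nhds hr] with r hr
  exact (hb.eq' hr).symm

/-- In the variables w and ρ one has σ ∂_t = ∂_w and V ∂_r = ∂_w + (V / 2ρ) ∂_ρ. The transversal
term is harmless since V ≤ V'(r₂) ρ². Hence at the branch one null derivative tends to the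
tangential derivative of the trace and the other to zero. -/
theorem IsBranch.abs_le (hb : IsBranch τ rc σ A a a' aρ a'') (hσ : σ * σ = 1)
    (hA : HasPartials A At Ar (beyond rc)) (h : IsExpanding V V' rc)
    (ht : IsTortoise V τ rc) {t r r₂ : ℝ} (hr : rc < r) (hr₂ : r ≤ r₂) :
    |(V r * Ar t r + σ * At t r) / 2 - a' (σ * t + τ r) (√(r - rc))| ≤
      V' r₂ * √(r - rc) * |aρ (σ * t + τ r) (√(r - rc))| ∧
    |(V r * Ar t r - σ * At t r) / 2| ≤
      V' r₂ * √(r - rc) * |aρ (σ * t + τ r) (√(r - rc))| := by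
  rw [hb.deriv_r hA ht hr, hb.deriv_t hA hr]
  set X := a' (σ * t + τ r) (√(r - rc))
  set Y := aρ (σ * t + τ r) (√(r - rc))
  have hV := h.pos hr
  have hs := Real.sqrt_pos.2 (sub_pos.2 hr)
  have e : V r * (X * (1 / V r) + Y * (1 / (2 * √(r - rc)))) = X + V r * Y / (2 * √(r - rc)) := by
    field_simp
  have e1 : σ * (σ * X) = X := by rw [← mul_assoc, hσ, one_mul]
  rw [e, e1]
  have key : |V r * Y / (2 * √(r - rc)) / 2| ≤ V' r₂ * √(r - rc) * |Y| := by
    rw [abs_div, abs_div, abs_mul, abs_of_pos hV, abs_of_pos (by positivity : 0 < 2 * √(r - rc)),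
      abs_two, div_div, div_le_iff₀ (by positivity)]
    have h1 := h.upper_of_le hr hr₂
    have h2 : V r ≤ V' r₂ * (√(r - rc) * √(r - rc)) := by
      rwa [Real.mul_self_sqrt (sub_pos.2 hr).le]
    have h3 := mul_le_mul_of_nonneg_right h2 (abs_nonneg Y)
    have h4 : 0 ≤ V r * |Y| := by positivity
    nlinarith
  constructor
  · convert! key using 2; ring
  · convert! key using 2; ring

theorem IsBranch.tendsto (hb : IsBranch τ rc σ A a a' aρ a'') (hσ : σ * σ = 1)
    (hA : HasPartials A At Ar (beyond rc)) (h : IsExpanding V V' rc)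
    (ht : IsTortoise V τ rc) {ι : Type*} {l : Filter ι} {t r : ι → ℝ} {w : ℝ}
    (hr : Tendsto r l (𝓝 rc)) (hrc : ∀ᶠ i in l, rc < r i) (hw : ∀ᶠ i in l, σ * t i + τ (r i) = w) :
    Tendsto (fun i => A (t i) (r i)) l (𝓝 (a w 0)) ∧
    Tendsto (fun i => (V (r i) * Ar (t i) (r i) + σ * At (t i) (r i)) / 2) l (𝓝 (a' w 0)) := by
  have hs : Tendsto (fun i => √(r i - rc)) l (𝓝 0) := by
    have := (hr.sub_const rc).sqrt
    simpa using this
  have hp : Tendsto (fun i => (w, √(r i - rc))) l (𝓝 (w, 0)) := tendsto_const_nhds.prodMk_nhds hs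
  have c0 := (continuousOn_univ.1 hb.partials.cont).continuousAt.tendsto.comp hp
  have c1 := (continuousOn_univ.1 hb.partials.cont_fst).continuousAt.tendsto.comp hp
  have c2 := (continuousOn_univ.1 hb.partials.cont_snd).continuousAt.tendsto.comp hp
  constructor
  · refine c0.congr' ?_
    filter_upwards [hrc, hw] with i h1 h2
    rw [hb.eq' h1, h2]
    rfl
  · have hz : Tendsto (fun i => V' (rc + 1) * √(r i - rc) * |aρ w (√(r i - rc))|) l (𝓝 0) := by
      have := (hs.const_mul (V' (rc + 1))).mul c2.abs
      simpa using this
    have hz2 : Tendsto (fun i => (V (r i) * Ar (t i) (r i) + σ * At (t i) (r i)) / 2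
        - a' w (√(r i - rc))) l (𝓝 0) := by
      refine squeeze_zero_norm' ?_ hz
      filter_upwards [hrc, hw, hr.eventually (gt_mem_nhds (lt_add_one rc))] with i h1 h2 h3
      have := (hb.abs_le hσ hA h ht (t := t i) h1 h3.le).1
      rw [h2] at this
      exact this
    have := hz2.add c1
    simpa using this

theorem IsBranch.strip (hb : IsBranch τ rc σ A a a' aρ a'') (hσ : σ * σ = 1)
    (hA : HasPartials A At Ar (beyond rc)) (h : IsExpanding V V' rc)
    (ht : IsTortoise V τ rc) {r₂ : ℝ} (hr₂ : rc < r₂) (α β : ℝ) :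
    ∃ B, ∀ t r, rc < r → r ≤ r₂ → σ * t + τ r ∈ Icc α β →
      |A t r| + |(V r * Ar t r + σ * At t r) / 2| + |(V r * Ar t r - σ * At t r) / 2| ≤ B := by
  have hK : IsCompact (Icc α β ×ˢ Icc 0 (√(r₂ - rc))) := isCompact_Icc.prod isCompact_Icc
  obtain ⟨B₀, h0⟩ := hK.exists_bound_of_continuousOn (hb.partials.cont.mono (subset_univ _))
  obtain ⟨B₁, h1⟩ := hK.exists_bound_of_continuousOn (hb.partials.cont_fst.mono (subset_univ _))
  obtain ⟨B₂, h2⟩ := hK.exists_bound_of_continuousOn (hb.partials.cont_snd.mono (subset_univ _))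
  refine ⟨B₀ + (B₁ + V' r₂ * √(r₂ - rc) * B₂) + V' r₂ * √(r₂ - rc) * B₂,
    fun t r hr hr' hw => ?_⟩
  have hmem : (σ * t + τ r, √(r - rc)) ∈ Icc α β ×ˢ Icc 0 (√(r₂ - rc)) :=
    ⟨hw, Real.sqrt_nonneg _, Real.sqrt_le_sqrt (by linarith)⟩
  have h0 := h0 _ hmem
  have h1 := h1 _ hmem
  have h2 := h2 _ hmem
  simp only [Real.norm_eq_abs] at h0 h1 h2
  rw [← hb.eq' hr] at h0
  obtain ⟨h3, h4⟩ := hb.abs_le hσ hA h ht (t := t) hr hr'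
  have h5 : V' r₂ * √(r - rc) * |aρ (σ * t + τ r) (√(r - rc))| ≤ V' r₂ * √(r₂ - rc) * B₂ := by
    have := (h.deriv_pos' hr₂.le).le
    have := hmem.2.2
    gcongr
  have h6 := abs_sub_abs_le_abs_sub ((V r * Ar t r + σ * At t r) / 2)
    (a' (σ * t + τ r) (√(r - rc)))
  linarith

end branch

/-- In u = t + τ, v = -t + τ the radius depends on u + v only, and the equation gives ∂_u ∂_v A as a
combination of lower-order terms that all carry the factor V. That factor is 2 W, and Z ≤ L W is the
lower bound V ≥ V'(r_c) (r - r_c). The constant K grows with the eigenvalue, which is harmless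
because only qualitative consequences are drawn. -/
theorem IsScalarWave.isDoubleNull {V V' τ R : ℝ → ℝ} {rc d m lam r₁ r₂ : ℝ}
    {A At Ar Att Atr Arr a a' aρ b b' bρ : ℝ → ℝ → ℝ} {a'' b'' : ℝ → ℝ}
    (hw : IsScalarWave V V' rc d m lam A At Ar Att Atr Arr)
    (h : IsExpanding V V' rc) (ht : IsTortoise V τ rc) (hR : IsRadius V τ R rc r₂)
    (hr₁ : rc < r₁) (hr₂ : r₁ < r₂) (hd : 1 ≤ d) (hlam : 0 ≤ lam)
    (ha : IsBranch τ rc 1 A a a' aρ a'') (hb : IsBranch τ rc (-1) A b b' bρ b'') :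
    ∃ K, IsDoubleNull (fun u v => A ((u - v) / 2) (R ((u + v) / 2)))
      (fun u v => (V (R ((u + v) / 2)) * Ar ((u - v) / 2) (R ((u + v) / 2)) +
        At ((u - v) / 2) (R ((u + v) / 2))) / 2)
      (fun u v => (V (R ((u + v) / 2)) * Ar ((u - v) / 2) (R ((u + v) / 2)) -
        At ((u - v) / 2) (R ((u + v) / 2))) / 2)
      (fun u v => -(V (R ((u + v) / 2)) / 4) *
        ((lam / R ((u + v) / 2) ^ 2 + m ^ 2) * A ((u - v) / 2) (R ((u + v) / 2)) +
          (d - 1) / R ((u + v) / 2) *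
            (V (R ((u + v) / 2)) * Ar ((u - v) / 2) (R ((u + v) / 2)))))
      (fun s => R (s / 2) - rc) (fun s => V (R (s / 2)) / 2)
      (fun u => a u 0) (fun u => a' u 0) (fun u => b u 0) (fun u => b' u 0)
      K (2 / V' rc) (2 * τ r₁) (2 * τ r₂) := by
  have half : ∀ s, s < 2 * τ r₂ → s / 2 < τ r₂ := fun s hs => by linarith
  have hm : ∀ s, s < 2 * τ r₂ → R (s / 2) ∈ Ioo rc r₂ := fun s hs => hR.mem _ (half s hs)
  have hU := isOpen_beyond rc
  have dR : ∀ u v, u + v < 2 * τ r₂ →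
      HasDerivAt (fun u => R ((u + v) / 2)) (V (R ((u + v) / 2)) / 2) u := fun u v huv => by
    have := (hR.hasDerivAt _ (half _ huv)).comp u (((hasDerivAt_id u).add_const v).div_const 2)
    convert! this using 1; ring
  have dR' : ∀ u v, u + v < 2 * τ r₂ →
      HasDerivAt (fun v => R ((u + v) / 2)) (V (R ((u + v) / 2)) / 2) v := fun u v huv => by
    have := (hR.hasDerivAt _ (half _ huv)).comp v (((hasDerivAt_id v).const_add u).div_const 2)
    convert! this using 1; ring
  have dt : ∀ u v : ℝ, HasDerivAt (fun u => (u - v) / 2) (1 / 2) u := fun u v =>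
    ((hasDerivAt_id u).sub_const v).div_const 2
  have dt' : ∀ u v : ℝ, HasDerivAt (fun v => (u - v) / 2) (-1 / 2) v := fun u v =>
    ((hasDerivAt_id v).const_sub u).div_const 2
  have hmap : ∀ {F F₁ F₂ : ℝ → ℝ → ℝ}, HasPartials F F₁ F₂ (beyond rc) → ∀ u v, u + v < 2 * τ r₂ →
      HasDerivAt (fun u => F ((u - v) / 2) (R ((u + v) / 2)))
        (F₁ ((u - v) / 2) (R ((u + v) / 2)) * (1 / 2) +
          F₂ ((u - v) / 2) (R ((u + v) / 2)) * (V (R ((u + v) / 2)) / 2)) u := by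
    intro F F₁ F₂ hF u v huv
    exact hF.comp hU (x := fun u => (u - v) / 2) (y := fun u => R ((u + v) / 2)) (hm _ huv).1
      (dt u v) (dR u v huv)
  have hmap' : ∀ {F F₁ F₂ : ℝ → ℝ → ℝ}, HasPartials F F₁ F₂ (beyond rc) → ∀ u v, u + v < 2 * τ r₂ →
      HasDerivAt (fun v => F ((u - v) / 2) (R ((u + v) / 2)))
        (F₁ ((u - v) / 2) (R ((u + v) / 2)) * (-1 / 2) +
          F₂ ((u - v) / 2) (R ((u + v) / 2)) * (V (R ((u + v) / 2)) / 2)) v := by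
    intro F F₁ F₂ hF u v huv
    exact hF.comp hU (x := fun v => (u - v) / 2) (y := fun v => R ((u + v) / 2)) (hm _ huv).1
      (dt' u v) (dR' u v huv)
  have dV : ∀ u v, u + v < 2 * τ r₂ → HasDerivAt (fun u => V (R ((u + v) / 2)))
      (V' (R ((u + v) / 2)) * (V (R ((u + v) / 2)) / 2)) u := fun u v huv =>
    (h.hasDerivAt _ (h.pos_of_lt (hm _ huv).1)).comp u (dR u v huv)
  have dV' : ∀ u v, u + v < 2 * τ r₂ → HasDerivAt (fun v => V (R ((u + v) / 2)))
      (V' (R ((u + v) / 2)) * (V (R ((u + v) / 2)) / 2)) v := fun u v huv =>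
    (h.hasDerivAt _ (h.pos_of_lt (hm _ huv).1)).comp v (dR' u v huv)
  have ht1 : ∀ u v, u + v < 2 * τ r₂ → (u - v) / 2 + τ (R ((u + v) / 2)) = u := fun u v huv => by
    rw [hR.right_inv _ (half _ huv)]; ring
  have ht2 : ∀ u v, u + v < 2 * τ r₂ → -((u - v) / 2) + τ (R ((u + v) / 2)) = v :=
    fun u v huv => by rw [hR.right_inv _ (half _ huv)]; ring
  have tl : ∀ v, Tendsto (fun u : ℝ => (u + v) / 2) atBot atBot := fun v =>
    (tendsto_atBot_add_const_right _ v tendsto_id).atBot_div_const two_pos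
  have tr : ∀ u, Tendsto (fun v : ℝ => (u + v) / 2) atBot atBot := fun u =>
    (tendsto_atBot_add_const_left _ u tendsto_id).atBot_div_const two_pos
  have el : ∀ v, ∀ᶠ u in atBot, u + v < 2 * τ r₂ := fun v =>
    (eventually_lt_atBot (2 * τ r₂ - v)).mono fun u hu => by linarith
  have er : ∀ u, ∀ᶠ v in atBot, u + v < 2 * τ r₂ := fun u =>
    (eventually_lt_atBot (2 * τ r₂ - u)).mono fun v hv => by linarith
  have limf := fun u => ha.tendsto (one_mul 1) hw.partials h ht (l := atBot)
    (t := fun v => (u - v) / 2) (r := fun v => R ((u + v) / 2)) (w := u)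
    (hR.tendsto.comp (tr u)) ((er u).mono fun v hv => (hm _ hv).1)
    ((er u).mono fun v hv => by rw [one_mul]; exact ht1 u v hv)
  have limg := fun v => hb.tendsto (by norm_num) hw.partials h ht (l := atBot)
    (t := fun u => (u - v) / 2) (r := fun u => R ((u + v) / 2)) (w := v)
    (hR.tendsto.comp (tl v)) ((el v).mono fun u hu => (hm _ hu).1)
    ((el v).mono fun u hu => by rw [neg_one_mul]; exact ht2 u v hu)
  have hτ : τ r₁ < τ r₂ := ht.strictMonoOn h hr₁ (hr₁.trans hr₂) hr₂
  have b1 : ∀ u, HasDerivAt (fun u => b u 0) (b' u 0) u := fun u =>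
    hb.partials.fst u 0 (mem_univ _)
  have a1 : ∀ u, HasDerivAt (fun u => a u 0) (a' u 0) u := fun u =>
    ha.partials.fst u 0 (mem_univ _)
  have K1 : 0 ≤ lam / rc ^ 2 + m ^ 2 := by positivity
  have K2 : 0 ≤ (d - 1) / rc := div_nonneg (by linarith) h.rc_pos.le
  refine ⟨lam / rc ^ 2 + m ^ 2 + (d - 1) / rc, by positivity, ?_, by linarith, ?_, ?_, ?_, ?_, ?_,
    ?_, ?_, ?_, ?_, ?_, ?_, ?_, ?_, ?_, ?_, ?_, ?_, ?_, ?_⟩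
  · have := h.deriv_pos; positivity
  · intro u v huv
    convert! hmap hw.partials u v huv using 1
    ring
  · intro u v huv
    convert! hmap' hw.partials u v huv using 1
    ring
  · intro u v huv
    have := (((dV' u v huv).mul (hmap' hw.partials_r u v huv)).add
      (hmap' hw.partials_t u v huv)).div_const 2
    convert! this using 1
    have := hw.eq ((u - v) / 2) _ (hm _ huv).1
    linear_combination (-1 / 4) * this
  · intro u v huv
    have := (((dV u v huv).mul (hmap hw.partials_r u v huv)).sub
      (hmap hw.partials_t u v huv)).div_const 2
    convert! this using 1
    have := hw.eq ((u - v) / 2) _ (hm _ huv).1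
    linear_combination (-1 / 4) * this
  · intro s hs
    have := ((hR.hasDerivAt _ (half s hs)).comp s ((hasDerivAt_id s).div_const 2)).sub_const rc
    convert! this using 1; ring
  · intro s hs
    exact (sub_pos.2 (hm s hs).1).le
  · intro s hs
    have := h.lower (hm s hs).1
    have := h.deriv_pos
    rw [div_mul_div_comm, mul_comm 2 (V _), mul_div_mul_right _ _ two_ne_zero, le_div_iff₀ this]
    linarith
  · intro s hs
    exact (div_pos (h.pos (hm s hs).1) two_pos).le
  · have : Tendsto (fun s : ℝ => R (s / 2)) atBot (𝓝 rc) :=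
      hR.tendsto.comp (tendsto_id.atBot_div_const two_pos)
    simpa using this.sub_const rc
  · intro u v huv
    have hr := hm _ huv
    set r := R ((u + v) / 2)
    set x := A ((u - v) / 2) r
    set X := V r * Ar ((u - v) / 2) r
    set Y := At ((u - v) / 2) r
    have hr0 := h.pos_of_lt hr.1
    have hrc := h.rc_pos
    have c1 : lam / r ^ 2 + m ^ 2 ≤ lam / rc ^ 2 + m ^ 2 := by
      have := hr.1.le
      gcongr
    have c2 : (d - 1) / r ≤ (d - 1) / rc := by
      have := hr.1.le
      have : 0 ≤ d - 1 := by linarith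
      gcongr
    have c0 : 0 ≤ lam / r ^ 2 + m ^ 2 := by positivity
    have c0' : 0 ≤ (d - 1) / r := div_nonneg (by linarith) hr0.le
    have hV := h.pos hr.1
    have hX : |X| ≤ |(X + Y) / 2| + |(X - Y) / 2| := by
      have : X = (X + Y) / 2 + (X - Y) / 2 := by ring
      calc |X| = |(X + Y) / 2 + (X - Y) / 2| := by rw [← this]
        _ ≤ _ := abs_add_le _ _
    set S := |(X + Y) / 2| + |(X - Y) / 2| with hS
    have hS0 : 0 ≤ S := by positivity
    have e : |(lam / r ^ 2 + m ^ 2) * x + (d - 1) / r * X| ≤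
        (lam / rc ^ 2 + m ^ 2) * |x| + (d - 1) / rc * S := by
      refine (abs_add_le _ _).trans ?_
      rw [abs_mul, abs_mul, abs_of_nonneg c0, abs_of_nonneg c0']
      gcongr
    rw [abs_mul, abs_neg, abs_of_pos (by positivity : 0 < V r / 4)]
    have e2 : (lam / rc ^ 2 + m ^ 2) * |x| + (d - 1) / rc * S ≤
        (lam / rc ^ 2 + m ^ 2 + (d - 1) / rc) * (|x| + S) := by
      nlinarith [mul_nonneg K1 hS0, mul_nonneg K2 (abs_nonneg x)]
    have e3 : 0 ≤ (lam / rc ^ 2 + m ^ 2 + (d - 1) / rc) * (|x| + S) := by positivity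
    calc V r / 4 * |(lam / r ^ 2 + m ^ 2) * x + (d - 1) / r * X|
        ≤ V r / 4 * ((lam / rc ^ 2 + m ^ 2 + (d - 1) / rc) * (|x| + S)) := by
          have := e.trans e2
          gcongr
      _ ≤ V r / 2 * ((lam / rc ^ 2 + m ^ 2 + (d - 1) / rc) * (|x| + S)) := by gcongr; norm_num
      _ = _ := by rw [hS]; ring
  · exact fun u => (limf u).1
  · exact fun v => (limg v).1
  · intro u; simpa using (limf u).2
  · intro v; simpa [sub_eq_add_neg] using (limg v).2
  · intro α β
    obtain ⟨B, hB⟩ := ha.strip (one_mul 1) hw.partials h ht (hr₁.trans hr₂) α β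
    refine ⟨B, fun u v hu huv => ?_⟩
    have huv' : u + v < 2 * τ r₂ := by linarith
    have := hB ((u - v) / 2) (R ((u + v) / 2)) (hm _ huv').1 (hm _ huv').2.le
      (by rw [one_mul, ht1 u v huv']; exact hu)
    simpa using this
  · intro α β
    obtain ⟨B, hB⟩ := hb.strip (by norm_num) hw.partials h ht (hr₁.trans hr₂) α β
    refine ⟨B, fun u v hv huv => ?_⟩
    have huv' : u + v < 2 * τ r₂ := by linarith
    have := hB ((u - v) / 2) (R ((u + v) / 2)) (hm _ huv').1 (hm _ huv').2.le
      (by rw [neg_one_mul, ht2 u v huv']; exact hv)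
    simp only [neg_one_mul, ← sub_eq_add_neg, sub_neg_eq_add] at this
    linarith
  · exact a1
  · exact tendsto_zero_of_integrable_sq a1 ha.int₀ ha.int₁
  · intro T
    obtain ⟨B₁, h1⟩ := exists_bound_Iic
      (continuous_iff_continuousAt.2 fun u => (b1 u).continuousAt)
      (tendsto_zero_of_integrable_sq b1 hb.int₀ hb.int₁) T
    obtain ⟨B₂, h2⟩ := exists_bound_Iic
      (continuous_iff_continuousAt.2 fun u => (hb.deriv₂ u).continuousAt)
      (tendsto_zero_of_integrable_sq hb.deriv₂ hb.int₁ hb.int₂) T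
    exact ⟨max B₁ B₂, fun v hv => ⟨(h1 v hv).trans (le_max_left _ _),
      (h2 v hv).trans (le_max_right _ _)⟩⟩

/-! ### Energy inequalities localized to domains of dependence -/

/-- A continuously differentiable nonincreasing cutoff function from `1` on `x ≤ c` to `0` on
`x ≥ c + 1`. -/
structure IsCutoff (ζ ζ' : ℝ → ℝ) (c : ℝ) : Prop where
  deriv : ∀ x, HasDerivAt ζ (ζ' x) x
  cont : Continuous ζ'
  nonpos : ∀ x, ζ' x ≤ 0
  nonneg : ∀ x, 0 ≤ ζ x
  le_one : ∀ x, ζ x ≤ 1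
  one : ∀ x, x ≤ c → ζ x = 1
  zero : ∀ x, c + 1 ≤ x → ζ x = 0

theorem exists_isCutoff (c : ℝ) : ∃ ζ ζ', IsCutoff ζ ζ' c := by
  have hd : ContDiff ℝ 1 (fun x => Real.smoothTransition (c + 1 - x)) :=
    (Real.smoothTransition.contDiff (n := 1)).comp (contDiff_const.sub contDiff_id)
  refine ⟨fun x => Real.smoothTransition (c + 1 - x), deriv _, fun x =>
    (hd.differentiable one_ne_zero x).hasDerivAt, hd.continuous_deriv le_rfl, fun x => ?_,
    fun x => Real.smoothTransition.nonneg _, fun x => Real.smoothTransition.le_one _,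
    fun x hx => Real.smoothTransition.one_of_one_le (by linarith),
    fun x hx => Real.smoothTransition.zero_of_nonpos (by linarith)⟩
  have : Antitone (fun x => Real.smoothTransition (c + 1 - x)) := fun x y hxy =>
    Real.smoothTransition.monotone (by linarith)
  exact this.deriv_nonpos

theorem IsCutoff.continuous {ζ ζ' : ℝ → ℝ} {c : ℝ} (h : IsCutoff ζ ζ' c) : Continuous ζ :=
  continuous_iff_continuousAt.2 fun x => (h.deriv x).continuousAt

theorem hasDerivAt_integral_of_support {G Gr : ℝ → ℝ → ℝ} {rc r₀ L : ℝ} (hr₀ : rc < r₀)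
    (hG : ∀ t r, rc < r → HasDerivAt (fun r => G t r) (Gr t r) r)
    (contG : ContinuousOn (fun z : ℝ × ℝ => G z.1 z.2) (beyond rc))
    (contGr : ContinuousOn (fun z : ℝ × ℝ => Gr z.1 z.2) (beyond rc))
    (hL : ∀ᶠ r in 𝓝 r₀, ∀ t, L < |t| → G t r = 0) :
    Integrable (fun t => G t r₀) ∧ Integrable (fun t => Gr t r₀) ∧
      HasDerivAt (fun r => ∫ t, G t r) (∫ t, Gr t r₀) r₀ := by
  have hslice : ∀ {F : ℝ → ℝ → ℝ}, ContinuousOn (fun z : ℝ × ℝ => F z.1 z.2) (beyond rc) →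
      ∀ r, rc < r → Continuous (fun t => F t r) := fun {F} hF r hr =>
    hF.comp_continuous (by fun_prop : Continuous fun t : ℝ => (t, r)) fun t => hr
  have hGr0 : ∀ t, L < |t| → Gr t r₀ = 0 := by
    intro t ht
    refine (hG t r₀ hr₀).unique ((hasDerivAt_const r₀ (0 : ℝ)).congr_of_eventuallyEq ?_)
    filter_upwards [hL] with r hr using hr t ht
  have hout : ∀ t, t ∉ Icc (-L) L → L < |t| := by
    intro t ht
    by_contra! h
    exact ht (abs_le.1 h)
  have hset : ∀ {f : ℝ → ℝ}, (∀ t, L < |t| → f t = 0) → ∫ t, f t = ∫ t in Icc (-L) L, f t :=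
    fun {f} hf => (setIntegral_eq_integral_of_forall_compl_eq_zero
      fun t ht => hf t (hout t ht)).symm
  have hint : ∀ {f : ℝ → ℝ}, Continuous f → (∀ t, L < |t| → f t = 0) → Integrable f := by
    intro f hf h0
    refine (integrableOn_iff_integrable_of_support_subset (s := Icc (-L) L) ?_).1
      (hf.continuousOn.integrableOn_compact isCompact_Icc)
    intro t ht
    by_contra h
    exact ht (h0 t (hout t h))
  have hi1 := hint (hslice contG r₀ hr₀) hL.self_of_nhds
  have hi2 := hint (hslice contGr r₀ hr₀) hGr0
  refine ⟨hi1, hi2, ?_⟩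
  obtain ⟨δ, hδ, hball⟩ := Metric.nhds_basis_closedBall.mem_iff.1 (Ioi_mem_nhds hr₀)
  have hK : IsCompact (Icc (-L) L ×ˢ Metric.closedBall r₀ δ) :=
    isCompact_Icc.prod (isCompact_closedBall _ _)
  obtain ⟨B, hB⟩ := hK.exists_bound_of_continuousOn
    (contGr.mono fun z hz => hball hz.2)
  have key := (hasDerivAt_integral_of_dominated_loc_of_deriv_le (𝕜 := ℝ)
    (μ := volume.restrict (Icc (-L) L)) (F := fun r t => G t r) (F' := fun r t => Gr t r)
    (bound := fun _ => B) (x₀ := r₀)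
    (Metric.closedBall_mem_nhds r₀ hδ) (by
      filter_upwards [lt_mem_nhds hr₀] with r hr
      exact (hslice contG r hr).aestronglyMeasurable)
    hi1.integrableOn (hslice contGr r₀ hr₀).aestronglyMeasurable
    ((ae_restrict_mem measurableSet_Icc).mono fun t ht r hr => hB (t, r) ⟨ht, hr⟩)
    (integrable_const _)
    (ae_of_all _ fun t r hr => hG t r (hball hr))).2
  rw [hset hGr0]
  refine key.congr_of_eventuallyEq ?_
  filter_upwards [hL] with r hr using hset hr

/-- The common form of the two energy inequalities: `G` is the weighted density and `H` the weighted
flux in t. Since `H` vanishes for large |t|, its t-derivative integrates to zero. -/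
theorem integral_deriv_le {G Gr H Ht : ℝ → ℝ → ℝ} {b : ℝ → ℝ} {rc r₀ L α : ℝ} (hr₀ : rc < r₀)
    (hG : ∀ t r, rc < r → HasDerivAt (fun r => G t r) (Gr t r) r)
    (contG : ContinuousOn (fun z : ℝ × ℝ => G z.1 z.2) (beyond rc))
    (contGr : ContinuousOn (fun z : ℝ × ℝ => Gr z.1 z.2) (beyond rc))
    (hL : ∀ᶠ r in 𝓝 r₀, ∀ t, L < |t| → G t r = 0)
    (hH : ∀ t, HasDerivAt (fun t => H t r₀) (Ht t r₀) t)
    (contHt : Continuous (fun t => Ht t r₀))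
    (hHL : ∀ t, L < |t| → H t r₀ = 0) (hb : Integrable b)
    (hle : ∀ t, Gr t r₀ ≤ Ht t r₀ + α * G t r₀ + b t) :
    HasDerivAt (fun r => ∫ t, G t r) (∫ t, Gr t r₀) r₀ ∧
      ∫ t, Gr t r₀ ≤ α * (∫ t, G t r₀) + ∫ t, b t := by
  obtain ⟨h1, h2, h3⟩ := hasDerivAt_integral_of_support hr₀ hG contG contGr hL
  refine ⟨h3, ?_⟩
  have hout : ∀ t, t ∉ Icc (-L) L → L < |t| := by
    intro t ht
    by_contra! h
    exact ht (abs_le.1 h)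
  have hHt0 : ∀ t, L < |t| → Ht t r₀ = 0 := by
    intro t ht
    refine (hH t).unique ((hasDerivAt_const t (0 : ℝ)).congr_of_eventuallyEq ?_)
    filter_upwards [continuous_abs.continuousAt.eventually (lt_mem_nhds ht)] with s hs
    exact hHL s hs
  have hint : ∀ {f : ℝ → ℝ}, Continuous f → (∀ t, L < |t| → f t = 0) → Integrable f := by
    intro f hf h0
    refine (integrableOn_iff_integrable_of_support_subset (s := Icc (-L) L) ?_).1
      (hf.continuousOn.integrableOn_compact isCompact_Icc)
    intro t ht
    by_contra h
    exact ht (h0 t (hout t h))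
  have i1 := hint contHt hHt0
  have i2 := hint (continuous_iff_continuousAt.2 fun t => (hH t).continuousAt) hHL
  have i3 : ∫ t, Ht t r₀ = 0 := integral_eq_zero_of_hasDerivAt_of_integrable hH i1 i2
  calc ∫ t, Gr t r₀ ≤ ∫ t, (Ht t r₀ + α * G t r₀ + b t) :=
        integral_mono h2 ((i1.add (h1.const_mul α)).add hb) hle
    _ = α * (∫ t, G t r₀) + ∫ t, b t := by
        have e1 := integral_add (i1.add (h1.const_mul α)) hb
        have e2 := integral_add i1 (h1.const_mul α)
        have e3 := integral_const_mul α (fun t => G t r₀) (μ := volume)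
        simp only [Pi.add_apply] at e1
        rw [e1, e2, e3, i3, zero_add]

/-- The weight that localizes the energy estimates to a domain of dependence. -/
def weight (ζ τ : ℝ → ℝ) (t r : ℝ) : ℝ := ζ (t + τ r) * ζ (-t + τ r)

section weight

variable {V V' τ ζ ζ' : ℝ → ℝ} {rc c : ℝ}

theorem weight_nonneg (hζ : IsCutoff ζ ζ' c) (t r : ℝ) : 0 ≤ weight ζ τ t r :=
  mul_nonneg (hζ.nonneg _) (hζ.nonneg _)

theorem weight_le_one (hζ : IsCutoff ζ ζ' c) (t r : ℝ) : weight ζ τ t r ≤ 1 :=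
  mul_le_one₀ (hζ.le_one _) (hζ.nonneg _) (hζ.le_one _)

theorem weight_eq_zero (hζ : IsCutoff ζ ζ' c) {t r : ℝ} (h : c + 1 - τ r < |t|) :
    weight ζ τ t r = 0 := by
  rcases lt_abs.1 h with h | h
  · rw [weight, hζ.zero (t + τ r) (by linarith), zero_mul]
  · rw [weight, hζ.zero (-t + τ r) (by linarith), mul_zero]

/-- The extra unit in c + 2 leaves room for the variation of τ near r₀, so that one t-interval
contains the supports at all nearby radii. -/
theorem weight_eventually_zero (hζ : IsCutoff ζ ζ' c) (ht : IsTortoise V τ rc) {r₀ : ℝ}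
    (hr₀ : rc < r₀) : ∀ᶠ r in 𝓝 r₀, ∀ t, c + 2 - τ r₀ < |t| → weight ζ τ t r = 0 := by
  filter_upwards [(ht.hasDerivAt r₀ hr₀).continuousAt.eventually
    (lt_mem_nhds (sub_one_lt (τ r₀)))] with r hr t h
  exact weight_eq_zero hζ (by linarith)

theorem hasDerivAt_weight_r (hζ : IsCutoff ζ ζ' c) (ht : IsTortoise V τ rc) {t r : ℝ}
    (hr : rc < r) : HasDerivAt (fun r => weight ζ τ t r)
      ((ζ' (t + τ r) * ζ (-t + τ r) + ζ (t + τ r) * ζ' (-t + τ r)) / V r) r := by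
  have h1 := (hζ.deriv _).comp r ((ht.hasDerivAt r hr).const_add t)
  have h2 := (hζ.deriv _).comp r ((ht.hasDerivAt r hr).const_add (-t))
  refine (h1.mul h2).congr_deriv ?_
  simp only [Function.comp]
  ring

theorem hasDerivAt_weight_t (hζ : IsCutoff ζ ζ' c) {t r : ℝ} :
    HasDerivAt (fun t => weight ζ τ t r)
      (ζ' (t + τ r) * ζ (-t + τ r) - ζ (t + τ r) * ζ' (-t + τ r)) t := by
  have h1 := (hζ.deriv _).comp t ((hasDerivAt_id t).add_const (τ r))
  have h2 := (hζ.deriv _).comp t ((hasDerivAt_id t).neg.add_const (τ r))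
  refine (h1.mul h2).congr_deriv ?_
  simp only [Function.comp, id, Pi.neg_apply]
  ring

theorem continuousOn_comp_u (ht : IsTortoise V τ rc) {f : ℝ → ℝ} (hf : Continuous f) :
    ContinuousOn (fun z : ℝ × ℝ => f (z.1 + τ z.2)) (beyond rc) :=
  hf.comp_continuousOn (continuousOn_fst.add
    (ht.continuousOn.comp continuousOn_snd fun _ hz => hz))

theorem continuousOn_comp_v (ht : IsTortoise V τ rc) {f : ℝ → ℝ} (hf : Continuous f) :
    ContinuousOn (fun z : ℝ × ℝ => f (-z.1 + τ z.2)) (beyond rc) :=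
  hf.comp_continuousOn (continuousOn_fst.neg.add
    (ht.continuousOn.comp continuousOn_snd fun _ hz => hz))

theorem continuousOn_weight (hζ : IsCutoff ζ ζ' c) (ht : IsTortoise V τ rc) :
    ContinuousOn (fun z : ℝ × ℝ => weight ζ τ z.1 z.2) (beyond rc) :=
  (continuousOn_comp_u ht hζ.continuous).mul (continuousOn_comp_v ht hζ.continuous)

end weight

/-- `ζ'(u) ζ(v) (e - 2 X Y) + ζ(u) ζ'(v) (e + 2 X Y) ≤ 0`: the flux through the boundary of a domain
of dependence has a sign. -/
theorem weight_flux_nonpos {ζ ζ' : ℝ → ℝ} {c : ℝ} (hζ : IsCutoff ζ ζ' c) (u v : ℝ) {e X Y : ℝ}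
    (he : X ^ 2 + Y ^ 2 ≤ e) :
    (ζ' u * ζ v + ζ u * ζ' v) * e - (ζ' u * ζ v - ζ u * ζ' v) * (2 * X * Y) ≤ 0 := by
  have h1 : 0 ≤ e - 2 * X * Y := by nlinarith [sq_nonneg (X - Y)]
  have h2 : 0 ≤ e + 2 * X * Y := by nlinarith [sq_nonneg (X + Y)]
  have h3 := mul_nonneg (mul_nonneg (neg_nonneg.2 (hζ.nonpos u)) (hζ.nonneg v)) h1
  have h4 := mul_nonneg (mul_nonneg (hζ.nonneg u) (neg_nonneg.2 (hζ.nonpos v))) h2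
  linarith

/-! ### The energy estimate near the horizon -/

/-- First-order form, `X = V ∂_r χ` and `Y = ∂_t χ`, of the Klein-Gordon equation of an angular mode
with a source term `V S`. -/
structure IsForcedWave (V V' : ℝ → ℝ) (rc d m lam : ℝ) (χ X Y Xt Yt S : ℝ → ℝ → ℝ) : Prop where
  χ_r : ∀ t r, rc < r → HasDerivAt (fun r => χ t r) (X t r / V r) r
  χ_t : ∀ t r, rc < r → HasDerivAt (fun t => χ t r) (Y t r) t
  X_r : ∀ t r, rc < r → HasDerivAt (fun r => X t r) ((Yt t r - (d - 1) * V r / r * X t r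
    - V r * (lam / r ^ 2 + m ^ 2) * χ t r - V r * S t r) / V r) r
  Y_r : ∀ t r, rc < r → HasDerivAt (fun r => Y t r) (Xt t r / V r) r
  X_t : ∀ t r, rc < r → HasDerivAt (fun t => X t r) (Xt t r) t
  Y_t : ∀ t r, rc < r → HasDerivAt (fun t => Y t r) (Yt t r) t
  cont_χ : ContinuousOn (fun z : ℝ × ℝ => χ z.1 z.2) (beyond rc)
  cont_X : ContinuousOn (fun z : ℝ × ℝ => X z.1 z.2) (beyond rc)
  cont_Y : ContinuousOn (fun z : ℝ × ℝ => Y z.1 z.2) (beyond rc)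
  cont_Xt : ContinuousOn (fun z : ℝ × ℝ => Xt z.1 z.2) (beyond rc)
  cont_Yt : ContinuousOn (fun z : ℝ × ℝ => Yt z.1 z.2) (beyond rc)
  cont_S : ContinuousOn (fun z : ℝ × ℝ => S z.1 z.2) (beyond rc)

section

variable {V V' τ : ℝ → ℝ} {rc : ℝ}

theorem IsExpanding.continuousOn_snd (h : IsExpanding V V' rc) :
    ContinuousOn (fun z : ℝ × ℝ => V z.2) (beyond rc) :=
  h.continuousOn.comp _root_.continuousOn_snd fun _ hz => h.pos_of_lt hz

theorem IsExpanding.continuousOn_deriv_snd (h : IsExpanding V V' rc) :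
    ContinuousOn (fun z : ℝ × ℝ => V' z.2) (beyond rc) :=
  h.continuousOn_deriv.comp _root_.continuousOn_snd fun _ hz => h.pos_of_lt hz

theorem IsScalarWave.isForcedWave {d m lam : ℝ} {A At Ar Att Atr Arr : ℝ → ℝ → ℝ}
    (hw : IsScalarWave V V' rc d m lam A At Ar Att Atr Arr) (h : IsExpanding V V' rc) :
    IsForcedWave V V' rc d m lam A (fun t r => V r * Ar t r) At (fun t r => V r * Atr t r) Att
      (fun _ _ => 0) := by
  have hV : ∀ r, rc < r → V r ≠ 0 := fun r hr => (h.pos hr).ne'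
  refine ⟨fun t r hr => ?_, fun t r hr => hw.partials.fst t r hr, fun t r hr => ?_,
    fun t r hr => ?_, fun t r hr => (hw.partials_r.fst t r hr).const_mul _,
    fun t r hr => hw.partials_t.fst t r hr, hw.partials.cont,
    h.continuousOn_snd.mul hw.partials.cont_snd, hw.partials.cont_fst,
    h.continuousOn_snd.mul hw.partials_t.cont_snd, hw.partials_t.cont_fst, continuousOn_const⟩
  · refine (hw.partials.snd t r hr).congr_deriv ?_
    field_simp [hV r hr]
  · refine ((h.hasDerivAt r (h.pos_of_lt hr)).mul (hw.partials_r.snd t r hr)).congr_deriv ?_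
    rw [eq_div_iff (hV r hr)]
    linear_combination hw.eq t r hr
  · refine (hw.partials_t.snd t r hr).congr_deriv ?_
    field_simp [hV r hr]

/-- Subtracting from a solution its traces `f(u) + g(v)` on the two branches of the horizon. -/
theorem IsScalarWave.isForcedWave_sub {d m lam : ℝ} {A At Ar Att Atr Arr : ℝ → ℝ → ℝ}
    {f f' f'' g g' g'' : ℝ → ℝ}
    (hw : IsScalarWave V V' rc d m lam A At Ar Att Atr Arr) (h : IsExpanding V V' rc)
    (ht : IsTortoise V τ rc)
    (hf : ∀ u, HasDerivAt f (f' u) u) (hf' : ∀ u, HasDerivAt f' (f'' u) u) (hf'' : Continuous f'')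
    (hg : ∀ u, HasDerivAt g (g' u) u) (hg' : ∀ u, HasDerivAt g' (g'' u) u)
    (hg'' : Continuous g'') :
    IsForcedWave V V' rc d m lam (fun t r => A t r - f (t + τ r) - g (-t + τ r))
      (fun t r => V r * Ar t r - f' (t + τ r) - g' (-t + τ r))
      (fun t r => At t r - f' (t + τ r) + g' (-t + τ r))
      (fun t r => V r * Atr t r - f'' (t + τ r) + g'' (-t + τ r))
      (fun t r => Att t r - f'' (t + τ r) - g'' (-t + τ r))
      (fun t r => (lam / r ^ 2 + m ^ 2) * (f (t + τ r) + g (-t + τ r)) +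
        (d - 1) / r * (f' (t + τ r) + g' (-t + τ r))) := by
  have w := hw.isForcedWave h
  have ur : ∀ {y y' : ℝ → ℝ}, (∀ u, HasDerivAt y (y' u) u) → ∀ t r, rc < r →
      HasDerivAt (fun r => y (t + τ r)) (y' (t + τ r) * (1 / V r)) r := fun hy t r hr =>
    (hy _).comp r ((ht.hasDerivAt r hr).const_add t)
  have vr : ∀ {y y' : ℝ → ℝ}, (∀ u, HasDerivAt y (y' u) u) → ∀ t r, rc < r →
      HasDerivAt (fun r => y (-t + τ r)) (y' (-t + τ r) * (1 / V r)) r := fun hy t r hr =>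
    (hy _).comp r ((ht.hasDerivAt r hr).const_add (-t))
  have ut : ∀ {y y' : ℝ → ℝ}, (∀ u, HasDerivAt y (y' u) u) → ∀ t r,
      HasDerivAt (fun t => y (t + τ r)) (y' (t + τ r)) t := fun {y y'} hy t r =>
    ((hy _).comp t ((hasDerivAt_id t).add_const (τ r))).congr_deriv (mul_one _)
  have vt : ∀ {y y' : ℝ → ℝ}, (∀ u, HasDerivAt y (y' u) u) → ∀ t r,
      HasDerivAt (fun t => y (-t + τ r)) (-y' (-t + τ r)) t := fun {y y'} hy t r =>
    ((hy _).comp t ((hasDerivAt_id t).neg.add_const (τ r))).congr_deriv (by simp)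
  have cf : Continuous f := continuous_iff_continuousAt.2 fun u => (hf u).continuousAt
  have cf' : Continuous f' := continuous_iff_continuousAt.2 fun u => (hf' u).continuousAt
  have cg : Continuous g := continuous_iff_continuousAt.2 fun u => (hg u).continuousAt
  have cg' : Continuous g' := continuous_iff_continuousAt.2 fun u => (hg' u).continuousAt
  have cr : ContinuousOn (fun z : ℝ × ℝ => z.2) (beyond rc) := continuousOn_snd
  have r0 : ∀ z ∈ beyond rc, z.2 ≠ 0 := fun z hz => (h.pos_of_lt hz).ne'
  refine ⟨fun t r hr => ?_, fun t r hr => ?_, fun t r hr => ?_, fun t r hr => ?_, fun t r hr => ?_,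
    fun t r hr => ?_, ?_, ?_, ?_, ?_, ?_, ?_⟩
  · refine (((w.χ_r t r hr).sub (ur hf t r hr)).sub (vr hg t r hr)).congr_deriv ?_
    ring
  · refine (((w.χ_t t r hr).sub (ut hf t r)).sub (vt hg t r)).congr_deriv ?_
    ring
  · refine (((w.X_r t r hr).sub (ur hf' t r hr)).sub (vr hg' t r hr)).congr_deriv ?_
    ring
  · refine (((w.Y_r t r hr).sub (ur hf' t r hr)).add (vr hg' t r hr)).congr_deriv ?_
    ring
  · refine (((w.X_t t r hr).sub (ut hf' t r)).sub (vt hg' t r)).congr_deriv ?_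
    ring
  · refine (((w.Y_t t r hr).sub (ut hf' t r)).add (vt hg' t r)).congr_deriv ?_
    ring
  · exact (w.cont_χ.sub (continuousOn_comp_u ht cf)).sub (continuousOn_comp_v ht cg)
  · exact (w.cont_X.sub (continuousOn_comp_u ht cf')).sub (continuousOn_comp_v ht cg')
  · exact (w.cont_Y.sub (continuousOn_comp_u ht cf')).add (continuousOn_comp_v ht cg')
  · exact (w.cont_Xt.sub (continuousOn_comp_u ht hf'')).add (continuousOn_comp_v ht hg'')
  · exact (w.cont_Yt.sub (continuousOn_comp_u ht hf'')).sub (continuousOn_comp_v ht hg'')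
  · exact (((continuousOn_const.div (cr.pow 2) fun z hz => pow_ne_zero 2 (r0 z hz)).add
      continuousOn_const).mul ((continuousOn_comp_u ht cf).add (continuousOn_comp_v ht cg))).add
      ((continuousOn_const.div cr r0).mul
        ((continuousOn_comp_u ht cf').add (continuousOn_comp_v ht cg')))

/-- The energy density of the multiplier `V ∂_r`. -/
noncomputable def nearDensity (V : ℝ → ℝ) (m lam : ℝ) (χ X Y : ℝ → ℝ → ℝ) (t r : ℝ) : ℝ :=
  X t r ^ 2 + Y t r ^ 2 + V r * (lam / r ^ 2 + m ^ 2 + 1) * χ t r ^ 2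

/-- The cutoff flux, the damping term with d - 1 and the derivative of λ/r² all have the good sign.
There remain V'/V, from the factor V in the zeroth-order part of the density, and the cross terms χX
and XS. These are split with weights that are powers of √V, so that the rate 1/√V is integrable at
r_c and does not involve λ. -/
theorem IsForcedWave.near_deriv {d m lam : ℝ} {χ X Y Xt Yt S : ℝ → ℝ → ℝ} {ζ ζ' b : ℝ → ℝ} {c : ℝ}
    (w : IsForcedWave V V' rc d m lam χ X Y Xt Yt S) (h : IsExpanding V V' rc)
    (ht : IsTortoise V τ rc) (hζ : IsCutoff ζ ζ' c) (hd : 1 ≤ d) (hlam : 0 ≤ lam) {r : ℝ}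
    (hr : rc < r) (hb : Integrable b) (hS : ∀ t, S t r ^ 2 ≤ b t) :
    ∃ E', HasDerivAt (fun r => ∫ t, weight ζ τ t r * nearDensity V m lam χ X Y t r) E' r ∧
      E' ≤ (V' r / V r + 2 / √(V r)) * (∫ t, weight ζ τ t r * nearDensity V m lam χ X Y t r) +
        √(V r) * ∫ t, b t := by
  have cV := h.continuousOn_snd
  have cV' := h.continuousOn_deriv_snd
  have cr : ContinuousOn (fun z : ℝ × ℝ => z.2) (beyond rc) := continuousOn_snd
  have r0 : ∀ z ∈ beyond rc, z.2 ≠ 0 := fun z hz => (h.pos_of_lt hz).ne'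
  have V0 : ∀ z ∈ beyond rc, V z.2 ≠ 0 := fun z hz => (h.pos hz).ne'
  have cQ : ContinuousOn (fun z : ℝ × ℝ => lam / z.2 ^ 2 + m ^ 2) (beyond rc) :=
    (continuousOn_const.div (cr.pow 2) fun z hz => pow_ne_zero 2 (r0 z hz)).add continuousOn_const
  have cη := continuousOn_weight hζ ht
  have ce : ContinuousOn (fun z : ℝ × ℝ => nearDensity V m lam χ X Y z.1 z.2) (beyond rc) :=
    ((w.cont_X.pow 2).add (w.cont_Y.pow 2)).add
      ((cV.mul (cQ.add continuousOn_const)).mul (w.cont_χ.pow 2))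
  have hz : ∀ t, c + 2 - τ r < |t| → weight ζ τ t r = 0 :=
    (weight_eventually_zero hζ ht hr).self_of_nhds
  have key := integral_deriv_le (G := fun t r => weight ζ τ t r * nearDensity V m lam χ X Y t r)
    (Gr := fun t r => (ζ' (t + τ r) * ζ (-t + τ r) + ζ (t + τ r) * ζ' (-t + τ r)) / V r *
      nearDensity V m lam χ X Y t r + weight ζ τ t r *
      (2 * X t r * ((Yt t r - (d - 1) * V r / r * X t r
        - V r * (lam / r ^ 2 + m ^ 2) * χ t r - V r * S t r) / V r) + 2 * Y t r * (Xt t r / V r) +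
        (V' r * (lam / r ^ 2 + m ^ 2 + 1) + V r * (-(lam * 2) / r ^ 3)) * χ t r ^ 2 +
        V r * (lam / r ^ 2 + m ^ 2 + 1) * (2 * χ t r * (X t r / V r))))
    (H := fun t r => weight ζ τ t r * (2 / V r * (X t r * Y t r)))
    (Ht := fun t r => (ζ' (t + τ r) * ζ (-t + τ r) - ζ (t + τ r) * ζ' (-t + τ r)) *
      (2 / V r * (X t r * Y t r)) + weight ζ τ t r *
      (2 / V r * (Xt t r * Y t r + X t r * Yt t r)))
    (b := fun t => √(V r) * b t) (rc := rc) (r₀ := r) (L := c + 2 - τ r)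
    (α := V' r / V r + 2 / √(V r)) hr ?_ (cη.mul ce) ?_ ?_ ?_ ?_ ?_ (hb.const_mul _) ?_
  · rw [integral_const_mul] at key
    exact ⟨_, key.1, key.2⟩
  · intro t r hr
    have h1 := ((hasDerivAt_const_div_pow lam 2 (h.pos_of_lt hr)).add_const (m ^ 2)).add_const 1
    have h2 := (((w.X_r t r hr).pow 2).add ((w.Y_r t r hr).pow 2)).add
      (((h.hasDerivAt r (h.pos_of_lt hr)).mul h1).mul ((w.χ_r t r hr).pow 2))
    refine ((hasDerivAt_weight_r hζ ht hr).mul h2).congr_deriv ?_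
    simp only [nearDensity, Pi.add_apply, Pi.mul_apply, Pi.pow_apply]
    push_cast
    ring
  · exact ((((continuousOn_comp_u ht hζ.cont).mul (continuousOn_comp_v ht hζ.continuous)).add
      ((continuousOn_comp_u ht hζ.continuous).mul (continuousOn_comp_v ht hζ.cont))).div cV V0
      |>.mul ce).add (cη.mul ((((continuousOn_const.mul w.cont_X).mul
        ((((w.cont_Yt.sub (((continuousOn_const.mul cV).div cr r0).mul w.cont_X)).sub
          ((cV.mul cQ).mul w.cont_χ)).sub (cV.mul w.cont_S)).div cV V0)).add
        ((continuousOn_const.mul w.cont_Y).mul (w.cont_Xt.div cV V0))).add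
        (((cV'.mul (cQ.add continuousOn_const)).add (cV.mul (continuousOn_const.div (cr.pow 3)
          fun z hz => pow_ne_zero 3 (r0 z hz)))).mul (w.cont_χ.pow 2)) |>.add
        ((cV.mul (cQ.add continuousOn_const)).mul ((continuousOn_const.mul w.cont_χ).mul
          (w.cont_X.div cV V0)))))
  · filter_upwards [weight_eventually_zero hζ ht hr] with s hs t hst
    rw [hs t hst, zero_mul]
  · intro t
    exact (hasDerivAt_weight_t hζ).mul (((w.X_t t r hr).mul (w.Y_t t r hr)).const_mul _)
  · have hm : ∀ t : ℝ, (t, r) ∈ beyond rc := fun t => hr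
    have hs : Continuous fun t : ℝ => (t, r) := by fun_prop
    exact ((((continuousOn_comp_u ht hζ.cont).mul (continuousOn_comp_v ht hζ.continuous)).sub
      ((continuousOn_comp_u ht hζ.continuous).mul (continuousOn_comp_v ht hζ.cont))).mul
      ((continuousOn_const.div cV V0).mul (w.cont_X.mul w.cont_Y)) |>.add
      (cη.mul ((continuousOn_const.div cV V0).mul ((w.cont_Xt.mul w.cont_Y).add
        (w.cont_X.mul w.cont_Yt))))).comp_continuous hs hm
  · intro t hst
    rw [hz t hst, zero_mul]
  · intro t
    have hV := h.pos hr
    have hr0 := h.pos_of_lt hr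
    have hV' := h.deriv_pos' hr.le
    have hs := Real.sqrt_pos.2 hV
    have hss : √(V r) * √(V r) = V r := Real.mul_self_sqrt hV.le
    have hη := weight_nonneg (τ := τ) hζ t r
    have hη1 := weight_le_one (τ := τ) hζ t r
    have he : X t r ^ 2 + Y t r ^ 2 ≤ nearDensity V m lam χ X Y t r := by
      have : 0 ≤ V r * (lam / r ^ 2 + m ^ 2 + 1) * χ t r ^ 2 := by positivity
      unfold nearDensity; linarith
    have flux := weight_flux_nonpos hζ (t + τ r) (-t + τ r) he
    have flux2 := div_nonpos_of_nonpos_of_nonneg flux hV.le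
    have bulk : -(2 * (d - 1) / r * X t r ^ 2) + 2 * χ t r * X t r - 2 * X t r * S t r +
        (V' r * (lam / r ^ 2 + m ^ 2 + 1) + V r * (-(lam * 2) / r ^ 3)) * χ t r ^ 2 ≤
        (V' r / V r + 2 / √(V r)) * nearDensity V m lam χ X Y t r + √(V r) * b t := by
      have b1 : 0 ≤ 2 * (d - 1) / r * X t r ^ 2 := by
        have : 0 ≤ d - 1 := by linarith
        positivity
      have b2 : 0 ≤ V r * ((lam * 2) / r ^ 3) * χ t r ^ 2 := by positivity
      have b3 : V' r * (lam / r ^ 2 + m ^ 2 + 1) * χ t r ^ 2 ≤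
          V' r / V r * nearDensity V m lam χ X Y t r := by
        rw [div_mul_eq_mul_div, le_div_iff₀ hV, nearDensity]
        have : 0 ≤ V' r * (X t r ^ 2 + Y t r ^ 2) := by positivity
        nlinarith
      have b4 : 2 * χ t r * X t r ≤ 1 / √(V r) * (X t r ^ 2 + V r * χ t r ^ 2) := by
        rw [one_div_mul_eq_div, le_div_iff₀ hs]
        have := sq_nonneg (X t r - √(V r) * χ t r)
        have e : (√(V r) * χ t r) ^ 2 = V r * χ t r ^ 2 := by rw [mul_pow, sq, hss]
        nlinarith
      have b5 : -(2 * X t r * S t r) ≤ 1 / √(V r) * X t r ^ 2 + √(V r) * S t r ^ 2 := by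
        have e : 1 / √(V r) * X t r ^ 2 + √(V r) * S t r ^ 2 + 2 * X t r * S t r =
          1 / √(V r) * (X t r + √(V r) * S t r) ^ 2 := by
          field_simp
          ring
        have : 0 ≤ 1 / √(V r) * (X t r + √(V r) * S t r) ^ 2 := by positivity
        linarith
      have b6 : 1 / √(V r) * (X t r ^ 2 + V r * χ t r ^ 2) + 1 / √(V r) * X t r ^ 2 ≤
          2 / √(V r) * nearDensity V m lam χ X Y t r := by
        have : X t r ^ 2 + V r * χ t r ^ 2 + X t r ^ 2 ≤ 2 * nearDensity V m lam χ X Y t r := by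
          unfold nearDensity
          have q1 : 0 ≤ V r * (lam / r ^ 2 + m ^ 2) * χ t r ^ 2 := by positivity
          have q2 : 0 ≤ V r * χ t r ^ 2 := by positivity
          nlinarith [sq_nonneg (Y t r)]
        calc _ = 1 / √(V r) * (X t r ^ 2 + V r * χ t r ^ 2 + X t r ^ 2) := by ring
          _ ≤ 1 / √(V r) * (2 * nearDensity V m lam χ X Y t r) := by gcongr
          _ = _ := by ring
      have b7 := mul_le_mul_of_nonneg_left (hS t) hs.le
      have e1 : (V' r * (lam / r ^ 2 + m ^ 2 + 1) + V r * (-(lam * 2) / r ^ 3)) * χ t r ^ 2 =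
        V' r * (lam / r ^ 2 + m ^ 2 + 1) * χ t r ^ 2 - V r * ((lam * 2) / r ^ 3) * χ t r ^ 2 := by
        ring
      rw [e1, add_mul]
      linarith
    have hb0 : 0 ≤ √(V r) * b t := mul_nonneg hs.le ((sq_nonneg _).trans (hS t))
    have bulk2 := mul_le_mul_of_nonneg_left bulk hη
    have bulk3 := mul_le_mul_of_nonneg_right hη1 hb0
    -- The r-derivative of the weighted density as a t-divergence, the flux through the cutoff, and
    -- the bulk. The derivatives `Xt`, `Yt` appear in the divergence only.
    have ident : (ζ' (t + τ r) * ζ (-t + τ r) + ζ (t + τ r) * ζ' (-t + τ r)) / V r *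
      nearDensity V m lam χ X Y t r + weight ζ τ t r *
      (2 * X t r * ((Yt t r - (d - 1) * V r / r * X t r
        - V r * (lam / r ^ 2 + m ^ 2) * χ t r - V r * S t r) / V r) + 2 * Y t r * (Xt t r / V r) +
        (V' r * (lam / r ^ 2 + m ^ 2 + 1) + V r * (-(lam * 2) / r ^ 3)) * χ t r ^ 2 +
        V r * (lam / r ^ 2 + m ^ 2 + 1) * (2 * χ t r * (X t r / V r))) =
      (ζ' (t + τ r) * ζ (-t + τ r) - ζ (t + τ r) * ζ' (-t + τ r)) *
      (2 / V r * (X t r * Y t r)) + weight ζ τ t r *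
      (2 / V r * (Xt t r * Y t r + X t r * Yt t r)) +
      ((ζ' (t + τ r) * ζ (-t + τ r) + ζ (t + τ r) * ζ' (-t + τ r)) *
        nearDensity V m lam χ X Y t r - (ζ' (t + τ r) * ζ (-t + τ r) -
        ζ (t + τ r) * ζ' (-t + τ r)) * (2 * X t r * Y t r)) / V r +
      weight ζ τ t r * (-(2 * (d - 1) / r * X t r ^ 2) + 2 * χ t r * X t r - 2 * X t r * S t r +
        (V' r * (lam / r ^ 2 + m ^ 2 + 1) + V r * (-(lam * 2) / r ^ 3)) * χ t r ^ 2) := by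
      have hVr : V r ≠ 0 := hV.ne'
      generalize nearDensity V m lam χ X Y t r = e
      generalize weight ζ τ t r = η
      field_simp
      ring
    rw [ident]
    linarith

end

/-- The norm of the data on the horizon that controls the energy of an angular mode. -/
noncomputable def dataNorm (lam : ℝ) (f f' g g' : ℝ → ℝ) : ℝ :=
  (lam ^ 2 + 1) * ((∫ u, f u ^ 2) + ∫ u, g u ^ 2) + (∫ u, f' u ^ 2) + ∫ u, g' u ^ 2

theorem dataNorm_nonneg (lam : ℝ) (f f' g g' : ℝ → ℝ) : 0 ≤ dataNorm lam f f' g g' := by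
  have h : ∀ f : ℝ → ℝ, 0 ≤ ∫ u, f u ^ 2 := fun f => integral_nonneg fun u => sq_nonneg _
  have := h f; have := h f'; have := h g; have := h g'
  unfold dataNorm; positivity

/-- On a slice of fixed radius, u and v are a translate and a reflected translate of t, so the size
of the source is the same at every radius. -/
theorem integral_data {lam : ℝ} {f f' g g' : ℝ → ℝ} (hf : Integrable fun u => f u ^ 2)
    (hf' : Integrable fun u => f' u ^ 2) (hg : Integrable fun u => g u ^ 2)
    (hg' : Integrable fun u => g' u ^ 2) (x : ℝ) :
    Integrable (fun t => (lam ^ 2 + 1) * (f (t + x) ^ 2 + g (-t + x) ^ 2) + f' (t + x) ^ 2 +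
      g' (-t + x) ^ 2) ∧
    ∫ t, ((lam ^ 2 + 1) * (f (t + x) ^ 2 + g (-t + x) ^ 2) + f' (t + x) ^ 2 + g' (-t + x) ^ 2) =
      dataNorm lam f f' g g' := by
  have i1 := hf.comp_add_right x
  have i2 := hf'.comp_add_right x
  have i3 := hg.comp_sub_left x
  have i4 := hg'.comp_sub_left x
  have e : ∀ t : ℝ, -t + x = x - t := fun t => by ring
  simp only [e]
  have i5 := (i1.add i3).const_mul (lam ^ 2 + 1)
  refine ⟨(i5.add i2).add i4, ?_⟩
  have e1 := integral_add (i5.add i2) i4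
  have e2 := integral_add i5 i2
  have e3 := integral_add i1 i3
  have e4 := integral_const_mul (lam ^ 2 + 1) (fun t => f (t + x) ^ 2 + g (x - t) ^ 2)
    (μ := volume)
  simp only [Pi.add_apply] at e1 e2 e3
  rw [e1, e2, e4, e3, integral_add_right_eq_self (fun t => f t ^ 2) x,
    integral_add_right_eq_self (fun t => f' t ^ 2) x,
    integral_sub_left_eq_self (fun t => g t ^ 2) volume x,
    integral_sub_left_eq_self (fun t => g' t ^ 2) volume x]
  rfl

section

variable {V V' τ : ℝ → ℝ} {rc : ℝ}

/-- The only place where the eigenvalue costs anything: λ multiplies f + g in the source, whence the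
factor λ² + 1 in `dataNorm` and the loss of two angular derivatives. -/
theorem source_sq_le {d m lam r f f' g g' : ℝ} (hrc : 0 < rc) (hr : rc < r) (hd : 1 ≤ d)
    (hlam : 0 ≤ lam) :
    ((lam / r ^ 2 + m ^ 2) * (f + g) + (d - 1) / r * (f' + g')) ^ 2 ≤
      (8 * (1 / rc ^ 4 + m ^ 4) + 4 * ((d - 1) / rc) ^ 2) *
        ((lam ^ 2 + 1) * (f ^ 2 + g ^ 2) + f' ^ 2 + g' ^ 2) := by
  have hd' : 0 ≤ d - 1 := by linarith
  have hr0 := hrc.trans hr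
  have hq : (lam / r ^ 2 + m ^ 2) ^ 2 ≤ 2 * (1 / rc ^ 4 + m ^ 4) * (lam ^ 2 + 1) := by
    have h1 : lam / r ^ 2 + m ^ 2 ≤ lam / rc ^ 2 + m ^ 2 := by gcongr
    have h2 : (lam / r ^ 2 + m ^ 2) ^ 2 ≤ (lam / rc ^ 2 + m ^ 2) ^ 2 := by gcongr
    have h3 : (lam / rc ^ 2 + m ^ 2) ^ 2 ≤ 2 * ((lam / rc ^ 2) ^ 2 + (m ^ 2) ^ 2) := by
      nlinarith [sq_nonneg (lam / rc ^ 2 - m ^ 2)]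
    have h4 : (lam / rc ^ 2) ^ 2 = 1 / rc ^ 4 * lam ^ 2 := by field_simp
    have h5 : 0 ≤ 1 / rc ^ 4 := by positivity
    have h6 : 0 ≤ m ^ 4 * lam ^ 2 := by positivity
    nlinarith
  have hp : ((d - 1) / r) ^ 2 ≤ ((d - 1) / rc) ^ 2 := by gcongr
  set Q := lam / r ^ 2 + m ^ 2
  set P := (d - 1) / r
  have h1 : (Q * (f + g) + P * (f' + g')) ^ 2 ≤
      4 * Q ^ 2 * (f ^ 2 + g ^ 2) + 4 * P ^ 2 * (f' ^ 2 + g' ^ 2) := by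
    have a1 : (Q * (f + g) + P * (f' + g')) ^ 2 ≤
        2 * (Q * (f + g)) ^ 2 + 2 * (P * (f' + g')) ^ 2 := by
      nlinarith [sq_nonneg (Q * (f + g) - P * (f' + g'))]
    have a2 := mul_nonneg (sq_nonneg Q) (sq_nonneg (f - g))
    have a3 := mul_nonneg (sq_nonneg P) (sq_nonneg (f' - g'))
    nlinarith
  have h2 : 4 * Q ^ 2 * (f ^ 2 + g ^ 2) ≤
      4 * (2 * (1 / rc ^ 4 + m ^ 4) * (lam ^ 2 + 1)) * (f ^ 2 + g ^ 2) := by gcongr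
  have h3 : 4 * P ^ 2 * (f' ^ 2 + g' ^ 2) ≤ 4 * ((d - 1) / rc) ^ 2 * (f' ^ 2 + g' ^ 2) := by
    gcongr
  have h4 : 0 ≤ (1 / rc ^ 4 + m ^ 4) * (f' ^ 2 + g' ^ 2) := by positivity
  have h5 : 0 ≤ ((d - 1) / rc) ^ 2 * ((lam ^ 2 + 1) * (f ^ 2 + g ^ 2)) := by positivity
  linarith

-- By `IsDoubleNull.remainder` the remainder and its null derivatives are O(r - r_c) on the support
-- of the weight, whose t-length is O(|τ|). The energy is therefore O((r - r_c)² |τ|), and its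
-- quotient by V ≥ V'(r_c) (r - r_c) tends to zero. The implied constant depends on the mode and the
-- cutoff, but the limit does not.
set_option maxHeartbeats 400000 in
theorem IsScalarWave.near_tendsto {d m lam : ℝ}
    {A At Ar Att Atr Arr a a' aρ b b' bρ : ℝ → ℝ → ℝ} {a'' b'' ζ ζ' : ℝ → ℝ} {c : ℝ}
    (hw : IsScalarWave V V' rc d m lam A At Ar Att Atr Arr)
    (h : IsExpanding V V' rc) (ht : IsTortoise V τ rc) (hd : 1 ≤ d) (hlam : 0 ≤ lam)
    (ha : IsBranch τ rc 1 A a a' aρ a'') (hb : IsBranch τ rc (-1) A b b' bρ b'')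
    (hζ : IsCutoff ζ ζ' c) :
    Tendsto (fun r => (∫ t, weight ζ τ t r * nearDensity V m lam
      (fun t r => A t r - a (t + τ r) 0 - b (-t + τ r) 0)
      (fun t r => V r * Ar t r - a' (t + τ r) 0 - b' (-t + τ r) 0)
      (fun t r => At t r - a' (t + τ r) 0 + b' (-t + τ r) 0) t r) / V r) (𝓝[>] rc) (𝓝 0) := by
  have hr₁ : rc < rc + 1 := by linarith
  have hr₂ : rc + 1 < rc + 2 := by linarith
  obtain ⟨R, hR⟩ := ht.exists_radius h (hr₁.trans hr₂)
  obtain ⟨K, hK⟩ := hw.isDoubleNull h ht hR hr₁ hr₂ hd hlam ha hb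
  -- The weight vanishes unless both u and v are at most c + 1.
  obtain ⟨C, hC, hrem⟩ := hK.remainder (c + 1)
  set Q : ℝ := V' (rc + 1) * (lam / rc ^ 2 + m ^ 2 + 1)
  have hrc := h.rc_pos
  have hκ := h.deriv_pos
  have hQ : 0 ≤ Q := mul_nonneg (h.deriv_pos' hr₁.le).le (by positivity)
  have hlim : Tendsto (fun r => (8 + Q) * C ^ 2 * (2 / V' rc) *
      ((c + 1) * (r - rc) - (r - rc) * τ r)) (𝓝[>] rc) (𝓝 0) := by
    have l0 : Tendsto (fun r => r - rc) (𝓝[>] rc) (𝓝 0) :=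
      (tendsto_sub_nhdsGT rc).mono_right nhdsWithin_le_nhds
    simpa using ((l0.const_mul (c + 1)).sub (ht.tendsto_mul h)).const_mul
      ((8 + Q) * C ^ 2 * (2 / V' rc))
  refine tendsto_of_tendsto_of_tendsto_of_le_of_le' tendsto_const_nhds hlim ?_ ?_
  · filter_upwards [self_mem_nhdsWithin] with r hr
    have hr : rc < r := hr
    have hV := h.pos hr
    have hr0 := h.pos_of_lt hr
    refine div_nonneg (integral_nonneg fun t => mul_nonneg (weight_nonneg hζ t r) ?_) hV.le
    unfold nearDensity
    positivity
  · filter_upwards [Ioo_mem_nhdsGT hr₁, (ht.tendsto_atBot h).eventually (eventually_lt_atBot (c + 1))]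
      with r hr hτ
    have hV := h.pos hr.1
    have hr0 := h.pos_of_lt hr.1
    have hz := sub_pos.2 hr.1
    have hτ1 : τ r ≤ τ (rc + 1) := (ht.strictMonoOn h).monotoneOn hr.1 hr₁ hr.2.le
    set B := (8 + Q) * C ^ 2 * (r - rc) ^ 2 with hB
    have hB0 : 0 ≤ B := by positivity
    set L := c + 1 - τ r with hL
    have hL0 : 0 ≤ L := by linarith
    set G := fun t => weight ζ τ t r * nearDensity V m lam
      (fun t r => A t r - a (t + τ r) 0 - b (-t + τ r) 0)
      (fun t r => V r * Ar t r - a' (t + τ r) 0 - b' (-t + τ r) 0)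
      (fun t r => At t r - a' (t + τ r) 0 + b' (-t + τ r) 0) t r with hG
    have hle : ∀ t, G t ≤ (Icc (-L) L).indicator (fun _ => B) t := by
      intro t
      by_cases htL : t ∈ Icc (-L) L
      swap
      · rw [indicator_of_notMem htL, hG]
        have : L < |t| := by
          by_contra! h
          exact htL (abs_le.1 h)
        simp only [weight_eq_zero hζ this, zero_mul, le_refl]
      · rw [indicator_of_mem htL]
        have hrr : R (τ r) = r := hR.left_inv r ⟨hr.1, hr.2.trans hr₂⟩
        obtain ⟨h1, h2, h3⟩ := hrem (t + τ r) (-t + τ r) (by linarith [htL.2])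
          (by linarith [htL.1]) (by linarith)
        have e1 : (t + τ r - (-t + τ r)) / 2 = t := by ring
        have e2 : (t + τ r + (-t + τ r)) / 2 = τ r := by ring
        simp only [e1, e2, hrr] at h1 h2 h3
        set Z := r - rc
        have hCZ : 0 ≤ C * Z := mul_nonneg hC hz.le
        have w0 := weight_nonneg (τ := τ) hζ t r
        have w1 := weight_le_one (τ := τ) hζ t r
        have hX : (V r * Ar t r - a' (t + τ r) 0 - b' (-t + τ r) 0) ^ 2 ≤ (2 * (C * Z)) ^ 2 := by
          rw [sq_le_sq, abs_of_nonneg (by positivity : 0 ≤ 2 * (C * Z))]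
          rw [abs_le] at h1 h2 ⊢
          constructor <;> linarith
        have hY : (At t r - a' (t + τ r) 0 + b' (-t + τ r) 0) ^ 2 ≤ (2 * (C * Z)) ^ 2 := by
          rw [sq_le_sq, abs_of_nonneg (by positivity : 0 ≤ 2 * (C * Z))]
          rw [abs_le] at h1 h2 ⊢
          constructor <;> linarith
        have hχ : (A t r - a (t + τ r) 0 - b (-t + τ r) 0) ^ 2 ≤ (C * Z) ^ 2 := by
          rw [sq_le_sq, abs_of_nonneg hCZ]
          exact h3
        have hVw : V r * (lam / r ^ 2 + m ^ 2 + 1) ≤ Q := by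
          have v1 : V r ≤ V' (rc + 1) := by
            refine (h.upper_of_le hr.1 hr.2.le).trans ?_
            have := h.deriv_pos' hr₁.le
            have : r - rc ≤ 1 := by linarith [hr.2]
            nlinarith
          have v2 : lam / r ^ 2 + m ^ 2 + 1 ≤ lam / rc ^ 2 + m ^ 2 + 1 := by
            have := hr.1.le
            gcongr
          exact mul_le_mul v1 v2 (by positivity) (h.deriv_pos' hr₁.le).le
        have hden : nearDensity V m lam
            (fun t r => A t r - a (t + τ r) 0 - b (-t + τ r) 0)
            (fun t r => V r * Ar t r - a' (t + τ r) 0 - b' (-t + τ r) 0)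
            (fun t r => At t r - a' (t + τ r) 0 + b' (-t + τ r) 0) t r ≤ B := by
          have := mul_le_mul hVw hχ (sq_nonneg _) hQ
          have e : B = (2 * (C * Z)) ^ 2 + (2 * (C * Z)) ^ 2 + Q * (C * Z) ^ 2 := by
            rw [hB]; ring
          rw [e]
          exact add_le_add (add_le_add hX hY) this
        calc G t ≤ weight ζ τ t r * B := mul_le_mul_of_nonneg_left hden w0
          _ ≤ 1 * B := mul_le_mul_of_nonneg_right w1 hB0
          _ = B := one_mul B
    have hInt : ∫ t, G t ≤ B * (2 * L) := by
      have hmeas : Integrable ((Icc (-L) L).indicator (fun _ => B)) :=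
        (integrable_indicator_iff measurableSet_Icc).2 (integrableOn_const (by simp))
      have : ∫ t, (Icc (-L) L).indicator (fun _ => B) t = B * (2 * L) := by
        rw [integral_indicator measurableSet_Icc, setIntegral_const, measureReal_def,
          Real.volume_Icc, ENNReal.toReal_ofReal (by linarith), smul_eq_mul]
        ring
      rw [← this]
      refine integral_mono_of_nonneg (ae_of_all _ fun t => ?_) hmeas (ae_of_all _ hle)
      refine mul_nonneg (weight_nonneg hζ t r) ?_
      unfold nearDensity
      positivity
    rw [div_le_iff₀ hV]
    have hlow := h.lower hr.1
    have e3 : (8 + Q) * C ^ 2 * (2 / V' rc) * ((c + 1) * (r - rc) - (r - rc) * τ r) * V r =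
        (8 + Q) * C ^ 2 * (2 * L) * (r - rc) / V' rc * V r := by
      rw [hL]; ring
    rw [e3]
    have : B * (2 * L) = (8 + Q) * C ^ 2 * (2 * L) * (r - rc) / V' rc * (V' rc * (r - rc)) := by
      rw [hB]; field_simp
    rw [this] at hInt
    refine hInt.trans (mul_le_mul_of_nonneg_left hlow ?_)
    positivity

/-- The energy at `r = r₁` of the remainder `A - f(u) - g(v)` is bounded by the data, uniformly in the
angular eigenvalue. -/
theorem exists_near_bound (h : IsExpanding V V' rc) (ht : IsTortoise V τ rc) {d r₁ : ℝ} (hd : 1 ≤ d)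
    (m : ℝ) (hr₁ : rc < r₁) : ∃ C, 0 ≤ C ∧ ∀ (lam : ℝ)
    (A At Ar Att Atr Arr a a' aρ b b' bρ : ℝ → ℝ → ℝ) (a'' b'' ζ ζ' : ℝ → ℝ) (c : ℝ),
    0 ≤ lam → IsScalarWave V V' rc d m lam A At Ar Att Atr Arr →
    IsBranch τ rc 1 A a a' aρ a'' → IsBranch τ rc (-1) A b b' bρ b'' → IsCutoff ζ ζ' c →
    ∫ t, weight ζ τ t r₁ * nearDensity V m lam
      (fun t r => A t r - a (t + τ r) 0 - b (-t + τ r) 0)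
      (fun t r => V r * Ar t r - a' (t + τ r) 0 - b' (-t + τ r) 0)
      (fun t r => At t r - a' (t + τ r) 0 + b' (-t + τ r) 0) t r₁ ≤
    C * dataNorm lam (fun u => a u 0) (fun u => a' u 0) (fun u => b u 0) (fun u => b' u 0) := by
  set C₀ := 8 * (1 / rc ^ 4 + m ^ 4) + 4 * ((d - 1) / rc) ^ 2 with hC₀
  have hrc := h.rc_pos
  have hκ := h.deriv_pos
  have hC₀0 : 0 ≤ C₀ := by positivity
  -- A primitive of (V'(r_c) (r - r_c))^{-1/2}, which dominates V^{-1/2}; it vanishes at r_c.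
  set J : ℝ → ℝ := fun r => 2 / √(V' rc) * √(r - rc) with hJ
  refine ⟨V r₁ * (C₀ / 2 * Real.exp (2 * J r₁)), by have := h.pos hr₁; positivity, ?_⟩
  intro lam A At Ar Att Atr Arr a a' aρ b b' bρ a'' b'' ζ ζ' c hlam hw ha hb hζ
  have hlim := hw.near_tendsto h ht hd hlam ha hb hζ
  have w := hw.isForcedWave_sub h ht (fun u => ha.partials.fst u 0 (mem_univ _)) ha.deriv₂ ha.cont₂
    (fun u => hb.partials.fst u 0 (mem_univ _)) hb.deriv₂ hb.cont₂
  set D := dataNorm lam (fun u => a u 0) (fun u => a' u 0) (fun u => b u 0) (fun u => b' u 0)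
  have hD : 0 ≤ D := dataNorm_nonneg _ _ _ _ _
  set E : ℝ → ℝ := fun r => ∫ t, weight ζ τ t r * nearDensity V m lam
      (fun t r => A t r - a (t + τ r) 0 - b (-t + τ r) 0)
      (fun t r => V r * Ar t r - a' (t + τ r) 0 - b' (-t + τ r) 0)
      (fun t r => At t r - a' (t + τ r) 0 + b' (-t + τ r) 0) t r with hE
  have hder : ∀ r, rc < r → ∃ E', HasDerivAt E E' r ∧
      E' ≤ (V' r / V r + 2 / √(V r)) * E r + √(V r) * (C₀ * D) := by
    intro r hr
    obtain ⟨hi, hi'⟩ := integral_data (lam := lam) ha.int₀ ha.int₁ hb.int₀ hb.int₁ (τ r)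
    obtain ⟨E', h1, h2⟩ := w.near_deriv h ht hζ hd hlam hr (hi.const_mul C₀)
      (fun t => source_sq_le hrc hr hd hlam)
    rw [integral_const_mul, hi'] at h2
    exact ⟨E', h1, h2⟩
  choose! E' hE' using hder
  have hJd : ∀ r, rc < r → HasDerivAt J (1 / (√(V' rc) * √(r - rc))) r := by
    intro r hr
    refine ((((hasDerivAt_id r).sub_const rc).sqrt (sub_pos.2 hr).ne').const_mul _).congr_deriv ?_
    have := Real.sqrt_pos.2 (sub_pos.2 hr)
    have := Real.sqrt_pos.2 hκ
    simp only [id]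
    field_simp
  -- Dividing E by V removes the nonintegrable rate V'/V, and adding C₀D/2 makes the differential
  -- inequality homogeneous, so `N` is nonincreasing.
  set N : ℝ → ℝ := fun r => (E r / V r + C₀ * D / 2) * Real.exp (-(2 * J r)) with hN
  have hE0 : ∀ r, rc < r → 0 ≤ E r := by
    intro r hr
    have hV := h.pos hr
    have hr0 := h.pos_of_lt hr
    refine integral_nonneg fun t => mul_nonneg (weight_nonneg hζ t r) ?_
    unfold nearDensity
    positivity
  have hNd : ∀ r, rc < r → HasDerivAt N
      (((E' r * V r - E r * V' r) / V r ^ 2) * Real.exp (-(2 * J r)) +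
      (E r / V r + C₀ * D / 2) * (Real.exp (-(2 * J r)) *
        (-(2 * (1 / (√(V' rc) * √(r - rc))))))) r := by
    intro r hr
    exact (((hE' r hr).1.div (h.hasDerivAt r (h.pos_of_lt hr)) (h.pos hr).ne').add_const _).mul
      (((hJd r hr).const_mul 2).neg.exp)
  have hanti : AntitoneOn N (Ioi rc) := by
    refine antitoneOn_of_hasDerivWithinAt_nonpos (convex_Ioi rc)
      (fun r hr => (hNd r hr).continuousAt.continuousWithinAt)
      (fun r hr => (hNd r (mem_Ioi.1 (interior_subset hr))).hasDerivWithinAt) fun r hr => ?_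
    have hr : rc < r := mem_Ioi.1 (interior_subset hr)
    have hV := h.pos hr
    have hs := Real.sqrt_pos.2 hV
    have hss : √(V r) * √(V r) = V r := Real.mul_self_sqrt hV.le
    have hj : 1 / √(V r) ≤ 1 / (√(V' rc) * √(r - rc)) := by
      refine one_div_le_one_div_of_le
        (mul_pos (Real.sqrt_pos.2 hκ) (Real.sqrt_pos.2 (sub_pos.2 hr))) ?_
      rw [← Real.sqrt_mul hκ.le]
      exact Real.sqrt_le_sqrt (h.lower hr)
    set j := 1 / (√(V' rc) * √(r - rc))
    have e0 := hE0 r hr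
    have h1 : (E' r * V r - E r * V' r) / V r ^ 2 ≤ 2 * j * (E r / V r) + C₀ * D * j := by
      have h2 := (hE' r hr).2
      have h3 : (E' r * V r - E r * V' r) / V r ^ 2 ≤
          (((V' r / V r + 2 / √(V r)) * E r + √(V r) * (C₀ * D)) * V r - E r * V' r) / V r ^ 2 := by
        gcongr
      have h4 : (((V' r / V r + 2 / √(V r)) * E r + √(V r) * (C₀ * D)) * V r - E r * V' r) / V r ^ 2
          = 2 * (1 / √(V r)) * (E r / V r) + C₀ * D * (1 / √(V r)) := by
        have : √(V r) / V r = 1 / √(V r) := by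
          rw [div_eq_div_iff hV.ne' hs.ne', one_mul, hss]
        rw [← this]
        field_simp
        have h5 : √(V r) ^ 2 = V r := Real.sq_sqrt hV.le
        rw [h5]
        ring
      have h6 : 0 ≤ E r / V r := div_nonneg e0 hV.le
      refine h3.trans (h4.le.trans ?_)
      gcongr
    have := mul_le_mul_of_nonneg_right h1 (Real.exp_pos (-(2 * J r))).le
    nlinarith
  have hJ0 : Tendsto J (𝓝[>] rc) (𝓝 0) := by
    have l0 : Tendsto (fun r => r - rc) (𝓝[>] rc) (𝓝 0) :=
      (tendsto_sub_nhdsGT rc).mono_right nhdsWithin_le_nhds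
    have := l0.sqrt.const_mul (2 / √(V' rc))
    simpa using this
  -- The initial value contains only the data, since E/V tends to zero; thus no constant that
  -- depends on the mode survives.
  have hN0 : Tendsto N (𝓝[>] rc) (𝓝 (C₀ * D / 2)) := by
    have h1 : Tendsto (fun r => Real.exp (-(2 * J r))) (𝓝[>] rc) (𝓝 1) := by
      have h0 : Tendsto (fun r => -(2 * J r)) (𝓝[>] rc) (𝓝 0) := by
        simpa using (hJ0.const_mul 2).neg
      have := (Real.continuous_exp.tendsto 0).comp h0
      rw [Real.exp_zero] at this
      exact this
    simpa using (hlim.add_const (C₀ * D / 2)).mul h1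
  have hfin : N r₁ ≤ C₀ * D / 2 := by
    refine ge_of_tendsto hN0 ?_
    filter_upwards [Ioo_mem_nhdsGT hr₁] with r hr
    exact hanti hr.1 hr₁ hr.2.le
  have hV := h.pos hr₁
  simp only [hN] at hfin
  rw [Real.exp_neg, ← div_eq_mul_inv, div_le_iff₀ (Real.exp_pos _)] at hfin
  have h7 : E r₁ / V r₁ ≤ C₀ * D / 2 * Real.exp (2 * J r₁) := by
    have : 0 ≤ C₀ * D / 2 := by positivity
    linarith
  rw [div_le_iff₀ hV] at h7
  linarith

end

/-! ### The energy estimate up to infinity -/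

/-- The energy density of the multiplier `r ∂_r + n / 2`. -/
noncomputable def farDensity (V : ℝ → ℝ) (n : ℕ) (κ lam : ℝ) (φ X Y : ℝ → ℝ → ℝ) (t r : ℝ) : ℝ :=
  (r / V r * X t r + n / 2 * φ t r) ^ 2 + κ * φ t r ^ 2 + lam / V r * φ t r ^ 2 +
    (r / V r) ^ 2 * Y t r ^ 2

section

variable {V V' τ : ℝ → ℝ} {rc : ℝ}

/-- For V = r² the cross term has the coefficient n²/4 - m² + κ, and 2√κ |φP| ≤ P² + κφ² turns `hβ`
into the growth rate 2β. The deviations r V'/V - 2 and r²/V - 1 are O(1/V) and contribute the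
remaining term. -/
theorem far_bulk_le {n m κ β K v v' r φ P : ℝ} (hn : 0 ≤ n) (hκ : 0 < κ) (hv : 0 < v)
    (hβ : |n ^ 2 / 4 - m ^ 2 + κ| ≤ 2 * β * √κ) (h1 : |r * v' - 2 * v| ≤ K)
    (h2 : |r ^ 2 - v| ≤ K) :
    2 * (n ^ 2 / 4 - m ^ 2 + κ + (-(m ^ 2 * (r ^ 2 / v - 1)) + n / 2 * (r * v' / v - 2))) * φ * P
      - 2 * (r * v' / v - 2) * P ^ 2 ≤
    (2 * β + ((m ^ 2 * K + n / 2 * K) / √κ + 2 * K) / v) * (P ^ 2 + κ * φ ^ 2) := by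
  have hs := Real.sqrt_pos.2 hκ
  have hss : √κ ^ 2 = κ := Real.sq_sqrt hκ.le
  have hφP : |φ * P| ≤ (P ^ 2 + κ * φ ^ 2) / (2 * √κ) := by
    rw [le_div_iff₀ (by positivity), ← abs_of_pos (by positivity : 0 < 2 * √κ), ← abs_mul, abs_le]
    constructor <;> nlinarith [sq_nonneg (P - √κ * φ), sq_nonneg (P + √κ * φ)]
  set e := P ^ 2 + κ * φ ^ 2
  have he : 0 ≤ e := by positivity
  have hP : P ^ 2 ≤ e := by
    have : 0 ≤ κ * φ ^ 2 := by positivity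
    simp only [e]; linarith
  have d1 : |r * v' / v - 2| ≤ K / v := by
    rw [show r * v' / v - 2 = (r * v' - 2 * v) / v by field_simp, abs_div, abs_of_pos hv]
    gcongr
  have d2 : |r ^ 2 / v - 1| ≤ K / v := by
    rw [show r ^ 2 / v - 1 = (r ^ 2 - v) / v by field_simp, abs_div, abs_of_pos hv]
    gcongr
  set δ₁ := r * v' / v - 2
  set δ₂ := r ^ 2 / v - 1
  have d3 : |-(m ^ 2 * δ₂) + n / 2 * δ₁| ≤ (m ^ 2 * K + n / 2 * K) / v := by
    refine (abs_add_le _ _).trans ?_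
    rw [abs_neg, abs_mul, abs_mul, abs_of_nonneg (sq_nonneg m), abs_of_nonneg (by positivity :
      0 ≤ n / 2), add_div, mul_div_assoc, mul_div_assoc]
    gcongr
  have t1 : 2 * (n ^ 2 / 4 - m ^ 2 + κ + (-(m ^ 2 * δ₂) + n / 2 * δ₁)) * φ * P ≤
      (2 * (2 * β * √κ) + 2 * ((m ^ 2 * K + n / 2 * K) / v)) * (e / (2 * √κ)) := by
    have a1 := mul_le_mul hβ hφP (abs_nonneg _) ((abs_nonneg _).trans hβ)
    have a2 := mul_le_mul d3 hφP (abs_nonneg _) ((abs_nonneg _).trans d3)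
    rw [← abs_mul] at a1 a2
    have b1 := le_abs_self ((n ^ 2 / 4 - m ^ 2 + κ) * (φ * P))
    have b2 := le_abs_self ((-(m ^ 2 * δ₂) + n / 2 * δ₁) * (φ * P))
    linarith
  have t2 : -(2 * δ₁ * P ^ 2) ≤ 2 * (K / v) * e := by
    have a1 := neg_abs_le δ₁
    have a3 : 0 ≤ K / v := (abs_nonneg _).trans d1
    have a2 : -δ₁ * P ^ 2 ≤ K / v * P ^ 2 :=
      mul_le_mul_of_nonneg_right (by linarith) (sq_nonneg P)
    have a4 := mul_le_mul_of_nonneg_left hP a3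
    linarith
  have t3 : (2 * (2 * β * √κ) + 2 * ((m ^ 2 * K + n / 2 * K) / v)) * (e / (2 * √κ)) =
      (2 * β + (m ^ 2 * K + n / 2 * K) / √κ / v) * e := by
    field_simp
  have t4 : (2 * β + ((m ^ 2 * K + n / 2 * K) / √κ + 2 * K) / v) * e =
      (2 * β + (m ^ 2 * K + n / 2 * K) / √κ / v) * e + 2 * (K / v) * e := by ring
  rw [t4]
  linarith

-- With P = r ∂_r φ + (n/2) φ and the weight r^n, the first-order damping of the equation is
-- absorbed. The angular term decreases because V' > 0, and the term in ∂_t φ because V ≤ r V'. Only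
-- P and φ remain, so the rate is independent of λ.
set_option maxHeartbeats 1000000 in
theorem IsForcedWave.far_deriv {n : ℕ} {m κ β lam K : ℝ} {φ X Y Xt Yt : ℝ → ℝ → ℝ}
    {ζ ζ' : ℝ → ℝ} {c : ℝ}
    (w : IsForcedWave V V' rc n m lam φ X Y Xt Yt (fun _ _ => 0)) (h : IsExpanding V V' rc)
    (ht : IsTortoise V τ rc) (hζ : IsCutoff ζ ζ' c) (hlam : 0 ≤ lam) (hκ : 0 < κ)
    (hβ : |(n : ℝ) ^ 2 / 4 - m ^ 2 + κ| ≤ 2 * β * √κ)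
    {r : ℝ} (hr : rc < r) (hK1 : |r * V' r - 2 * V r| ≤ K) (hK2 : |r ^ 2 - V r| ≤ K) :
    ∃ E', HasDerivAt (fun r => ∫ t, weight ζ τ t r * (r ^ n * farDensity V n κ lam φ X Y t r)) E' r ∧
      E' ≤ (2 * β + ((m ^ 2 * K + n / 2 * K) / √κ + 2 * K) / V r) / r *
        (∫ t, weight ζ τ t r * (r ^ n * farDensity V n κ lam φ X Y t r)) := by
  have cV := h.continuousOn_snd
  have cV' := h.continuousOn_deriv_snd
  have cr : ContinuousOn (fun z : ℝ × ℝ => z.2) (beyond rc) := continuousOn_snd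
  have r0 : ∀ z ∈ beyond rc, z.2 ≠ 0 := fun z hz => (h.pos_of_lt hz).ne'
  have V0 : ∀ z ∈ beyond rc, V z.2 ≠ 0 := fun z hz => (h.pos hz).ne'
  have cη := continuousOn_weight hζ ht
  have cP : ContinuousOn (fun z : ℝ × ℝ => z.2 / V z.2 * X z.1 z.2 + n / 2 * φ z.1 z.2)
    (beyond rc) := ((cr.div cV V0).mul w.cont_X).add (continuousOn_const.mul w.cont_χ)
  have cU : ContinuousOn (fun z : ℝ × ℝ =>
      1 * (1 / V z.2) * X z.1 z.2 + z.2 * (-V' z.2 / V z.2 ^ 2) * X z.1 z.2 + z.2 / V z.2 *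
      ((Yt z.1 z.2 - ((n : ℝ) - 1) * V z.2 / z.2 * X z.1 z.2
        - V z.2 * (lam / z.2 ^ 2 + m ^ 2) * φ z.1 z.2 - V z.2 * 0) / V z.2)
      + n / 2 * (X z.1 z.2 / V z.2)) (beyond rc) :=
    ((((continuousOn_const.mul (continuousOn_const.div cV V0)).mul w.cont_X).add
      ((cr.mul (cV'.neg.div (cV.pow 2) fun z hz => pow_ne_zero 2 (V0 z hz))).mul w.cont_X)).add
      ((cr.div cV V0).mul ((((w.cont_Yt.sub (((continuousOn_const.mul cV).div cr r0).mul
        w.cont_X)).sub ((cV.mul ((continuousOn_const.div (cr.pow 2)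
          fun z hz => pow_ne_zero 2 (r0 z hz)).add continuousOn_const)).mul w.cont_χ)).sub
          (cV.mul continuousOn_const)).div cV V0))).add
      (continuousOn_const.mul (w.cont_X.div cV V0))
  have ce : ContinuousOn (fun z : ℝ × ℝ => farDensity V n κ lam φ X Y z.1 z.2) (beyond rc) :=
    (((cP.pow 2).add (continuousOn_const.mul (w.cont_χ.pow 2))).add
      ((continuousOn_const.div cV V0).mul (w.cont_χ.pow 2))).add
      (((cr.div cV V0).pow 2).mul (w.cont_Y.pow 2))
  have hz : ∀ t, c + 2 - τ r < |t| → weight ζ τ t r = 0 :=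
    (weight_eventually_zero hζ ht hr).self_of_nhds
  have key := integral_deriv_le
    (G := fun t r => weight ζ τ t r * (r ^ n * farDensity V n κ lam φ X Y t r))
    (Gr := fun t r => (ζ' (t + τ r) * ζ (-t + τ r) + ζ (t + τ r) * ζ' (-t + τ r)) / V r *
      (r ^ n * farDensity V n κ lam φ X Y t r) + weight ζ τ t r *
      (n * r ^ (n - 1) * farDensity V n κ lam φ X Y t r + r ^ n *
        (2 * (r / V r * X t r + n / 2 * φ t r) *
          (1 * (1 / V r) * X t r + r * (-V' r / V r ^ 2) * X t r + r / V r *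
          ((Yt t r - ((n : ℝ) - 1) * V r / r * X t r
        - V r * (lam / r ^ 2 + m ^ 2) * φ t r - V r * 0) / V r) + n / 2 * (X t r / V r)) +
        κ * (2 * φ t r * (X t r / V r)) + (lam * (-V' r / V r ^ 2) * φ t r ^ 2 +
          lam / V r * (2 * φ t r * (X t r / V r))) +
        (2 * (r / V r) * (1 * (1 / V r) + r * (-V' r / V r ^ 2)) * Y t r ^ 2 +
          (r / V r) ^ 2 * (2 * Y t r * (Xt t r / V r))))))
    (H := fun t r => weight ζ τ t r * (r ^ n * (2 * r / V r ^ 2) *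
      (Y t r * (r / V r * X t r + n / 2 * φ t r))))
    (Ht := fun t r => (ζ' (t + τ r) * ζ (-t + τ r) - ζ (t + τ r) * ζ' (-t + τ r)) *
      (r ^ n * (2 * r / V r ^ 2) * (Y t r * (r / V r * X t r + n / 2 * φ t r))) + weight ζ τ t r *
      (r ^ n * (2 * r / V r ^ 2) * (Yt t r * (r / V r * X t r + n / 2 * φ t r) +
        Y t r * (r / V r * Xt t r + n / 2 * Y t r))))
    (b := fun t => 0) (rc := rc) (r₀ := r) (L := c + 2 - τ r)
    (α := (2 * β + ((m ^ 2 * K + n / 2 * K) / √κ + 2 * K) / V r) / r) hr ?_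
    (cη.mul ((cr.pow n).mul ce)) ?_ ?_ ?_ ?_ ?_ (integrable_zero _ _ _) ?_
  · rw [integral_zero, add_zero] at key
    exact ⟨_, key.1, key.2⟩
  · intro t r hr
    have dV := h.hasDerivAt r (h.pos_of_lt hr)
    have dinv : HasDerivAt (fun r => 1 / V r) (-V' r / V r ^ 2) r := by
      have := dV.inv (h.pos hr).ne'
      simp only [one_div]
      exact this
    have drV : HasDerivAt (fun r => r / V r) (1 * (1 / V r) + r * (-V' r / V r ^ 2)) r := by
      have := (hasDerivAt_id r).mul dinv
      refine (this.congr_of_eventuallyEq (Eventually.of_forall fun x => ?_)).congr_deriv rfl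
      simp [div_eq_mul_inv]
    have dlV : HasDerivAt (fun r => lam / V r) (lam * (-V' r / V r ^ 2)) r := by
      refine (dinv.const_mul lam).congr_of_eventuallyEq (Eventually.of_forall fun x => ?_)
      simp [div_eq_mul_inv]
    have dP := (drV.mul (w.X_r t r hr)).add ((w.χ_r t r hr).const_mul ((n : ℝ) / 2))
    have h2 := (((dP.pow 2).add (((w.χ_r t r hr).pow 2).const_mul κ)).add
      (dlV.mul ((w.χ_r t r hr).pow 2))).add ((drV.pow 2).mul ((w.Y_r t r hr).pow 2))
    refine ((hasDerivAt_weight_r hζ ht hr).mul ((hasDerivAt_pow n r).mul h2)).congr_deriv ?_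
    simp only [farDensity, Pi.add_apply, Pi.mul_apply, Pi.pow_apply]
    push_cast
    ring
  · exact ((((continuousOn_comp_u ht hζ.cont).mul (continuousOn_comp_v ht hζ.continuous)).add
      ((continuousOn_comp_u ht hζ.continuous).mul (continuousOn_comp_v ht hζ.cont))).div cV V0
      |>.mul ((cr.pow n).mul ce)).add (cη.mul (((continuousOn_const.mul (cr.pow (n - 1))).mul ce).add
        ((cr.pow n).mul (((((continuousOn_const.mul cP).mul cU).add (continuousOn_const.mul
          ((continuousOn_const.mul w.cont_χ).mul (w.cont_X.div cV V0)))).add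
          (((continuousOn_const.mul (cV'.neg.div (cV.pow 2) fun z hz => pow_ne_zero 2
            (V0 z hz))).mul (w.cont_χ.pow 2)).add ((continuousOn_const.div cV V0).mul
              ((continuousOn_const.mul w.cont_χ).mul (w.cont_X.div cV V0))))).add
          ((((continuousOn_const.mul (cr.div cV V0)).mul ((continuousOn_const.mul
            (continuousOn_const.div cV V0)).add (cr.mul (cV'.neg.div (cV.pow 2) fun z hz =>
              pow_ne_zero 2 (V0 z hz))))).mul (w.cont_Y.pow 2)).add (((cr.div cV V0).pow 2).mul
                ((continuousOn_const.mul w.cont_Y).mul (w.cont_Xt.div cV V0))))))))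
  · filter_upwards [weight_eventually_zero hζ ht hr] with s hs t hst
    rw [hs t hst, zero_mul]
  · intro t
    exact (hasDerivAt_weight_t hζ).mul (((w.Y_t t r hr).mul (((w.X_t t r hr).const_mul _).add
      ((w.χ_t t r hr).const_mul _))).const_mul _)
  · have hm : ∀ t : ℝ, (t, r) ∈ beyond rc := fun t => hr
    have hs : Continuous fun t : ℝ => (t, r) := by fun_prop
    have cc : ContinuousOn (fun z : ℝ × ℝ => z.2 ^ n * (2 * z.2 / V z.2 ^ 2)) (beyond rc) :=
      (cr.pow n).mul ((continuousOn_const.mul cr).div (cV.pow 2) fun z hz => pow_ne_zero 2 (V0 z hz))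
    exact ((((continuousOn_comp_u ht hζ.cont).mul (continuousOn_comp_v ht hζ.continuous)).sub
      ((continuousOn_comp_u ht hζ.continuous).mul (continuousOn_comp_v ht hζ.cont))).mul
      (cc.mul (w.cont_Y.mul cP)) |>.add
      (cη.mul (cc.mul ((w.cont_Yt.mul cP).add (w.cont_Y.mul (((cr.div cV V0).mul w.cont_Xt).add
        (continuousOn_const.mul w.cont_Y))))))).comp_continuous hs hm
  · intro t hst
    rw [hz t hst, zero_mul]
  · intro t
    have hV := h.pos hr
    have hr0 := h.pos_of_lt hr
    have hV' := h.deriv_pos' hr.le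
    have hη := weight_nonneg (τ := τ) hζ t r
    have hrn : 0 < r ^ n := by positivity
    obtain ⟨P, hP⟩ : ∃ P, P = r / V r * X t r + n / 2 * φ t r := ⟨_, rfl⟩
    have hX : X t r = (P - n / 2 * φ t r) * V r / r := by
      rw [hP]; field_simp; ring
    have he : P ^ 2 + (r / V r * Y t r) ^ 2 ≤ farDensity V n κ lam φ X Y t r := by
      have a1 : 0 ≤ κ * φ t r ^ 2 := by positivity
      have a2 : 0 ≤ lam / V r * φ t r ^ 2 := by positivity
      rw [farDensity, ← hP, mul_pow]
      linarith
    have he2 : P ^ 2 + κ * φ t r ^ 2 ≤ farDensity V n κ lam φ X Y t r := by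
      have a1 : 0 ≤ (r / V r) ^ 2 * Y t r ^ 2 := by positivity
      have a2 : 0 ≤ lam / V r * φ t r ^ 2 := by positivity
      rw [farDensity, ← hP]
      linarith
    have flux := weight_flux_nonpos hζ (t + τ r) (-t + τ r) he
    have flux2 := mul_nonpos_of_nonneg_of_nonpos (by positivity : 0 ≤ r ^ n / V r) flux
    have hn0 : (0 : ℝ) ≤ n := by positivity
    have bulk := far_bulk_le (φ := φ t r) (P := P) hn0 hκ hV hβ hK1 hK2
    have hβ0 : 0 ≤ β := by
      have := (abs_nonneg _).trans hβ
      have hs := Real.sqrt_pos.2 hκ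
      by_contra! hneg
      nlinarith
    have hK0 : 0 ≤ K := (abs_nonneg _).trans hK1
    have hcoef : 0 ≤ 2 * β + ((m ^ 2 * K + n / 2 * K) / √κ + 2 * K) / V r := by positivity
    have bulk2 := mul_le_mul_of_nonneg_left he2 hcoef
    have good1 : 0 ≤ lam * (r * V' r) / V r ^ 2 * φ t r ^ 2 := by positivity
    have good2 : 0 ≤ 2 * (r * V' r / V r - 1) * ((r / V r) ^ 2 * Y t r ^ 2) := by
      have : 1 ≤ r * V' r / V r := by
        rw [le_div_iff₀ hV, one_mul]; exact h.le_mul_deriv hr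
      have : 0 ≤ r * V' r / V r - 1 := by linarith
      positivity
    -- The bulk term of the energy identity, up to the factor r^n / r: the part estimated by
    -- `far_bulk_le` and two terms of good sign.
    obtain ⟨Q, hQ⟩ : ∃ Q, Q = 2 * ((n : ℝ) ^ 2 / 4 - m ^ 2 + κ + (-(m ^ 2 * (r ^ 2 / V r - 1)) +
      n / 2 * (r * V' r / V r - 2))) * φ t r * P - 2 * (r * V' r / V r - 2) * P ^ 2
      - lam * (r * V' r) / V r ^ 2 * φ t r ^ 2
      - 2 * (r * V' r / V r - 1) * ((r / V r) ^ 2 * Y t r ^ 2) := ⟨_, rfl⟩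
    have hQle : Q ≤ (2 * β + ((m ^ 2 * K + n / 2 * K) / √κ + 2 * K) / V r) *
        farDensity V n κ lam φ X Y t r := by
      rw [hQ]; linarith
    have hQ2 := mul_le_mul_of_nonneg_left hQle
      (by positivity : 0 ≤ weight ζ τ t r * (r ^ n / r))
    have hpow : (n : ℝ) * r ^ (n - 1) = n * (r ^ n / r) := by
      rcases n with _ | k
      · simp
      · rw [Nat.add_sub_cancel, pow_succ, mul_div_assoc, div_self hr0.ne', mul_one]
    have ident : n * (r ^ n / r) * farDensity V n κ lam φ X Y t r + r ^ n *
        (2 * P *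
          (1 * (1 / V r) * X t r + r * (-V' r / V r ^ 2) * X t r + r / V r *
          ((Yt t r - ((n : ℝ) - 1) * V r / r * X t r
        - V r * (lam / r ^ 2 + m ^ 2) * φ t r - V r * 0) / V r) + n / 2 * (X t r / V r)) +
        κ * (2 * φ t r * (X t r / V r)) + (lam * (-V' r / V r ^ 2) * φ t r ^ 2 +
          lam / V r * (2 * φ t r * (X t r / V r))) +
        (2 * (r / V r) * (1 * (1 / V r) + r * (-V' r / V r ^ 2)) * Y t r ^ 2 +
          (r / V r) ^ 2 * (2 * Y t r * (Xt t r / V r)))) =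
        r ^ n * (2 * r / V r ^ 2) * (Yt t r * P +
        Y t r * (r / V r * Xt t r + n / 2 * Y t r)) + r ^ n / r * Q := by
      rw [hQ, farDensity, ← hP, hX]
      have hVr : V r ≠ 0 := hV.ne'
      have hrr : r ≠ 0 := hr0.ne'
      generalize r ^ n = ρ
      field_simp
      ring
    simp only [← hP]
    rw [hpow, ident, weight]
    rw [weight] at hQ2
    have flux3 : r ^ n / V r * ((ζ' (t + τ r) * ζ (-t + τ r) + ζ (t + τ r) * ζ' (-t + τ r)) *
        farDensity V n κ lam φ X Y t r - (ζ' (t + τ r) * ζ (-t + τ r) -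
          ζ (t + τ r) * ζ' (-t + τ r)) * (2 * P * (r / V r * Y t r))) =
        (ζ' (t + τ r) * ζ (-t + τ r) + ζ (t + τ r) * ζ' (-t + τ r)) / V r *
        (r ^ n * farDensity V n κ lam φ X Y t r) -
        (ζ' (t + τ r) * ζ (-t + τ r) - ζ (t + τ r) * ζ' (-t + τ r)) *
        (r ^ n * (2 * r / V r ^ 2) * (Y t r * P)) := by
      field_simp
    rw [flux3] at flux2
    have e3 : ζ (t + τ r) * ζ (-t + τ r) * (r ^ n / r) *
        ((2 * β + ((m ^ 2 * K + n / 2 * K) / √κ + 2 * K) / V r) *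
        farDensity V n κ lam φ X Y t r) =
        (2 * β + ((m ^ 2 * K + n / 2 * K) / √κ + 2 * K) / V r) / r *
        (ζ (t + τ r) * ζ (-t + τ r) * (r ^ n * farDensity V n κ lam φ X Y t r)) := by ring
    rw [e3] at hQ2
    linarith

end

section

variable {V V' τ : ℝ → ℝ} {rc : ℝ}

theorem farDensity_nonneg {n : ℕ} {κ lam r : ℝ} {φ X Y : ℝ → ℝ → ℝ} (hκ : 0 ≤ κ) (hlam : 0 ≤ lam)
    (hV : 0 < V r) (t : ℝ) : 0 ≤ farDensity V n κ lam φ X Y t r := by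
  unfold farDensity; positivity

/-- Growth of the far energy. -/
theorem exists_far_growth (h : IsExpanding V V' rc) (ht : IsTortoise V τ rc) (n : ℕ)
    {m κ β r₁ : ℝ} (hκ : 0 < κ) (hβ : |(n : ℝ) ^ 2 / 4 - m ^ 2 + κ| ≤ 2 * β * √κ) (hr₁ : rc < r₁) :
    ∃ C, 0 ≤ C ∧ ∀ (lam : ℝ) (φ X Y Xt Yt : ℝ → ℝ → ℝ) (ζ ζ' : ℝ → ℝ) (c : ℝ), 0 ≤ lam →
    IsForcedWave V V' rc n m lam φ X Y Xt Yt (fun _ _ => 0) → IsCutoff ζ ζ' c → ∀ r, r₁ ≤ r →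
    ∫ t, weight ζ τ t r * (r ^ n * farDensity V n κ lam φ X Y t r) ≤
      C * r ^ (2 * β) * ∫ t, weight ζ τ t r₁ * farDensity V n κ lam φ X Y t r₁ := by
  obtain ⟨K, hK⟩ := h.asymp
  have hrc := h.rc_pos
  have hr₁0 := h.pos_of_lt hr₁
  have hd := h.deriv_pos
  have hK0 : 0 ≤ K := (abs_nonneg _).trans (hK rc le_rfl).1
  set K₂ := (m ^ 2 * K + n / 2 * K) / √κ + 2 * K with hK₂
  have hK₂0 : 0 ≤ K₂ := by positivity
  have hfr : 0 < 1 - rc / r₁ := by rw [sub_pos, div_lt_one hr₁0]; exact hr₁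
  -- The linear bound V ≥ V'(r_c) (1 - r_c/r₁) r for r ≥ r₁ already turns the error K₂ / (V r) into
  -- K₃ / r², which is integrable at infinity.
  set K₃ := K₂ / (V' rc * (1 - rc / r₁)) with hK₃
  have hK₃0 : 0 ≤ K₃ := by positivity
  refine ⟨r₁ ^ (-(2 * β)) * Real.exp (K₃ / r₁) * r₁ ^ n, by positivity, ?_⟩
  intro lam φ X Y Xt Yt ζ ζ' c hlam w hζ
  set E : ℝ → ℝ := fun r => ∫ t, weight ζ τ t r * (r ^ n * farDensity V n κ lam φ X Y t r) with hE
  have hE0 : ∀ r, rc < r → 0 ≤ E r := fun r hr => integral_nonneg fun t =>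
    mul_nonneg (weight_nonneg hζ t r) (mul_nonneg (pow_nonneg (h.pos_of_lt hr).le n)
      (farDensity_nonneg hκ.le hlam (h.pos hr) t))
  have hder : ∀ r, rc < r → ∃ E', HasDerivAt E E' r ∧ E' ≤ (2 * β + K₂ / V r) / r * E r :=
    fun r hr => w.far_deriv h ht hζ hlam hκ hβ hr (hK r hr.le).2 (hK r hr.le).1
  choose! E' hE' using hder
  -- Integrating factor: the power removes the main growth, and the derivative of the exponential
  -- compensates K₃ / r².
  set N : ℝ → ℝ := fun r => E r * (r ^ (-(2 * β)) * Real.exp (K₃ / r)) with hN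
  have hNd : ∀ r, rc < r → HasDerivAt N (E' r * (r ^ (-(2 * β)) * Real.exp (K₃ / r)) +
      E r * (-(2 * β) * r ^ (-(2 * β) - 1) * Real.exp (K₃ / r) +
        r ^ (-(2 * β)) * (Real.exp (K₃ / r) * (-K₃ / r ^ 2)))) r := by
    intro r hr
    have hr0 := h.pos_of_lt hr
    have h1 := Real.hasDerivAt_rpow_const (x := r) (p := -(2 * β)) (Or.inl hr0.ne')
    have h2 : HasDerivAt (fun r => K₃ / r) (-K₃ / r ^ 2) r := by
      have := hasDerivAt_const_div_pow K₃ 1 hr0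
      simpa using this
    exact (hE' r hr).1.mul (h1.mul h2.exp)
  have hsub : ∀ r, r ∈ Ici r₁ → rc < r := fun r hr => hr₁.trans_le hr
  have hanti : AntitoneOn N (Ici r₁) := by
    refine antitoneOn_of_hasDerivWithinAt_nonpos (convex_Ici r₁)
      (fun r hr => (hNd r (hsub r hr)).continuousAt.continuousWithinAt)
      (fun r hr => (hNd r (hsub r (interior_subset hr))).hasDerivWithinAt) fun r hr => ?_
    have hr := interior_subset hr
    have hr' := hsub r hr
    have hr0 := h.pos_of_lt hr'
    have hr1 : r₁ ≤ r := hr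
    have hV := h.pos hr'
    have hK₃V : K₂ / V r / r ≤ K₃ / r ^ 2 := by
      rw [hK₃, div_div, div_div]
      have hVr : V' rc * (1 - rc / r₁) * r ≤ V r := by
        refine le_trans ?_ (h.lower hr')
        have : rc ≤ rc / r₁ * r := by
          rw [div_mul_eq_mul_div, le_div_iff₀ hr₁0]
          gcongr
        nlinarith
      refine div_le_div_of_nonneg_left hK₂0 (by positivity) ?_
      nlinarith
    have hpow : r ^ (-(2 * β) - 1) = r ^ (-(2 * β)) / r := by
      rw [Real.rpow_sub_one hr0.ne']
    rw [hpow]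
    have hp : 0 ≤ r ^ (-(2 * β)) * Real.exp (K₃ / r) := by positivity
    have h1 : E' r ≤ (2 * β / r + K₃ / r ^ 2) * E r := by
      refine (hE' r hr').2.trans ?_
      rw [add_div]
      exact mul_le_mul_of_nonneg_right (by linarith) (hE0 r hr')
    have h2 := mul_le_mul_of_nonneg_right h1 hp
    have h3 : E r * (-(2 * β) * (r ^ (-(2 * β)) / r) * Real.exp (K₃ / r) +
        r ^ (-(2 * β)) * (Real.exp (K₃ / r) * (-K₃ / r ^ 2))) =
        -((2 * β / r + K₃ / r ^ 2) * E r * (r ^ (-(2 * β)) * Real.exp (K₃ / r))) := by ring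
    rw [h3]
    linarith
  intro r hr
  have hr' := hr₁.trans_le hr
  have hr0 := h.pos_of_lt hr'
  have h1 : N r ≤ N r₁ := hanti self_mem_Ici hr hr
  have h2 : E r * r ^ (-(2 * β)) ≤ N r := by
    simp only [hN]
    rw [← mul_assoc]
    refine le_mul_of_one_le_right (mul_nonneg (hE0 r hr') (by positivity)) ?_
    exact Real.one_le_exp (by positivity)
  have h3 : E r₁ = r₁ ^ n * ∫ t, weight ζ τ t r₁ * farDensity V n κ lam φ X Y t r₁ := by
    rw [hE, ← integral_const_mul]
    refine integral_congr_ae (ae_of_all _ fun t => ?_)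
    simp only
    ring
  have h4 : E r = E r * r ^ (-(2 * β)) * r ^ (2 * β) := by
    rw [mul_assoc, ← Real.rpow_add hr0, neg_add_cancel, Real.rpow_zero, mul_one]
  have h5 : E r * r ^ (-(2 * β)) * r ^ (2 * β) ≤ N r₁ * r ^ (2 * β) :=
    mul_le_mul_of_nonneg_right (h2.trans h1) (by positivity)
  change E r ≤ _
  rw [h4]
  refine h5.trans (le_of_eq ?_)
  simp only [hN]
  rw [h3]
  ring

/-! ### Decay of one mode, uniformly in the eigenvalue -/

/-- Passage from the near to the far energy at one radius, where φ is the remainder χ plus the two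
traces. The factors do not contain λ: (λ + 1) χ² is dominated by the zeroth-order part of
`nearDensity`, and λ + 1 ≤ 2 (λ² + 1) handles the traces. -/
theorem farDensity_le {n : ℕ} {m κ lam r : ℝ} {φ X Y : ℝ → ℝ → ℝ} {t x₀ x₁ y₀ y₁ χ X' Y' : ℝ}
    (hκ : 0 ≤ κ) (hlam : 0 ≤ lam) (hV : 0 < V r) (hr : 0 < r)
    (hφ : φ t r = χ + x₀ + y₀) (hX : X t r = X' + x₁ + y₁) (hY : Y t r = Y' + x₁ - y₁) :
    farDensity V n κ lam φ X Y t r ≤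
      (2 * (r / V r) ^ 2 + n ^ 2 / 2 + κ + 1 / V r) * (3 * (1 + (r ^ 2 + 1) / V r) *
        (X' ^ 2 + Y' ^ 2 + V r * (lam / r ^ 2 + m ^ 2 + 1) * χ ^ 2) +
        6 * ((lam ^ 2 + 1) * (x₀ ^ 2 + y₀ ^ 2) + x₁ ^ 2 + y₁ ^ 2)) := by
  set C := 2 * (r / V r) ^ 2 + (n : ℝ) ^ 2 / 2 + κ + 1 / V r with hC
  have c1 : 2 * (r / V r) ^ 2 ≤ C := by
    have : 0 ≤ (n : ℝ) ^ 2 / 2 + κ + 1 / V r := by positivity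
    linarith
  have c0 : 0 ≤ C := by positivity
  have h1 : farDensity V n κ lam φ X Y t r ≤ C * (X t r ^ 2 + Y t r ^ 2 + (lam + 1) * φ t r ^ 2) := by
    have e1 : (r / V r * X t r + n / 2 * φ t r) ^ 2 ≤
        2 * (r / V r) ^ 2 * X t r ^ 2 + (n : ℝ) ^ 2 / 2 * φ t r ^ 2 := by
      nlinarith [sq_nonneg (r / V r * X t r - n / 2 * φ t r)]
    have e2 := mul_le_mul_of_nonneg_right c1 (sq_nonneg (X t r))
    have e3 := mul_le_mul_of_nonneg_right c1 (sq_nonneg (Y t r))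
    have e4 : 0 ≤ (r / V r) ^ 2 * Y t r ^ 2 := by positivity
    have e5 : ((n : ℝ) ^ 2 / 2 + κ) * φ t r ^ 2 + lam / V r * φ t r ^ 2 ≤
        C * ((lam + 1) * φ t r ^ 2) := by
      have f1 : (n : ℝ) ^ 2 / 2 + κ + lam / V r ≤ C * (lam + 1) := by
        have g1 : 0 ≤ (2 * (r / V r) ^ 2 + (n : ℝ) ^ 2 / 2 + κ) * lam := by positivity
        have g2 : 0 ≤ 2 * (r / V r) ^ 2 := by positivity
        have g3 : lam / V r = 1 / V r * lam := by ring
        have g4 : 0 ≤ 1 / V r := by positivity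
        rw [g3, hC]
        linarith
      have := mul_le_mul_of_nonneg_right f1 (sq_nonneg (φ t r))
      linarith
    unfold farDensity
    linarith
  have three : ∀ a b c : ℝ, (a + b + c) ^ 2 ≤ 3 * (a ^ 2 + b ^ 2 + c ^ 2) := fun a b c => by
    nlinarith [sq_nonneg (a - b), sq_nonneg (b - c), sq_nonneg (a - c)]
  have h2 : X t r ^ 2 ≤ 3 * (X' ^ 2 + x₁ ^ 2 + y₁ ^ 2) := by rw [hX]; exact three _ _ _
  have h3 : Y t r ^ 2 ≤ 3 * (Y' ^ 2 + x₁ ^ 2 + y₁ ^ 2) := by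
    rw [hY, sub_eq_add_neg]
    simpa using three Y' x₁ (-y₁)
  have h4 : φ t r ^ 2 ≤ 3 * (χ ^ 2 + x₀ ^ 2 + y₀ ^ 2) := by rw [hφ]; exact three _ _ _
  have h5 : (lam + 1) * φ t r ^ 2 ≤ 3 * ((lam + 1) * χ ^ 2) +
      6 * ((lam ^ 2 + 1) * (x₀ ^ 2 + y₀ ^ 2)) := by
    have g1 := mul_le_mul_of_nonneg_left h4 (by linarith : 0 ≤ lam + 1)
    have g2 : lam + 1 ≤ 2 * (lam ^ 2 + 1) := by nlinarith [sq_nonneg (lam - 1)]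
    have g3 := mul_le_mul_of_nonneg_right g2 (by positivity : 0 ≤ x₀ ^ 2 + y₀ ^ 2)
    linarith
  have h6 : (lam + 1) * χ ^ 2 ≤
      (r ^ 2 + 1) / V r * (V r * (lam / r ^ 2 + m ^ 2 + 1) * χ ^ 2) := by
    have e : (r ^ 2 + 1) / V r * (V r * (lam / r ^ 2 + m ^ 2 + 1) * χ ^ 2) =
        (r ^ 2 + 1) * (lam / r ^ 2 + m ^ 2 + 1) * χ ^ 2 := by field_simp
    rw [e]
    have f : lam + 1 ≤ (r ^ 2 + 1) * (lam / r ^ 2 + m ^ 2 + 1) := by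
      have : r ^ 2 * (lam / r ^ 2) = lam := by field_simp
      have : 0 ≤ lam / r ^ 2 := by positivity
      have : 0 ≤ r ^ 2 * m ^ 2 := by positivity
      nlinarith [sq_nonneg m, sq_nonneg r]
    exact mul_le_mul_of_nonneg_right f (sq_nonneg χ)
  have h7 : 0 ≤ (r ^ 2 + 1) / V r * (X' ^ 2 + Y' ^ 2) := by positivity
  have h8 : 0 ≤ V r * (lam / r ^ 2 + m ^ 2 + 1) * χ ^ 2 := by positivity
  refine h1.trans (mul_le_mul_of_nonneg_left ?_ c0)
  linarith

/-- Uniform decay of the angular modes of a solution with data in `H²` on the horizon. -/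
theorem exists_mode_decay (h : IsExpanding V V' rc) (ht : IsTortoise V τ rc) {n : ℕ} (hn : 1 ≤ n)
    {m κ β r₁ : ℝ} (hκ : 0 < κ) (hβ : |(n : ℝ) ^ 2 / 4 - m ^ 2 + κ| ≤ 2 * β * √κ) (hr₁ : rc < r₁) :
    ∃ C, 0 ≤ C ∧ ∀ (lam : ℝ) (A At Ar Att Atr Arr a a' aρ b b' bρ : ℝ → ℝ → ℝ) (a'' b'' : ℝ → ℝ),
    0 ≤ lam → IsScalarWave V V' rc n m lam A At Ar Att Atr Arr →
    IsBranch τ rc 1 A a a' aρ a'' → IsBranch τ rc (-1) A b b' bρ b'' → ∀ r, r₁ ≤ r → ∀ T,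
    ∫ t in Icc (-T) T, A t r ^ 2 ≤ C * r ^ (2 * β - n) *
      dataNorm lam (fun u => a u 0) (fun u => a' u 0) (fun u => b u 0) (fun u => b' u 0) := by
  have hn' : (1 : ℝ) ≤ n := by exact_mod_cast hn
  obtain ⟨C₁, hC₁, near⟩ := exists_near_bound h ht hn' m hr₁
  obtain ⟨C₂, hC₂, far⟩ := exists_far_growth h ht n hκ hβ hr₁
  have hV₁ := h.pos hr₁
  have hr₁0 := h.pos_of_lt hr₁
  set C₃ := 2 * (r₁ / V r₁) ^ 2 + (n : ℝ) ^ 2 / 2 + κ + 1 / V r₁ with hC₃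
  set C₄ := 3 * (1 + (r₁ ^ 2 + 1) / V r₁) with hC₄
  refine ⟨κ⁻¹ * (C₂ * (C₃ * (C₄ * C₁ + 6))), by positivity, ?_⟩
  intro lam A At Ar Att Atr Arr a a' aρ b b' bρ a'' b'' hlam hw ha hb r hr T
  -- Both u and v are at most T + |τ r| when |t| ≤ T, so the weight is 1 on the interval of
  -- interest. The two energy bounds do not see the cutoff, hence the result is uniform in T.
  obtain ⟨ζ, ζ', hζ⟩ := exists_isCutoff (T + |τ r|)
  set c := T + |τ r| with hc
  have near := near lam A At Ar Att Atr Arr a a' aρ b b' bρ a'' b'' ζ ζ' c hlam hw ha hb hζ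
  have w := hw.isForcedWave h
  have far := far lam _ _ _ _ _ ζ ζ' c hlam w hζ r hr
  set D := dataNorm lam (fun u => a u 0) (fun u => a' u 0) (fun u => b u 0) (fun u => b' u 0) with hD
  have hD0 : 0 ≤ D := dataNorm_nonneg _ _ _ _ _
  have hr' := hr₁.trans_le hr
  have hr0 := h.pos_of_lt hr'
  have hV := h.pos hr'
  obtain ⟨hi, hi'⟩ := integral_data (lam := lam) ha.int₀ ha.int₁ hb.int₀ hb.int₁ (τ r₁)
  set den := fun t => nearDensity V m lam
      (fun t r => A t r - a (t + τ r) 0 - b (-t + τ r) 0)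
      (fun t r => V r * Ar t r - a' (t + τ r) 0 - b' (-t + τ r) 0)
      (fun t r => At t r - a' (t + τ r) 0 + b' (-t + τ r) 0) t r₁ with hden
  have hcs : Continuous fun t : ℝ => (t, r₁) := by fun_prop
  have hcompact : ∀ {F : ℝ → ℝ} {s : ℝ}, rc < s → Continuous F →
      Integrable (fun t => weight ζ τ t s * F t) := by
    intro F s hs hF
    have cw : Continuous (fun t => weight ζ τ t s) :=
      (continuousOn_weight hζ ht).comp_continuous (by fun_prop : Continuous fun t : ℝ => (t, s))
        fun t => hs
    refine (cw.mul hF).integrable_of_hasCompactSupport ?_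
    refine HasCompactSupport.intro (K := Icc (-(c + 1 - τ s)) (c + 1 - τ s)) isCompact_Icc ?_
    intro t ht'
    have : c + 1 - τ s < |t| := by
      by_contra! h
      exact ht' (abs_le.1 h)
    show weight ζ τ t s * F t = 0
    rw [weight_eq_zero hζ this, zero_mul]
  have cA : ∀ s, rc < s → Continuous fun t => A t s := fun s hs =>
    w.cont_χ.comp_continuous (by fun_prop : Continuous fun t : ℝ => (t, s)) fun t => hs
  have cX : Continuous fun t => V r₁ * Ar t r₁ := w.cont_X.comp_continuous hcs fun t => hr₁
  have cY : Continuous fun t => At t r₁ := w.cont_Y.comp_continuous hcs fun t => hr₁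
  have ca : ∀ {F F₁ F₂ : ℝ → ℝ → ℝ}, HasPartials F F₁ F₂ univ → Continuous (fun u => F u 0) ∧
      Continuous (fun u => F₁ u 0) := fun hF =>
    ⟨(continuousOn_univ.1 hF.cont).comp (by fun_prop : Continuous fun u : ℝ => (u, (0 : ℝ))),
      (continuousOn_univ.1 hF.cont_fst).comp (by fun_prop : Continuous fun u : ℝ => (u, (0 : ℝ)))⟩
  have cu : Continuous fun t : ℝ => t + τ r₁ := by fun_prop
  have cv : Continuous fun t : ℝ => -t + τ r₁ := by fun_prop
  have cden : Continuous den := by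
    have q1 := (ca ha.partials).1.comp cu
    have q2 := (ca ha.partials).2.comp cu
    have q3 := (ca hb.partials).1.comp cv
    have q4 := (ca hb.partials).2.comp cv
    exact ((((cX.sub q2).sub q4).pow 2).add (((cY.sub q2).add q4).pow 2)).add
      (continuous_const.mul ((((cA r₁ hr₁).sub q1).sub q3).pow 2))
  have iden : Integrable (fun t => weight ζ τ t r₁ * den t) := hcompact hr₁ cden
  have cfar : ∀ s, rc < s → Continuous fun t => farDensity V n κ lam A
      (fun t r => V r * Ar t r) At t s := by
    intro s hs
    have hcs : Continuous fun t : ℝ => (t, s) := by fun_prop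
    have cX : Continuous fun t => V s * Ar t s := w.cont_X.comp_continuous hcs fun t => hs
    have cY : Continuous fun t => At t s := w.cont_Y.comp_continuous hcs fun t => hs
    have cA := cA s hs
    unfold farDensity
    fun_prop
  -- the energy at `r₁`
  have hstart : ∫ t, weight ζ τ t r₁ * farDensity V n κ lam A (fun t r => V r * Ar t r) At t r₁ ≤
      C₃ * (C₄ * C₁ + 6) * D := by
    have hle : ∀ t, weight ζ τ t r₁ * farDensity V n κ lam A (fun t r => V r * Ar t r) At t r₁ ≤
        C₃ * C₄ * (weight ζ τ t r₁ * den t) + C₃ * 6 * ((lam ^ 2 + 1) * (a (t + τ r₁) 0 ^ 2 +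
          b (-t + τ r₁) 0 ^ 2) + a' (t + τ r₁) 0 ^ 2 + b' (-t + τ r₁) 0 ^ 2) := by
      intro t
      have := farDensity_le (V := V) (n := n) (m := m) (κ := κ) (lam := lam) (r := r₁) (φ := A)
        (X := fun t r => V r * Ar t r) (Y := At) (t := t) (x₀ := a (t + τ r₁) 0)
        (x₁ := a' (t + τ r₁) 0) (y₀ := b (-t + τ r₁) 0) (y₁ := b' (-t + τ r₁) 0)
        (χ := A t r₁ - a (t + τ r₁) 0 - b (-t + τ r₁) 0)
        (X' := V r₁ * Ar t r₁ - a' (t + τ r₁) 0 - b' (-t + τ r₁) 0)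
        (Y' := At t r₁ - a' (t + τ r₁) 0 + b' (-t + τ r₁) 0)
        hκ.le hlam hV₁ hr₁0 (by ring) (by ring) (by ring)
      have h2 := mul_le_mul_of_nonneg_left this (weight_nonneg (τ := τ) hζ t r₁)
      have h3 := weight_le_one (τ := τ) hζ t r₁
      have h4 : 0 ≤ C₃ * 6 * ((lam ^ 2 + 1) * (a (t + τ r₁) 0 ^ 2 +
          b (-t + τ r₁) 0 ^ 2) + a' (t + τ r₁) 0 ^ 2 + b' (-t + τ r₁) 0 ^ 2) := by positivity
      have h5 := mul_le_mul_of_nonneg_right h3 h4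
      have e : den t = (V r₁ * Ar t r₁ - a' (t + τ r₁) 0 - b' (-t + τ r₁) 0) ^ 2 +
        (At t r₁ - a' (t + τ r₁) 0 + b' (-t + τ r₁) 0) ^ 2 +
        V r₁ * (lam / r₁ ^ 2 + m ^ 2 + 1) * (A t r₁ - a (t + τ r₁) 0 - b (-t + τ r₁) 0) ^ 2 := rfl
      rw [← e, ← hC₃, ← hC₄] at h2
      linarith
    have i3 := (iden.const_mul (C₃ * C₄)).add (hi.const_mul (C₃ * 6))
    have := integral_mono (hcompact hr₁ (cfar r₁ hr₁)) i3 hle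
    refine this.trans ?_
    have e1 := integral_add (iden.const_mul (C₃ * C₄)) (hi.const_mul (C₃ * 6))
    simp only [Pi.add_apply] at e1 ⊢
    rw [e1, integral_const_mul, integral_const_mul, hi']
    have := mul_le_mul_of_nonneg_left near (by positivity : 0 ≤ C₃ * C₄)
    linarith
  have hfinal : ∫ t in Icc (-T) T, A t r ^ 2 ≤ κ⁻¹ * (r ^ n)⁻¹ *
      ∫ t, weight ζ τ t r * (r ^ n * farDensity V n κ lam A (fun t r => V r * Ar t r) At t r) := by
    rw [← integral_indicator measurableSet_Icc, ← integral_const_mul]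
    refine integral_mono_of_nonneg (ae_of_all _ fun t => indicator_nonneg
      (fun _ _ => sq_nonneg _) _) ((hcompact hr' (by
        have := cfar r hr'; fun_prop)).const_mul _) (ae_of_all _ fun t => ?_)
    have hrn : 0 < r ^ n := by positivity
    have f0 := farDensity_nonneg (n := n) (φ := A) (X := fun t r => V r * Ar t r) (Y := At)
      hκ.le hlam hV t
    by_cases htT : t ∈ Icc (-T) T
    · rw [indicator_of_mem htT]
      have h1 : weight ζ τ t r = 1 := by
        have := le_abs_self (τ r)
        rw [weight, hζ.one _ (by linarith [htT.2]), hζ.one _ (by linarith [htT.1]), one_mul]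
      simp only
      rw [h1, one_mul]
      have h2 : κ * A t r ^ 2 ≤ farDensity V n κ lam A (fun t r => V r * Ar t r) At t r := by
        unfold farDensity
        have : 0 ≤ (r / V r * (V r * Ar t r) + n / 2 * A t r) ^ 2 := sq_nonneg _
        have : 0 ≤ lam / V r * A t r ^ 2 := by positivity
        have : 0 ≤ (r / V r) ^ 2 * At t r ^ 2 := by positivity
        linarith
      have e : κ⁻¹ * (r ^ n)⁻¹ * (r ^ n * farDensity V n κ lam A (fun t r => V r * Ar t r) At t r)
        = κ⁻¹ * farDensity V n κ lam A (fun t r => V r * Ar t r) At t r := by field_simp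
      rw [e, inv_mul_eq_div, le_div_iff₀ hκ]
      linarith
    · rw [indicator_of_notMem htT]
      have := weight_nonneg (τ := τ) hζ t r
      positivity
  refine hfinal.trans ?_
  have hrp : r ^ (2 * β - n) = r ^ (2 * β) * (r ^ n)⁻¹ := by
    rw [Real.rpow_sub hr0, Real.rpow_natCast, div_eq_mul_inv]
  rw [hrp]
  have h1 := far.trans (mul_le_mul_of_nonneg_left hstart
    (mul_nonneg hC₂ (Real.rpow_nonneg hr0.le (2 * β))))
  have h2 := mul_le_mul_of_nonneg_left h1 (by positivity : 0 ≤ κ⁻¹ * (r ^ n)⁻¹)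
  refine h2.trans (le_of_eq ?_)
  ring

end

/-! ### Rotation fields and integration over the sphere -/

/-- The rotation field `x^a ∂_b - x^b ∂_a`. -/
noncomputable def rotField {n : ℕ} (a b : Fin n) (x : E n) : E n :=
  EuclideanSpace.single b (x a) - EuclideanSpace.single a (x b)

/-- The derivative along a rotation field. -/
noncomputable def rot {n : ℕ} (a b : Fin n) (h : E n → ℝ) (x : E n) : ℝ :=
  fderiv ℝ h x (rotField a b x)

lemma rotField_smul {n : ℕ} (a b : Fin n) (c : ℝ) (x : E n) :
    rotField a b (c • x) = c • rotField a b x := by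
  ext i
  simp [rotField, mul_sub]

lemma rotField_eq_sum {n : ℕ} (a b : Fin n) (x : E n) :
    rotField a b x = x a • EuclideanSpace.single b 1 - x b • EuclideanSpace.single a 1 := by
  ext i
  simp [rotField]

lemma inner_rotField {n : ℕ} (a b : Fin n) (x : E n) : inner ℝ x (rotField a b x) = 0 := by
  simp [rotField, inner_sub_right, EuclideanSpace.inner_single_right]
  ring

lemma continuous_rotField {n : ℕ} (a b : Fin n) : Continuous (rotField a b : E n → E n) := by
  simp only [funext (rotField_eq_sum a b)]
  fun_prop

lemma contDiff_rotField {n : ℕ} (a b : Fin n) {k : WithTop ℕ∞} :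
    ContDiff ℝ k (rotField a b : E n → E n) := by
  simp only [funext (rotField_eq_sum a b)]
  fun_prop

/-- The radial projection onto the unit sphere. -/
noncomputable def radial {n : ℕ} (x : E n) : E n := ‖x‖⁻¹ • x

lemma radial_mem {n : ℕ} {x : E n} (hx : x ≠ 0) : radial x ∈ Metric.sphere (0 : E n) 1 := by
  simp [radial, norm_smul, hx]

lemma contDiffAt_radial {n : ℕ} {x : E n} (hx : x ≠ 0) {k : WithTop ℕ∞} :
    ContDiffAt ℝ k (radial : E n → E n) x :=
  ((contDiffAt_norm ℝ hx).inv (norm_ne_zero_iff.2 hx)).smul contDiffAt_id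

lemma hasFDerivAt_norm_rotField {n : ℕ} (a b : Fin n) {x : E n} (hx : x ≠ 0) :
    fderiv ℝ (fun y : E n => ‖y‖) x (rotField a b x) = 0 := by
  have h1 : DifferentiableAt ℝ (fun y : E n => ‖y‖) x :=
    (contDiffAt_norm ℝ hx (n := 1)).differentiableAt (by norm_num)
  have h2 := (h1.hasFDerivAt.mul h1.hasFDerivAt)
  have h3 : HasFDerivAt (fun y : E n => ‖y‖ * ‖y‖) (2 • (innerSL ℝ x)) x := by
    have := (hasStrictFDerivAt_norm_sq x).hasFDerivAt
    simpa only [sq] using this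
  have h4 := congrArg (fun L => L (rotField a b x)) (h2.unique h3)
  simp [inner_rotField] at h4
  have : 0 < ‖x‖ := norm_pos_iff.2 hx
  rcases h4 with h | h
  · exact absurd h hx
  · exact h

lemma fderiv_radial_rotField {n : ℕ} (a b : Fin n) {x : E n} (hx : x ≠ 0) :
    fderiv ℝ (radial : E n → E n) x (rotField a b x) = rotField a b (radial x) := by
  have h1 : DifferentiableAt ℝ (fun y : E n => ‖y‖⁻¹) x :=
    ((contDiffAt_norm ℝ hx (n := 1)).inv (norm_ne_zero_iff.2 hx)).differentiableAt (by norm_num)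
  have hd : DifferentiableAt ℝ (fun y : E n => ‖y‖) x :=
    (contDiffAt_norm ℝ hx (n := 1)).differentiableAt (by norm_num)
  have h0 : fderiv ℝ (fun y : E n => ‖y‖⁻¹) x (rotField a b x) = 0 := by
    have := ((hasDerivAt_inv (norm_ne_zero_iff.2 hx)).comp_hasFDerivAt x hd.hasFDerivAt).fderiv
    rw [show (fun y : E n => ‖y‖⁻¹) = Inv.inv ∘ fun y : E n => ‖y‖ from rfl, this]
    simp [hasFDerivAt_norm_rotField a b hx]
  have h2 := (h1.hasFDerivAt.smul (hasFDerivAt_id x)).fderiv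
  have : (radial : E n → E n) = (fun y : E n => ‖y‖⁻¹) • id := rfl
  rw [this, h2]
  simp [h0, rotField_smul]

lemma rot_comp_radial {n : ℕ} (a b : Fin n) {h : E n → ℝ} {x : E n} (hx : x ≠ 0)
    (hh : DifferentiableAt ℝ h (radial x)) :
    rot a b (fun y => h (radial y)) x = rot a b h (radial x) := by
  have h1 := (hh.hasFDerivAt.comp x ((contDiffAt_radial hx (k := 1)).differentiableAt
    (by norm_num)).hasFDerivAt).fderiv
  unfold rot
  rw [show (fun y => h (radial y)) = h ∘ radial from rfl, h1]
  simp [fderiv_radial_rotField a b hx]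

/-- The surface measure of the unit sphere. -/
noncomputable abbrev sphereMeasure (n : ℕ) : Measure (S n) := (volume : Measure (E n)).toSphere

/-- Rotation fields are divergence free: integration by parts of x_a ∂_b g leaves -δ_{ab} ∫ g, which
is symmetric in a and b and cancels. -/
lemma integral_rot_of_hasCompactSupport {n : ℕ} (a b : Fin n) {g : E n → ℝ}
    (hg : ContDiff ℝ 1 g) (hc : HasCompactSupport g) : ∫ x, rot a b g x = 0 := by
  have hd : Continuous (fderiv ℝ g) := hg.continuous_fderiv (by norm_num)
  have hcd : ∀ v : E n, HasCompactSupport fun x => fderiv ℝ g x v := fun v => hc.fderiv_apply ℝ v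
  have key : ∀ a b : Fin n, Integrable (fun x : E n => x a * fderiv ℝ g x
      (EuclideanSpace.single b 1)) ∧ ∫ x : E n, x a * fderiv ℝ g x (EuclideanSpace.single b 1) =
      -∫ x : E n, (EuclideanSpace.single b (1 : ℝ) : E n) a * g x := by
    intro a b
    have i1 : Integrable (fun x : E n => x a * fderiv ℝ g x (EuclideanSpace.single b 1)) :=
      Continuous.integrable_of_hasCompactSupport (by fun_prop) (hcd _).mul_left
    have i2 : Integrable (fun x : E n => (EuclideanSpace.single b (1 : ℝ) : E n) a * g x) :=
      (hg.continuous.integrable_of_hasCompactSupport hc).const_mul _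
    have i3 : Integrable (fun x : E n => x a * g x) :=
      Continuous.integrable_of_hasCompactSupport
        ((by fun_prop : Continuous fun x : E n => x a).mul hg.continuous) hc.mul_left
    refine ⟨i1, ?_⟩
    exact integral_bilinear_hasLineDerivAt_right_eq_neg_left_of_integrable
      (B := ContinuousLinearMap.mul ℝ ℝ) (f := fun x : E n => x a)
      (f' := fun _ => (EuclideanSpace.single b (1 : ℝ) : E n) a) (g := g)
      (g' := fun x => fderiv ℝ g x (EuclideanSpace.single b 1))
      (v := EuclideanSpace.single b 1) i2 i1 i3
      (fun x _ => ((EuclideanSpace.proj a : E n →L[ℝ] ℝ).hasFDerivAt (x := x)).hasLineDerivAt _)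
      (fun x _ => ((hg.differentiable (by norm_num)) x).hasFDerivAt.hasLineDerivAt _)
  have e : (fun x => rot a b g x) = fun x : E n =>
      x a * fderiv ℝ g x (EuclideanSpace.single b 1) -
        x b * fderiv ℝ g x (EuclideanSpace.single a 1) := by
    ext x
    simp [rot, rotField_eq_sum]
  rw [e, integral_sub (key a b).1 (key b a).1, (key a b).2, (key b a).2]
  by_cases hab : a = b
  · subst hab; ring
  · simp [hab, Ne.symm hab]

lemma integral_polar {n : ℕ} (f : S n → ℝ) (χ : ℝ → ℝ) (hn : 0 < n) :
    ∫ x : E n, χ ‖x‖ * (open Classical in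
      if h : radial x ∈ Metric.sphere (0 : E n) 1 then f ⟨radial x, h⟩ else 0) =
    (∫ w, f w ∂(sphereMeasure n)) *
      ∫ s : Ioi (0 : ℝ), χ s ∂(Measure.volumeIoiPow (n - 1)) := by
  have : Nonempty (Fin n) := ⟨⟨0, hn⟩⟩
  have hmp := (volume : Measure (E n)).measurePreserving_homeomorphUnitSphereProd
  have hme := (homeomorphUnitSphereProd (E n)).measurableEmbedding
  have h1 := hmp.integral_comp hme (fun z : S n × Ioi (0 : ℝ) => f z.1 * χ z.2)
  rw [integral_prod_mul f (fun s : Ioi (0 : ℝ) => χ s), finrank_euclideanSpace_fin] at h1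
  rw [← h1]
  have h2 : ∀ F : E n → ℝ, ∫ x, F x = ∫ x : ({0}ᶜ : Set (E n)), F x.1 ∂(volume.comap Subtype.val) := by
    intro F
    rw [integral_subtype_comap (measurableSet_singleton _).compl, restrict_compl_singleton]
  rw [h2]
  refine integral_congr_ae (ae_of_all _ fun x => ?_)
  have hx : (x : E n) ≠ 0 := x.2
  have hr := radial_mem hx
  simp only [dif_pos hr]
  have a1 : (homeomorphUnitSphereProd (E n) x).1 = ⟨radial (x : E n), hr⟩ :=
    Subtype.ext (homeomorphUnitSphereProd_apply_fst_coe (E n) x)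
  have a2 : ((homeomorphUnitSphereProd (E n) x).2 : ℝ) = ‖(x : E n)‖ :=
    homeomorphUnitSphereProd_apply_snd_coe (E n) x
  rw [mul_comm, a1, a2]

/-- The integral of a derivative along a rotation field over the sphere vanishes. -/
theorem integral_sphere_rot {n : ℕ} (a b : Fin n) {h : E n → ℝ} {U : Set (E n)} (hU : IsOpen U)
    (hSU : Metric.sphere (0 : E n) 1 ⊆ U) (hh : ContDiffOn ℝ 1 h U) :
    ∫ w : S n, rot a b h w ∂(sphereMeasure n) = 0 := by
  have hn : 0 < n := a.pos
  have : Nonempty (Fin n) := ⟨a⟩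
  -- A radial cutoff supported in 1 ≤ ‖x‖ ≤ 3 reduces the claim to compactly supported functions on
  -- ℝⁿ. Rotations do not differentiate it, so it factors out in polar coordinates.
  let χ : ContDiffBump (2 : ℝ) := ⟨1 / 2, 1, by norm_num, by norm_num⟩
  have hχ0 : ∀ x : E n, ‖x‖ ≤ 1 ∨ 3 ≤ ‖x‖ → χ ‖x‖ = 0 := by
    intro x hx
    apply χ.zero_of_le_dist
    rw [Real.dist_eq]
    change 1 ≤ _
    rcases hx with hx | hx
    · rw [abs_sub_comm]; exact le_trans (by linarith) (le_abs_self _)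
    · exact le_trans (by linarith) (le_abs_self _)
  have hχd : ∀ x : E n, x ≠ 0 → ContDiffAt ℝ 1 (fun y : E n => χ ‖y‖) x := fun x hx =>
    χ.contDiff.contDiffAt.comp x (contDiffAt_norm ℝ hx)
  have hhd : ∀ x : E n, x ≠ 0 → ContDiffAt ℝ 1 h (radial x) := fun x hx =>
    hh.contDiffAt (hU.mem_nhds (hSU (radial_mem hx)))
  have hgz : (fun x : E n => χ ‖x‖ * h (radial x)) =ᶠ[𝓝 0] 0 := by
    filter_upwards [Metric.ball_mem_nhds (0 : E n) one_pos] with x hx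
    rw [mem_ball_zero_iff] at hx
    simp [hχ0 x (Or.inl hx.le)]
  have hg : ContDiff ℝ 1 fun x : E n => χ ‖x‖ * h (radial x) := by
    rw [contDiff_iff_contDiffAt]
    intro x
    by_cases hx : x = 0
    · subst hx
      exact contDiffAt_const.congr_of_eventuallyEq hgz
    · exact (hχd x hx).mul ((hhd x hx).comp x (contDiffAt_radial hx))
  have hc : HasCompactSupport fun x : E n => χ ‖x‖ * h (radial x) := by
    refine HasCompactSupport.intro (isCompact_closedBall (0 : E n) 3) fun x hx => ?_
    rw [mem_closedBall_zero_iff, not_le] at hx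
    simp [hχ0 x (Or.inr hx.le)]
  have h0 := integral_rot_of_hasCompactSupport a b hg hc
  have e1 : ∀ x : E n, rot a b (fun x : E n => χ ‖x‖ * h (radial x)) x = χ ‖x‖ *
      (open Classical in if hx : radial x ∈ Metric.sphere (0 : E n) 1 then
        (fun w : S n => rot a b h w) ⟨radial x, hx⟩ else 0) := by
    intro x
    by_cases hx : x = 0
    · subst hx
      rw [hχ0 0 (by simp)]
      simp only [rot, hgz.fderiv_eq]
      simp
    · rw [dif_pos (radial_mem hx)]
      simp only
      rw [← rot_comp_radial a b hx ((hhd x hx).differentiableAt (by norm_num))]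
      unfold rot
      have d1 : DifferentiableAt ℝ (fun y : E n => ‖y‖) x :=
        (contDiffAt_norm ℝ hx (n := 1)).differentiableAt (by norm_num)
      have d2 := ((χ.contDiff (n := 1)).differentiable (by norm_num) ‖x‖).hasDerivAt.comp_hasFDerivAt
        x d1.hasFDerivAt
      have d3 : DifferentiableAt ℝ (fun y => h (radial y)) x :=
        ((hhd x hx).comp x (contDiffAt_radial hx)).differentiableAt (by norm_num)
      have d4 := (d2.mul d3.hasFDerivAt).fderiv
      rw [show (fun x : E n => χ ‖x‖ * h (radial x)) =
        (⇑χ ∘ fun y : E n => ‖y‖) * fun y => h (radial y) from rfl, d4]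
      simp [hasFDerivAt_norm_rotField a b hx]
  simp only [e1] at h0
  rw [integral_polar (fun w : S n => rot a b h w) χ hn] at h0
  refine (mul_eq_zero.1 h0).resolve_right ?_
  -- If the radial factor were zero, so would be the integral of the nonnegative, nonzero cutoff
  -- over ℝⁿ.
  have h1 := integral_polar (n := n) (fun _ => (1 : ℝ)) χ hn
  intro hz
  rw [hz, mul_zero] at h1
  have e2 : ∀ᵐ x : E n, χ ‖x‖ * (open Classical in
      if hx : radial x ∈ Metric.sphere (0 : E n) 1 then (1 : ℝ) else 0) = χ ‖x‖ := by
    have : ∀ᵐ x : E n, x ≠ 0 := by simp [ae_iff]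
    filter_upwards [this] with x hx
    rw [dif_pos (radial_mem hx), mul_one]
  rw [integral_congr_ae e2] at h1
  have hcont : Continuous fun x : E n => χ ‖x‖ := χ.continuous.comp continuous_norm
  have hcs : HasCompactSupport fun x : E n => χ ‖x‖ := by
    refine HasCompactSupport.intro (isCompact_closedBall (0 : E n) 3) fun x hx => ?_
    rw [mem_closedBall_zero_iff, not_le] at hx
    simp [hχ0 x (Or.inr hx.le)]
  have hpos := hcont.integral_pos_of_hasCompactSupport_nonneg_nonzero (μ := volume) hcs
    (fun x => χ.nonneg) (x := EuclideanSpace.single a (2 : ℝ)) (by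
      have : ‖(EuclideanSpace.single a (2 : ℝ) : E n)‖ = 2 := by simp
      simp only [this]
      rw [χ.one_of_mem_closedBall (Metric.mem_closedBall_self χ.rIn_pos.le)]
      norm_num)
  exact hpos.ne' h1

end RNdS

namespace RNdS

open Set Filter Topology MvPolynomial

/-! ### Spherical harmonics from restrictions of polynomials -/

/-- Polynomials of degree less than `d`. -/
noncomputable def polyLT (n d : ℕ) : Submodule ℝ (MvPolynomial (Fin n) ℝ) :=
  restrictSupport ℝ {α : Fin n →₀ ℕ | α.degree < d}

lemma monomial_mem_polyLT {n d : ℕ} {α : Fin n →₀ ℕ} (h : α.degree < d) :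
    monomial α (1 : ℝ) ∈ polyLT n d :=
  (monomial_mem_restrictSupport ℝ).2 (Or.inl h)

lemma polyLT_le_of_monomial {n d : ℕ} {P : Submodule ℝ (MvPolynomial (Fin n) ℝ)}
    (h : ∀ α : Fin n →₀ ℕ, α.degree < d → monomial α (1 : ℝ) ∈ P) : polyLT n d ≤ P := by
  rw [polyLT, restrictSupport_eq_span, Submodule.span_le]
  rintro _ ⟨α, hα, rfl⟩
  exact h α hα

lemma polyLT_mono {n : ℕ} {d d' : ℕ} (h : d ≤ d') : polyLT n d ≤ polyLT n d' :=
  restrictSupport_mono ℝ fun _ hα => lt_of_lt_of_le hα h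

instance (n d : ℕ) : Module.Finite ℝ (polyLT n d) := by
  have : Finite {α : Fin n →₀ ℕ | α.degree < d} := (Finsupp.finite_of_degree_lt d).to_subtype
  exact Module.Finite.of_basis (basisRestrictSupport ℝ _)

lemma exists_mem_polyLT {n : ℕ} (p : MvPolynomial (Fin n) ℝ) : ∃ d, p ∈ polyLT n d := by
  refine ⟨p.support.sup (fun α => α.degree) + 1, ?_⟩
  rw [polyLT, mem_restrictSupport_iff]
  intro α hα
  exact Nat.lt_succ_of_le (Finset.le_sup (f := fun α : Fin n →₀ ℕ => α.degree) hα)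

lemma X_mul_mem_polyLT {n d : ℕ} (i : Fin n) {p : MvPolynomial (Fin n) ℝ} (hp : p ∈ polyLT n d) :
    X i * p ∈ polyLT n (d + 1) := by
  have : polyLT n d ≤ (polyLT n (d + 1)).comap (LinearMap.mulLeft ℝ (X i)) := by
    refine polyLT_le_of_monomial fun α hα => ?_
    simp only [Submodule.mem_comap, LinearMap.mulLeft_apply, X, monomial_mul, one_mul]
    refine monomial_mem_polyLT ?_
    simp; omega
  exact this hp

lemma pderiv_mem_polyLT {n d : ℕ} (i : Fin n) {p : MvPolynomial (Fin n) ℝ}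
    (hp : p ∈ polyLT n (d + 1)) : pderiv i p ∈ polyLT n d := by
  have : polyLT n (d + 1) ≤ (polyLT n d).comap (pderiv i : Derivation ℝ _ _).toLinearMap := by
    refine polyLT_le_of_monomial fun α hα => ?_
    simp only [Submodule.mem_comap]
    change pderiv i (monomial α 1) ∈ _
    rw [pderiv_monomial]
    by_cases h : α i = 0
    · simp [h]
    · have e : (monomial (α - Finsupp.single i 1) (1 * (α i : ℝ))) =
          (α i : ℝ) • monomial (α - Finsupp.single i 1) (1 : ℝ) := by simp [smul_monomial]
      rw [e]
      refine Submodule.smul_mem _ _ (monomial_mem_polyLT ?_)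
      have h1 : α = (α - Finsupp.single i 1) + Finsupp.single i 1 := by
        ext j
        by_cases hj : j = i
        · subst hj; simp; omega
        · simp [Finsupp.single_eq_of_ne hj]
      have h2 := congrArg Finsupp.degree h1
      rw [map_add, Finsupp.degree_single] at h2
      omega
  exact this hp

/-- The rotation derivation `X_a ∂_b - X_b ∂_a`. -/
noncomputable def rotD {n : ℕ} (a b : Fin n) :
    MvPolynomial (Fin n) ℝ →ₗ[ℝ] MvPolynomial (Fin n) ℝ :=
  LinearMap.mulLeft ℝ (X a) ∘ₗ (pderiv b : Derivation ℝ _ _).toLinearMap -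
    LinearMap.mulLeft ℝ (X b) ∘ₗ (pderiv a : Derivation ℝ _ _).toLinearMap

lemma rotD_apply {n : ℕ} (a b : Fin n) (p : MvPolynomial (Fin n) ℝ) :
    rotD a b p = X a * pderiv b p - X b * pderiv a p := rfl

lemma rotD_mem_polyLT {n d : ℕ} (a b : Fin n) {p : MvPolynomial (Fin n) ℝ}
    (hp : p ∈ polyLT n d) : rotD a b p ∈ polyLT n d := by
  rcases d with _ | d
  · have : p = 0 := by
      have : polyLT n 0 ≤ ⊥ := polyLT_le_of_monomial fun α hα => absurd hα (by simp)
      simpa using this hp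
    simp [this]
  · rw [rotD_apply]
    exact Submodule.sub_mem _ (X_mul_mem_polyLT a (pderiv_mem_polyLT b hp))
      (X_mul_mem_polyLT b (pderiv_mem_polyLT a hp))

/-- With the Euler operator 𝓔 this is twice |x|² Δ - 𝓔 (𝓔 + n - 2); the factor 2 appears because the
sum runs over ordered pairs. -/
lemma sum_rotD_rotD {n : ℕ} (p : MvPolynomial (Fin n) ℝ) :
    ∑ a, ∑ b, rotD a b (rotD a b p) =
      (2 : ℝ) • ((∑ a, X a ^ 2) * ∑ b, pderiv b (pderiv b p))
        + (2 - 2 * n : ℝ) • ∑ a, X a * pderiv a p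
        - (2 : ℝ) • ∑ a, ∑ b, X a * X b * pderiv a (pderiv b p) := by
  have comm : ∀ a b : Fin n, pderiv b (pderiv a p) = pderiv a (pderiv b p) := by
    intro a b
    have := congrArg (fun D : Derivation ℝ _ _ => D p)
      (show ⁅(pderiv a : Derivation ℝ (MvPolynomial (Fin n) ℝ) _), pderiv b⁆ = 0 from
        MvPolynomial.derivation_ext fun i => by
          classical
          simp [Derivation.commutator_apply, pderiv_X, Pi.single_apply, apply_ite])
    simp only [Derivation.commutator_apply] at this
    exact (sub_eq_zero.1 this).symm
  have e : ∀ a b : Fin n, rotD a b (rotD a b p) =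
      X a ^ 2 * pderiv b (pderiv b p) + X b ^ 2 * pderiv a (pderiv a p)
      + (if a = b then (2 : ℝ) • (X a * pderiv a p) else 0) - X a * pderiv a p - X b * pderiv b p
      - (2 : ℝ) • (X a * X b * pderiv a (pderiv b p)) := by
    intro a b
    simp only [two_smul, rotD_apply, map_sub, pderiv_mul, pderiv_X_self, comm a b]
    by_cases h : a = b
    · subst h
      simp only [pderiv_X_self, if_true]
      ring
    · rw [pderiv_X_of_ne h, pderiv_X_of_ne (Ne.symm h), if_neg h]
      ring
  simp only [e, Finset.sum_add_distrib, Finset.sum_sub_distrib, Finset.sum_ite_eq,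
    Finset.mem_univ, if_true, ← Finset.mul_sum, ← Finset.sum_mul, Finset.sum_const,
    Finset.card_univ, Fintype.card_fin, ← Nat.cast_smul_eq_nsmul ℝ]
  simp only [mul_smul_comm, ← Finset.smul_sum]
  module

lemma X_mul_pderiv_monomial {n : ℕ} (a : Fin n) (α : Fin n →₀ ℕ) :
    X a * pderiv a (monomial α (1 : ℝ)) = (α a : ℝ) • monomial α 1 := by
  rw [pderiv_monomial, X, monomial_mul]
  by_cases h : α a = 0
  · simp [h]
  · have h1 : Finsupp.single a 1 + (α - Finsupp.single a 1) = α := by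
      ext j
      by_cases hj : j = a
      · subst hj; simp; omega
      · simp [Finsupp.single_eq_of_ne hj]
    rw [h1, smul_monomial]
    simp

lemma sum_rotD_rotD_monomial {n : ℕ} (α : Fin n →₀ ℕ) :
    ∑ a, ∑ b, rotD a b (rotD a b (monomial α (1 : ℝ))) =
      (2 : ℝ) • ((∑ a, X a ^ 2) * ∑ b, pderiv b (pderiv b (monomial α 1)))
        - (2 * ((α.degree : ℝ) ^ 2 + (n - 2) * α.degree)) • monomial α 1 := by
  have hdeg : (α.degree : ℝ) = ∑ i, (α i : ℝ) := by
    rw [Finsupp.degree_eq_sum]; push_cast; rfl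
  have h1 : ∑ a, X a * pderiv a (monomial α (1 : ℝ)) = (α.degree : ℝ) • monomial α 1 := by
    simp only [X_mul_pderiv_monomial, ← Finset.sum_smul, hdeg]
  have h2 : ∑ a, ∑ b, X a * X b * pderiv a (pderiv b (monomial α (1 : ℝ))) =
      ((α.degree : ℝ) ^ 2 - α.degree) • monomial α 1 := by
    have e : ∀ a b : Fin n, X a * X b * pderiv a (pderiv b (monomial α (1 : ℝ))) =
        ((α a : ℝ) * α b) • monomial α 1 -
          (if a = b then X a * pderiv a (monomial α (1 : ℝ)) else 0) := by
      intro a b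
      have h3 : X a * pderiv a (X b * pderiv b (monomial α (1 : ℝ))) =
          ((α a : ℝ) * α b) • monomial α 1 := by
        rw [X_mul_pderiv_monomial, Derivation.map_smul, mul_smul_comm, X_mul_pderiv_monomial,
          smul_smul, mul_comm]
      rw [← h3, pderiv_mul]
      by_cases h : a = b
      · subst h
        rw [pderiv_X_self, if_pos rfl]; ring
      · rw [pderiv_X_of_ne (Ne.symm h), if_neg h]; ring
    simp only [e, Finset.sum_sub_distrib, Finset.sum_ite_eq, Finset.mem_univ, if_true, h1,
      ← Finset.mul_sum, ← Finset.sum_mul, ← Finset.sum_smul]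
    rw [hdeg, sub_smul, sq]
  rw [sum_rotD_rotD, h1, h2]
  module

/-- The polynomial function on Euclidean space. -/
noncomputable def ev {n : ℕ} (p : MvPolynomial (Fin n) ℝ) (x : E n) : ℝ := eval (fun i => x i) p

lemma contDiff_ev {n : ℕ} (p : MvPolynomial (Fin n) ℝ) {k : WithTop ℕ∞} :
    ContDiff ℝ k (ev p) := by
  induction p using MvPolynomial.induction_on with
  | C a =>
    have : ev (C a : MvPolynomial (Fin n) ℝ) = fun _ => a := by ext x; simp [ev]
    rw [this]; exact contDiff_const
  | add p q hp hq =>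
    have : ev (p + q) = fun x => ev p x + ev q x := by ext x; simp [ev]
    rw [this]; exact hp.add hq
  | mul_X p i hp =>
    have : ev (p * X i) = fun x => ev p x * x i := by ext x; simp [ev]
    rw [this]
    exact hp.mul (by fun_prop)

lemma continuous_ev {n : ℕ} (p : MvPolynomial (Fin n) ℝ) : Continuous (ev p) :=
  (contDiff_ev p (k := 0)).continuous

lemma differentiable_ev {n : ℕ} (p : MvPolynomial (Fin n) ℝ) : Differentiable ℝ (ev p) :=
  (contDiff_ev p (k := 1)).differentiable (by norm_num)

lemma fderiv_ev_single {n : ℕ} (p : MvPolynomial (Fin n) ℝ) (i : Fin n) (x : E n) :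
    fderiv ℝ (ev p) x (EuclideanSpace.single i 1) = ev (pderiv i p) x := by
  induction p using MvPolynomial.induction_on with
  | C a =>
    have : ev (C a : MvPolynomial (Fin n) ℝ) = fun _ => a := by ext x; simp [ev]
    rw [this]
    simp [ev]
  | add p q hp hq =>
    have : ev (p + q) = ev p + ev q := by ext x; simp [ev]
    rw [this, fderiv_add (differentiable_ev p x) (differentiable_ev q x)]
    simp [hp, hq, ev]
  | mul_X p j hp =>
    have : ev (p * X j) = ev p * ⇑(EuclideanSpace.proj j : E n →L[ℝ] ℝ) := by
      ext x; simp [ev]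
    rw [this, fderiv_mul (differentiable_ev p x) (ContinuousLinearMap.differentiableAt _),
      ContinuousLinearMap.fderiv]
    classical
    simp [hp, ev, pderiv_X, Pi.single_apply, apply_ite]

lemma rot_ev {n : ℕ} (a b : Fin n) (p : MvPolynomial (Fin n) ℝ) (x : E n) :
    rot a b (ev p) x = ev (rotD a b p) x := by
  rw [rot, rotField_eq_sum, map_sub, map_smul, map_smul, fderiv_ev_single, fderiv_ev_single]
  simp [rotD_apply, ev]

/-- The restriction of a polynomial to the unit sphere. -/
noncomputable def toC {n : ℕ} : MvPolynomial (Fin n) ℝ →ₐ[ℝ] C(S n, ℝ) :=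
  aeval fun i => ⟨fun w => (w : E n) i, by fun_prop⟩

lemma toC_apply {n : ℕ} (p : MvPolynomial (Fin n) ℝ) (w : S n) : toC p w = ev p w := by
  induction p using MvPolynomial.induction_on with
  | C a => simp [toC, ev]
  | add p q hp hq => simp [hp, hq, ev]
  | mul_X p j hp =>
    rw [map_mul, ContinuousMap.mul_apply, hp]
    simp [toC, ev]

/-- The space `L²(S^{n-1})`. -/
abbrev L2S (n : ℕ) : Type := Lp ℝ 2 (sphereMeasure n)

/-- The inclusion of continuous functions in `L²(S^{n-1})`. -/
noncomputable def toL2 {n : ℕ} : C(S n, ℝ) →L[ℝ] L2S n :=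
  ContinuousMap.toLp (E := ℝ) 2 (sphereMeasure n) ℝ

lemma inner_toL2 {n : ℕ} (f g : C(S n, ℝ)) :
    inner ℝ (toL2 f) (toL2 g) = ∫ w, f w * g w ∂(sphereMeasure n) := by
  rw [toL2, ContinuousMap.inner_toLp]
  simp [mul_comm]

lemma toL2_injective {n : ℕ} : Function.Injective (toL2 : C(S n, ℝ) → L2S n) :=
  ContinuousMap.toLp_injective _

/-- The class in `L²(S^{n-1})` of a polynomial. -/
noncomputable def polyL2 {n : ℕ} : MvPolynomial (Fin n) ℝ →ₗ[ℝ] L2S n :=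
  (toL2 : C(S n, ℝ) →L[ℝ] L2S n).toLinearMap ∘ₗ toC.toLinearMap

lemma polyL2_apply {n : ℕ} (p : MvPolynomial (Fin n) ℝ) : polyL2 p = toL2 (toC p) := rfl

lemma inner_polyL2 {n : ℕ} (f : C(S n, ℝ)) (p : MvPolynomial (Fin n) ℝ) :
    inner ℝ (toL2 f) (polyL2 p) = ∫ w, f w * ev p w ∂(sphereMeasure n) := by
  rw [polyL2_apply, inner_toL2]
  simp only [toC_apply]

lemma integrable_sphere {n : ℕ} {f : S n → ℝ} (hf : Continuous f) :
    Integrable f (sphereMeasure n) :=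
  hf.integrable_of_hasCompactSupport (HasCompactSupport.of_compactSpace f)

/-- Integration by parts on the sphere. -/
lemma integral_rot_mul {n : ℕ} (a b : Fin n) {h : E n → ℝ} {U : Set (E n)} (hU : IsOpen U)
    (hSU : Metric.sphere (0 : E n) 1 ⊆ U) (hh : ContDiffOn ℝ 1 h U)
    (p : MvPolynomial (Fin n) ℝ) :
    ∫ w : S n, rot a b h w * ev p w ∂(sphereMeasure n) =
      -∫ w : S n, h w * ev (rotD a b p) w ∂(sphereMeasure n) := by
  have h0 := integral_sphere_rot a b hU hSU (hh.mul (contDiff_ev p).contDiffOn)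
  have hd : ∀ w : S n, DifferentiableAt ℝ h w := fun w =>
    (hh.contDiffAt (hU.mem_nhds (hSU w.2))).differentiableAt (by norm_num)
  have e : ∀ w : S n, rot a b (fun x => h x * ev p x) w =
      rot a b h w * ev p w + h w * ev (rotD a b p) w := by
    intro w
    rw [← rot_ev]
    unfold rot
    rw [show (fun x => h x * ev p x) = h * ev p from rfl,
      fderiv_mul (hd w) (differentiable_ev p _)]
    simp
    ring
  have c1 : Continuous fun w : S n => h w :=
    hh.continuousOn.comp_continuous continuous_subtype_val fun w => hSU w.2
  have c2 : Continuous fun w : S n => rot a b h w := by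
    have := (hh.continuousOn_fderiv_of_isOpen hU le_rfl).comp_continuous
      continuous_subtype_val fun w : S n => hSU w.2
    exact this.clm_apply ((continuous_rotField a b).comp continuous_subtype_val)
  have c3 : ∀ q : MvPolynomial (Fin n) ℝ, Continuous fun w : S n => ev q w := fun q =>
    (continuous_ev q).comp continuous_subtype_val
  simp only [e] at h0
  have h1 := integral_add (integrable_sphere (c2.mul (c3 p)))
    (integrable_sphere (c1.mul (c3 (rotD a b p))))
  simp only [Pi.mul_apply] at h1
  linarith

lemma inner_polyL2_rotD {n : ℕ} (a b : Fin n) (p q : MvPolynomial (Fin n) ℝ) :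
    inner ℝ (polyL2 (rotD a b p)) (polyL2 q) = -inner ℝ (polyL2 p) (polyL2 (rotD a b q)) := by
  rw [polyL2_apply (rotD a b p), polyL2_apply p, inner_polyL2, inner_polyL2]
  simp only [toC_apply, ← rot_ev a b p]
  exact integral_rot_mul a b isOpen_univ (subset_univ _) (contDiff_ev p).contDiffOn q

/-- The classes of polynomials of degree less than `d`. -/
noncomputable def polyL2LT (n d : ℕ) : Submodule ℝ (L2S n) := (polyLT n d).map polyL2

/-- Spherical harmonics of degree `d`. -/
noncomputable def harmonics (n d : ℕ) : Submodule ℝ (L2S n) :=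
  (polyL2LT n d)ᗮ ⊓ polyL2LT n (d + 1)

instance (n d : ℕ) : FiniteDimensional ℝ (polyL2LT n d) := by
  unfold polyL2LT; infer_instance

instance (n d : ℕ) : FiniteDimensional ℝ (harmonics n d) :=
  Submodule.finiteDimensional_of_le (inf_le_right : harmonics n d ≤ polyL2LT n (d + 1))

lemma polyL2LT_mono {n d d' : ℕ} (h : d ≤ d') : polyL2LT n d ≤ polyL2LT n d' :=
  Submodule.map_mono (polyLT_mono h)

lemma polyL2LT_zero (n : ℕ) : polyL2LT n 0 = ⊥ := by
  have : polyLT n 0 ≤ ⊥ := polyLT_le_of_monomial fun α hα => absurd hα (by simp)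
  rw [polyL2LT, le_bot_iff.1 this, Submodule.map_bot]

lemma polyL2LT_succ (n d : ℕ) : polyL2LT n (d + 1) = polyL2LT n d ⊔ harmonics n d :=
  (Submodule.sup_orthogonal_inf_of_hasOrthogonalProjection (polyL2LT_mono d.le_succ)).symm

/-- The sum of the squares of all rotation derivations. -/
noncomputable def casimir {n : ℕ} : MvPolynomial (Fin n) ℝ →ₗ[ℝ] MvPolynomial (Fin n) ℝ :=
  ∑ a, ∑ b, rotD a b ∘ₗ rotD a b

lemma casimir_apply {n : ℕ} (p : MvPolynomial (Fin n) ℝ) :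
    casimir p = ∑ a, ∑ b, rotD a b (rotD a b p) := by
  simp [casimir, LinearMap.sum_apply]

lemma casimir_mem_polyLT {n d : ℕ} {p : MvPolynomial (Fin n) ℝ}
    (hp : p ∈ polyLT n d) : casimir p ∈ polyLT n d := by
  rw [casimir_apply]
  exact Submodule.sum_mem _ fun a _ => Submodule.sum_mem _ fun b _ =>
    rotD_mem_polyLT a b (rotD_mem_polyLT a b hp)

lemma inner_polyL2_casimir {n : ℕ} (p q : MvPolynomial (Fin n) ℝ) :
    inner ℝ (polyL2 (casimir p)) (polyL2 q) = inner ℝ (polyL2 p) (polyL2 (casimir q)) := by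
  simp only [casimir_apply, map_sum, sum_inner, inner_sum, inner_polyL2_rotD, neg_neg]

/-- The eigenvalue of `-Δ` on spherical harmonics of degree `d`. -/
noncomputable def sphEigenvalue (n d : ℕ) : ℝ := (d : ℝ) ^ 2 + (n - 2) * d

lemma toC_sum_X_sq {n : ℕ} : toC (∑ a : Fin n, X a ^ 2) = 1 := by
  ext w
  rw [toC_apply]
  have := EuclideanSpace.real_norm_sq_eq (w : E n)
  rw [norm_eq_of_mem_sphere] at this
  simp [ev, ← this]

/-- A monomial of degree d is an eigenvector of the Casimir operator up to |x|² Δ, and |x|² = 1 on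
the sphere turns that term into one of lower degree. -/
lemma polyL2_casimir_add_mem {n d : ℕ} {p : MvPolynomial (Fin n) ℝ} (hp : p ∈ polyLT n (d + 1)) :
    polyL2 (casimir p) + (2 * sphEigenvalue n d) • polyL2 p ∈ polyL2LT n d := by
  have : polyLT n (d + 1) ≤ (polyL2LT n d).comap
      (polyL2 ∘ₗ (casimir + (2 * sphEigenvalue n d) • LinearMap.id)) := by
    refine polyLT_le_of_monomial fun α hα => ?_
    simp only [Submodule.mem_comap, LinearMap.comp_apply, LinearMap.add_apply,
      LinearMap.smul_apply, LinearMap.id_apply]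
    rcases Nat.lt_succ_iff_lt_or_eq.1 hα with h | h
    · have := monomial_mem_polyLT h
      exact Submodule.mem_map_of_mem (Submodule.add_mem _ (casimir_mem_polyLT this)
        (Submodule.smul_mem _ _ this))
    · rw [casimir_apply, sum_rotD_rotD_monomial, h, sphEigenvalue, sub_add_cancel, map_smul]
      refine Submodule.smul_mem _ _ ?_
      rw [polyL2_apply, map_mul, toC_sum_X_sq, one_mul, ← polyL2_apply]
      exact Submodule.mem_map_of_mem (Submodule.sum_mem _ fun b _ =>
        pderiv_mem_polyLT b (polyLT_mono d.le_succ (pderiv_mem_polyLT b (monomial_mem_polyLT hα))))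
  have := this hp
  simpa using this

/-- Rotations are antisymmetric and preserve the degree filtration, hence also the orthogonal
complements inside it. -/
lemma polyL2_rotD_mem_harmonics {n d : ℕ} (a b : Fin n) {p : MvPolynomial (Fin n) ℝ}
    (hp : p ∈ polyLT n (d + 1)) (hh : polyL2 p ∈ harmonics n d) :
    polyL2 (rotD a b p) ∈ harmonics n d := by
  refine Submodule.mem_inf.2 ⟨?_, Submodule.mem_map_of_mem (rotD_mem_polyLT a b hp)⟩
  rw [Submodule.mem_orthogonal']
  rintro _ ⟨q, hq, rfl⟩
  rw [inner_polyL2_rotD, (Submodule.mem_orthogonal' _ _).1 hh.1 _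
    (Submodule.mem_map_of_mem (rotD_mem_polyLT a b hq)), neg_zero]

/-- The error in the eigenvalue equation has lower degree, and by symmetry of the Casimir operator
it is also orthogonal to lower degrees, so it vanishes. Harmonicity in the sense of Δp = 0 never
enters. -/
lemma polyL2_casimir_of_mem_harmonics {n d : ℕ} {p : MvPolynomial (Fin n) ℝ}
    (hp : p ∈ polyLT n (d + 1)) (hh : polyL2 p ∈ harmonics n d) :
    polyL2 (casimir p) = -(2 * sphEigenvalue n d) • polyL2 p := by
  have h1 := polyL2_casimir_add_mem hp
  have h2 : polyL2 (casimir p) + (2 * sphEigenvalue n d) • polyL2 p ∈ (polyL2LT n d)ᗮ := by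
    refine Submodule.add_mem _ ?_ (Submodule.smul_mem _ _ hh.1)
    rw [Submodule.mem_orthogonal']
    rintro _ ⟨q, hq, rfl⟩
    rw [inner_polyL2_casimir]
    exact (Submodule.mem_orthogonal' _ _).1 hh.1 _
      (Submodule.mem_map_of_mem (casimir_mem_polyLT hq))
  have h3 := Submodule.mem_inf.2 ⟨h1, h2⟩
  rw [Submodule.inf_orthogonal_eq_bot, Submodule.mem_bot] at h3
  rw [neg_smul]
  exact eq_neg_of_add_eq_zero_left h3

/-- The dimension of the space of spherical harmonics of degree `d`. -/
noncomputable def harmDim (n d : ℕ) : ℕ := Module.finrank ℝ (harmonics n d)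

lemma exists_harmPoly (n d : ℕ) (i : Fin (harmDim n d)) :
    ∃ p ∈ polyLT n (d + 1), polyL2 p = (stdOrthonormalBasis ℝ (harmonics n d) i : L2S n) := by
  have := (Submodule.mem_inf.1 (stdOrthonormalBasis ℝ (harmonics n d) i).2).2
  obtain ⟨p, hp, e⟩ := this
  exact ⟨p, hp, e⟩

/-- Polynomials whose restrictions to the sphere are an orthonormal basis of the spherical
harmonics of degree `d`. -/
noncomputable def harmPoly (n d : ℕ) (i : Fin (harmDim n d)) : MvPolynomial (Fin n) ℝ :=
  (exists_harmPoly n d i).choose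

lemma harmPoly_mem (n d : ℕ) (i : Fin (harmDim n d)) : harmPoly n d i ∈ polyLT n (d + 1) :=
  (exists_harmPoly n d i).choose_spec.1

lemma polyL2_harmPoly (n d : ℕ) (i : Fin (harmDim n d)) :
    polyL2 (harmPoly n d i) = (stdOrthonormalBasis ℝ (harmonics n d) i : L2S n) :=
  (exists_harmPoly n d i).choose_spec.2

lemma polyL2_harmPoly_mem (n d : ℕ) (i : Fin (harmDim n d)) :
    polyL2 (harmPoly n d i) ∈ harmonics n d := by
  rw [polyL2_harmPoly]; exact Subtype.coe_prop _

lemma inner_harmPoly (n d : ℕ) (i j : Fin (harmDim n d)) :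
    inner ℝ (polyL2 (harmPoly n d i)) (polyL2 (harmPoly n d j)) = if i = j then (1 : ℝ) else 0 := by
  rw [polyL2_harmPoly, polyL2_harmPoly, ← Submodule.coe_inner]
  exact orthonormal_iff_ite.1 (stdOrthonormalBasis ℝ (harmonics n d)).orthonormal i j

lemma sum_inner_smul_harmPoly {n d : ℕ} {v : L2S n} (hv : v ∈ harmonics n d) :
    ∑ i, (inner ℝ v (polyL2 (harmPoly n d i)) : ℝ) • polyL2 (harmPoly n d i) = v := by
  have := congrArg (Subtype.val) ((stdOrthonormalBasis ℝ (harmonics n d)).sum_repr' ⟨v, hv⟩)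
  simp only [AddSubmonoidClass.coe_finsetSum, Submodule.coe_smul, Submodule.coe_inner] at this
  refine Eq.trans (Finset.sum_congr rfl fun i _ => ?_) this
  rw [polyL2_harmPoly, real_inner_comm]

lemma sum_sq_inner_harmPoly {n d : ℕ} {v : L2S n} (hv : v ∈ harmonics n d) :
    ∑ i, (inner ℝ v (polyL2 (harmPoly n d i)) : ℝ) ^ 2 = inner ℝ v v := by
  conv_rhs => rw [← sum_inner_smul_harmPoly hv, sum_inner]
  rw [sum_inner_smul_harmPoly hv]
  refine Finset.sum_congr rfl fun i _ => ?_
  rw [real_inner_smul_left, real_inner_comm v, sq]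

/-- The square of the norm of the projection on the spherical harmonics of degree `d`. -/
noncomputable def harmEnergy {n : ℕ} (d : ℕ) (v : L2S n) : ℝ :=
  ∑ i, (inner ℝ v (polyL2 (harmPoly n d i)) : ℝ) ^ 2

lemma harmEnergy_nonneg {n : ℕ} (d : ℕ) (v : L2S n) : 0 ≤ harmEnergy d v :=
  Finset.sum_nonneg fun _ _ => sq_nonneg _

/-- The hypothesis says that `v' a b` is a weak rotational derivative of `v`. Projection on degree d
commutes with rotations, so each term is the squared norm of a rotational derivative of the
projection, and integrating by parts produces the Casimir operator. -/
theorem sum_harmEnergy_rot {n : ℕ} (d : ℕ) (v : L2S n) (v' : Fin n → Fin n → L2S n)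
    (h : ∀ a b p, inner ℝ (v' a b) (polyL2 p) = -inner ℝ v (polyL2 (rotD a b p))) :
    ∑ a, ∑ b, harmEnergy d (v' a b) = 2 * sphEigenvalue n d * harmEnergy d v := by
  set q : MvPolynomial (Fin n) ℝ :=
    ∑ i, (inner ℝ v (polyL2 (harmPoly n d i)) : ℝ) • harmPoly n d i with hq
  have hqm : q ∈ polyLT n (d + 1) :=
    Submodule.sum_mem _ fun i _ => Submodule.smul_mem _ _ (harmPoly_mem n d i)
  have hqh : polyL2 q ∈ harmonics n d := by
    rw [hq, map_sum]
    simp only [map_smul]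
    exact Submodule.sum_mem _ fun i _ => Submodule.smul_mem _ _ (polyL2_harmPoly_mem n d i)
  have hproj : ∀ u ∈ harmonics n d, inner ℝ v u = inner ℝ (polyL2 q) u := by
    intro u hu
    conv_lhs => rw [← sum_inner_smul_harmPoly hu, inner_sum]
    rw [hq, map_sum, sum_inner]
    refine Finset.sum_congr rfl fun i _ => ?_
    rw [map_smul, real_inner_smul_left, real_inner_smul_right, real_inner_comm u, mul_comm]
  have h1 : ∀ a b, harmEnergy d (v' a b) =
      inner ℝ (polyL2 (rotD a b q)) (polyL2 (rotD a b q)) := by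
    intro a b
    rw [← sum_sq_inner_harmPoly (polyL2_rotD_mem_harmonics a b hqm hqh)]
    refine Finset.sum_congr rfl fun i _ => ?_
    rw [h, hproj _ (polyL2_rotD_mem_harmonics a b (harmPoly_mem n d i) (polyL2_harmPoly_mem n d i)),
      inner_polyL2_rotD]
  have h2 : harmEnergy d v = inner ℝ (polyL2 q) (polyL2 q) := by
    rw [← sum_sq_inner_harmPoly hqh]
    exact Finset.sum_congr rfl fun i _ => by rw [hproj _ (polyL2_harmPoly_mem n d i)]
  simp only [h1, inner_polyL2_rotD, h2]
  have h4 : ∑ a, ∑ b, (inner ℝ (polyL2 q) (polyL2 (rotD a b (rotD a b q))) : ℝ) =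
      inner ℝ (polyL2 q) (polyL2 (casimir q)) := by
    simp only [casimir_apply, map_sum, inner_sum]
  simp only [Finset.sum_neg_distrib]
  rw [h4, polyL2_casimir_of_mem_harmonics hqm hqh, real_inner_smul_right]
  ring

/-! ### Orthonormality and completeness -/

lemma orthonormal_harmPoly (n : ℕ) : Orthonormal ℝ
    fun z : Σ d, Fin (harmDim n d) => polyL2 (harmPoly n z.1 z.2) := by
  have key : ∀ d d' : ℕ, d < d' → ∀ i j,
      (inner ℝ (polyL2 (harmPoly n d' j)) (polyL2 (harmPoly n d i)) : ℝ) = 0 := by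
    intro d d' h i j
    refine (Submodule.mem_orthogonal' _ _).1 (Submodule.mem_inf.1
      (polyL2_harmPoly_mem n d' j)).1 _ ?_
    exact polyL2LT_mono (Nat.succ_le_of_lt h) (Submodule.mem_inf.1 (polyL2_harmPoly_mem n d i)).2
  classical
  rw [orthonormal_iff_ite]
  rintro ⟨d, i⟩ ⟨d', j⟩
  rcases lt_trichotomy d d' with h | h | h
  · rw [real_inner_comm, key d d' h i j, if_neg]
    intro e; exact h.ne (congrArg Sigma.fst e)
  · subst h
    rw [inner_harmPoly]
    simp
  · rw [key d' d h j i, if_neg]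
    intro e; exact h.ne' (congrArg Sigma.fst e)

/-- Bessel's inequality. -/
lemma sum_harmEnergy_le {n : ℕ} (v : L2S n) (D : ℕ) :
    ∑ d ∈ Finset.range D, harmEnergy d v ≤ inner ℝ v v := by
  have := (orthonormal_harmPoly n).sum_inner_products_le v
    (s := (Finset.range D).sigma fun _ => Finset.univ)
  rw [Finset.sum_sigma] at this
  rw [real_inner_self_eq_norm_sq]
  refine le_trans (le_of_eq ?_) this
  refine Finset.sum_congr rfl fun d _ => Finset.sum_congr rfl fun i _ => ?_
  rw [Real.norm_eq_abs, sq_abs, real_inner_comm v]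

/-- The partial sum of the expansion in spherical harmonics. -/
noncomputable def harmSum {n : ℕ} (D : ℕ) (v : L2S n) : MvPolynomial (Fin n) ℝ :=
  ∑ d ∈ Finset.range D, ∑ i, (inner ℝ v (polyL2 (harmPoly n d i)) : ℝ) • harmPoly n d i

/-- Best approximation: the error is orthogonal to the harmonics of every degree below D, hence, by
induction along the filtration, to all polynomials of degree less than D. -/
lemma norm_sub_harmSum_le {n : ℕ} (D : ℕ) (v : L2S n) {w : L2S n} (hw : w ∈ polyL2LT n D) :
    ‖v - polyL2 (harmSum D v)‖ ≤ ‖v - w‖ := by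
  have hmem : polyL2 (harmSum D v) ∈ polyL2LT n D := by
    rw [harmSum, map_sum]
    refine Submodule.sum_mem _ fun d hd => ?_
    rw [map_sum]
    refine Submodule.sum_mem _ fun i _ => ?_
    rw [map_smul]
    exact Submodule.smul_mem _ _ (polyL2LT_mono (Finset.mem_range.1 hd)
      (Submodule.mem_inf.1 (polyL2_harmPoly_mem n d i)).2)
  have horth : ∀ d, d ≤ D → ∀ u ∈ polyL2LT n d,
      (inner ℝ (v - polyL2 (harmSum D v)) u : ℝ) = 0 := by
    intro d
    induction d with
    | zero => intro _ u hu; rw [polyL2LT_zero, Submodule.mem_bot] at hu; rw [hu, inner_zero_right]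
    | succ d ih =>
      intro hd u hu
      rw [polyL2LT_succ] at hu
      obtain ⟨y, hy, z, hz, rfl⟩ := Submodule.mem_sup.1 hu
      rw [inner_add_right, ih (by omega) y hy, zero_add, ← sum_inner_smul_harmPoly hz, inner_sum]
      refine Finset.sum_eq_zero fun i _ => ?_
      rw [real_inner_smul_right]
      have : (inner ℝ (v - polyL2 (harmSum D v)) (polyL2 (harmPoly n d i)) : ℝ) = 0 := by
        rw [inner_sub_left, harmSum, map_sum, sum_inner]
        have e : ∀ d' ∈ Finset.range D, (inner ℝ (polyL2 (∑ i, (inner ℝ v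
            (polyL2 (harmPoly n d' i)) : ℝ) • harmPoly n d' i)) (polyL2 (harmPoly n d i)) : ℝ) =
            if d = d' then inner ℝ v (polyL2 (harmPoly n d i)) else 0 := by
          intro d' _
          rw [map_sum, sum_inner]
          simp only [map_smul, real_inner_smul_left]
          have on := orthonormal_iff_ite.1 (orthonormal_harmPoly n)
          by_cases h : d = d'
          · subst h
            simp [inner_harmPoly]
          · rw [if_neg h]
            refine Finset.sum_eq_zero fun j _ => ?_
            have := on ⟨d', j⟩ ⟨d, i⟩
            rw [if_neg (fun e => h (congrArg Sigma.fst e).symm)] at this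
            rw [this, mul_zero]
        rw [Finset.sum_congr rfl e, Finset.sum_ite_eq, if_pos (Finset.mem_range.2 (by omega)),
          sub_self]
      rw [this, mul_zero]
  have h0 := horth D le_rfl _ (Submodule.sub_mem _ hmem hw)
  have h1 := norm_add_sq_eq_norm_sq_add_norm_sq_real h0
  rw [sub_add_sub_cancel] at h1
  exact abs_le_of_sq_le_sq' (by nlinarith [mul_self_nonneg ‖polyL2 (harmSum D v) - w‖])
    (norm_nonneg _) |>.2

lemma exists_polynomial_near {n : ℕ} (f : C(S n, ℝ)) {ε : ℝ} (hε : 0 < ε) :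
    ∃ p : MvPolynomial (Fin n) ℝ, ‖f - toC p‖ < ε := by
  have hsep : (toC : MvPolynomial (Fin n) ℝ →ₐ[ℝ] C(S n, ℝ)).range.SeparatesPoints := by
    intro x y hxy
    obtain ⟨i, hi⟩ : ∃ i, (x : E n) i ≠ (y : E n) i := by
      by_contra! h
      exact hxy (Subtype.ext (by ext i; exact h i))
    refine ⟨_, ⟨toC (X i), ⟨X i, rfl⟩, rfl⟩, ?_⟩
    simpa [toC_apply, ev] using hi
  have htop := ContinuousMap.subalgebra_topologicalClosure_eq_top_of_separatesPoints _ hsep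
  have hf : f ∈ (toC : MvPolynomial (Fin n) ℝ →ₐ[ℝ] C(S n, ℝ)).range.topologicalClosure := by
    rw [htop]; trivial
  obtain ⟨g, ⟨p, rfl⟩, hg⟩ := Metric.mem_closure_iff.1 hf ε hε
  exact ⟨p, by rw [← dist_eq_norm]; exact hg⟩

/-- A bound on the partial sums of the expansion in spherical harmonics holds for the function. -/
theorem abs_le_of_harmSum_le {n : ℕ} (f : C(S n, ℝ)) {B : ℝ}
    (h : ∀ D, ∀ w : S n, |ev (harmSum D (toL2 f)) w| ≤ B) (w : S n) : |f w| ≤ B := by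
  -- The excess of |f| over B is pointwise below the error of every partial sum. That error tends to
  -- zero in L² by the Stone-Weierstrass theorem, so uniform convergence of the expansion is not
  -- needed.
  set δ : C(S n, ℝ) := ⟨fun w => max (|f w| - B) 0, by fun_prop⟩ with hδ
  have h1 : ∀ D, inner ℝ (toL2 δ) (toL2 δ) ≤ ‖toL2 f - polyL2 (harmSum D (toL2 f))‖ ^ 2 := by
    intro D
    rw [← real_inner_self_eq_norm_sq, polyL2_apply, ← map_sub, inner_toL2, inner_toL2]
    refine integral_mono (integrable_sphere (by fun_prop)) (integrable_sphere (by fun_prop)) ?_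
    intro w
    have h2 : δ w ≤ |f w - toC (harmSum D (toL2 f)) w| := by
      rw [toC_apply]
      refine max_le ?_ (abs_nonneg _)
      have := abs_sub_abs_le_abs_sub (f w) (ev (harmSum D (toL2 f)) w)
      have := h D w
      linarith
    have h3 : 0 ≤ δ w := le_max_right _ _
    have := mul_self_le_mul_self h3 h2
    rw [abs_mul_abs_self] at this
    exact this
  have h2 : ∀ ε > 0, inner ℝ (toL2 δ) (toL2 δ) ≤ ε ^ 2 := by
    intro ε hε
    have hC : 0 < ‖(toL2 : C(S n, ℝ) →L[ℝ] L2S n)‖ + 1 := by positivity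
    obtain ⟨p, hp⟩ := exists_polynomial_near f (div_pos hε hC)
    obtain ⟨D, hD⟩ := exists_mem_polyLT p
    have h3 := norm_sub_harmSum_le D (toL2 f) (w := polyL2 p) (Submodule.mem_map_of_mem hD)
    have h4 : ‖toL2 f - polyL2 p‖ ≤ ε := by
      rw [polyL2_apply, ← map_sub]
      refine (ContinuousLinearMap.le_opNorm _ _).trans ?_
      calc _ ≤ (‖(toL2 : C(S n, ℝ) →L[ℝ] L2S n)‖ + 1) *
            (ε / (‖(toL2 : C(S n, ℝ) →L[ℝ] L2S n)‖ + 1)) := by gcongr; linarith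
        _ = ε := by field_simp
    exact (h1 D).trans (by gcongr; exact h3.trans h4)
  have h5 : toL2 δ = 0 := by
    rw [← inner_self_eq_zero (𝕜 := ℝ)]
    refine le_antisymm (le_of_forall_pos_le_add fun ε hε => ?_) real_inner_self_nonneg
    have := h2 (√ε) (Real.sqrt_pos.2 hε)
    rw [Real.sq_sqrt hε.le] at this
    linarith
  have h6 : δ = 0 := toL2_injective (by rw [h5, map_zero])
  have h7 := DFunLike.congr_fun h6 w
  have h8 : |f w| - B ≤ δ w := le_max_left _ _
  rw [h7] at h8
  simpa using h8

lemma fderiv_radial_self {n : ℕ} {x : E n} (hx : x ≠ 0) :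
    fderiv ℝ (radial : E n → E n) x x = 0 := by
  have hd : DifferentiableAt ℝ (radial : E n → E n) x :=
    (contDiffAt_radial hx (k := 1)).differentiableAt (by norm_num)
  have h1 : HasDerivAt (fun s : ℝ => s • x) x 1 := by
    simpa using (hasDerivAt_id (1 : ℝ)).smul_const x
  have h2 : HasDerivAt (fun s : ℝ => radial (s • x)) (fderiv ℝ (radial : E n → E n) x x) 1 := by
    have h3 : HasFDerivAt (radial : E n → E n) (fderiv ℝ (radial : E n → E n) x)
        ((1 : ℝ) • x) := by rw [one_smul]; exact hd.hasFDerivAt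
    exact h3.comp_hasDerivAt (1 : ℝ) h1
  have h4 : (fun s : ℝ => radial (s • x)) =ᶠ[𝓝 1] fun _ => radial x := by
    filter_upwards [lt_mem_nhds (zero_lt_one (α := ℝ))] with s hs
    rw [radial, radial, norm_smul, Real.norm_of_nonneg hs.le, smul_smul]
    congr 1
    field_simp
  exact (h2.congr_of_eventuallyEq h4.symm).unique (hasDerivAt_const _ _)

/-- The rotation fields and the radial field span: a function whose rotational and radial
derivatives vanish at x ≠ 0 has zero gradient there. -/
lemma sum_smul_rotField {n : ℕ} (b : Fin n) (x : E n) :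
    ∑ a, x a • rotField a b x = ‖x‖ ^ 2 • EuclideanSpace.single b 1 - x b • x := by
  simp only [rotField_eq_sum, smul_sub, smul_smul, Finset.sum_sub_distrib, ← Finset.sum_smul]
  congr 1
  · rw [EuclideanSpace.real_norm_sq_eq]
    simp only [sq]
  · ext i
    simp [Finset.sum_apply, mul_comm, Pi.single_apply]

/-- A function on the sphere with vanishing rotational derivatives is constant. -/
theorem eq_of_rot_eq_zero {n : ℕ} (hn : 1 < n) {K : E n → ℝ} (hK : Differentiable ℝ K)
    (h : ∀ a b, ∀ w ∈ Metric.sphere (0 : E n) 1, rot a b K w = 0) {w w' : E n}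
    (hw : w ∈ Metric.sphere (0 : E n) 1) (hw' : w' ∈ Metric.sphere (0 : E n) 1) : K w = K w' := by
  have hr : ∀ v ∈ Metric.sphere (0 : E n) 1, radial v = v := by
    intro v hv
    rw [mem_sphere_zero_iff_norm] at hv
    simp [radial, hv]
  have h0 : ∀ v ∈ Metric.sphere (0 : E n) 1, v ≠ 0 := by
    rintro v hv rfl
    simp at hv
  have hpre : IsPreconnected ({0}ᶜ : Set (E n)) := by
    refine (isConnected_compl_singleton_of_one_lt_rank ?_ 0).isPreconnected
    rw [← Module.finrank_eq_rank, finrank_euclideanSpace_fin]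
    exact_mod_cast hn
  have hd : ∀ x : E n, x ≠ 0 → DifferentiableAt ℝ (radial : E n → E n) x := fun x hx =>
    (contDiffAt_radial hx (k := 1)).differentiableAt (by norm_num)
  have key := isOpen_compl_singleton.is_const_of_fderiv_eq_zero hpre (𝕜 := ℝ)
    (f := fun x => K (radial x))
    (fun x hx => ((hK _).comp x (hd x hx)).differentiableWithinAt) (by
      intro x hx
      have hx : x ≠ 0 := hx
      have e1 : fderiv ℝ (fun x => K (radial x)) x x = 0 := by
        rw [show (fun x => K (radial x)) = K ∘ radial from rfl, fderiv_comp x (hK _) (hd x hx)]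
        simp [fderiv_radial_self hx]
      have e2 : ∀ a b, fderiv ℝ (fun x => K (radial x)) x (rotField a b x) = 0 := by
        intro a b
        have := rot_comp_radial a b hx (hK (radial x))
        rw [h a b _ (radial_mem hx)] at this
        exact this
      have e3 : ∀ b, fderiv ℝ (fun x => K (radial x)) x (EuclideanSpace.single b 1) = 0 := by
        intro b
        have := congrArg (fderiv ℝ (fun x => K (radial x)) x) (sum_smul_rotField b x)
        simp only [map_sum, map_smul, e2, smul_zero, Finset.sum_const_zero, map_sub, e1,
          sub_zero] at this
        have hx2 : ‖x‖ ^ 2 ≠ 0 := by simpa using hx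
        exact (smul_eq_zero.1 this.symm).resolve_left hx2
      refine ContinuousLinearMap.coe_injective ?_
      refine (EuclideanSpace.basisFun (Fin n) ℝ).toBasis.ext fun b => ?_
      simpa using e3 b) (h0 w hw) (h0 w' hw')
  simpa only [hr w hw, hr w' hw'] using key

/-- The addition theorem for spherical harmonics on the diagonal. -/
theorem sum_sq_harmPoly {n : ℕ} (hn : 1 < n) (d : ℕ) (w : S n) :
    (∑ i, ev (harmPoly n d i) w ^ 2) * (sphereMeasure n).real univ = harmDim n d := by
  set K : E n → ℝ := fun x => ∑ i, ev (harmPoly n d i) x ^ 2 with hKdef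
  have hrot : ∀ a b, ∀ x ∈ Metric.sphere (0 : E n) 1, rot a b K x = 0 := by
    intro a b x hx
    have e1 : rot a b K x =
        ∑ i, 2 * ev (harmPoly n d i) x * ev (rotD a b (harmPoly n d i)) x := by
      have : HasFDerivAt K (∑ i, (2 * ev (harmPoly n d i) x) • fderiv ℝ (ev (harmPoly n d i)) x) x := by
        refine HasFDerivAt.fun_sum fun i _ => ?_
        have := (differentiable_ev (harmPoly n d i) x).hasFDerivAt.pow 2
        simpa using this
      rw [rot, this.fderiv]
      simp only [sum_apply, smul_apply, smul_eq_mul]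
      exact Finset.sum_congr rfl fun i _ => by rw [← rot_ev]; rfl
    have e2 : ∀ i, ev (rotD a b (harmPoly n d i)) x = ∑ j, (inner ℝ (polyL2 (rotD a b
        (harmPoly n d i))) (polyL2 (harmPoly n d j)) : ℝ) * ev (harmPoly n d j) x := by
      intro i
      have h1 := sum_inner_smul_harmPoly (polyL2_rotD_mem_harmonics a b (harmPoly_mem n d i)
        (polyL2_harmPoly_mem n d i))
      simp only [polyL2_apply (harmPoly n d _), ← map_smul, ← map_sum] at h1
      have h2 := toL2_injective (a₂ := toC (rotD a b (harmPoly n d i))) h1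
      have h3 := DFunLike.congr_fun h2 ⟨x, hx⟩
      rw [toC_apply, toC_apply] at h3
      rw [← h3]
      simp [ev, polyL2_apply]
    have e3 : ∀ i j, (inner ℝ (polyL2 (rotD a b (harmPoly n d i))) (polyL2 (harmPoly n d j)) : ℝ) =
        -inner ℝ (polyL2 (rotD a b (harmPoly n d j))) (polyL2 (harmPoly n d i)) := by
      intro i j
      rw [inner_polyL2_rotD, real_inner_comm]
    -- A rotation acts on the orthonormal basis by an antisymmetric matrix, whose quadratic form is
    -- zero. Thus the sum of squares is constant on the sphere.
    have e4 : rot a b K x = -rot a b K x := by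
      conv_lhs => rw [e1]
      rw [e1]
      simp only [e2, Finset.mul_sum]
      conv_lhs => rw [Finset.sum_comm]
      rw [← Finset.sum_neg_distrib]
      refine Finset.sum_congr rfl fun i _ => ?_
      rw [← Finset.sum_neg_distrib]
      refine Finset.sum_congr rfl fun j _ => ?_
      rw [e3 j i]
      ring
    linarith
  have hKd : Differentiable ℝ K := by
    intro x
    exact DifferentiableAt.fun_sum fun i _ => (differentiable_ev _ x).pow 2
  have hconst : ∀ x : S n, K x = K w := fun x => eq_of_rot_eq_zero hn hKd hrot x.2 w.2
  have h1 : ∫ x : S n, K x ∂(sphereMeasure n) = harmDim n d := by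
    simp only [hKdef]
    rw [integral_finsetSum (f := fun i (x : S n) => ev (harmPoly n d i) x ^ 2) Finset.univ
      fun i _ => integrable_sphere (((continuous_ev _).comp continuous_subtype_val).pow 2)]
    have : ∀ i, ∫ x : S n, ev (harmPoly n d i) x ^ 2 ∂(sphereMeasure n) = 1 := by
      intro i
      have := inner_harmPoly n d i i
      rw [if_pos rfl] at this
      have h2 := (inner_polyL2 (toC (harmPoly n d i)) (harmPoly n d i)).symm.trans this
      simpa only [toC_apply, sq] using h2
    simp [this]
  rw [integral_congr_ae (ae_of_all _ hconst), integral_const, smul_eq_mul, mul_comm] at h1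
  exact h1

/-! ### The dimension of the spaces of spherical harmonics -/

/-- The multi-indices of degree `d` with prescribed entries except for the last. -/
noncomputable def multiIdx (l d : ℕ) (z : Fin 2 × (Fin l → Fin (d + 1))) : Fin (l + 2) →₀ ℕ :=
  Finsupp.equivFunOnFinite.symm (Fin.cons (z.1 : ℕ) (Fin.snoc (fun i => (z.2 i : ℕ))
    (d - z.1 - ∑ i, (z.2 i : ℕ)) : Fin (l + 1) → ℕ))

lemma exists_multiIdx {l d : ℕ} {α : Fin (l + 2) →₀ ℕ} (h : α.degree = d) (h0 : α 0 < 2) :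
    ∃ z, multiIdx l d z = α := by
  rw [Finsupp.degree_eq_sum, Fin.sum_univ_succ, Fin.sum_univ_castSucc] at h
  have hle : ∀ i : Fin l, α i.castSucc.succ < d + 1 := by
    intro i
    have := Finset.single_le_sum (f := fun i : Fin l => α i.castSucc.succ) (by simp)
      (Finset.mem_univ i)
    omega
  refine ⟨(⟨α 0, h0⟩, fun i => ⟨α i.castSucc.succ, hle i⟩), ?_⟩
  ext j
  refine Fin.cases ?_ (fun j => ?_) j
  · simp [multiIdx]
  · refine Fin.lastCases ?_ (fun i => ?_) j
    · simp [multiIdx]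
      simp at h
      omega
    · simp [multiIdx]

/-- On the sphere X₀² = 1 - ∑_{i>0} X_i². A monomial with exponent at least 2 in X₀ is thus a
combination of a polynomial of lower degree and of monomials whose exponent in X₀ is smaller by 2.
-/
lemma polyL2LT_succ_le (l d : ℕ) : polyL2LT (l + 2) (d + 1) ≤ polyL2LT (l + 2) d ⊔
    Submodule.span ℝ (range fun z => polyL2 (monomial (multiIdx l d z) (1 : ℝ))) := by
  rw [polyL2LT, Submodule.map_le_iff_le_comap]
  set W := polyL2LT (l + 2) d ⊔
    Submodule.span ℝ (range fun z => polyL2 (monomial (multiIdx l d z) (1 : ℝ))) with hW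
  have key : ∀ m : ℕ, ∀ α : Fin (l + 2) →₀ ℕ, α 0 = m → α.degree = d →
      polyL2 (monomial α (1 : ℝ)) ∈ W := by
    intro m
    induction m using Nat.strong_induction_on with
    | _ m ih =>
    intro α h0 hα
    by_cases hm : m < 2
    · obtain ⟨z, rfl⟩ := exists_multiIdx hα (h0 ▸ hm)
      exact Submodule.mem_sup_right (Submodule.subset_span ⟨z, rfl⟩)
    · set β := α - Finsupp.single 0 2 with hβ
      have hαβ : α = β + Finsupp.single 0 2 := by
        ext j
        by_cases hj : j = 0
        · subst hj; simp [hβ]; omega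
        · simp [hβ, Finsupp.single_eq_of_ne hj]
      have hdeg : β.degree + 2 = d := by
        rw [← hα, hαβ, map_add, Finsupp.degree_single]
      have hmul : ∀ i, X i ^ 2 * monomial β (1 : ℝ) = monomial (β + Finsupp.single i 2) 1 := by
        intro i
        rw [X_pow_eq_monomial, monomial_mul, one_mul, add_comm (Finsupp.single i 2)]
      have h1 : polyL2 ((∑ i, X i ^ 2) * monomial β (1 : ℝ)) = polyL2 (monomial β (1 : ℝ)) := by
        rw [polyL2_apply, map_mul, toC_sum_X_sq, one_mul, polyL2_apply]
      rw [Fin.sum_univ_succ, add_mul, Finset.sum_mul] at h1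
      simp only [hmul] at h1
      rw [← hαβ, map_add, map_sum] at h1
      rw [eq_sub_of_add_eq h1]
      refine Submodule.sub_mem _ (Submodule.mem_sup_left (Submodule.mem_map_of_mem
        (monomial_mem_polyLT (by omega)))) (Submodule.sum_mem _ fun i _ => ?_)
      refine ih (m - 2) (by omega) _ ?_ ?_
      · simp [hβ, h0]
      · rw [map_add, Finsupp.degree_single, hdeg]
  refine polyLT_le_of_monomial fun α hα => ?_
  rcases Nat.lt_succ_iff_lt_or_eq.1 hα with h | h
  · exact Submodule.mem_sup_left (Submodule.mem_map_of_mem (monomial_mem_polyLT h))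
  · exact key _ α rfl h

/-- A count of exponents modulo lower degree: two choices for the first, at most d + 1 for each of
the next l, and the last is determined by the degree. -/
theorem harmDim_le (l d : ℕ) : harmDim (l + 2) d ≤ 2 * (d + 1) ^ l := by
  have : FiniteDimensional ℝ
      (Submodule.span ℝ (range fun z => polyL2 (monomial (multiIdx l d z) (1 : ℝ)))) :=
    FiniteDimensional.span_of_finite ℝ (finite_range _)
  have h1 := Submodule.finrank_add_inf_finrank_orthogonal (polyL2LT_mono (n := l + 2) d.le_succ)
  have h2 := Submodule.finrank_mono (polyL2LT_succ_le l d)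
  have h3 := Submodule.finrank_add_le_finrank_add_finrank (polyL2LT (l + 2) d)
    (Submodule.span ℝ (range fun z => polyL2 (monomial (multiIdx l d z) (1 : ℝ))))
  have h4 := finrank_range_le_card (R := ℝ)
    fun z => polyL2 (monomial (multiIdx l d z) (1 : ℝ))
  simp only [Fintype.card_prod, Fintype.card_fin, Fintype.card_fun] at h4
  have h5 : harmDim (l + 2) d = Module.finrank ℝ
    ((polyL2LT (l + 2) d)ᗮ ⊓ polyL2LT (l + 2) (d + 1) : Submodule ℝ (L2S (l + 2))) := rfl
  unfold Set.finrank at h4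
  simp only [Nat.succ_eq_add_one] at h1
  omega

/-! ### The Sobolev inequality on the sphere -/

/-- The frequency `√(1 - Δ)` on spherical harmonics of degree `d`. -/
noncomputable def sphFreq (n d : ℕ) : ℝ := √(1 + sphEigenvalue n d)

lemma sphEigenvalue_nonneg {n : ℕ} (hn : 2 ≤ n) (d : ℕ) : 0 ≤ sphEigenvalue n d := by
  have : (2 : ℝ) ≤ n := by exact_mod_cast hn
  have : (0 : ℝ) ≤ (n - 2) * d := mul_nonneg (by linarith) (by positivity)
  unfold sphEigenvalue; positivity

lemma sphFreq_sq {n : ℕ} (hn : 2 ≤ n) (d : ℕ) : sphFreq n d ^ 2 = 1 + sphEigenvalue n d :=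
  Real.sq_sqrt (by linarith [sphEigenvalue_nonneg hn d])

lemma one_le_sphFreq {n : ℕ} (hn : 2 ≤ n) (d : ℕ) : 1 ≤ sphFreq n d :=
  Real.one_le_sqrt.2 (by linarith [sphEigenvalue_nonneg hn d])

lemma le_sphFreq {n : ℕ} (hn : 2 ≤ n) (d : ℕ) : ((d : ℝ) + 1) / 2 ≤ sphFreq n d := by
  refine Real.le_sqrt_of_sq_le ?_
  have : (2 : ℝ) ≤ n := by exact_mod_cast hn
  have : (0 : ℝ) ≤ (n - 2) * d := mul_nonneg (by linarith) (by positivity)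
  unfold sphEigenvalue
  nlinarith [sq_nonneg ((d : ℝ) - 1)]

/-- The dimensions grow at most like d^{n-2} and the frequency is at least (d + 1)/2, so p ≥ n gives
comparison with the series of (d + 1)^{-2}. -/
lemma exists_sum_harmDim_le {n : ℕ} (hn : 2 ≤ n) {p : ℕ} (hp : n ≤ p) :
    ∃ K : ℝ, 0 ≤ K ∧ ∀ D, ∑ d ∈ Finset.range D, (harmDim n d : ℝ) / sphFreq n d ^ p ≤ K := by
  obtain ⟨l, rfl⟩ : ∃ l, n = l + 2 := ⟨n - 2, by omega⟩
  have hs : Summable fun d : ℕ => 2 * 2 ^ p * (1 / ((d : ℝ) + 1) ^ 2) := by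
    have := (summable_nat_add_iff 1).2 (Real.summable_one_div_nat_pow.2 one_lt_two)
    push_cast at this
    exact this.mul_left _
  have h0 : ∀ d : ℕ, 0 ≤ 2 * 2 ^ p * (1 / ((d : ℝ) + 1) ^ 2) := fun d => by positivity
  refine ⟨∑' d : ℕ, 2 * 2 ^ p * (1 / ((d : ℝ) + 1) ^ 2), tsum_nonneg h0, fun D => ?_⟩
  refine (Finset.sum_le_sum fun d _ => ?_).trans (hs.sum_le_tsum _ fun d _ => h0 d)
  have h1 : (harmDim (l + 2) d : ℝ) ≤ 2 * ((d : ℝ) + 1) ^ l := by exact_mod_cast harmDim_le l d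
  have h2 : (((d : ℝ) + 1) / 2) ^ p ≤ sphFreq (l + 2) d ^ p := by
    gcongr; exact le_sphFreq hn d
  have hd : (1 : ℝ) ≤ (d : ℝ) + 1 := by linarith [(Nat.cast_nonneg d : (0 : ℝ) ≤ d)]
  calc (harmDim (l + 2) d : ℝ) / sphFreq (l + 2) d ^ p
      ≤ 2 * ((d : ℝ) + 1) ^ l / (((d : ℝ) + 1) / 2) ^ p := by gcongr
    _ = 2 * 2 ^ p * (((d : ℝ) + 1) ^ l / ((d : ℝ) + 1) ^ p) := by
        rw [div_pow]; field_simp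
    _ ≤ 2 * 2 ^ p * (1 / ((d : ℝ) + 1) ^ 2) := by
        refine mul_le_mul_of_nonneg_left ?_ (by positivity)
        rw [div_le_div_iff₀ (by positivity) (by positivity), one_mul, ← pow_add]
        exact pow_le_pow_right₀ hd hp

/-- The Sobolev inequality for partial sums of expansions in spherical harmonics. -/
theorem exists_harmSum_sq_le {n : ℕ} (hn : 2 ≤ n) {p : ℕ} (hp : n ≤ p) :
    ∃ K : ℝ, 0 ≤ K ∧ ∀ (v : L2S n) (D : ℕ) (w : S n), ev (harmSum D v) w ^ 2 ≤
      K * ∑ d ∈ Finset.range D, sphFreq n d ^ p * harmEnergy d v := by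
  obtain ⟨K, hK, hsum⟩ := exists_sum_harmDim_le hn hp
  have : Nonempty (Fin n) := ⟨⟨0, by omega⟩⟩
  have hσ : 0 < (sphereMeasure n).real univ := by
    rw [measureReal_def, ENNReal.toReal_pos_iff]
    exact ⟨(Measure.measure_univ_pos).2 (Measure.toSphere_ne_zero _), measure_lt_top _ _⟩
  refine ⟨K / (sphereMeasure n).real univ, by positivity, fun v D w => ?_⟩
  set Ω := (Finset.range D).sigma fun d => (Finset.univ : Finset (Fin (harmDim n d)))
  have hpos : ∀ d, 0 < sphFreq n d := fun d => zero_lt_one.trans_le (one_le_sphFreq hn d)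
  have e1 : ev (harmSum D v) w =
      ∑ z ∈ Ω, inner ℝ v (polyL2 (harmPoly n z.1 z.2)) * ev (harmPoly n z.1 z.2) w := by
    rw [Finset.sum_sigma]
    simp [harmSum, ev]
  -- Cauchy-Schwarz with the weights μ^{-p} and μ^p. The addition theorem then evaluates the first
  -- factor independently of the point.
  have cs := Finset.sum_sq_le_sum_mul_sum_of_sq_le_mul Ω
    (r := fun z => inner ℝ v (polyL2 (harmPoly n z.1 z.2)) * ev (harmPoly n z.1 z.2) w)
    (f := fun z => ev (harmPoly n z.1 z.2) w ^ 2 / sphFreq n z.1 ^ p)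
    (g := fun z => sphFreq n z.1 ^ p * (inner ℝ v (polyL2 (harmPoly n z.1 z.2)) : ℝ) ^ 2)
    (fun z _ => by have := hpos z.1; positivity) (fun z _ => by have := hpos z.1; positivity)
    (fun z _ => by have := (hpos z.1).ne'; apply le_of_eq; field_simp)
  rw [← e1, Finset.sum_sigma, Finset.sum_sigma] at cs
  refine cs.trans ?_
  simp only [← Finset.mul_sum, ← Finset.sum_div]
  have e2 : ∀ d, (∑ i, ev (harmPoly n d i) w ^ 2) =
      (harmDim n d : ℝ) / (sphereMeasure n).real univ := fun d =>
    (eq_div_iff hσ.ne').2 (sum_sq_harmPoly (by omega) d w)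
  have e3 : ∑ d ∈ Finset.range D, (∑ i, ev (harmPoly n d i) w ^ 2) / sphFreq n d ^ p =
      (∑ d ∈ Finset.range D, (harmDim n d : ℝ) / sphFreq n d ^ p) /
        (sphereMeasure n).real univ := by
    rw [Finset.sum_div]
    exact Finset.sum_congr rfl fun d _ => by rw [e2]; ring
  rw [e3]
  have h4 : 0 ≤ ∑ d ∈ Finset.range D, sphFreq n d ^ p * harmEnergy d v :=
    Finset.sum_nonneg fun d _ => mul_nonneg (pow_nonneg (hpos d).le _) (harmEnergy_nonneg d v)
  exact mul_le_mul_of_nonneg_right (by gcongr; exact hsum D) h4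

/-! ### Integrals over the sphere depending on parameters -/

lemma continuousOn_sphere_integral {n : ℕ} {X : Type*} [TopologicalSpace X]
    [FirstCountableTopology X] [LocallyCompactSpace X] {Ω : Set X} (hΩ : IsOpen Ω)
    {f : X → S n → ℝ} (hf : ContinuousOn (fun z : X × S n => f z.1 z.2) (Ω ×ˢ univ)) :
    ContinuousOn (fun x => ∫ w, f x w ∂(sphereMeasure n)) Ω := by
  have : LocallyCompactSpace Ω := hΩ.locallyCompactSpace
  rw [continuousOn_iff_continuous_domRestrict]
  have h1 : Continuous (fun (x : Ω) (w : S n) => f x w).uncurry :=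
    hf.comp_continuous (by fun_prop : Continuous fun z : Ω × S n => ((z.1 : X), z.2))
      fun z => ⟨z.1.2, mem_univ _⟩
  have := continuous_parametric_integral_of_continuous (μ := sphereMeasure n) h1 isCompact_univ
  simp only [Measure.restrict_univ] at this
  exact this

lemma hasDerivAt_sphere_integral {n : ℕ} {I : Set ℝ} (hI : IsOpen I) {f f' : ℝ → S n → ℝ}
    (hf : ∀ s ∈ I, ∀ w, HasDerivAt (fun s => f s w) (f' s w) s)
    (hc : ∀ s ∈ I, Continuous (f s))
    (hf' : ContinuousOn (fun z : ℝ × S n => f' z.1 z.2) (I ×ˢ univ)) {s₀ : ℝ} (hs : s₀ ∈ I) :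
    HasDerivAt (fun s => ∫ w, f s w ∂(sphereMeasure n)) (∫ w, f' s₀ w ∂(sphereMeasure n)) s₀ := by
  obtain ⟨δ, hδ, hsub⟩ := Metric.nhds_basis_closedBall.mem_iff.1 (hI.mem_nhds hs)
  have hK : IsCompact (Metric.closedBall s₀ δ ×ˢ (univ : Set (S n))) :=
    (isCompact_closedBall _ _).prod isCompact_univ
  obtain ⟨C, hC⟩ := hK.exists_bound_of_continuousOn (hf'.mono (prod_mono_left hsub))
  have hc' : ∀ s ∈ I, Continuous (f' s) := fun s hs =>
    hf'.comp_continuous (by fun_prop : Continuous fun w : S n => (s, w)) fun w => ⟨hs, mem_univ _⟩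
  refine (hasDerivAt_integral_of_dominated_loc_of_deriv_le (bound := fun _ => C)
    (Metric.closedBall_mem_nhds s₀ hδ) ?_ (integrable_sphere (hc s₀ hs))
    (hc' s₀ hs).aestronglyMeasurable (ae_of_all _ fun w s hs' => hC (s, w) ⟨hs', mem_univ _⟩)
    (integrable_const C) (ae_of_all _ fun w s hs' => hf s (hsub hs') w)).2
  filter_upwards [hI.mem_nhds hs] with s hs
  exact (hc s hs).aestronglyMeasurable

/-! ### Coefficients in spherical harmonics -/

/-- The coefficient `∫ h p dΩ` of a function on the sphere. -/
noncomputable def coef {n : ℕ} (h : E n → ℝ) (p : MvPolynomial (Fin n) ℝ) : ℝ :=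
  ∫ w : S n, h w * ev p w ∂(sphereMeasure n)

/-- The square of the norm of the component of degree `d` of a function on the sphere. -/
noncomputable def modeEnergy {n : ℕ} (d : ℕ) (h : E n → ℝ) : ℝ :=
  ∑ i, coef h (harmPoly n d i) ^ 2

lemma modeEnergy_nonneg {n : ℕ} (d : ℕ) (h : E n → ℝ) : 0 ≤ modeEnergy d h :=
  Finset.sum_nonneg fun _ _ => sq_nonneg _

lemma inner_polyL2_eq_coef {n : ℕ} {h : E n → ℝ} (hc : Continuous fun w : S n => h w)
    (p : MvPolynomial (Fin n) ℝ) :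
    inner ℝ (toL2 ⟨fun w : S n => h w, hc⟩) (polyL2 p) = coef h p := inner_polyL2 _ _

lemma harmEnergy_eq_modeEnergy {n : ℕ} {h : E n → ℝ} (hc : Continuous fun w : S n => h w)
    (d : ℕ) : harmEnergy d (toL2 ⟨fun w : S n => h w, hc⟩) = modeEnergy d h := by
  simp only [harmEnergy, modeEnergy, inner_polyL2_eq_coef]

lemma sum_modeEnergy_le {n : ℕ} {h : E n → ℝ} (hc : Continuous fun w : S n => h w) (D : ℕ) :
    ∑ d ∈ Finset.range D, modeEnergy d h ≤ ∫ w : S n, h w ^ 2 ∂(sphereMeasure n) := by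
  have := sum_harmEnergy_le (toL2 ⟨fun w : S n => h w, hc⟩) D
  simp only [harmEnergy_eq_modeEnergy hc, inner_toL2] at this
  simp only [sq]
  exact this

/-- Passage from ordered pairs, natural for the Casimir operator, to the pairs a < b that index the
Killing frame. -/
lemma sum_lt_of_symm {n : ℕ} (G : Fin n → Fin n → ℝ) (h0 : ∀ a, G a a = 0)
    (hs : ∀ a b, G a b = G b a) :
    ∑ a, ∑ b, G a b = 2 * ∑ q : {p : Fin n × Fin n // p.1 < p.2}, G q.1.1 q.1.2 := by
  have e1 : ∑ q : {p : Fin n × Fin n // p.1 < p.2}, G q.1.1 q.1.2 =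
      ∑ a, ∑ b, if a < b then G a b else 0 := by
    rw [← Fintype.sum_prod_type' fun a b => if a < b then G a b else 0, ← Finset.sum_filter]
    exact (Finset.sum_subtype (Finset.univ.filter fun p : Fin n × Fin n => p.1 < p.2)
      (p := fun p => p.1 < p.2) (by simp) fun p => G p.1 p.2).symm
  have e2 : ∑ a, ∑ b, (if a < b then G a b else 0) = ∑ a, ∑ b, if b < a then G a b else 0 := by
    rw [Finset.sum_comm]
    exact Finset.sum_congr rfl fun a _ => Finset.sum_congr rfl fun b _ => by rw [hs]
  rw [two_mul, e1]
  nth_rewrite 2 [e2]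
  rw [← Finset.sum_add_distrib]
  refine Finset.sum_congr rfl fun a _ => ?_
  rw [← Finset.sum_add_distrib]
  refine Finset.sum_congr rfl fun b _ => ?_
  rcases lt_trichotomy a b with h | h | h
  · simp [h, h.not_gt]
  · subst h; simp [h0]
  · simp [h, h.not_gt]

lemma continuous_rot {n : ℕ} (a b : Fin n) {h : E n → ℝ} {U : Set (E n)} (hU : IsOpen U)
    (hSU : Metric.sphere (0 : E n) 1 ⊆ U) (hh : ContDiffOn ℝ 1 h U) :
    Continuous fun w : S n => rot a b h w :=
  ((hh.continuousOn_fderiv_of_isOpen hU le_rfl).comp_continuous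
    continuous_subtype_val fun w : S n => hSU w.2).clm_apply
    ((continuous_rotField a b).comp continuous_subtype_val)

lemma rot_self {n : ℕ} (a : Fin n) (h : E n → ℝ) (x : E n) : rot a a h x = 0 := by
  simp [rot, rotField]

lemma rot_swap {n : ℕ} (a b : Fin n) (h : E n → ℝ) (x : E n) : rot a b h x = -rot b a h x := by
  rw [rot, rot, ← map_neg]
  congr 1
  simp [rotField]

/-- The Dirichlet energy of the component of degree `d`. -/
theorem sum_modeEnergy_rot {n : ℕ} (d : ℕ) {h : E n → ℝ} {U : Set (E n)} (hU : IsOpen U)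
    (hSU : Metric.sphere (0 : E n) 1 ⊆ U) (hh : ContDiffOn ℝ 1 h U) :
    ∑ q : {p : Fin n × Fin n // p.1 < p.2}, modeEnergy d (rot q.1.1 q.1.2 h) =
      sphEigenvalue n d * modeEnergy d h := by
  have hc : Continuous fun w : S n => h w :=
    hh.continuousOn.comp_continuous continuous_subtype_val fun w => hSU w.2
  have hr := fun a b => continuous_rot a b hU hSU hh
  have h1 := sum_harmEnergy_rot d (toL2 ⟨fun w : S n => h w, hc⟩)
    (fun a b => toL2 ⟨fun w : S n => rot a b h w, hr a b⟩) fun a b p => by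
      rw [inner_polyL2_eq_coef, inner_polyL2_eq_coef]
      exact integral_rot_mul a b hU hSU hh p
  simp only [harmEnergy_eq_modeEnergy] at h1
  rw [sum_lt_of_symm] at h1
  · linarith
  · intro a
    simp [modeEnergy, coef, rot_self]
  · intro a b
    have : rot a b h = fun x => -rot b a h x := funext (rot_swap a b h)
    simp [modeEnergy, this, coef, integral_neg]

/-- Spherical harmonics are eigenfunctions of the Laplace operator. -/
theorem sum_coef_rot_rot {n : ℕ} (d : ℕ) (i : Fin (harmDim n d)) {h : E n → ℝ} {U : Set (E n)}
    (hU : IsOpen U) (hSU : Metric.sphere (0 : E n) 1 ⊆ U) (hh : ContDiffOn ℝ 2 h U) :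
    ∑ a, ∑ b, coef (rot a b (rot a b h)) (harmPoly n d i) =
      -(2 * sphEigenvalue n d) * coef h (harmPoly n d i) := by
  have hc : Continuous fun w : S n => h w :=
    hh.continuousOn.comp_continuous continuous_subtype_val fun w => hSU w.2
  have hr : ∀ a b, ContDiffOn ℝ 1 (rot a b h) U := fun a b =>
    (hh.fderiv_of_isOpen hU (by norm_num)).clm_apply (contDiff_rotField a b).contDiffOn
  have e : ∀ a b, coef (rot a b (rot a b h)) (harmPoly n d i) =
      coef h (rotD a b (rotD a b (harmPoly n d i))) := by
    intro a b
    unfold coef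
    rw [integral_rot_mul a b hU hSU (hr a b),
      integral_rot_mul a b hU hSU (hh.of_le (by norm_num)), neg_neg]
  simp only [e, ← inner_polyL2_eq_coef hc, ← inner_sum, ← map_sum]
  rw [← casimir_apply, polyL2_casimir_of_mem_harmonics (harmPoly_mem n d i)
    (polyL2_harmPoly_mem n d i), real_inner_smul_right]

/-! ### Killing derivatives -/

lemma contDiff_killingField {n : ℕ} (Z : KillingIdx n) :
    ContDiff ℝ ∞ (killingField Z : ℝ × E n → ℝ × E n) := by
  rcases Z with _ | q
  · exact contDiff_const
  · have : (killingField (some q) : ℝ × E n → ℝ × E n) =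
        fun p => (0, rotField q.1.1 q.1.2 p.2) := rfl
    rw [this]
    exact contDiff_const.prodMk ((contDiff_rotField _ _).comp contDiff_snd)

lemma contDiffOn_killingDeriv {n : ℕ} {F : ℝ × E n → ℝ} {U : Set (ℝ × E n)} (hU : IsOpen U)
    (hF : ContDiffOn ℝ ∞ F U) (w : List (KillingIdx n)) :
    ContDiffOn ℝ ∞ (killingDeriv w F) U := by
  induction w with
  | nil => exact hF
  | cons Z w ih =>
    exact (ih.fderiv_of_isOpen hU (by simp)).clm_apply (contDiff_killingField Z).contDiffOn

lemma killingDeriv_append {n : ℕ} (w w' : List (KillingIdx n)) (F : ℝ × E n → ℝ) :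
    killingDeriv (w ++ w') F = killingDeriv w (killingDeriv w' F) := by
  simp [killingDeriv, List.foldr_append]

lemma killingDeriv_rot {n : ℕ} {F : ℝ × E n → ℝ} {t : ℝ} {x : E n}
    (hF : DifferentiableAt ℝ F (t, x)) (q : {p : Fin n × Fin n // p.1 < p.2}) :
    killingDeriv [some q] F (t, x) = rot q.1.1 q.1.2 (fun y => F (t, y)) x := by
  have h1 : HasFDerivAt (fun y : E n => (t, y)) (ContinuousLinearMap.inr ℝ ℝ (E n)) x :=
    hasFDerivAt_prodMk_right t x
  have h2 := (hF.hasFDerivAt.comp x h1).fderiv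
  rw [rot, show (fun y => F (t, y)) = F ∘ fun y => (t, y) from rfl, h2]
  rfl

lemma hasDerivAt_killingDeriv {n : ℕ} {F : ℝ × E n → ℝ} {t : ℝ} {x : E n}
    (hF : DifferentiableAt ℝ F (t, x)) :
    HasDerivAt (fun t => F (t, x)) (killingDeriv [none] F (t, x)) t := by
  have h1 : HasDerivAt (fun t : ℝ => (t, x)) (1, 0) t :=
    (hasDerivAt_id t).prodMk (hasDerivAt_const t x)
  exact hF.hasFDerivAt.comp_hasDerivAt t h1

/-- The complement of the axis in `ℝ × ℝⁿ`. -/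
def offAxis (n : ℕ) : Set (ℝ × E n) := {p | p.2 ≠ 0}

lemma isOpen_offAxis (n : ℕ) : IsOpen (offAxis n) :=
  isOpen_ne.preimage continuous_snd

lemma mem_offAxis {n : ℕ} (t : ℝ) (w : S n) : (t, (w : E n)) ∈ offAxis n :=
  ne_zero_of_mem_unit_sphere w

lemma continuous_cyl {n : ℕ} {F : ℝ × E n → ℝ} (hF : ContinuousOn F (offAxis n)) :
    Continuous fun p : ℝ × S n => F (p.1, p.2) :=
  hF.comp_continuous (by fun_prop) fun p => mem_offAxis p.1 p.2

lemma continuous_coef {n : ℕ} {F : ℝ × E n → ℝ} (hF : ContinuousOn F (offAxis n))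
    (p : MvPolynomial (Fin n) ℝ) : Continuous fun t => coef (fun x => F (t, x)) p := by
  rw [← continuousOn_univ]
  refine continuousOn_sphere_integral isOpen_univ (Continuous.continuousOn ?_)
  exact (continuous_cyl hF).mul ((continuous_ev p).comp (by fun_prop))

lemma continuous_modeEnergy {n : ℕ} {F : ℝ × E n → ℝ} (hF : ContinuousOn F (offAxis n))
    (d : ℕ) : Continuous fun t => modeEnergy d fun x => F (t, x) :=
  continuous_finsetSum _ fun _ _ => (continuous_coef hF _).pow 2

/-- Square integrability of all Killing derivatives of order at most `j`. -/
def HasFiniteWords {n : ℕ} (j : ℕ) (F : ℝ × E n → ℝ) : Prop :=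
  ∀ w : List (KillingIdx n), w.length ≤ j →
    ∫⁻ p : ℝ × S n, ENNReal.ofReal (killingDeriv w F (p.1, p.2) ^ 2) ∂(cylMeasure n) < ⊤

lemma HasFiniteWords.mono {n : ℕ} {j j' : ℕ} {F : ℝ × E n → ℝ} (h : HasFiniteWords j F)
    (hj : j' ≤ j) : HasFiniteWords j' F := fun w hw => h w (hw.trans hj)

lemma HasFiniteWords.killingDeriv {n : ℕ} {j : ℕ} {F : ℝ × E n → ℝ}
    {v : List (KillingIdx n)} (h : HasFiniteWords (j + v.length) F) :
    HasFiniteWords j (killingDeriv v F) := by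
  intro w hw
  rw [← killingDeriv_append]
  exact h _ (by rw [List.length_append]; omega)

lemma hasFiniteWords_of_cylSobolevSq {n k : ℕ} {f : ℝ × S n → ℝ} (h : cylSobolevSq k f < ⊤) :
    HasFiniteWords k (rayExtension f) := by
  intro w hw
  have h1 := (ENNReal.sum_lt_top.1 h) w.length (Finset.mem_range.2 (by omega))
  have h2 := (ENNReal.sum_lt_top.1 h1) w.get (Finset.mem_univ _)
  rwa [List.ofFn_get] at h2

/-- For j = 0 this is Bessel's inequality on each sphere, integrated in t. The step from j to j + 1
writes μ² = 1 + λ and trades λ for the rotational derivatives through `sum_modeEnergy_rot`. -/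
theorem exists_sum_modeEnergy_le {n : ℕ} (hn : 2 ≤ n) (j : ℕ) : ∀ {F : ℝ × E n → ℝ},
    ContDiffOn ℝ ∞ F (offAxis n) → HasFiniteWords j F → ∃ B : ℝ≥0∞, B < ⊤ ∧ ∀ D,
      ∑ d ∈ Finset.range D, ∫⁻ t, ENNReal.ofReal
        (sphFreq n d ^ (2 * j) * modeEnergy d fun x => F (t, x)) ≤ B := by
  induction j with
  | zero =>
    intro F hF hw
    refine ⟨_, hw [] le_rfl, fun D => ?_⟩
    have hc := continuous_cyl hF.continuousOn
    rw [← lintegral_finsetSum _ fun d _ => by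
      have := continuous_modeEnergy hF.continuousOn d
      exact (ENNReal.continuous_ofReal.comp (continuous_const.mul this)).measurable]
    rw [cylMeasure, lintegral_prod _ (by
      have : Continuous fun p : ℝ × S n => ENNReal.ofReal (killingDeriv [] F (p.1, p.2) ^ 2) :=
        ENNReal.continuous_ofReal.comp (hc.pow 2)
      exact this.measurable.aemeasurable)]
    refine lintegral_mono fun t => ?_
    have ht : Continuous fun w : S n => F (t, w) := hc.comp (by fun_prop : Continuous fun w => (t, w))
    simp only [mul_zero, pow_zero, one_mul]
    rw [← ENNReal.ofReal_sum_of_nonneg fun d _ => modeEnergy_nonneg d _]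
    refine (ENNReal.ofReal_le_ofReal (sum_modeEnergy_le ht D)).trans ?_
    exact (ofReal_integral_eq_lintegral_ofReal (integrable_sphere (ht.pow 2))
      (ae_of_all _ fun w => sq_nonneg _)).le
  | succ j ih =>
    intro F hF hw
    obtain ⟨B, hB, h1⟩ := ih hF (hw.mono j.le_succ)
    have hF' := fun q => contDiffOn_killingDeriv (isOpen_offAxis n) hF [some q]
    choose B' hB' h2 using fun q => ih (hF' q) (HasFiniteWords.killingDeriv (v := [some q]) hw)
    refine ⟨B + ∑ q, B' q, ENNReal.add_lt_top.2 ⟨hB, ENNReal.sum_lt_top.2 fun q _ => hB' q⟩,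
      fun D => ?_⟩
    have e : ∀ d t, sphFreq n d ^ (2 * (j + 1)) * modeEnergy d (fun x => F (t, x)) =
        sphFreq n d ^ (2 * j) * modeEnergy d (fun x => F (t, x)) +
        ∑ q, sphFreq n d ^ (2 * j) *
          modeEnergy d (fun x => killingDeriv [some q] F (t, x)) := by
      intro d t
      have hs : ContDiffOn ℝ 1 (fun x : E n => F (t, x)) {0}ᶜ :=
        (hF.of_le (by simp)).comp (contDiff_prodMk_right t).contDiffOn fun x hx => hx
      have h3 := sum_modeEnergy_rot d isOpen_compl_singleton
        (fun x hx => ne_zero_of_mem_unit_sphere (⟨x, hx⟩ : S n)) hs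
      have h4 : ∀ q, modeEnergy d (fun x => killingDeriv [some q] F (t, x)) =
          modeEnergy d (rot q.1.1 q.1.2 fun x => F (t, x)) := by
        intro q
        refine Finset.sum_congr rfl fun i _ => ?_
        congr 1
        refine integral_congr_ae (ae_of_all _ fun w => ?_)
        have := killingDeriv_rot ((hF.contDiffAt ((isOpen_offAxis n).mem_nhds
          (mem_offAxis t w))).differentiableAt (by simp)) q
        simp only [this]
      rw [← Finset.mul_sum, Finset.sum_congr rfl fun q _ => h4 q, h3, mul_add, pow_add,
        mul_one, sphFreq_sq hn]
      ring
    calc _ ≤ ∑ d ∈ Finset.range D, ((∫⁻ t, ENNReal.ofReal (sphFreq n d ^ (2 * j) *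
            modeEnergy d (fun x => F (t, x)))) + ∑ q, ∫⁻ t, ENNReal.ofReal
            (sphFreq n d ^ (2 * j) * modeEnergy d (fun x => killingDeriv [some q] F (t, x)))) := by
          refine Finset.sum_le_sum fun d _ => ?_
          have h0 : 0 ≤ sphFreq n d ^ (2 * j) := by unfold sphFreq; positivity
          have m : ∀ {G : ℝ × E n → ℝ}, ContDiffOn ℝ ∞ G (offAxis n) → Measurable fun t =>
              ENNReal.ofReal (sphFreq n d ^ (2 * j) * modeEnergy d fun x => G (t, x)) := by
            intro G hG
            have := continuous_modeEnergy hG.continuousOn d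
            exact (ENNReal.continuous_ofReal.comp (continuous_const.mul this)).measurable
          rw [← lintegral_finsetSum _ fun q _ => m (hF' q), ← lintegral_add_left (m hF)]
          refine lintegral_mono fun t => ?_
          rw [e, ENNReal.ofReal_add (mul_nonneg h0 (modeEnergy_nonneg _ _))
            (Finset.sum_nonneg fun q _ => mul_nonneg h0 (modeEnergy_nonneg _ _)),
            ENNReal.ofReal_sum_of_nonneg fun q _ => mul_nonneg h0 (modeEnergy_nonneg _ _)]
      _ ≤ _ := by
          rw [Finset.sum_add_distrib, Finset.sum_comm]
          exact add_le_add (h1 D) (Finset.sum_le_sum fun q _ => h2 q D)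

end RNdS

namespace RNdS

open Set Filter Topology

/-! ### The d'Alembert operator in the coordinates (t, x) -/

lemma fderiv_norm_self {n : ℕ} {x : E n} (hx : x ≠ 0) :
    fderiv ℝ (fun y : E n => ‖y‖) x x = ‖x‖ := by
  have h1 : DifferentiableAt ℝ (fun y : E n => ‖y‖) x :=
    (contDiffAt_norm ℝ hx (n := 1)).differentiableAt (by norm_num)
  have h3 : HasFDerivAt (fun y : E n => ‖y‖ * ‖y‖) (2 • (innerSL ℝ x)) x := by
    have := (hasStrictFDerivAt_norm_sq x).hasFDerivAt
    simpa only [sq] using this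
  have h4 := congrArg (fun L => L x) ((h1.hasFDerivAt.mul h1.hasFDerivAt).unique h3)
  have : 0 < ‖x‖ := norm_pos_iff.2 hx
  simp at h4
  nlinarith

/-- The radial components `ξ_μ` of the coordinate basis. -/
noncomputable def radialCovector {n : ℕ} (x : E n) (μ : Option (Fin n)) : ℝ :=
  dr x (basisVec μ).2

lemma radialCovector_none {n : ℕ} (x : E n) : radialCovector x none = 0 := by
  simp [radialCovector, dr, basisVec]

lemma radialCovector_some {n : ℕ} (x : E n) (i : Fin n) : radialCovector x (some i) = x i / ‖x‖ := by
  simp [radialCovector, dr, basisVec, EuclideanSpace.inner_single_right]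

lemma sum_radialCovector_sq {n : ℕ} {x : E n} (hx : x ≠ 0) :
    ∑ i, (x i / ‖x‖) ^ 2 = 1 := by
  simp only [div_pow, ← Finset.sum_div, ← EuclideanSpace.real_norm_sq_eq]
  exact div_self (by simpa using hx)

lemma metric_eq {n : ℕ} (M e : ℝ) (p : ℝ × E n) : metric n M e p =
    Matrix.of fun μ ν => (if μ = ν then 1 else 0) +
      (V n M e ‖p.2‖ - 1) * ((if μ = none then 1 else 0) * (if ν = none then 1 else 0)) -
      (1 + 1 / V n M e ‖p.2‖) * (radialCovector p.2 μ * radialCovector p.2 ν) := by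
  ext μ ν
  rcases μ with _ | i <;> rcases ν with _ | j
  · simp [metric, basisVec, dr, radialCovector_none]
  · simp [metric, basisVec, dr, radialCovector_none]
  · simp [metric, basisVec, dr, radialCovector_none]
  · have h1 := radialCovector_some p.2 i
    have h2 := radialCovector_some p.2 j
    unfold radialCovector at *
    simp only [metric, Matrix.of_apply, h1, h2]
    simp [basisVec, EuclideanSpace.inner_single_right, eq_comm]
    ring

/-- The inverse metric. -/
noncomputable def inverseMetric (n : ℕ) (M e : ℝ) (p : ℝ × E n) :
    Matrix (Option (Fin n)) (Option (Fin n)) ℝ :=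
  Matrix.of fun μ ν => (if μ = ν then 1 else 0) +
      (1 / V n M e ‖p.2‖ - 1) * ((if μ = none then 1 else 0) * (if ν = none then 1 else 0)) -
      (1 + V n M e ‖p.2‖) * (radialCovector p.2 μ * radialCovector p.2 ν)

/-- The metric is a perturbation of rank two of the identity, so the determinant reduces to a 2 × 2
one, in which the coefficients V of dt² and -1/V of dr² cancel. In these coordinates the volume
density is therefore 1. -/
lemma det_metric {n : ℕ} {M e : ℝ} {p : ℝ × E n} (hx : p.2 ≠ 0) (hV : V n M e ‖p.2‖ ≠ 0) :
    (metric n M e p).det = -1 := by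
  set v := V n M e ‖p.2‖ with hv
  let A : Matrix (Option (Fin n)) (Fin 2) ℝ := Matrix.of fun μ =>
    ![(v - 1) * (if μ = none then 1 else 0), -(1 + 1 / v) * radialCovector p.2 μ]
  let B : Matrix (Fin 2) (Option (Fin n)) ℝ :=
    Matrix.of ![fun μ => if μ = none then 1 else 0, fun μ => radialCovector p.2 μ]
  have h1 : metric n M e p = 1 + A * B := by
    rw [metric_eq]
    ext μ ν
    simp [A, B, Matrix.mul_apply, Fin.sum_univ_two, Matrix.one_apply, ← hv]
    ring
  have h2 := sum_radialCovector_sq hx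
  rw [h1, Matrix.det_one_add_mul_comm, Matrix.det_fin_two]
  have b00 : (B * A) 0 0 = v - 1 := by
    simp [A, B, Matrix.mul_apply]
  have b01 : (B * A) 0 1 = 0 := by
    simp [A, B, Matrix.mul_apply, radialCovector_none]
  have b11 : (B * A) 1 1 = -(1 + 1 / v) := by
    simp only [A, B, Matrix.mul_apply, Fintype.sum_option, radialCovector_none,
      radialCovector_some, Matrix.of_apply, Matrix.cons_val_one,
      Matrix.cons_val_fin_one]
    have : ∀ i, p.2 i / ‖p.2‖ * (-(1 + 1 / v) * (p.2 i / ‖p.2‖)) =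
      -(1 + 1 / v) * (p.2 i / ‖p.2‖) ^ 2 := fun i => by ring
    simp only [this, ← Finset.mul_sum, h2]
    ring
  simp only [Matrix.add_apply, b00, b01, b11, Matrix.one_apply_eq]
  have : (0 : Fin 2) ≠ 1 := by decide
  rw [Matrix.one_apply_ne this]
  field_simp
  ring

lemma inv_metric {n : ℕ} {M e : ℝ} {p : ℝ × E n} (hx : p.2 ≠ 0) (hV : V n M e ‖p.2‖ ≠ 0) :
    (metric n M e p)⁻¹ = inverseMetric n M e p := by
  refine Matrix.inv_eq_right_inv ?_
  rw [metric_eq, inverseMetric]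
  set v := V n M e ‖p.2‖ with hv
  have h2 := sum_radialCovector_sq hx
  ext μ ν
  rw [Matrix.mul_apply, Fintype.sum_option]
  simp only [Matrix.of_apply, radialCovector_none]
  rcases μ with _ | i <;> rcases ν with _ | j
  · simp [radialCovector_none, hV]
  · simp [radialCovector_none]
  · simp [radialCovector_none]
  · simp only [radialCovector_some]
    have : ∀ k, ((if (some i : Option (Fin n)) = some k then (1 : ℝ) else 0) +
        (v - 1) * ((if (some i : Option (Fin n)) = none then 1 else 0) *
          (if (some k : Option (Fin n)) = none then 1 else 0)) -
        (1 + 1 / v) * (p.2 i / ‖p.2‖ * (p.2 k / ‖p.2‖))) *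
        ((if (some k : Option (Fin n)) = some j then (1 : ℝ) else 0) +
        (1 / v - 1) * ((if (some k : Option (Fin n)) = none then 1 else 0) *
          (if (some j : Option (Fin n)) = none then 1 else 0)) -
        (1 + v) * (p.2 k / ‖p.2‖ * (p.2 j / ‖p.2‖))) =
        (if i = k then (if k = j then (1 : ℝ) else 0) else 0)
        - (if i = k then (1 + v) * (p.2 k / ‖p.2‖ * (p.2 j / ‖p.2‖)) else 0)
        - (if k = j then (1 + 1 / v) * (p.2 i / ‖p.2‖ * (p.2 k / ‖p.2‖)) else 0)
        + (1 + 1 / v) * (1 + v) * (p.2 i / ‖p.2‖) * (p.2 j / ‖p.2‖) * (p.2 k / ‖p.2‖) ^ 2 := by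
      intro k
      simp only [Option.some.injEq, reduceCtorEq, if_false]
      split_ifs <;> ring
    simp only [this, Finset.sum_add_distrib, Finset.sum_sub_distrib, ← Finset.mul_sum, h2,
      Finset.sum_ite_eq, Finset.sum_ite_eq', Finset.mem_univ, if_true]
    simp [Matrix.one_apply]
    field_simp
    ring

lemma sum_smul_basisVec {n : ℕ} (x : E n) :
    ∑ j, x j • (basisVec (some j) : ℝ × E n) = (0, x) := by
  refine Prod.ext ?_ ?_
  · simp [basisVec, Prod.fst_sum]
  · rw [Prod.snd_sum]
    ext i
    simp [basisVec, Finset.sum_apply, Pi.single_apply]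

/-- The region `‖x‖ > r_c`. -/
def outside (n : ℕ) (rc : ℝ) : Set (ℝ × E n) := {p | rc < ‖p.2‖}

lemma isOpen_outside (n : ℕ) (rc : ℝ) : IsOpen (outside n rc) :=
  isOpen_lt continuous_const (by fun_prop)

/-- The d'Alembert operator of the metric in terms of the second derivative. -/
theorem boxOp_metric {n : ℕ} {M e rc : ℝ} {V' : ℝ → ℝ} (h : IsExpanding (V n M e) V' rc)
    {φ : ℝ × E n → ℝ} (hφ : ContDiffOn ℝ ∞ φ (outside n rc)) {P : ℝ × E n}
    (hP : P ∈ outside n rc) :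
    boxOp (metric n M e) φ P =
      fderiv ℝ (fderiv ℝ φ) P (1, 0) (1, 0) / V n M e ‖P.2‖
      + ∑ i : Fin n, fderiv ℝ (fderiv ℝ φ) P (basisVec (some i)) (basisVec (some i))
      - (1 + V n M e ‖P.2‖) / ‖P.2‖ ^ 2 * fderiv ℝ (fderiv ℝ φ) P (0, P.2) (0, P.2)
      - (V' ‖P.2‖ / ‖P.2‖ + (n - 1) * (1 + V n M e ‖P.2‖) / ‖P.2‖ ^ 2) *
        fderiv ℝ φ P (0, P.2) := by
  set W := V n M e with hW
  have hn0 : ∀ {q : ℝ × E n}, q ∈ outside n rc → q.2 ≠ 0 := fun {q} hq =>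
    norm_pos_iff.1 (h.pos_of_lt hq)
  -- Since |det g| = 1, the operator is the plain divergence of the gradient raised by the inverse
  -- metric.
  have hpart : ∀ {q : ℝ × E n}, q ∈ outside n rc → ∀ μ,
      √|(metric n M e q).det| * ∑ ν, (metric n M e q)⁻¹ μ ν * partialDeriv ν φ q =
        ∑ ν, inverseMetric n M e q μ ν * fderiv ℝ φ q (basisVec ν) := by
    intro q hq μ
    have hV : V n M e ‖q.2‖ ≠ 0 := (h.pos hq).ne'
    rw [det_metric (hn0 hq) hV, inv_metric (hn0 hq) hV]
    simp [partialDeriv]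
  have hnone : ∀ {q : ℝ × E n}, q ∈ outside n rc →
      ∑ ν, inverseMetric n M e q none ν * fderiv ℝ φ q (basisVec ν) =
        (W ‖q.2‖)⁻¹ * fderiv ℝ φ q (1, 0) := by
    intro q hq
    rw [Fintype.sum_option]
    simp [inverseMetric, radialCovector_none, basisVec, hW]
  have hsome : ∀ {q : ℝ × E n}, q ∈ outside n rc → ∀ i,
      ∑ ν, inverseMetric n M e q (some i) ν * fderiv ℝ φ q (basisVec ν) =
        fderiv ℝ φ q (basisVec (some i)) -
          (1 + W ‖q.2‖) / ‖q.2‖ ^ 2 * fderiv ℝ φ q (0, q.2) * q.2 i := by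
    intro q hq i
    rw [Fintype.sum_option]
    simp only [inverseMetric, Matrix.of_apply, radialCovector_none, radialCovector_some]
    have : ∀ j, ((if (some i : Option (Fin n)) = some j then (1 : ℝ) else 0) +
        (1 / V n M e ‖q.2‖ - 1) * ((if (some i : Option (Fin n)) = none then 1 else 0) *
          (if (some j : Option (Fin n)) = none then 1 else 0)) -
        (1 + V n M e ‖q.2‖) * (q.2 i / ‖q.2‖ * (q.2 j / ‖q.2‖))) *
          fderiv ℝ φ q (basisVec (some j)) =
        (if i = j then fderiv ℝ φ q (basisVec (some j)) else 0) -
          (1 + W ‖q.2‖) / ‖q.2‖ ^ 2 * q.2 i * (q.2 j * fderiv ℝ φ q (basisVec (some j))) := by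
      intro j
      simp only [Option.some.injEq, reduceCtorEq, if_false, ← hW]
      have := norm_ne_zero_iff.2 (hn0 hq)
      split_ifs <;> field_simp <;> ring
    simp only [this, Finset.sum_sub_distrib, Finset.sum_ite_eq, Finset.mem_univ, if_true,
      ← Finset.mul_sum]
    have e1 : ∑ j, q.2 j * fderiv ℝ φ q (basisVec (some j)) = fderiv ℝ φ q (0, q.2) := by
      rw [← sum_smul_basisVec, map_sum]
      simp
    rw [e1]
    simp
    ring
  have hev : ∀ᶠ q in 𝓝 P, q ∈ outside n rc := (isOpen_outside n rc).mem_nhds hP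
  have hr := h.pos_of_lt hP
  have hrne : ‖P.2‖ ≠ 0 := hr.ne'
  have hVpos := h.pos hP
  -- derivatives
  have hD : HasFDerivAt (fderiv ℝ φ) (fderiv ℝ (fderiv ℝ φ) P) P := by
    have := (hφ.fderiv_of_isOpen (m := ∞) (isOpen_outside n rc) (by simp)).contDiffAt
      ((isOpen_outside n rc).mem_nhds hP)
    exact (this.differentiableAt (by simp)).hasFDerivAt
  set H := fderiv ℝ (fderiv ℝ φ) P with hH
  obtain ⟨N, hN, hNx, hNt⟩ : ∃ N : ℝ × E n →L[ℝ] ℝ,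
      HasFDerivAt (fun q : ℝ × E n => ‖q.2‖) N P ∧ N (0, P.2) = ‖P.2‖ ∧ N (1, 0) = 0 := by
    have h1 : DifferentiableAt ℝ (fun y : E n => ‖y‖) P.2 :=
      (contDiffAt_norm ℝ (hn0 hP) (n := 1)).differentiableAt (by norm_num)
    refine ⟨_, h1.hasFDerivAt.comp P hasFDerivAt_snd, ?_, ?_⟩
    · simpa using fderiv_norm_self (hn0 hP)
    · simp
  have hWd := (h.hasDerivAt _ (h.rc_pos.trans hP))
  have hWN := hWd.comp_hasFDerivAt P hN
  have hconst : ∀ v : ℝ × E n, HasFDerivAt (fun q => fderiv ℝ φ q v)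
      ((ContinuousLinearMap.apply ℝ ℝ v).comp H) P := fun v =>
    (ContinuousLinearMap.apply ℝ ℝ v).hasFDerivAt.comp P hD
  have hrad : HasFDerivAt (fun q : ℝ × E n => ((0 : ℝ), q.2))
      ((0 : ℝ × E n →L[ℝ] ℝ).prod (ContinuousLinearMap.snd ℝ ℝ (E n))) P :=
    (hasFDerivAt_const 0 P).prodMk hasFDerivAt_snd
  have hDx := hD.clm_apply hrad
  have hk : HasDerivAt (fun r => (1 + W r) / r ^ 2)
      (V' ‖P.2‖ / ‖P.2‖ ^ 2 - 2 * (1 + W ‖P.2‖) / ‖P.2‖ ^ 3) ‖P.2‖ := by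
    convert! (hWd.const_add 1).div (hasDerivAt_pow 2 ‖P.2‖) (by positivity) using 1
    field_simp
    ring
  have hg := (hk.comp_hasFDerivAt P hN).mul hDx
  obtain ⟨G, hG⟩ : ∃ G, G = ((1 + W ‖P.2‖) / ‖P.2‖ ^ 2) • (((fderiv ℝ φ P).comp
      ((0 : ℝ × E n →L[ℝ] ℝ).prod (ContinuousLinearMap.snd ℝ ℝ (E n)))) + H.flip (0, P.2)) +
      (fderiv ℝ φ P (0, P.2)) •
      ((V' ‖P.2‖ / ‖P.2‖ ^ 2 - 2 * (1 + W ‖P.2‖) / ‖P.2‖ ^ 3) • N) := ⟨_, rfl⟩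
  have hg' : HasFDerivAt (fun q : ℝ × E n => (1 + W ‖q.2‖) / ‖q.2‖ ^ 2 * fderiv ℝ φ q (0, q.2))
      G P := by rw [hG]; exact hg
  have hcoord : ∀ i, HasFDerivAt (fun q : ℝ × E n => q.2 i)
      ((EuclideanSpace.proj i : E n →L[ℝ] ℝ).comp (ContinuousLinearMap.snd ℝ ℝ (E n))) P :=
    fun i => (EuclideanSpace.proj i : E n →L[ℝ] ℝ).hasFDerivAt.comp P hasFDerivAt_snd
  have dnone : partialDeriv none (fun q => √|(metric n M e q).det| *
      ∑ ν, (metric n M e q)⁻¹ none ν * partialDeriv ν φ q) P =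
      H (1, 0) (1, 0) / W ‖P.2‖ := by
    have heq : (fun q => √|(metric n M e q).det| *
        ∑ ν, (metric n M e q)⁻¹ none ν * partialDeriv ν φ q) =ᶠ[𝓝 P]
        fun q => (W ‖q.2‖)⁻¹ * fderiv ℝ φ q (1, 0) := by
      filter_upwards [hev] with q hq
      rw [hpart hq, hnone hq]
    have h1 := ((hasDerivAt_inv hVpos.ne').comp_hasFDerivAt P hWN).mul (hconst (1, 0))
    rw [partialDeriv, heq.fderiv_eq]
    have h2 : fderiv ℝ (fun q => (W ‖q.2‖)⁻¹ * fderiv ℝ φ q (1, 0)) P = _ := h1.fderiv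
    rw [h2]
    simp [basisVec, hNt]
    field_simp
  have dsome : ∀ i, partialDeriv (some i) (fun q => √|(metric n M e q).det| *
      ∑ ν, (metric n M e q)⁻¹ (some i) ν * partialDeriv ν φ q) P =
      H (basisVec (some i)) (basisVec (some i)) - (P.2 i * G (basisVec (some i)) +
        (1 + W ‖P.2‖) / ‖P.2‖ ^ 2 * fderiv ℝ φ P (0, P.2)) := by
    intro i
    have heq : (fun q => √|(metric n M e q).det| *
        ∑ ν, (metric n M e q)⁻¹ (some i) ν * partialDeriv ν φ q) =ᶠ[𝓝 P]
        fun q => fderiv ℝ φ q (basisVec (some i)) -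
          (1 + W ‖q.2‖) / ‖q.2‖ ^ 2 * fderiv ℝ φ q (0, q.2) * q.2 i := by
      filter_upwards [hev] with q hq
      rw [hpart hq, hsome hq]
    have h1 := (hconst (basisVec (some i))).sub (hg'.mul (hcoord i))
    rw [partialDeriv, heq.fderiv_eq]
    have h2 : fderiv ℝ (fun q => fderiv ℝ φ q (basisVec (some i)) -
          (1 + W ‖q.2‖) / ‖q.2‖ ^ 2 * fderiv ℝ φ q (0, q.2) * q.2 i) P = _ := h1.fderiv
    rw [h2]
    simp [basisVec]
    ring
  rw [boxOp, Fintype.sum_option, dnone, Finset.sum_congr rfl fun i _ => dsome i,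
    det_metric (hn0 hP) hVpos.ne']
  -- The divergence of a radial vector field contracts the derivative of its coefficient with x, so
  -- only the radial derivative enters.
  have hsumG : ∑ i, P.2 i * G (basisVec (some i)) = G (0, P.2) := by
    rw [← sum_smul_basisVec, map_sum]
    simp
  simp only [Finset.sum_sub_distrib, Finset.sum_add_distrib, hsumG, Finset.sum_const,
    Finset.card_univ, Fintype.card_fin, nsmul_eq_mul]
  have hGx : G (0, P.2) = (1 + W ‖P.2‖) / ‖P.2‖ ^ 2 * (fderiv ℝ φ P (0, P.2) +
      H (0, P.2) (0, P.2)) + fderiv ℝ φ P (0, P.2) *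
      ((V' ‖P.2‖ / ‖P.2‖ ^ 2 - 2 * (1 + W ‖P.2‖) / ‖P.2‖ ^ 3) * ‖P.2‖) := by
    rw [hG]
    simp [hNx]
    ring
  rw [hGx]
  simp
  field_simp
  ring

lemma two_le_infty : (2 : WithTop ℕ∞) ≤ ((⊤ : ℕ∞) : WithTop ℕ∞) :=
  ENat.LEInfty.out

lemma rot_comp_smul {n : ℕ} (a b : Fin n) (ψ : E n → ℝ) (r : ℝ) :
    rot a b (fun y => ψ (r • y)) = fun x => rot a b ψ (r • x) := by
  ext x
  rw [rot, rot, rotField_smul, map_smul]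
  have := fderiv_comp_smul (𝕜 := ℝ) (f := ψ) (x := x) r
  rw [this]
  rfl

lemma sum_sum_rotField {n : ℕ} (x : E n) :
    ∑ a, ∑ b, rotField a b (rotField a b x) = -(2 * ((n : ℝ) - 1)) • x := by
  have e : ∀ a b : Fin n, rotField a b (rotField a b x) =
      (if a = b then (2 * x a) • EuclideanSpace.single a (1 : ℝ) else 0) -
        x b • EuclideanSpace.single b 1 - x a • EuclideanSpace.single a 1 := by
    intro a b
    have e1 := rotField_eq_sum a b (rotField a b x)
    rw [e1]
    by_cases h : a = b
    · subst h; simp [rotField, two_mul, add_smul]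
    · simp [rotField, h, Ne.symm h]
  have e2 : ∑ a, x a • EuclideanSpace.single a (1 : ℝ) = x := by
    ext i; simp [Finset.sum_apply, Pi.single_apply]
  simp only [e, Finset.sum_sub_distrib, Finset.sum_ite_eq, Finset.mem_univ, if_true, e2,
    Finset.sum_const, Finset.card_univ, Fintype.card_fin, mul_smul, ← Finset.smul_sum,
    ← Nat.cast_smul_eq_nsmul ℝ]
  module

/-- The sum of the squares of the rotation fields in terms of the second derivative. -/
theorem sum_rot_rot {n : ℕ} {ψ : E n → ℝ} {U : Set (E n)} (hU : IsOpen U)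
    (hψ : ContDiffOn ℝ 2 ψ U) {x : E n} (hx : x ∈ U) :
    ∑ a, ∑ b, rot a b (rot a b ψ) x =
      2 * ‖x‖ ^ 2 * ∑ i, fderiv ℝ (fderiv ℝ ψ) x (EuclideanSpace.single i 1)
        (EuclideanSpace.single i 1)
      - 2 * fderiv ℝ (fderiv ℝ ψ) x x x - 2 * ((n : ℝ) - 1) * fderiv ℝ ψ x x := by
  have hD : HasFDerivAt (fderiv ℝ ψ) (fderiv ℝ (fderiv ℝ ψ) x) x :=
    (((hψ.fderiv_of_isOpen (m := 1) hU (by norm_num)).contDiffAt (hU.mem_nhds hx)).differentiableAt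
      (by norm_num)).hasFDerivAt
  set H := fderiv ℝ (fderiv ℝ ψ) x
  have hlin : ∀ a b : Fin n, IsLinearMap ℝ (rotField a b : E n → E n) := by
    intro a b
    refine ⟨fun u v => ?_, fun c u => rotField_smul a b c u⟩
    ext i
    simp [rotField]
    split_ifs <;> ring
  have hR : ∀ a b : Fin n, HasFDerivAt (rotField a b : E n → E n)
      (LinearMap.toContinuousLinearMap (hlin a b).mk') x := fun a b =>
    (LinearMap.toContinuousLinearMap (hlin a b).mk').hasFDerivAt
  have e1 : ∀ a b, rot a b (rot a b ψ) x = H (rotField a b x) (rotField a b x) +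
      fderiv ℝ ψ x (rotField a b (rotField a b x)) := by
    intro a b
    have h1 := (hD.clm_apply (hR a b)).fderiv
    have h2 : fderiv ℝ (rot a b ψ) x = _ := h1
    rw [rot, h2]
    simp [add_comm]
  have e2 : ∀ a b, H (rotField a b x) (rotField a b x) =
      x a * x a * H (EuclideanSpace.single b 1) (EuclideanSpace.single b 1) +
      x b * x b * H (EuclideanSpace.single a 1) (EuclideanSpace.single a 1) -
      x a * x b * H (EuclideanSpace.single b 1) (EuclideanSpace.single a 1) -
      x b * x a * H (EuclideanSpace.single a 1) (EuclideanSpace.single b 1) := by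
    intro a b
    rw [rotField_eq_sum]
    simp
    ring
  have e3 : ∑ a, x a • EuclideanSpace.single a (1 : ℝ) = x := by
    ext i; simp [Finset.sum_apply, Pi.single_apply]
  have e4 : H x x = ∑ a, ∑ b, x a * x b * H (EuclideanSpace.single a 1)
      (EuclideanSpace.single b 1) := by
    conv_lhs => rw [← e3]
    simp only [map_sum, map_smul, sum_apply, smul_apply, smul_eq_mul, Finset.mul_sum]
    rw [Finset.sum_comm]
    exact Finset.sum_congr rfl fun a _ => Finset.sum_congr rfl fun b _ => by ring
  have e5 : ∑ a, ∑ b, x a * x b * H (EuclideanSpace.single b 1)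
      (EuclideanSpace.single a 1) = H x x := by
    rw [e4, Finset.sum_comm]
    exact Finset.sum_congr rfl fun a _ => Finset.sum_congr rfl fun b _ => by ring
  have e6 : ∑ a, ∑ b, x b * x a * H (EuclideanSpace.single a 1)
      (EuclideanSpace.single b 1) = H x x := by
    rw [e4]
    exact Finset.sum_congr rfl fun a _ => Finset.sum_congr rfl fun b _ => by ring
  have e7 : ∑ a, ∑ b, fderiv ℝ ψ x (rotField a b (rotField a b x)) =
      -(2 * ((n : ℝ) - 1)) * fderiv ℝ ψ x x := by
    rw [← smul_eq_mul, ← map_smul, ← sum_sum_rotField]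
    simp only [map_sum]
  simp only [e1, Finset.sum_add_distrib, e7, e2, Finset.sum_sub_distrib, e5, e6,
    ← Finset.mul_sum, ← Finset.sum_mul]
  have e8 : ∑ a, x a * x a = ‖x‖ ^ 2 := by
    rw [EuclideanSpace.real_norm_sq_eq]; simp only [sq]
  rw [e8]
  ring

/-! ### Solutions: time derivatives and polar coordinates -/

/-- A smooth solution of the Klein-Gordon equation in the region `‖x‖ > r_c`. -/
structure IsKleinGordon {n : ℕ} (W W' : ℝ → ℝ) (rc m : ℝ) (φ : ℝ × E n → ℝ) : Prop where
  contDiffOn : ContDiffOn ℝ ∞ φ (outside n rc)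
  eq : ∀ P ∈ outside n rc, fderiv ℝ (fderiv ℝ φ) P (1, 0) (1, 0) / W ‖P.2‖
      + ∑ i : Fin n, fderiv ℝ (fderiv ℝ φ) P (basisVec (some i)) (basisVec (some i))
      - (1 + W ‖P.2‖) / ‖P.2‖ ^ 2 * fderiv ℝ (fderiv ℝ φ) P (0, P.2) (0, P.2)
      - (W' ‖P.2‖ / ‖P.2‖ + (n - 1) * (1 + W ‖P.2‖) / ‖P.2‖ ^ 2) *
        fderiv ℝ φ P (0, P.2) = m ^ 2 * φ P

namespace IsKleinGordon

variable {n : ℕ} {W W' : ℝ → ℝ} {rc m : ℝ} {φ : ℝ × E n → ℝ}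

lemma contDiffOn_fderiv (h : IsKleinGordon W W' rc m φ) :
    ContDiffOn ℝ ∞ (fderiv ℝ φ) (outside n rc) :=
  h.contDiffOn.fderiv_of_isOpen (isOpen_outside n rc) (by simp)

lemma contDiffOn_fderiv₂ (h : IsKleinGordon W W' rc m φ) :
    ContDiffOn ℝ ∞ (fderiv ℝ (fderiv ℝ φ)) (outside n rc) :=
  h.contDiffOn_fderiv.fderiv_of_isOpen (isOpen_outside n rc) (by simp)

lemma hasFDerivAt (h : IsKleinGordon W W' rc m φ) {P : ℝ × E n} (hP : P ∈ outside n rc) :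
    HasFDerivAt φ (fderiv ℝ φ P) P :=
  ((h.contDiffOn.contDiffAt ((isOpen_outside n rc).mem_nhds hP)).differentiableAt
    (by simp)).hasFDerivAt

lemma hasFDerivAt₂ (h : IsKleinGordon W W' rc m φ) {P : ℝ × E n} (hP : P ∈ outside n rc) :
    HasFDerivAt (fderiv ℝ φ) (fderiv ℝ (fderiv ℝ φ) P) P :=
  ((h.contDiffOn_fderiv.contDiffAt ((isOpen_outside n rc).mem_nhds hP)).differentiableAt
    (by simp)).hasFDerivAt

lemma hasFDerivAt₃ (h : IsKleinGordon W W' rc m φ) {P : ℝ × E n} (hP : P ∈ outside n rc) :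
    HasFDerivAt (fderiv ℝ (fderiv ℝ φ)) (fderiv ℝ (fderiv ℝ (fderiv ℝ φ)) P) P :=
  ((h.contDiffOn_fderiv₂.contDiffAt ((isOpen_outside n rc).mem_nhds hP)).differentiableAt
    (by simp)).hasFDerivAt

lemma symm (h : IsKleinGordon W W' rc m φ) {P : ℝ × E n} (hP : P ∈ outside n rc)
    (u v : ℝ × E n) : fderiv ℝ (fderiv ℝ φ) P u v = fderiv ℝ (fderiv ℝ φ) P v u :=
  (h.contDiffOn.contDiffAt ((isOpen_outside n rc).mem_nhds hP)).isSymmSndFDerivAt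
    (by simpa using two_le_infty) u v

lemma symm₃ (h : IsKleinGordon W W' rc m φ) {P : ℝ × E n} (hP : P ∈ outside n rc)
    (u v : ℝ × E n) : fderiv ℝ (fderiv ℝ (fderiv ℝ φ)) P u v =
      fderiv ℝ (fderiv ℝ (fderiv ℝ φ)) P v u :=
  (h.contDiffOn_fderiv.contDiffAt ((isOpen_outside n rc).mem_nhds hP)).isSymmSndFDerivAt
    (by simpa using two_le_infty) u v

/-- The time derivative of a solution is a solution. -/
theorem timeDeriv (h : IsKleinGordon W W' rc m φ) :
    IsKleinGordon W W' rc m fun q => fderiv ℝ φ q (1, 0) := by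
  have hO := isOpen_outside n rc
  have h1 : ∀ q ∈ outside n rc, fderiv ℝ (fun q => fderiv ℝ φ q (1, 0)) q =
      fderiv ℝ (fderiv ℝ φ) q (1, 0) := by
    intro q hq
    have := ((h.hasFDerivAt₂ hq).clm_apply (hasFDerivAt_const (1, 0) q)).fderiv
    rw [this]
    ext v <;> simp [h.symm hq _ (1, 0)]
  have h2 : ∀ q ∈ outside n rc, ∀ u v, fderiv ℝ (fderiv ℝ fun q => fderiv ℝ φ q (1, 0)) q u v =
      fderiv ℝ (fderiv ℝ (fderiv ℝ φ)) q (1, 0) u v := by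
    intro q hq u v
    have e : (fderiv ℝ fun q => fderiv ℝ φ q (1, 0)) =ᶠ[𝓝 q]
        fun q => fderiv ℝ (fderiv ℝ φ) q (1, 0) := by
      filter_upwards [hO.mem_nhds hq] with q hq using h1 q hq
    rw [e.fderiv_eq, ((h.hasFDerivAt₃ hq).clm_apply (hasFDerivAt_const (1, 0) q)).fderiv,
      h.symm₃ hq (1, 0) u]
    simp
  refine ⟨h.contDiffOn_fderiv.clm_apply contDiffOn_const, ?_⟩
  rintro ⟨t, x⟩ hP
  simp only [h1 _ hP, h2 _ hP]
  -- The coefficients depend on ‖x‖ only, so the equation may be differentiated along this line.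
  -- Symmetry of the second and third derivatives has brought the direction (1, 0) to the front.
  have hline : HasDerivAt (fun s : ℝ => (s, x)) (1, 0) t :=
    (hasDerivAt_id t).prodMk (hasDerivAt_const t x)
  have d3 : ∀ u v, HasDerivAt (fun s : ℝ => fderiv ℝ (fderiv ℝ φ) (s, x) u v)
      (fderiv ℝ (fderiv ℝ (fderiv ℝ φ)) (t, x) (1, 0) u v) t := by
    intro u v
    have := (((h.hasFDerivAt₃ hP).clm_apply (hasFDerivAt_const u _)).clm_apply
      (hasFDerivAt_const v _)).comp_hasDerivAt t hline
    exact this.congr_deriv (by simp)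
  have d2 : ∀ u, HasDerivAt (fun s : ℝ => fderiv ℝ φ (s, x) u)
      (fderiv ℝ (fderiv ℝ φ) (t, x) (1, 0) u) t := by
    intro u
    have := ((h.hasFDerivAt₂ hP).clm_apply (hasFDerivAt_const u _)).comp_hasDerivAt t hline
    exact this.congr_deriv (by simp)
  have d1 : HasDerivAt (fun s : ℝ => φ (s, x)) (fderiv ℝ φ (t, x) (1, 0)) t :=
    (h.hasFDerivAt hP).comp_hasDerivAt t hline
  have dl := ((((d3 (1, 0) (1, 0)).div_const (W ‖x‖)).add (HasDerivAt.fun_sum (u := Finset.univ)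
    fun i _ => d3 (basisVec (some i)) (basisVec (some i)))).sub
    ((d3 (0, x) (0, x)).const_mul ((1 + W ‖x‖) / ‖x‖ ^ 2))).sub
    ((d2 (0, x)).const_mul (W' ‖x‖ / ‖x‖ + (n - 1) * (1 + W ‖x‖) / ‖x‖ ^ 2))
  refine dl.unique ((d1.const_mul (m ^ 2)).congr_of_eventuallyEq (Eventually.of_forall fun s => ?_))
  exact h.eq (s, x) hP

/-- The Klein-Gordon equation in polar coordinates. -/
theorem eq_polar (h : IsKleinGordon W W' rc m φ) (hrc : 0 < rc) (hW : ∀ r, rc < r → 0 < W r)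
    {t r : ℝ} (hr : rc < r) (w : S n) :
    fderiv ℝ (fderiv ℝ φ) (t, r • (w : E n)) (1, 0) (1, 0) =
      W r ^ 2 * fderiv ℝ (fderiv ℝ φ) (t, r • (w : E n)) (0, w) (0, w) +
      (W r * W' r + (n - 1) * W r ^ 2 / r) * fderiv ℝ φ (t, r • (w : E n)) (0, w) +
      (-(W r / (2 * r ^ 2)) * ∑ a, ∑ b, rot a b (rot a b fun x => φ (t, r • x)) w +
      W r * m ^ 2 * φ (t, r • (w : E n))) := by
  have hr0 := hrc.trans hr
  have hn : ‖r • (w : E n)‖ = r := by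
    rw [norm_smul, norm_eq_of_mem_sphere, mul_one, Real.norm_of_nonneg hr0.le]
  have hP : (t, r • (w : E n)) ∈ outside n rc := by
    change rc < ‖r • (w : E n)‖
    rwa [hn]
  have e0 : ∀ c : ℝ, ∀ x : E n, ((0 : ℝ), c • x) = c • ((0 : ℝ), x) := by
    intro c x; simp
  have hwave := h.eq _ hP
  simp only [hn, e0, map_smul, smul_apply, smul_eq_mul] at hwave
  set U : Set (E n) := {x | rc < ‖x‖} with hUdef
  have hU : IsOpen U := isOpen_lt continuous_const continuous_norm
  have hψ : ContDiffOn ℝ 2 (fun x => φ (t, x)) U :=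
    (h.contDiffOn.of_le two_le_infty).comp (contDiff_prodMk_right t).contDiffOn
      fun x hx => hx
  have hxU : r • (w : E n) ∈ U := hP
  have e1 : ∀ a b, rot a b (rot a b fun x => φ (t, r • x)) w =
      rot a b (rot a b fun x => φ (t, x)) (r • (w : E n)) := by
    intro a b
    rw [rot_comp_smul a b (fun x => φ (t, x)) r, rot_comp_smul]
  have d1 : ∀ y ∈ U, ∀ v, fderiv ℝ (fun x => φ (t, x)) y v = fderiv ℝ φ (t, y) (0, v) := by
    intro y hy v
    have := ((h.hasFDerivAt (P := (t, y)) hy).comp y (hasFDerivAt_prodMk_right t y)).fderiv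
    rw [show (fun x => φ (t, x)) = φ ∘ fun x => (t, x) from rfl, this]
    rfl
  have d2 : ∀ y ∈ U, ∀ u v, fderiv ℝ (fderiv ℝ fun x => φ (t, x)) y u v =
      fderiv ℝ (fderiv ℝ φ) (t, y) (0, u) (0, v) := by
    intro y hy u v
    have e : (fderiv ℝ fun x => φ (t, x)) =ᶠ[𝓝 y]
        fun y => (fderiv ℝ φ (t, y)).comp (ContinuousLinearMap.inr ℝ ℝ (E n)) := by
      filter_upwards [hU.mem_nhds hy] with y hy
      ext v
      simp [d1 y hy]
    have h3 := (h.hasFDerivAt₂ (P := (t, y)) hy).comp y (hasFDerivAt_prodMk_right t y)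
    have h4 := (h3.clm_comp (hasFDerivAt_const (ContinuousLinearMap.inr ℝ ℝ (E n)) y)).fderiv
    rw [e.fderiv_eq]
    have h5 : fderiv ℝ (fun y => (fderiv ℝ φ (t, y)).comp
      (ContinuousLinearMap.inr ℝ ℝ (E n))) y = _ := h4
    rw [h5]
    simp
  -- This eliminates the flat Laplacian in favour of the rotational one. The factor 2 in the
  -- denominator of the claim comes from summing over ordered pairs.
  have hlap := sum_rot_rot hU hψ hxU
  simp only [e1]
  simp only [d2 _ hxU, d1 _ hxU, hn, e0, map_smul, smul_apply, smul_eq_mul] at hlap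
  rw [hlap]
  have e2 : ∀ i : Fin n, (basisVec (some i) : ℝ × E n) = (0, EuclideanSpace.single i 1) :=
    fun i => rfl
  simp only [e2] at hwave
  have hWr := (hW r hr).ne'
  have hr1 := hr0.ne'
  set X := fderiv ℝ (fderiv ℝ φ) (t, r • (w : E n)) (1, 0) (1, 0)
  have hX := (sub_eq_iff_eq_add.1 (sub_eq_iff_eq_add.1 hwave))
  rw [← eq_sub_iff_add_eq, div_eq_iff hWr] at hX
  rw [hX]
  field_simp
  ring

end IsKleinGordon

end RNdS

namespace RNdS

open Set Filter Topology MvPolynomial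

/-! ### Projection of the equation and of the horizon data on spherical harmonics -/

lemma hasPartials_sphere_integral {n : ℕ} {Ω : Set (ℝ × ℝ)} (hΩ : IsOpen Ω)
    {f f₁ f₂ : ℝ → ℝ → S n → ℝ}
    (hc : ContinuousOn (fun z : (ℝ × ℝ) × S n => f z.1.1 z.1.2 z.2) (Ω ×ˢ univ))
    (hc₁ : ContinuousOn (fun z : (ℝ × ℝ) × S n => f₁ z.1.1 z.1.2 z.2) (Ω ×ˢ univ))
    (hc₂ : ContinuousOn (fun z : (ℝ × ℝ) × S n => f₂ z.1.1 z.1.2 z.2) (Ω ×ˢ univ))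
    (h₁ : ∀ x y w, (x, y) ∈ Ω → HasDerivAt (fun x => f x y w) (f₁ x y w) x)
    (h₂ : ∀ x y w, (x, y) ∈ Ω → HasDerivAt (fun y => f x y w) (f₂ x y w) y) :
    HasPartials (fun x y => ∫ w, f x y w ∂(sphereMeasure n))
      (fun x y => ∫ w, f₁ x y w ∂(sphereMeasure n))
      (fun x y => ∫ w, f₂ x y w ∂(sphereMeasure n)) Ω where
  fst x y hxy := by
    have hI : IsOpen {x | (x, y) ∈ Ω} := hΩ.preimage (by fun_prop)
    refine hasDerivAt_sphere_integral hI (f := fun x w => f x y w) (f' := fun x w => f₁ x y w)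
      (fun s hs w => h₁ s y w hs) (fun s hs => ?_) ?_ hxy
    · exact hc.comp_continuous (by fun_prop : Continuous fun w : S n => ((s, y), w))
        fun w => ⟨hs, mem_univ _⟩
    · exact hc₁.comp (by fun_prop : Continuous fun z : ℝ × S n => ((z.1, y), z.2)).continuousOn
        fun z hz => ⟨hz.1, mem_univ _⟩
  snd x y hxy := by
    have hI : IsOpen {y | (x, y) ∈ Ω} := hΩ.preimage (by fun_prop)
    refine hasDerivAt_sphere_integral hI (f := fun y w => f x y w) (f' := fun y w => f₂ x y w)
      (fun s hs w => h₂ x s w hs) (fun s hs => ?_) ?_ hxy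
    · exact hc.comp_continuous (by fun_prop : Continuous fun w : S n => ((x, s), w))
        fun w => ⟨hs, mem_univ _⟩
    · exact hc₂.comp (by fun_prop : Continuous fun z : ℝ × S n => ((x, z.1), z.2)).continuousOn
        fun z hz => ⟨hz.1, mem_univ _⟩
  cont := continuousOn_sphere_integral hΩ hc
  cont_fst := continuousOn_sphere_integral hΩ hc₁
  cont_snd := continuousOn_sphere_integral hΩ hc₂

lemma coef_add {n : ℕ} {f g : E n → ℝ} (p : MvPolynomial (Fin n) ℝ)
    (hf : Continuous fun w : S n => f w) (hg : Continuous fun w : S n => g w) :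
    coef (fun x => f x + g x) p = coef f p + coef g p := by
  have c3 : Continuous fun w : S n => ev p w := (continuous_ev p).comp continuous_subtype_val
  have := integral_add (integrable_sphere (hf.mul c3)) (integrable_sphere (hg.mul c3))
  simp only [coef, add_mul]
  exact this

lemma coef_const_mul {n : ℕ} (c : ℝ) (f : E n → ℝ) (p : MvPolynomial (Fin n) ℝ) :
    coef (fun x => c * f x) p = c * coef f p := by
  simp only [coef, mul_assoc, integral_const_mul]

lemma coef_sum {n : ℕ} {ι : Type*} (s : Finset ι) {f : ι → E n → ℝ} (p : MvPolynomial (Fin n) ℝ)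
    (hf : ∀ i, Continuous fun w : S n => f i w) :
    coef (fun x => ∑ i ∈ s, f i x) p = ∑ i ∈ s, coef (f i) p := by
  have c3 : Continuous fun w : S n => ev p w := (continuous_ev p).comp continuous_subtype_val
  simp only [coef, Finset.sum_mul]
  exact integral_finsetSum (f := fun i (w : S n) => f i w * ev p w) s
    fun i _ => integrable_sphere ((hf i).mul c3)

lemma coef_congr {n : ℕ} {f g : E n → ℝ} (p : MvPolynomial (Fin n) ℝ)
    (h : ∀ w : S n, f w = g w) : coef f p = coef g p := by
  simp only [coef, h]

section waves

variable {n : ℕ} {W W' : ℝ → ℝ} {rc m : ℝ} {φ : ℝ × E n → ℝ}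

lemma smul_mem_outside (hrc : 0 < rc) {t r : ℝ} (hr : rc < r) (w : S n) :
    (t, r • (w : E n)) ∈ outside n rc := by
  change rc < ‖r • (w : E n)‖
  rwa [norm_smul, norm_eq_of_mem_sphere, mul_one, Real.norm_of_nonneg (hrc.trans hr).le]

lemma mapsTo_outside (hrc : 0 < rc) : MapsTo
    (fun z : (ℝ × ℝ) × S n => (z.1.1, z.1.2 • (z.2 : E n))) (beyond rc ×ˢ univ)
    (outside n rc) :=
  fun z hz => smul_mem_outside hrc hz.1 z.2

/-- The coefficients of a solution in spherical harmonics solve the scalar equation. -/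
theorem IsKleinGordon.isScalarWave (h : IsKleinGordon W W' rc m φ) (hrc : 0 < rc)
    (hW : ∀ r, rc < r → 0 < W r) (d : ℕ) (i : Fin (harmDim n d)) :
    IsScalarWave W W' rc n m (sphEigenvalue n d)
      (fun t r => coef (fun x => φ (t, r • x)) (harmPoly n d i))
      (fun t r => coef (fun x => fderiv ℝ φ (t, r • x) (1, 0)) (harmPoly n d i))
      (fun t r => coef (fun x => fderiv ℝ φ (t, r • x) (0, x)) (harmPoly n d i))
      (fun t r => coef (fun x => fderiv ℝ (fderiv ℝ φ) (t, r • x) (1, 0) (1, 0)) (harmPoly n d i))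
      (fun t r => coef (fun x => fderiv ℝ (fderiv ℝ φ) (t, r • x) (1, 0) (0, x)) (harmPoly n d i))
      (fun t r => coef (fun x => fderiv ℝ (fderiv ℝ φ) (t, r • x) (0, x) (0, x))
        (harmPoly n d i)) := by
  set Y := harmPoly n d i with hY
  have hO := isOpen_outside n rc
  have hB := isOpen_beyond rc
  have hmap : ContinuousOn (fun z : (ℝ × ℝ) × S n => (z.1.1, z.1.2 • (z.2 : E n)))
      (beyond rc ×ˢ univ) := by fun_prop
  have hmt := mapsTo_outside (n := n) hrc
  have cY : ContinuousOn (fun z : (ℝ × ℝ) × S n => ev Y z.2) (beyond rc ×ˢ univ) :=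
    ((continuous_ev Y).comp (by fun_prop)).continuousOn
  have c0 := h.contDiffOn.continuousOn.comp hmap hmt
  have c1 := h.contDiffOn_fderiv.continuousOn.comp hmap hmt
  have c2 := h.contDiffOn_fderiv₂.continuousOn.comp hmap hmt
  have ct : ContinuousOn (fun _ : (ℝ × ℝ) × S n => ((1 : ℝ), (0 : E n))) (beyond rc ×ˢ univ) :=
    continuousOn_const
  have cr : ContinuousOn (fun z : (ℝ × ℝ) × S n => ((0 : ℝ), (z.2 : E n))) (beyond rc ×ˢ univ) := by
    fun_prop
  have lt : ∀ (t r : ℝ) (w : S n), HasDerivAt (fun t : ℝ => (t, r • (w : E n))) (1, 0) t :=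
    fun t r w => (hasDerivAt_id t).prodMk (hasDerivAt_const t _)
  have lr : ∀ (t r : ℝ) (w : S n), HasDerivAt (fun r : ℝ => (t, r • (w : E n))) (0, (w : E n)) r := by
    intro t r w
    refine (hasDerivAt_const r t).prodMk ?_
    simpa using (hasDerivAt_id r).smul_const (w : E n)
  have hm : ∀ {t r : ℝ} (w : S n), (t, r) ∈ beyond rc → (t, r • (w : E n)) ∈ outside n rc :=
    fun w hr => smul_mem_outside hrc hr w
  have d2 : ∀ {P : ℝ × E n} (v : ℝ × E n), P ∈ outside n rc → HasFDerivAt (fun q => fderiv ℝ φ q v)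
      ((ContinuousLinearMap.apply ℝ ℝ v).comp (fderiv ℝ (fderiv ℝ φ) P)) P := fun v hP =>
    (ContinuousLinearMap.apply ℝ ℝ v).hasFDerivAt.comp _ (h.hasFDerivAt₂ hP)
  constructor
  · exact hasPartials_sphere_integral hB (c0.mul cY) ((c1.clm_apply ct).mul cY)
      ((c1.clm_apply cr).mul cY)
      (fun t r w hr => ((h.hasFDerivAt (hm w hr)).comp_hasDerivAt t (lt t r w)).mul_const _)
      (fun t r w hr => ((h.hasFDerivAt (hm w hr)).comp_hasDerivAt r (lr t r w)).mul_const _)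
  · refine hasPartials_sphere_integral hB ((c1.clm_apply ct).mul cY)
      (((c2.clm_apply ct).clm_apply ct).mul cY) (((c2.clm_apply ct).clm_apply cr).mul cY)
      (fun t r w hr => ((d2 _ (hm w hr)).comp_hasDerivAt t (lt t r w)).mul_const _)
      (fun t r w hr => ?_)
    beta_reduce
    rw [h.symm (hm w hr)]
    exact ((d2 _ (hm w hr)).comp_hasDerivAt r (lr t r w)).mul_const _
  · exact hasPartials_sphere_integral hB ((c1.clm_apply cr).mul cY)
      (((c2.clm_apply ct).clm_apply cr).mul cY) (((c2.clm_apply cr).clm_apply cr).mul cY)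
      (fun t r w hr => ((d2 _ (hm w hr)).comp_hasDerivAt t (lt t r w)).mul_const _)
      (fun t r w hr => ((d2 _ (hm w hr)).comp_hasDerivAt r (lr t r w)).mul_const _)
  · intro t r hr
    have hslice : ∀ {Z : Type} [TopologicalSpace Z] {G : (ℝ × ℝ) × S n → Z},
        ContinuousOn G (beyond rc ×ˢ univ) → Continuous fun w : S n => G ((t, r), w) :=
      fun hG => hG.comp_continuous (by fun_prop) fun w => ⟨hr, mem_univ _⟩
    have hr0 := hrc.trans hr
    set U : Set (E n) := {x | rc < ‖r • x‖} with hUdef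
    have hU : IsOpen U := isOpen_lt continuous_const (by fun_prop)
    have hSU : Metric.sphere (0 : E n) 1 ⊆ U := fun x hx => smul_mem_outside (t := t) hrc hr ⟨x, hx⟩
    have hψ : ContDiffOn ℝ 2 (fun x => φ (t, r • x)) U :=
      (h.contDiffOn.of_le two_le_infty).comp
        (by fun_prop : ContDiff ℝ 2 fun x : E n => (t, r • x)).contDiffOn fun x hx => hx
    have hrot : ∀ a b, ContDiffOn ℝ 1 (rot a b fun x => φ (t, r • x)) U := fun a b =>
      (hψ.fderiv_of_isOpen hU (by norm_num)).clm_apply (contDiff_rotField a b).contDiffOn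
    have crot : ∀ a b, Continuous fun w : S n => rot a b (rot a b fun x => φ (t, r • x)) w :=
      fun a b => continuous_rot a b hU hSU (hrot a b)
    have k0 : Continuous fun w : S n => φ (t, r • (w : E n)) := hslice c0
    have k1 : Continuous fun w : S n => fderiv ℝ φ (t, r • (w : E n)) (0, w) :=
      hslice (c1.clm_apply cr)
    have k2 : Continuous fun w : S n => fderiv ℝ (fderiv ℝ φ) (t, r • (w : E n)) (0, w) (0, w) :=
      hslice ((c2.clm_apply cr).clm_apply cr)
    have k3 : Continuous fun w : S n => ∑ a, ∑ b, rot a b (rot a b fun x => φ (t, r • x)) w :=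
      continuous_finsetSum _ fun a _ => continuous_finsetSum _ fun b _ => crot a b
    have e1 := coef_congr Y
      (f := fun x => fderiv ℝ (fderiv ℝ φ) (t, r • x) (1, 0) (1, 0))
      (g := fun x => W r ^ 2 * fderiv ℝ (fderiv ℝ φ) (t, r • x) (0, x) (0, x) +
        (W r * W' r + (n - 1) * W r ^ 2 / r) * fderiv ℝ φ (t, r • x) (0, x) +
        (-(W r / (2 * r ^ 2)) * ∑ a, ∑ b, rot a b (rot a b fun x => φ (t, r • x)) x +
        W r * m ^ 2 * φ (t, r • x))) fun w : S n => h.eq_polar hrc hW hr w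
    -- Two integrations by parts move the rotations onto the spherical harmonic, which turns the
    -- angular operator into the eigenvalue.
    have e2 : coef (fun x => ∑ a, ∑ b, rot a b (rot a b fun x => φ (t, r • x)) x) Y =
        -(2 * sphEigenvalue n d) * coef (fun x => φ (t, r • x)) Y := by
      rw [← sum_coef_rot_rot d i hU hSU hψ, coef_sum _ _ fun a => continuous_finsetSum _
        fun b _ => crot a b]
      exact Finset.sum_congr rfl fun a _ => coef_sum _ _ fun b => crot a b
    have e3 := e1.trans (coef_add Y
      (f := fun x => W r ^ 2 * fderiv ℝ (fderiv ℝ φ) (t, r • x) (0, x) (0, x) +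
        (W r * W' r + (n - 1) * W r ^ 2 / r) * fderiv ℝ φ (t, r • x) (0, x))
      (g := fun x => -(W r / (2 * r ^ 2)) * ∑ a, ∑ b, rot a b (rot a b fun x => φ (t, r • x)) x +
        W r * m ^ 2 * φ (t, r • x)) ((k2.const_mul _).add (k1.const_mul _))
      ((k3.const_mul _).add (k0.const_mul _)))
    rw [coef_add Y (k2.const_mul _) (k1.const_mul _), coef_add Y (k3.const_mul _) (k0.const_mul _),
      coef_const_mul, coef_const_mul, coef_const_mul, coef_const_mul, e2] at e3
    simp only [e3]
    have := hr0.ne'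
    field_simp
    ring

end waves

section finiteWords

variable {n : ℕ}

lemma killingDeriv_congr {F G : ℝ × E n → ℝ} (h : EqOn F G (offAxis n))
    (w : List (KillingIdx n)) : EqOn (killingDeriv w F) (killingDeriv w G) (offAxis n) := by
  induction w with
  | nil => exact h
  | cons Z w ih =>
    intro p hp
    have : killingDeriv w F =ᶠ[𝓝 p] killingDeriv w G := by
      filter_upwards [(isOpen_offAxis n).mem_nhds hp] with q hq using ih hq
    exact congrArg (fun L : ℝ × E n →L[ℝ] ℝ => L (killingField Z p)) this.fderiv_eq

lemma killingDeriv_const_mul (c : ℝ) (F : ℝ × E n → ℝ) (w : List (KillingIdx n)) :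
    killingDeriv w (fun p => c * F p) = fun p => c * killingDeriv w F p := by
  induction w with
  | nil => rfl
  | cons Z w ih =>
    ext p
    change fderiv ℝ (killingDeriv w fun p => c * F p) p _ = c * fderiv ℝ (killingDeriv w F) p _
    rw [ih]
    rw [show (fun p => c * killingDeriv w F p) = c • killingDeriv w F from rfl,
      fderiv_const_smul_field]
    rfl

lemma HasFiniteWords.congr {j : ℕ} {F G : ℝ × E n → ℝ} (hF : HasFiniteWords j F)
    (h : EqOn F G (offAxis n)) : HasFiniteWords j G := by
  intro w hw
  convert! hF w hw using 4 with p
  rw [killingDeriv_congr h w (mem_offAxis p.1 p.2)]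

lemma HasFiniteWords.const_mul {j : ℕ} {F : ℝ × E n → ℝ} (hF : HasFiniteWords j F) (c : ℝ) :
    HasFiniteWords j fun p => c * F p := by
  intro w hw
  simp only [killingDeriv_const_mul, mul_pow, ENNReal.ofReal_mul (sq_nonneg c)]
  rw [lintegral_const_mul' _ _ ENNReal.ofReal_ne_top]
  exact ENNReal.mul_lt_top ENNReal.ofReal_lt_top (hF w hw)

lemma integrable_modeEnergy (hn : 2 ≤ n) {F : ℝ × E n → ℝ} (hF : ContDiffOn ℝ ∞ F (offAxis n))
    (hw : HasFiniteWords 0 F) (d : ℕ) : Integrable fun t => modeEnergy d fun x => F (t, x) := by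
  obtain ⟨B, hB, h⟩ := exists_sum_modeEnergy_le hn 0 hF hw
  refine ⟨(continuous_modeEnergy hF.continuousOn d).aestronglyMeasurable, ?_⟩
  rw [hasFiniteIntegral_iff_ofReal (ae_of_all _ fun t => modeEnergy_nonneg d _)]
  refine lt_of_le_of_lt ?_ hB
  refine le_trans ?_ (h (d + 1))
  have := Finset.single_le_sum (f := fun d => ∫⁻ t, ENNReal.ofReal
    (sphFreq n d ^ (2 * 0) * modeEnergy d fun x => F (t, x))) (fun _ _ => zero_le)
    (Finset.self_mem_range_succ d)
  simpa using this

lemma integrable_coef_sq (hn : 2 ≤ n) {F : ℝ × E n → ℝ} (hF : ContDiffOn ℝ ∞ F (offAxis n))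
    (hw : HasFiniteWords 0 F) (d : ℕ) (i : Fin (harmDim n d)) :
    Integrable fun t => coef (fun x => F (t, x)) (harmPoly n d i) ^ 2 := by
  refine (integrable_modeEnergy hn hF hw d).mono'
    ((continuous_coef hF.continuousOn _).pow 2).aestronglyMeasurable (ae_of_all _ fun t => ?_)
  rw [Real.norm_of_nonneg (sq_nonneg _)]
  exact Finset.single_le_sum (f := fun i => coef (fun x => F (t, x)) (harmPoly n d i) ^ 2)
    (fun _ _ => sq_nonneg _) (Finset.mem_univ i)

lemma exists_sum_integral_coef_le (hn : 2 ≤ n) (j : ℕ) {F : ℝ × E n → ℝ}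
    (hF : ContDiffOn ℝ ∞ F (offAxis n)) (hw : HasFiniteWords j F) : ∃ B : ℝ, 0 ≤ B ∧ ∀ D,
      ∑ d ∈ Finset.range D, sphFreq n d ^ (2 * j) *
        ∑ i, ∫ t, coef (fun x => F (t, x)) (harmPoly n d i) ^ 2 ≤ B := by
  obtain ⟨B, hB, h⟩ := exists_sum_modeEnergy_le hn j hF hw
  have h0 := hw.mono (Nat.zero_le j)
  refine ⟨B.toReal, ENNReal.toReal_nonneg, fun D => ?_⟩
  rw [← ENNReal.ofReal_le_iff_le_toReal hB.ne]
  have hμ : ∀ d, 0 ≤ sphFreq n d ^ (2 * j) := fun d => by unfold sphFreq; positivity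
  refine le_trans (le_of_eq ?_) (h D)
  rw [ENNReal.ofReal_sum_of_nonneg fun d _ => mul_nonneg (hμ d)
    (Finset.sum_nonneg fun i _ => integral_nonneg fun t => sq_nonneg _)]
  refine Finset.sum_congr rfl fun d _ => ?_
  rw [← integral_finsetSum (f := fun i t => coef (fun x => F (t, x)) (harmPoly n d i) ^ 2) _
    fun i _ => integrable_coef_sq hn hF h0 d i, ← integral_const_mul]
  exact ofReal_integral_eq_lintegral_ofReal ((integrable_modeEnergy hn hF h0 d).const_mul _)
      (ae_of_all _ fun t => mul_nonneg (hμ d) (modeEnergy_nonneg d _))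

end finiteWords

/-- The function `g(u, ρ, x)` is smooth off the axis, also where `ρ = 0`, and represents the
function `φ` of `(t, x)` in terms of `u = σ t + τ(r)` and `ρ = (r - r_c)^{1/2}`. -/
structure IsHorizonExtension {n : ℕ} (τ : ℝ → ℝ) (rc σ : ℝ) (φ : ℝ × E n → ℝ)
    (g : ℝ × ℝ × E n → ℝ) : Prop where
  contDiffOn : ContDiffOn ℝ ∞ g {z | z.2.2 ≠ 0}
  eq : ∀ (t ρ : ℝ) (w : S n), 0 < ρ →
    g (σ * t + τ (rc + ρ ^ 2), ρ, w) = φ (t, (rc + ρ ^ 2) • (w : E n))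

/-- The restriction of `g(u, ρ, x)` to `ρ = 0`. -/
def horizonTrace {n : ℕ} (g : ℝ × ℝ × E n → ℝ) (p : ℝ × E n) : ℝ := g (p.1, 0, p.2)

namespace IsHorizonExtension

variable {n : ℕ} {τ W W' : ℝ → ℝ} {rc m σ : ℝ} {φ : ℝ × E n → ℝ} {g : ℝ × ℝ × E n → ℝ}

lemma isOpen_domain (n : ℕ) : IsOpen {z : ℝ × ℝ × E n | z.2.2 ≠ 0} :=
  isOpen_ne.preimage (by fun_prop)

lemma hasFDerivAt (hg : IsHorizonExtension τ rc σ φ g) {z : ℝ × ℝ × E n} (hz : z.2.2 ≠ 0) :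
    HasFDerivAt g (fderiv ℝ g z) z :=
  ((hg.contDiffOn.contDiffAt ((isOpen_domain n).mem_nhds hz)).differentiableAt
    (by simp)).hasFDerivAt

lemma contDiffOn_fderiv (hg : IsHorizonExtension τ rc σ φ g) (v : ℝ × ℝ × E n) :
    ContDiffOn ℝ ∞ (fun z => fderiv ℝ g z v) {z | z.2.2 ≠ 0} :=
  (hg.contDiffOn.fderiv_of_isOpen (isOpen_domain n) (by simp)).clm_apply contDiffOn_const

lemma hasDerivAt_fst (hg : IsHorizonExtension τ rc σ φ g) (u ρ : ℝ) {x : E n} (hx : x ≠ 0) :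
    HasDerivAt (fun u => g (u, ρ, x)) (fderiv ℝ g (u, ρ, x) (1, 0, 0)) u :=
  (hg.hasFDerivAt (z := (u, ρ, x)) hx).comp_hasDerivAt u
    ((hasDerivAt_id u).prodMk (hasDerivAt_const u (ρ, x)))

lemma hasDerivAt_snd (hg : IsHorizonExtension τ rc σ φ g) (u ρ : ℝ) {x : E n} (hx : x ≠ 0) :
    HasDerivAt (fun ρ => g (u, ρ, x)) (fderiv ℝ g (u, ρ, x) (0, 1, 0)) ρ :=
  (hg.hasFDerivAt (z := (u, ρ, x)) hx).comp_hasDerivAt ρ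
    ((hasDerivAt_const ρ u).prodMk ((hasDerivAt_id ρ).prodMk (hasDerivAt_const ρ x)))

/-- At fixed r the field ∂_t equals σ ∂_u, which is tangent to the horizon. So the time derivative
of the solution is of the same kind, with one derivative less on the horizon. -/
lemma timeDeriv (hg : IsHorizonExtension τ rc σ φ g) (hφ : IsKleinGordon W W' rc m φ)
    (hrc : 0 < rc) : IsHorizonExtension τ rc σ (fun q => fderiv ℝ φ q (1, 0))
      (fun z => σ * fderiv ℝ g z (1, 0, 0)) where
  contDiffOn := contDiffOn_const.mul (hg.contDiffOn_fderiv _)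
  eq t ρ w hρ := by
    have hr : rc < rc + ρ ^ 2 := by linarith [pow_pos hρ 2]
    have h1 : HasDerivAt (fun t => g (σ * t + τ (rc + ρ ^ 2), ρ, w))
        (fderiv ℝ g (σ * t + τ (rc + ρ ^ 2), ρ, w) (1, 0, 0) * σ) t := by
      have h2 : HasDerivAt (fun t => σ * t + τ (rc + ρ ^ 2)) σ t := by
        simpa using ((hasDerivAt_id t).const_mul σ).add_const (τ (rc + ρ ^ 2))
      exact (hg.hasDerivAt_fst _ ρ (ne_zero_of_mem_unit_sphere w)).comp t h2
    have h3 : HasDerivAt (fun t => φ (t, (rc + ρ ^ 2) • (w : E n)))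
        (fderiv ℝ φ (t, (rc + ρ ^ 2) • (w : E n)) (1, 0)) t :=
      (hφ.hasFDerivAt (smul_mem_outside hrc hr w)).comp_hasDerivAt t
        ((hasDerivAt_id t).prodMk (hasDerivAt_const t _))
    simp only [hg.eq _ ρ w hρ] at h1
    rw [mul_comm]
    exact h1.unique h3

lemma contDiffOn_trace (hg : IsHorizonExtension τ rc σ φ g) :
    ContDiffOn ℝ ∞ (horizonTrace g) (offAxis n) :=
  hg.contDiffOn.comp (by fun_prop : ContDiff ℝ ∞ fun p : ℝ × E n => (p.1, (0 : ℝ), p.2)).contDiffOn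
    fun _ hp => hp

lemma killingDeriv_trace (hg : IsHorizonExtension τ rc σ φ g) :
    EqOn (killingDeriv [none] (horizonTrace g))
      (horizonTrace fun z => fderiv ℝ g z (1, 0, 0)) (offAxis n) := by
  rintro ⟨u, x⟩ hx
  have h1 := hasDerivAt_killingDeriv (t := u) (x := x) (((hg.contDiffOn_trace.contDiffAt
    ((isOpen_offAxis n).mem_nhds hx))).differentiableAt (by simp))
  exact h1.unique (hg.hasDerivAt_fst u 0 hx)

lemma hasFiniteWords_trace (hg : IsHorizonExtension τ rc σ φ g) {j : ℕ}
    (hw : HasFiniteWords (j + 1) (horizonTrace g)) :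
    HasFiniteWords j (horizonTrace fun z => fderiv ℝ g z (1, 0, 0)) :=
  (HasFiniteWords.killingDeriv (v := [none]) hw).congr hg.killingDeriv_trace

/-- The coefficients in spherical harmonics have an extension to the branch of the horizon. -/
theorem isBranch (hg : IsHorizonExtension τ rc σ φ g) (hn : 2 ≤ n)
    (hw : HasFiniteWords 2 (horizonTrace g)) (d : ℕ) (i : Fin (harmDim n d)) :
    IsBranch τ rc σ (fun t r => coef (fun x => φ (t, r • x)) (harmPoly n d i))
      (fun u ρ => coef (fun x => g (u, ρ, x)) (harmPoly n d i))
      (fun u ρ => coef (fun x => fderiv ℝ g (u, ρ, x) (1, 0, 0)) (harmPoly n d i))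
      (fun u ρ => coef (fun x => fderiv ℝ g (u, ρ, x) (0, 1, 0)) (harmPoly n d i))
      (fun u => coef (fun x => fderiv ℝ (fun z => fderiv ℝ g z (1, 0, 0)) (u, 0, x) (1, 0, 0))
        (harmPoly n d i)) := by
  set Y := harmPoly n d i with hY
  have cY : ContinuousOn (fun z : (ℝ × ℝ) × S n => ev Y z.2) (univ ×ˢ univ) :=
    ((continuous_ev Y).comp (by fun_prop)).continuousOn
  have hmap : ContinuousOn (fun z : (ℝ × ℝ) × S n => (z.1.1, z.1.2, (z.2 : E n)))
      (univ ×ˢ univ) := by fun_prop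
  have hmt : MapsTo (fun z : (ℝ × ℝ) × S n => (z.1.1, z.1.2, (z.2 : E n))) (univ ×ˢ univ)
      {z | z.2.2 ≠ 0} := fun z _ => ne_zero_of_mem_unit_sphere z.2
  have hu := hg.contDiffOn_fderiv (1, 0, 0)
  have hp : HasPartials (fun u ρ => coef (fun x => g (u, ρ, x)) Y)
      (fun u ρ => coef (fun x => fderiv ℝ g (u, ρ, x) (1, 0, 0)) Y)
      (fun u ρ => coef (fun x => fderiv ℝ g (u, ρ, x) (0, 1, 0)) Y) univ :=
    hasPartials_sphere_integral isOpen_univ ((hg.contDiffOn.continuousOn.comp hmap hmt).mul cY)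
      ((hu.continuousOn.comp hmap hmt).mul cY)
      (((hg.contDiffOn_fderiv _).continuousOn.comp hmap hmt).mul cY)
      (fun u ρ w _ => (hg.hasDerivAt_fst u ρ (ne_zero_of_mem_unit_sphere w)).mul_const _)
      (fun u ρ w _ => (hg.hasDerivAt_snd u ρ (ne_zero_of_mem_unit_sphere w)).mul_const _)
  have htr : ContDiffOn ℝ ∞ (horizonTrace fun z => fderiv ℝ g z (1, 0, 0)) (offAxis n) :=
    hu.comp (by fun_prop : ContDiff ℝ ∞ fun p : ℝ × E n => (p.1, (0 : ℝ), p.2)).contDiffOn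
      fun _ hp => hp
  have htr' := contDiffOn_killingDeriv (isOpen_offAxis n) htr [none]
  -- The second derivative along the horizon is a Killing derivative of the trace, hence its square
  -- integrability is part of the finite Sobolev norm.
  have hk : ∀ (u : ℝ) (w : S n), killingDeriv [none] (horizonTrace fun z =>
      fderiv ℝ g z (1, 0, 0)) (u, w) =
      fderiv ℝ (fun z => fderiv ℝ g z (1, 0, 0)) (u, 0, (w : E n)) (1, 0, 0) := by
    intro u w
    have hw0 := mem_offAxis u w
    have h1 := hasDerivAt_killingDeriv (t := u) (x := (w : E n)) ((htr.contDiffAt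
      ((isOpen_offAxis n).mem_nhds hw0)).differentiableAt (by simp))
    have h2 : HasFDerivAt (fun z => fderiv ℝ g z (1, 0, 0))
        (fderiv ℝ (fun z => fderiv ℝ g z (1, 0, 0)) (u, 0, (w : E n))) (u, 0, (w : E n)) :=
      ((hu.contDiffAt ((isOpen_domain n).mem_nhds hw0)).differentiableAt (by simp)).hasFDerivAt
    have h3 : HasDerivAt (fun u => fderiv ℝ g (u, 0, (w : E n)) (1, 0, 0))
        (fderiv ℝ (fun z => fderiv ℝ g z (1, 0, 0)) (u, 0, (w : E n)) (1, 0, 0)) u :=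
      HasFDerivAt.comp_hasDerivAt (f := fun u : ℝ => (u, (0 : ℝ), (w : E n))) u h2
        ((hasDerivAt_id u).prodMk (hasDerivAt_const u ((0 : ℝ), (w : E n))))
    exact h1.unique h3
  have hk' : ∀ u, coef (fun x => killingDeriv [none] (horizonTrace fun z =>
      fderiv ℝ g z (1, 0, 0)) (u, x)) Y =
      coef (fun x => fderiv ℝ (fun z => fderiv ℝ g z (1, 0, 0)) (u, 0, x) (1, 0, 0)) Y :=
    fun u => coef_congr Y fun w => hk u w
  have hw1 := hg.hasFiniteWords_trace hw
  have hw2 := HasFiniteWords.killingDeriv (j := 0) (v := [none]) hw1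
  refine ⟨hp, fun t ρ hρ => coef_congr Y fun w => hg.eq t ρ w hρ, fun u => ?_, ?_, ?_, ?_, ?_⟩
  · have cY' : Continuous fun z : ℝ × S n => ev Y z.2 := (continuous_ev Y).comp (by fun_prop)
    have c1 := continuous_cyl htr.continuousOn
    have c2 := continuous_cyl htr'.continuousOn
    rw [← hk' u]
    refine hasDerivAt_sphere_integral (n := n) (I := univ) isOpen_univ
      (f := fun u w => fderiv ℝ g (u, 0, (w : E n)) (1, 0, 0) * ev Y w)
      (f' := fun u w => killingDeriv [none] (horizonTrace fun z =>
        fderiv ℝ g z (1, 0, 0)) (u, (w : E n)) * ev Y w) (fun s _ w => ?_) (fun s _ => ?_)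
      (c2.mul cY').continuousOn (mem_univ u)
    · exact (hasDerivAt_killingDeriv ((htr.contDiffAt
        ((isOpen_offAxis n).mem_nhds (mem_offAxis s w))).differentiableAt (by simp))).mul_const _
    · exact (c1.mul cY').comp (by fun_prop : Continuous fun w : S n => (s, w))
  · simp only [← hk']
    exact continuous_coef htr'.continuousOn Y
  · exact integrable_coef_sq hn hg.contDiffOn_trace (hw.mono (by omega)) d i
  · exact integrable_coef_sq hn htr (hw1.mono (by omega)) d i
  · simp only [← hk']
    exact integrable_coef_sq hn htr' hw2 d i

/-- Summability of the data on a branch of the horizon. -/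
theorem exists_sum_data_le (hg : IsHorizonExtension τ rc σ φ g) (hn : 2 ≤ n) {j : ℕ}
    (hw : HasFiniteWords (j + 2) (horizonTrace g)) : ∃ B : ℝ, 0 ≤ B ∧ ∀ D,
      ∑ d ∈ Finset.range D, sphFreq n d ^ (2 * j) * ∑ i, (sphFreq n d ^ 4 *
        (∫ u, coef (fun x => g (u, 0, x)) (harmPoly n d i) ^ 2) +
        ∫ u, coef (fun x => fderiv ℝ g (u, 0, x) (1, 0, 0)) (harmPoly n d i) ^ 2) ≤ B := by
  -- The undifferentiated trace carries μ^{2j+4}, that is j + 2 angular derivatives. Its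
  -- u-derivative carries only μ^{2j} and would need just j + 1 derivatives in all.
  obtain ⟨B₁, hB₁, h₁⟩ := exists_sum_integral_coef_le hn (j + 2) hg.contDiffOn_trace hw
  have htr : ContDiffOn ℝ ∞ (horizonTrace fun z => fderiv ℝ g z (1, 0, 0)) (offAxis n) :=
    (hg.contDiffOn_fderiv (1, 0, 0)).comp
      (by fun_prop : ContDiff ℝ ∞ fun p : ℝ × E n => (p.1, (0 : ℝ), p.2)).contDiffOn
      fun _ hp => hp
  obtain ⟨B₂, hB₂, h₂⟩ := exists_sum_integral_coef_le hn j htr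
    ((hg.hasFiniteWords_trace hw).mono (by omega))
  refine ⟨B₁ + B₂, by positivity, fun D => ?_⟩
  refine le_trans (le_of_eq ?_) (add_le_add (h₁ D) (h₂ D))
  rw [← Finset.sum_add_distrib]
  refine Finset.sum_congr rfl fun d _ => ?_
  rw [Finset.sum_add_distrib, ← Finset.mul_sum, mul_add, ← mul_assoc, ← pow_add]
  rfl

end IsHorizonExtension

/-! ### Summation over the modes -/

/-- A Sobolev inequality on an interval of length `μ⁻¹`. -/
lemma sq_le_integral_add {A A' : ℝ → ℝ} (hA : ∀ t, HasDerivAt A (A' t) t) (hA' : Continuous A')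
    {μ : ℝ} (hμ : 1 ≤ μ) {t T : ℝ} (hT : |t| + 1 ≤ T) :
    A t ^ 2 ≤ 2 * μ * (∫ s in Icc (-T) T, A s ^ 2) + μ⁻¹ * ∫ s in Icc (-T) T, A' s ^ 2 := by
  have hμ0 : 0 < μ := by linarith
  have hδ : t ≤ t + μ⁻¹ := by simpa using hμ0.le
  have hδ1 : μ⁻¹ ≤ 1 := inv_le_one_of_one_le₀ hμ
  have cA : Continuous A := continuous_iff_continuousAt.2 fun s => (hA s).continuousAt
  -- The weight falls linearly from 1 at s = t to 0 at s = t + 1/μ, so A(t)² is the integral of this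
  -- derivative. Since μ ≥ 1, the interval stays inside [-T, T].
  have hB : ∀ s, HasDerivAt (fun s => -((1 - μ * (s - t)) * A s ^ 2))
      (μ * A s ^ 2 - (1 - μ * (s - t)) * (2 * A s * A' s)) s := by
    intro s
    have h1 : HasDerivAt (fun s => 1 - μ * (s - t)) (-μ) s := by
      simpa using (((hasDerivAt_id s).sub_const t).const_mul μ).const_sub 1
    refine (h1.mul ((hA s).pow 2)).neg.congr_deriv ?_
    simp
    ring
  have hint := intervalIntegral.integral_eq_sub_of_hasDerivAt (a := t) (b := t + μ⁻¹)
    (fun s _ => hB s) ((by fun_prop : Continuous fun s =>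
      μ * A s ^ 2 - (1 - μ * (s - t)) * (2 * A s * A' s)).intervalIntegrable _ _)
  have he : A t ^ 2 = ∫ s in t..t + μ⁻¹,
      (μ * A s ^ 2 - (1 - μ * (s - t)) * (2 * A s * A' s)) := by
    rw [hint, add_sub_cancel_left, mul_inv_cancel₀ hμ0.ne']
    ring
  have cF : Continuous fun s => 2 * μ * A s ^ 2 + μ⁻¹ * A' s ^ 2 := by fun_prop
  have hmono : A t ^ 2 ≤ ∫ s in t..t + μ⁻¹, (2 * μ * A s ^ 2 + μ⁻¹ * A' s ^ 2) := by
    rw [he]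
    refine intervalIntegral.integral_mono_on hδ
      (Continuous.intervalIntegrable (by fun_prop) _ _) (cF.intervalIntegrable _ _) fun s hs => ?_
    have h0 : 0 ≤ 1 - μ * (s - t) := by
      have : μ * (s - t) ≤ μ * μ⁻¹ := by gcongr; linarith [hs.2]
      rw [mul_inv_cancel₀ hμ0.ne'] at this
      linarith
    have h1 : 1 - μ * (s - t) ≤ 1 := by
      have : 0 ≤ μ * (s - t) := mul_nonneg hμ0.le (by linarith [hs.1])
      linarith
    have h2 : |2 * A s * A' s| ≤ μ * A s ^ 2 + μ⁻¹ * A' s ^ 2 := by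
      have e1 : (μ * A s + A' s) ^ 2 = μ * (μ * A s ^ 2 + μ⁻¹ * A' s ^ 2 + 2 * A s * A' s) := by
        field_simp; ring
      have e2 : (μ * A s - A' s) ^ 2 = μ * (μ * A s ^ 2 + μ⁻¹ * A' s ^ 2 - 2 * A s * A' s) := by
        field_simp; ring
      have p1 := nonneg_of_mul_nonneg_right (e1 ▸ sq_nonneg (μ * A s + A' s)) hμ0
      have p2 := nonneg_of_mul_nonneg_right (e2 ▸ sq_nonneg (μ * A s - A' s)) hμ0
      exact abs_le.2 ⟨by linarith, by linarith⟩
    have h3 : -((1 - μ * (s - t)) * (2 * A s * A' s)) ≤ |2 * A s * A' s| := by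
      refine (neg_le_abs _).trans ?_
      rw [abs_mul, abs_of_nonneg h0]
      exact mul_le_of_le_one_left (abs_nonneg _) h1
    linarith
  refine hmono.trans ?_
  rw [intervalIntegral.integral_of_le hδ, ← integral_const_mul, ← integral_const_mul]
  have i1 : IntegrableOn (fun s => 2 * μ * A s ^ 2) (Icc (-T) T) :=
    Continuous.integrableOn_Icc (by fun_prop)
  have i2 : IntegrableOn (fun s => μ⁻¹ * A' s ^ 2) (Icc (-T) T) :=
    Continuous.integrableOn_Icc (by fun_prop)
  rw [← integral_add i1 i2]
  refine setIntegral_mono_set cF.integrableOn_Icc (ae_of_all _ fun s => by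
    simp only [Pi.zero_apply]; positivity) (ae_of_all _ fun s hs => ?_)
  obtain ⟨h1, h2⟩ := abs_le.1 (le_refl |t|)
  exact ⟨by linarith [hs.1], by linarith [hs.2]⟩

lemma dataNorm_sphEigenvalue_le {n : ℕ} (hn : 2 ≤ n) (d : ℕ) (f f' g g' : ℝ → ℝ) :
    dataNorm (sphEigenvalue n d) f f' g g' ≤
      (sphFreq n d ^ 4 * (∫ u, f u ^ 2) + ∫ u, f' u ^ 2) +
      (sphFreq n d ^ 4 * (∫ u, g u ^ 2) + ∫ u, g' u ^ 2) := by
  have h0 := sphEigenvalue_nonneg hn d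
  have h1 : sphEigenvalue n d ^ 2 + 1 ≤ sphFreq n d ^ 4 := by
    have : sphFreq n d ^ 4 = (sphFreq n d ^ 2) ^ 2 := by ring
    rw [this, sphFreq_sq hn]
    nlinarith
  have hf : 0 ≤ ∫ u, f u ^ 2 := integral_nonneg fun u => sq_nonneg (f u)
  have hg : 0 ≤ ∫ u, g u ^ 2 := integral_nonneg fun u => sq_nonneg (g u)
  have h2 := mul_le_mul_of_nonneg_right h1 (add_nonneg hf hg)
  unfold dataNorm
  linarith

section

variable {n : ℕ} {τ W W' : ℝ → ℝ} {rc m κ β : ℝ} {φ : ℝ × E n → ℝ} {g₁ g₂ : ℝ × ℝ × E n → ℝ}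

/-- The mode estimates can be added because their constant depends neither on the eigenvalue nor on
T. The data norm costs μ⁴, so j + 2 derivatives on the horizon control the weight μ^{2j} at radius
r. -/
lemma exists_sum_integral_sq_le (h : IsExpanding W W' rc) (ht : IsTortoise W τ rc) (hn : 2 ≤ n)
    (hκ : 0 < κ) (hβ : |(n : ℝ) ^ 2 / 4 - m ^ 2 + κ| ≤ 2 * β * √κ)
    (hφ : IsKleinGordon W W' rc m φ) (hg₁ : IsHorizonExtension τ rc 1 φ g₁)
    (hg₂ : IsHorizonExtension τ rc (-1) φ g₂) {j : ℕ}
    (hw₁ : HasFiniteWords (j + 2) (horizonTrace g₁))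
    (hw₂ : HasFiniteWords (j + 2) (horizonTrace g₂)) {r₁ : ℝ} (hr₁ : rc < r₁) :
    ∃ C : ℝ, 0 ≤ C ∧ ∀ r, r₁ ≤ r → ∀ T D,
      ∑ d ∈ Finset.range D, sphFreq n d ^ (2 * j) * ∑ i, ∫ t in Icc (-T) T,
        coef (fun x => φ (t, r • x)) (harmPoly n d i) ^ 2 ≤ C * r ^ (2 * β - n) := by
  obtain ⟨C, hC, hdecay⟩ := exists_mode_decay h ht (by omega : 1 ≤ n) hκ hβ hr₁
  obtain ⟨B₁, hB₁, h₁⟩ := hg₁.exists_sum_data_le hn hw₁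
  obtain ⟨B₂, hB₂, h₂⟩ := hg₂.exists_sum_data_le hn hw₂
  refine ⟨C * (B₁ + B₂), by positivity, fun r hr T D => ?_⟩
  have hr0 : 0 < r := h.pos_of_lt (hr₁.trans_le hr)
  have hsum := add_le_add (h₁ D) (h₂ D)
  rw [← Finset.sum_add_distrib] at hsum
  have hX : 0 ≤ C * r ^ (2 * β - n) := by positivity
  calc _ ≤ C * r ^ (2 * β - n) * _ := ?_
    _ ≤ C * r ^ (2 * β - n) * (B₁ + B₂) := mul_le_mul_of_nonneg_left hsum hX
    _ = _ := by ring
  rw [Finset.mul_sum]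
  refine Finset.sum_le_sum fun d _ => ?_
  rw [← mul_add, ← Finset.sum_add_distrib, mul_left_comm, Finset.mul_sum _ _ (C * _)]
  refine mul_le_mul_of_nonneg_left (Finset.sum_le_sum fun i _ => ?_)
    (pow_nonneg (zero_le_one.trans (one_le_sphFreq hn d)) _)
  refine (hdecay _ _ _ _ _ _ _ _ _ _ _ _ _ _ _ (sphEigenvalue_nonneg hn d)
    (hφ.isScalarWave h.rc_pos (fun r hr => h.pos hr) d i)
    (hg₁.isBranch hn (hw₁.mono (by omega)) d i)
    (hg₂.isBranch hn (hw₂.mono (by omega)) d i) r hr T).trans ?_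
  exact mul_le_mul_of_nonneg_left (dataNorm_sphEigenvalue_le hn d _ _ _ _) hX

/-- The angular Sobolev inequality is applied with the exponent 2j + 1, and for each mode the one in
t at the scale 1/μ: μ^{2j+1} A² ≤ 2 μ^{2j+2} ∫ A² + μ^{2j} ∫ (∂_t A)². At this scale pointwise
control in t costs half a derivative. The two sums are bounded by the preceding lemma, for φ with j
+ 1 and for ∂_t φ with j; either way j + 3 derivatives on the horizon are used. -/
theorem exists_pointwise_decay (h : IsExpanding W W' rc) (ht : IsTortoise W τ rc) (hn : 2 ≤ n)
    (hκ : 0 < κ) (hβ : |(n : ℝ) ^ 2 / 4 - m ^ 2 + κ| ≤ 2 * β * √κ)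
    (hφ : IsKleinGordon W W' rc m φ) (hg₁ : IsHorizonExtension τ rc 1 φ g₁)
    (hg₂ : IsHorizonExtension τ rc (-1) φ g₂) {j : ℕ} (hj : n ≤ 2 * j + 1)
    (hw₁ : HasFiniteWords (j + 3) (horizonTrace g₁))
    (hw₂ : HasFiniteWords (j + 3) (horizonTrace g₂)) {r₁ : ℝ} (hr₁ : rc < r₁) :
    ∃ C : ℝ, 0 ≤ C ∧ ∀ r, r₁ ≤ r → ∀ (t : ℝ) (w : S n),
      |φ (t, r • (w : E n))| ≤ C * r ^ (β - n / 2) := by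
  have hrc := h.rc_pos
  obtain ⟨C₁, hC₁, b₁⟩ := exists_sum_integral_sq_le (j := j + 1) h ht hn hκ hβ hφ hg₁ hg₂ hw₁ hw₂ hr₁
  obtain ⟨C₂, hC₂, b₂⟩ := exists_sum_integral_sq_le (j := j) h ht hn hκ hβ hφ.timeDeriv
    (hg₁.timeDeriv hφ hrc) (hg₂.timeDeriv hφ hrc) ((hg₁.hasFiniteWords_trace hw₁).const_mul 1)
    ((hg₂.hasFiniteWords_trace hw₂).const_mul (-1)) hr₁
  obtain ⟨K, hK, hsup⟩ := exists_harmSum_sq_le hn hj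
  refine ⟨√(K * (2 * C₁ + C₂)), Real.sqrt_nonneg _, fun r hr t w => ?_⟩
  have hr' := hr₁.trans_le hr
  have hr0 : 0 < r := h.pos_of_lt hr'
  have hc : Continuous fun w : S n => φ (t, r • (w : E n)) :=
    hφ.contDiffOn.continuousOn.comp_continuous (by fun_prop)
      fun w => smul_mem_outside hrc hr' w
  -- It suffices to bound the partial sums uniformly in D, so only finite sums of modes have to be
  -- handled.
  refine abs_le_of_harmSum_le (n := n) ⟨_, hc⟩ (fun D w' => ?_) w
  refine abs_le_of_sq_le_sq ?_ (by positivity)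
  refine (hsup _ D w').trans ?_
  rw [mul_pow, Real.sq_sqrt (by positivity), mul_assoc, ← Real.rpow_mul_natCast hr0.le]
  refine mul_le_mul_of_nonneg_left ?_ hK
  have hexp : (β - n / 2) * ((2 : ℕ) : ℝ) = 2 * β - n := by push_cast; ring
  rw [hexp, add_mul, mul_assoc]
  set T := |t| + 1 with hT
  have hs := add_le_add (mul_le_mul_of_nonneg_left (b₁ r hr T D) zero_le_two) (b₂ r hr T D)
  refine le_trans ?_ hs
  rw [Finset.mul_sum, ← Finset.sum_add_distrib]
  refine Finset.sum_le_sum fun d _ => ?_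
  rw [harmEnergy_eq_modeEnergy (h := fun x => φ (t, r • x)) hc d]
  have hμ := one_le_sphFreq hn d
  have hμ0 : 0 < sphFreq n d := by linarith
  unfold modeEnergy
  rw [Finset.mul_sum, Finset.mul_sum, Finset.mul_sum, Finset.mul_sum, ← Finset.sum_add_distrib]
  refine Finset.sum_le_sum fun i _ => ?_
  have hw := hφ.isScalarWave hrc (fun r hr => h.pos hr) d i
  have hsob := sq_le_integral_add (t := t) (T := T) (fun s => hw.partials.fst s r hr')
    (hw.partials.cont_fst.comp_continuous (f := fun s : ℝ => (s, r)) (by fun_prop)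
      fun s => hr') hμ le_rfl
  refine (mul_le_mul_of_nonneg_left hsob (pow_nonneg hμ0.le _)).trans (le_of_eq ?_)
  rw [mul_add]
  field_simp
  ring

end

/-! ### From the hypotheses on the horizon to the decay estimate -/

/-- The substitution r = r_c + ρ² maps a full neighbourhood of ρ = 0 into the closed region r ≥ r_c,
so smoothness up to the boundary becomes smoothness on an open set. The radial projection makes the
result constant on rays in x, in agreement with `rayExtension`. -/
lemma isHorizonExtension_of_eq {n : ℕ} {τ : ℝ → ℝ} {rc σ : ℝ} {φ ψ : ℝ × E n → ℝ} (hrc : 0 < rc)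
    (hψ : ContDiffOn ℝ ∞ ψ {p | rc ≤ ‖p.2‖})
    (h : ∀ (t : ℝ) (x : E n), rc < ‖x‖ → ψ (σ * t + τ ‖x‖, x) = φ (t, x)) :
    IsHorizonExtension τ rc σ φ fun z => ψ (z.1, (rc + z.2.1 ^ 2) • radial z.2.2) where
  contDiffOn := by
    refine hψ.comp (t := {p | rc ≤ ‖p.2‖}) (fun z hz => ?_) fun z hz => ?_
    · have h1 : ContDiffAt ℝ ∞ (fun z : ℝ × ℝ × E n => radial z.2.2) z :=
        ContDiffAt.comp (g := radial) (f := fun z : ℝ × ℝ × E n => z.2.2) z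
          (contDiffAt_radial hz) (by fun_prop)
      have h2 : ContDiffAt ℝ ∞ (fun z : ℝ × ℝ × E n => rc + z.2.1 ^ 2) z := by fun_prop
      exact (contDiffAt_fst.prodMk (h2.smul h1)).contDiffWithinAt
    · have h1 : ‖radial z.2.2‖ = 1 := norm_eq_of_mem_sphere ⟨_, radial_mem hz⟩
      change rc ≤ ‖(rc + z.2.1 ^ 2) • radial z.2.2‖
      rw [norm_smul, h1, mul_one, Real.norm_of_nonneg (by positivity)]
      linarith [sq_nonneg z.2.1]
  eq t ρ w hρ := by
    have hr : 0 < rc + ρ ^ 2 := by positivity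
    have hw : ‖(w : E n)‖ = 1 := norm_eq_of_mem_sphere w
    have hx : ‖(rc + ρ ^ 2) • (w : E n)‖ = rc + ρ ^ 2 := by
      rw [norm_smul, hw, mul_one, Real.norm_of_nonneg hr.le]
    have hrad : radial (w : E n) = w := by rw [radial, hw, inv_one, one_smul]
    have := h t ((rc + ρ ^ 2) • (w : E n)) (by rw [hx]; linarith [pow_pos hρ 2])
    rw [hx] at this
    simpa only [hrad] using this

lemma hasFiniteWords_horizonTrace {n k : ℕ} {rc : ℝ} {ψ : ℝ × E n → ℝ}
    (h : cylSobolevSq k (slice ψ rc) < ⊤) : HasFiniteWords k (horizonTrace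
      fun z : ℝ × ℝ × E n => ψ (z.1, (rc + z.2.1 ^ 2) • radial z.2.2)) := by
  refine (hasFiniteWords_of_cylSobolevSq h).congr fun p hp => ?_
  have h1 : ‖p.2‖⁻¹ • p.2 ∈ Metric.sphere (0 : E n) 1 := radial_mem hp
  simp only [rayExtension, dif_pos h1, slice, horizonTrace, radial]
  simp

lemma eLpNorm_slice_top_le {n : ℕ} {φ : ℝ × E n → ℝ} {r B : ℝ}
    (h : ∀ (t : ℝ) (w : S n), |φ (t, r • (w : E n))| ≤ B) :
    eLpNorm (slice φ r) ⊤ (cylMeasure n) ≤ ENNReal.ofReal B := by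
  rw [eLpNorm_exponent_top]
  exact eLpNormEssSup_le_of_ae_bound (ae_of_all _ fun p => h p.1 p.2)

end RNdS

theorem theorem4 (n : ℕ) (hn : 2 < n) (M e m : ℝ) (hM : 0 < M) (he : 0 < e)
    -- the three horizon radii, and the nondegeneracy assumptions
    (rm rp rc : ℝ) (hsub : RNdS.IsSubextremal n M e rm rp rc)
    (hV'' : 0 < deriv (deriv (RNdS.V n M e)) rc)
    -- the base point of the integral that defines `u` and `v`
    (rs : ℝ) (hrs : rc < rs)
    (k : ℕ) (hk : (n : ℝ) / 2 + 2 < k)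
    -- a smooth solution of the Klein-Gordon equation in the cosmological region, in `(t, x)`
    (φ : ℝ × RNdS.E n → ℝ)
    (hφ : ContDiffOn ℝ ∞ φ {p | rc < ‖p.2‖})
    (hKG : ∀ p : ℝ × RNdS.E n, rc < ‖p.2‖ →
      RNdS.boxOp (RNdS.metric n M e) φ p - m ^ 2 * φ p = 0)
    -- in the coordinates `(u, x)` it is smooth up to the first branch of the horizon
    (φ₁ : ℝ × RNdS.E n → ℝ)
    (hφ₁ : ContDiffOn ℝ ∞ φ₁ {p | rc ≤ ‖p.2‖})
    (hφφ₁ : ∀ (t : ℝ) (x : RNdS.E n), rc < ‖x‖ →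
      φ₁ (t + RNdS.tortoise n M e rs ‖x‖, x) = φ (t, x))
    -- in the coordinates `(v, x)` it is smooth up to the second branch of the horizon
    (φ₂ : ℝ × RNdS.E n → ℝ)
    (hφ₂ : ContDiffOn ℝ ∞ φ₂ {p | rc ≤ ‖p.2‖})
    (hφφ₂ : ∀ (t : ℝ) (x : RNdS.E n), rc < ‖x‖ →
      φ₂ (-t + RNdS.tortoise n M e rs ‖x‖, x) = φ (t, x))
    -- finite Sobolev norms on both branches
    (hCH₁ : RNdS.cylSobolevSq k (RNdS.slice φ₁ rc) < ⊤)
    (hCH₂ : RNdS.cylSobolevSq k (RNdS.slice φ₂ rc) < ⊤)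
    (ε : ℝ) (hε : 0 < ε) :
    ((n : ℝ) / 2 < |m| →
      ∃ r₀ : ℝ, rc < r₀ ∧ ∃ C : ℝ, ∀ r : ℝ, r₀ ≤ r →
        MeasureTheory.eLpNorm (RNdS.slice φ r) ⊤ (RNdS.cylMeasure n) ≤
          ENNReal.ofReal (C * r ^ (-(n : ℝ) / 2 + ε))) ∧
    (|m| ≤ (n : ℝ) / 2 →
      ∃ r₀ : ℝ, rc < r₀ ∧ ∃ C : ℝ, ∀ r : ℝ, r₀ ≤ r →
        MeasureTheory.eLpNorm (RNdS.slice φ r) ⊤ (RNdS.cylMeasure n) ≤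
          ENNReal.ofReal (C * r ^ (-(n : ℝ) / 2 + √((n : ℝ) ^ 2 / 4 - m ^ 2) + ε))) := by
  have h := RNdS.isExpanding_V hn hM hsub hV''
  have ht : RNdS.IsTortoise (RNdS.V n M e) (RNdS.tortoise n M e rs) rc := h.isTortoise hrs
  have hK : RNdS.IsKleinGordon (RNdS.V n M e) (RNdS.Vderiv n M e) rc m φ :=
    ⟨hφ, fun P hP => by rw [← RNdS.boxOp_metric h hφ hP]; linarith [hKG P hP]⟩
  have hg₁ := RNdS.isHorizonExtension_of_eq (τ := RNdS.tortoise n M e rs) (σ := 1) (φ := φ)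
    h.rc_pos hφ₁ fun t x hx => by rw [one_mul]; exact hφφ₁ t x hx
  have hg₂ := RNdS.isHorizonExtension_of_eq (τ := RNdS.tortoise n M e rs) (σ := -1) (φ := φ)
    h.rc_pos hφ₂ fun t x hx => by rw [neg_one_mul]; exact hφφ₂ t x hx
  -- Integrality sharpens 2k > n + 4. With k = j + 3 this is n ≤ 2j + 1, as the Sobolev inequalities
  -- require.
  have hk' : n + 5 ≤ 2 * k := by
    have : (n : ℝ) + 4 < 2 * k := by linarith
    have : n + 4 < 2 * k := by exact_mod_cast this
    omega
  obtain ⟨j, rfl⟩ := Nat.exists_eq_add_of_le' (by omega : 3 ≤ k)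
  have key : ∀ {κ β : ℝ}, 0 < κ → |(n : ℝ) ^ 2 / 4 - m ^ 2 + κ| ≤ 2 * β * √κ →
      ∃ r₀ : ℝ, rc < r₀ ∧ ∃ C : ℝ, ∀ r : ℝ, r₀ ≤ r →
        eLpNorm (RNdS.slice φ r) ⊤ (RNdS.cylMeasure n) ≤
          ENNReal.ofReal (C * r ^ (β - n / 2)) := by
    intro κ β hκ hβ
    obtain ⟨C, -, hC⟩ := RNdS.exists_pointwise_decay h ht hn.le hκ hβ hK hg₁ hg₂
      (by omega : n ≤ 2 * j + 1) (RNdS.hasFiniteWords_horizonTrace hCH₁)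
      (RNdS.hasFiniteWords_horizonTrace hCH₂) (lt_add_one rc)
    exact ⟨rc + 1, lt_add_one rc, C, fun r hr => RNdS.eLpNorm_slice_top_le (hC r hr)⟩
  have hn0 : (0 : ℝ) ≤ n / 2 := by positivity
  constructor
  · intro hm
    have hκ : 0 < m ^ 2 - (n : ℝ) ^ 2 / 4 := by
      have := pow_lt_pow_left₀ hm hn0 two_ne_zero
      rw [sq_abs] at this
      linarith [this, div_pow (n : ℝ) 2 2]
    rw [show -(n : ℝ) / 2 + ε = ε - n / 2 by ring]
    -- With κ = m² - n²/4 the cross term vanishes, so any β ≥ 0 is admissible; here β = ε.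
    refine key hκ ?_
    rw [show (n : ℝ) ^ 2 / 4 - m ^ 2 + (m ^ 2 - (n : ℝ) ^ 2 / 4) = 0 by ring, abs_zero]
    positivity
  · intro hm
    have hq : 0 ≤ (n : ℝ) ^ 2 / 4 - m ^ 2 := by
      have := pow_le_pow_left₀ (abs_nonneg m) hm 2
      rw [sq_abs] at this
      linarith [this, div_pow (n : ℝ) 2 2]
    set s := √((n : ℝ) ^ 2 / 4 - m ^ 2) with hs
    have hs0 : 0 ≤ s := Real.sqrt_nonneg _
    rw [show -(n : ℝ) / 2 + s + ε = s + ε - n / 2 by ring]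
    -- With β = √κ = s + ε the condition reads s² + (s + ε)² ≤ 2 (s + ε)². The ε keeps κ positive in
    -- the borderline case s = 0.
    refine key (κ := (s + ε) ^ 2) (by positivity) ?_
    rw [← Real.sq_sqrt hq, ← hs, Real.sqrt_sq (by positivity), abs_of_nonneg (by positivity)]
    nlinarith
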